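/- Let $k$ be an algebraically closed field and let $\mathcal A$ be a small $k$-linear abelian category (for instance an Ext-finite one). Let $\operatorname{Ind}\mathcal A$ be the Grothendieck category of ind-objects of $\mathcal A$, and let $D^b(\mathcal A)\to D(\operatorname{Ind}\mathcal A)$ be the canonical functor. Let $\mathfrak K$ be the full subcategory of the homotopy category $K(\operatorname{Ind}\mathcal A)$ whose objects are the bounded below complexes $F$ of injective objects with $H^i(F)\in\mathcal A$ for all $i$ and $H^i(F)=0$ for $i\gg 0$; it is canonically equivalent to $D^b(\mathcal A)$, by the equivalence compatible with the functors to $D(\operatorname{Ind}\mathcal A)$. Let $n>0$ be an integer. An object $E\in D^b(\mathcal A)$, with $A=\operatorname{End}(E)$, is *generalized $n$-spherical* if * (S1) $E$ has a finite resolution by injective objects of $\operatorname{Ind}\mathcal A$; * (S2) $\bigoplus_i\operatorname{Hom}(E,F[i])$ and $\bigoplus_i\operatorname{Hom}(F,E[i])$ are finite-dimensional over $k$ for all $F\in D^b(\mathcal A)$; * (S3) $A\cong k^r$ as $k$-algebras for some $r$, $\operatorname{Hom}(E,E[i])=0$ for $i\ne 0,n$, and $\operatorname{Hom}(E,E[n])$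 is isomorphic to $A$ as a left $A$-module and as a right $A$-module; * (S4) for all $F\in D^b(\mathcal A)$ and $j\in\mathbb Z$ the composition $\operatorname{Hom}(F,E[j])\times\operatorname{Hom}(E,F[n-j])\to\operatorname{Hom}(E,E[n])$ is non-degenerate: an element of either factor which pairs to zero with all elements of the other one is zero. A *model* of $E$ is a bounded complex of injective objects of $\operatorname{Ind}\mathcal A$ (again written $E$) representing $E$, on which $A$ acts strictly, i.e. with a $k$-algebra of endomorphisms of the complex which is mapped isomorphically onto $\operatorname{End}(E)$. For a model and a complex $F$ let $\underline{\operatorname{Hom}}$ be the complex of all homogeneous morphisms. For a complex $V$ of right $A$-modules put $(V\otimes_A E)^m=\bigoplus_{i+j=m}V^i\otimes_A E^j$ with differential $v\otimes x\mapsto dv\otimes x+(-1)^i v\otimes dx$ for $v\in V^i$, and for a complex $W$ of left $A$-modules put $\underline{\operatorname{lin}}_A(W,E)^m=\prod_{j-i=m}\operatorname{lin}_A(W^i,E^j)$, where $\operatorname{lin}_A(W^i,E^j)$ is the object of $A$-linear maps, with differential $(df)(w)=(-1)^i\bigl(d(f(w))-f(dw)\bigr)$ for $w\in W^i$. The *twist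 functor* and the *dual twist functor* of $E$ are the functors $\mathfrak K\to\mathfrak K$ $$T_EF=\{\underline{\operatorname{Hom}}(E,F)\otimes_AE\to F\},\qquad T_E^*F=\{F\to\underline{\operatorname{lin}}_A(\underline{\operatorname{Hom}}(F,E),E)\}$$ (total complexes of evaluation and of coevaluation, with $F$ in degree $0$, replaced by isomorphic objects of $D(\operatorname{Ind}\mathcal A)$ which lie in $\mathfrak K$), and the corresponding functors $D^b(\mathcal A)\to D^b(\mathcal A)$. **Theorem.** Let $E\in D^b(\mathcal A)$ be generalized $n$-spherical. Then $E$ has a model, and for every model the functors $T_E$ and $T_E^*$ exist on $\mathfrak K$ and on $D^b(\mathcal A)$. On $\mathfrak K$ there are natural isomorphisms $T_E^*T_E\cong \mathrm{id}$ and $T_ET_E^*\cong\mathrm{id}$, and on $D^b(\mathcal A)$ the functors $T_E$ and $T_E^*$ are mutually quasi-inverse autoequivalences. -/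

import Mathlib

open CategoryTheory Limits CochainComplex.HomComplex

universe u w w' v

namespace TwistFunctors

noncomputable section

/-! ## Tensor products and linear-map objects over a ring

`A` is a ring acting from the left on an object `X` of an abelian category. -/

section TensorObjects

variable {B : Type v} [Category.{u} B] [Abelian B] [HasCoproducts.{u} B] {A : Type u} [Ring A]

/-- The relations `(m + m') ⊗ x = m ⊗ x + m' ⊗ x` and `m a ⊗ x = m ⊗ a x`. -/
def tensorRel (M : ModuleCat.{u} Aᵐᵒᵖ) {X : B} (ρ : A → (X ⟶ X)) :
    (∐ fun _ : (M × M) ⊕ (M × A) => X) ⟶ (∐ fun _ : M => X) :=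
  Sigma.desc fun
    | .inl p => Sigma.ι (fun _ : M => X) (p.1 + p.2) - Sigma.ι (fun _ : M => X) p.1
        - Sigma.ι (fun _ : M => X) p.2
    | .inr p => Sigma.ι (fun _ : M => X) (MulOpposite.op p.2 • p.1)
        - ρ p.2 ≫ Sigma.ι (fun _ : M => X) p.1

/-- The tensor product `M ⊗_A X` of a right `A`-module with an object on which `A` acts:
the quotient of the coproduct of copies of `X` indexed by `M` by the bilinearity relations. -/
abbrev tensorObj (M : ModuleCat.{u} Aᵐᵒᵖ) {X : B} (ρ : A → (X ⟶ X)) : B :=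
  cokernel (tensorRel M ρ)

/-- The morphism `x ↦ m ⊗ x`. -/
def tensorι (M : ModuleCat.{u} Aᵐᵒᵖ) {X : B} (ρ : A → (X ⟶ X)) (m : M) : X ⟶ tensorObj M ρ :=
  Sigma.ι (fun _ : M => X) m ≫ cokernel.π (tensorRel M ρ)

lemma tensorι_add (M : ModuleCat.{u} Aᵐᵒᵖ) {X : B} (ρ : A → (X ⟶ X)) (m m' : M) :
    tensorι M ρ (m + m') = tensorι M ρ m + tensorι M ρ m' := by
  have h := Sigma.ι (fun _ : (M × M) ⊕ (M × A) => X) (.inl (m, m')) ≫=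
    cokernel.condition (tensorRel M ρ)
  have e : Sigma.ι (fun _ : (M × M) ⊕ (M × A) => X) (.inl (m, m')) ≫ tensorRel M ρ =
      Sigma.ι (fun _ : M => X) (m + m') - Sigma.ι (fun _ : M => X) m
        - Sigma.ι (fun _ : M => X) m' := by simp [tensorRel]
  rw [← Category.assoc, e, comp_zero, Preadditive.sub_comp, Preadditive.sub_comp, sub_sub,
    sub_eq_zero] at h
  exact h

lemma tensorι_smul (M : ModuleCat.{u} Aᵐᵒᵖ) {X : B} (ρ : A → (X ⟶ X)) (a : A) (m : M) :
    tensorι M ρ (MulOpposite.op a • m) = ρ a ≫ tensorι M ρ m := by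
  have h := Sigma.ι (fun _ : (M × M) ⊕ (M × A) => X) (.inr (m, a)) ≫=
    cokernel.condition (tensorRel M ρ)
  have e : Sigma.ι (fun _ : (M × M) ⊕ (M × A) => X) (.inr (m, a)) ≫ tensorRel M ρ =
      Sigma.ι (fun _ : M => X) (MulOpposite.op a • m) - ρ a ≫ Sigma.ι (fun _ : M => X) m := by
    simp [tensorRel]
  rw [← Category.assoc, e, comp_zero, Preadditive.sub_comp, sub_eq_zero, Category.assoc] at h
  exact h

lemma tensor_hom_ext {M : ModuleCat.{u} Aᵐᵒᵖ} {X Y : B} {ρ : A → (X ⟶ X)}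
    {f g : tensorObj M ρ ⟶ Y} (h : ∀ m, tensorι M ρ m ≫ f = tensorι M ρ m ≫ g) : f = g := by
  refine (cancel_epi (cokernel.π (tensorRel M ρ))).1 (Sigma.hom_ext _ _ fun m => ?_)
  simpa [tensorι] using h m

/-- The universal property of `M ⊗_A X`. -/
def tensorDesc (M : ModuleCat.{u} Aᵐᵒᵖ) {X Y : B} (ρ : A → (X ⟶ X)) (f : M → (X ⟶ Y))
    (hadd : ∀ m m', f (m + m') = f m + f m')
    (hsmul : ∀ (a : A) m, f (MulOpposite.op a • m) = ρ a ≫ f m) : tensorObj M ρ ⟶ Y :=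
  cokernel.desc (tensorRel M ρ) (Sigma.desc f) (by
    refine Sigma.hom_ext _ _ fun b => ?_
    rcases b with ⟨m, m'⟩ | ⟨m, a⟩
    · simp [tensorRel, hadd]
    · simp [tensorRel, hsmul])

@[simp]
lemma tensorι_desc (M : ModuleCat.{u} Aᵐᵒᵖ) {X Y : B} (ρ : A → (X ⟶ X)) (f : M → (X ⟶ Y))
    (hadd) (hsmul) (m : M) : tensorι M ρ m ≫ tensorDesc M ρ f hadd hsmul = f m := by
  simp [tensorι, tensorDesc]

end TensorObjects

section LinObjects

variable {B : Type v} [Category.{u} B] [Abelian B] [HasProducts.{u} B] {A : Type u} [Ring A]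

/-- The relations `f (m + m') = f m + f m'` and `f (a m) = a (f m)`. -/
def linRel (M : ModuleCat.{u} A) {X : B} (ρ : A → (X ⟶ X)) :
    (∏ᶜ fun _ : M => X) ⟶ (∏ᶜ fun _ : (M × M) ⊕ (M × A) => X) :=
  Pi.lift fun
    | .inl p => Pi.π (fun _ : M => X) (p.1 + p.2) - Pi.π (fun _ : M => X) p.1
        - Pi.π (fun _ : M => X) p.2
    | .inr p => Pi.π (fun _ : M => X) (p.2 • p.1) - Pi.π (fun _ : M => X) p.1 ≫ ρ p.2

/-- The object `lin_A(M, X)` of `A`-linear maps from a left `A`-module to an object on which `A`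
acts: the subobject of the product of copies of `X` indexed by `M` cut out by linearity.
For a finitely generated projective module `M` it is `Hom_A(M, A) ⊗_A X`. -/
abbrev linObj (M : ModuleCat.{u} A) {X : B} (ρ : A → (X ⟶ X)) : B :=
  kernel (linRel M ρ)

/-- Evaluation of linear maps at `m`. -/
def linπ (M : ModuleCat.{u} A) {X : B} (ρ : A → (X ⟶ X)) (m : M) : linObj M ρ ⟶ X :=
  kernel.ι (linRel M ρ) ≫ Pi.π (fun _ : M => X) m

lemma linπ_add (M : ModuleCat.{u} A) {X : B} (ρ : A → (X ⟶ X)) (m m' : M) :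
    linπ M ρ (m + m') = linπ M ρ m + linπ M ρ m' := by
  have h := kernel.condition (linRel M ρ) =≫
    Pi.π (fun _ : (M × M) ⊕ (M × A) => X) (.inl (m, m'))
  have e : linRel M ρ ≫ Pi.π (fun _ : (M × M) ⊕ (M × A) => X) (.inl (m, m')) =
      Pi.π (fun _ : M => X) (m + m') - Pi.π (fun _ : M => X) m
        - Pi.π (fun _ : M => X) m' := by simp [linRel]
  rw [Category.assoc, e, zero_comp, Preadditive.comp_sub, Preadditive.comp_sub, sub_sub,
    sub_eq_zero] at h
  exact h

lemma linπ_smul (M : ModuleCat.{u} A) {X : B} (ρ : A → (X ⟶ X)) (a : A) (m : M) :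
    linπ M ρ (a • m) = linπ M ρ m ≫ ρ a := by
  have h := kernel.condition (linRel M ρ) =≫
    Pi.π (fun _ : (M × M) ⊕ (M × A) => X) (.inr (m, a))
  have e : linRel M ρ ≫ Pi.π (fun _ : (M × M) ⊕ (M × A) => X) (.inr (m, a)) =
      Pi.π (fun _ : M => X) (a • m) - Pi.π (fun _ : M => X) m ≫ ρ a := by simp [linRel]
  rw [Category.assoc, e, zero_comp, Preadditive.comp_sub, sub_eq_zero, ← Category.assoc] at h
  exact h

lemma lin_hom_ext {M : ModuleCat.{u} A} {X Y : B} {ρ : A → (X ⟶ X)}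
    {f g : Y ⟶ linObj M ρ} (h : ∀ m, f ≫ linπ M ρ m = g ≫ linπ M ρ m) : f = g := by
  refine (cancel_mono (kernel.ι (linRel M ρ))).1 (Pi.hom_ext _ _ fun m => ?_)
  simpa [linπ] using h m

/-- The universal property of `lin_A(M, X)`. -/
def linLift (M : ModuleCat.{u} A) {X Y : B} (ρ : A → (X ⟶ X)) (f : M → (Y ⟶ X))
    (hadd : ∀ m m', f (m + m') = f m + f m')
    (hsmul : ∀ (a : A) m, f (a • m) = f m ≫ ρ a) : Y ⟶ linObj M ρ :=
  kernel.lift (linRel M ρ) (Pi.lift f) (by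
    refine Pi.hom_ext _ _ fun b => ?_
    rcases b with ⟨m, m'⟩ | ⟨m, a⟩
    · simp [linRel, hadd]
    · simp [linRel, hsmul])

@[simp]
lemma linLift_π (M : ModuleCat.{u} A) {X Y : B} (ρ : A → (X ⟶ X)) (f : M → (Y ⟶ X))
    (hadd) (hsmul) (m : M) : linLift M ρ f hadd hsmul ≫ linπ M ρ m = f m := by
  simp [linπ, linLift]

end LinObjects

/-! ## The corresponding complexes -/

section HomComplexes

variable {B : Type v} [Category.{u} B] [Abelian B] {A : Type u} [Ring A]
  {E : CochainComplex B ℤ} (ρ : A →+* End E)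

/-- The action of `A` on the term of degree `j` of the complex `E`. -/
def act (j : ℤ) (a : A) : E.X j ⟶ E.X j := HomologicalComplex.Hom.f (ρ a) j

lemma act_d (i j : ℤ) (a : A) : act ρ i a ≫ E.d i j = E.d i j ≫ act ρ j a :=
  HomologicalComplex.Hom.comm (ρ a) i j

/-- The right `A`-module structure `φ a = φ ∘ a` on the cochains from `E` to `F`. -/
abbrev rightModule (F : CochainComplex B ℤ) (i : ℤ) : Module Aᵐᵒᵖ (Cochain E F i) where
  smul a φ := (Cochain.ofHom (ρ a.unop)).comp φ (zero_add i)
  one_smul φ := by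
    change (Cochain.ofHom (ρ 1)).comp φ (zero_add i) = φ
    rw [map_one]
    exact Cochain.id_comp φ
  mul_smul a b φ := by
    change (Cochain.ofHom (ρ (b.unop * a.unop))).comp φ (zero_add i) =
      (Cochain.ofHom (ρ a.unop)).comp ((Cochain.ofHom (ρ b.unop)).comp φ (zero_add i)) (zero_add i)
    rw [map_mul, End.mul_def, Cochain.ofHom_comp, Cochain.comp_assoc_of_first_is_zero_cochain]
  smul_zero a := Cochain.comp_zero _ _
  smul_add a φ ψ := Cochain.comp_add _ _ _ _
  add_smul a b φ := by
    change (Cochain.ofHom (ρ (a.unop + b.unop))).comp φ (zero_add i) = _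
    rw [map_add]
    exact (congrArg (fun z => Cochain.comp z φ (zero_add i)) (Cochain.ofHom_add _ _)).trans
      (Cochain.add_comp _ _ _ _)
  zero_smul φ := by
    change (Cochain.ofHom (ρ 0)).comp φ (zero_add i) = 0
    rw [map_zero]
    exact (congrArg (fun z => Cochain.comp z φ (zero_add i)) (Cochain.ofHom_zero _ _)).trans
      (Cochain.zero_comp _ _)

/-- The left `A`-module structure `a φ = a ∘ φ` on the cochains from `F` to `E`. -/
abbrev leftModule (F : CochainComplex B ℤ) (i : ℤ) : Module A (Cochain F E i) where
  smul a φ := φ.comp (Cochain.ofHom (ρ a)) (add_zero i)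
  one_smul φ := by
    change φ.comp (Cochain.ofHom (ρ 1)) (add_zero i) = φ
    rw [map_one]
    exact Cochain.comp_id φ
  mul_smul a b φ := by
    change φ.comp (Cochain.ofHom (ρ (a * b))) (add_zero i) =
      (φ.comp (Cochain.ofHom (ρ b)) (add_zero i)).comp (Cochain.ofHom (ρ a)) (add_zero i)
    rw [map_mul, End.mul_def, Cochain.ofHom_comp, Cochain.comp_assoc_of_second_is_zero_cochain]
  smul_zero a := Cochain.zero_comp _ _
  smul_add a φ ψ := Cochain.add_comp _ _ _ _
  add_smul a b φ := by
    change φ.comp (Cochain.ofHom (ρ (a + b))) (add_zero i) = _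
    rw [map_add]
    exact (congrArg (fun z => Cochain.comp φ z (add_zero i)) (Cochain.ofHom_add _ _)).trans
      (Cochain.comp_add _ _ _ _)
  zero_smul φ := by
    change φ.comp (Cochain.ofHom (ρ 0)) (add_zero i) = 0
    rw [map_zero]
    exact (congrArg (fun z => Cochain.comp φ z (add_zero i)) (Cochain.ofHom_zero _ _)).trans
      (Cochain.comp_zero _ _)

/-- The right `A`-module `∏ⱼ Hom(Eʲ, Fⁱ⁺ʲ)`. -/
def homFromX (F : CochainComplex B ℤ) (i : ℤ) : ModuleCat.{u} Aᵐᵒᵖ :=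
  @ModuleCat.of Aᵐᵒᵖ _ (Cochain E F i) _ (rightModule ρ F i)

/-- The differential `φ ↦ d ∘ φ - (-1)ⁱ φ ∘ d` on cochains from `E` to `F`. -/
def homFromD (F : CochainComplex B ℤ) (i j : ℤ) : homFromX ρ F i ⟶ homFromX ρ F j :=
  letI := rightModule ρ F i
  letI := rightModule ρ F j
  ModuleCat.ofHom
    { toFun := δ i j
      map_add' := δ_add i j
      map_smul' := fun a φ => δ_ofHom_comp (ρ a.unop) φ j }

/-- The cochain complex of right `A`-modules `Hom(E, F)`. -/
def homFrom (F : CochainComplex B ℤ) : CochainComplex (ModuleCat.{u} Aᵐᵒᵖ) ℤ where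
  X := homFromX ρ F
  d := homFromD ρ F
  shape i j h := ModuleCat.hom_ext (LinearMap.ext fun φ => δ_shape i j h φ)
  d_comp_d' i j l _ _ := ModuleCat.hom_ext (LinearMap.ext fun φ => δ_δ i j l φ)

/-- The left `A`-module `∏ⱼ Hom(Fʲ, Eⁱ⁺ʲ)`. -/
def homToX (F : CochainComplex B ℤ) (i : ℤ) : ModuleCat.{u} A :=
  @ModuleCat.of A _ (Cochain F E i) _ (leftModule ρ F i)

/-- The differential `φ ↦ d ∘ φ - (-1)ⁱ φ ∘ d` on cochains from `F` to `E`. -/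
def homToD (F : CochainComplex B ℤ) (i j : ℤ) : homToX ρ F i ⟶ homToX ρ F j :=
  letI := leftModule ρ F i
  letI := leftModule ρ F j
  ModuleCat.ofHom
    { toFun := δ i j
      map_add' := δ_add i j
      map_smul' := fun a φ => δ_comp_ofHom φ (ρ a) j }

/-- The cochain complex of left `A`-modules `Hom(F, E)`. -/
def homTo (F : CochainComplex B ℤ) : CochainComplex (ModuleCat.{u} A) ℤ where
  X := homToX ρ F
  d := homToD ρ F
  shape i j h := ModuleCat.hom_ext (LinearMap.ext fun φ => δ_shape i j h φ)
  d_comp_d' i j l _ _ := ModuleCat.hom_ext (LinearMap.ext fun φ => δ_δ i j l φ)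

/-- Postcomposition with a morphism `F ⟶ F'`. -/
def homFromMap {F F' : CochainComplex B ℤ} (f : F ⟶ F') : homFrom ρ F ⟶ homFrom ρ F' where
  f i :=
    letI := rightModule ρ F i
    letI := rightModule ρ F' i
    ModuleCat.ofHom
      { toFun := fun φ => Cochain.comp φ (Cochain.ofHom f) (add_zero i)
        map_add' := fun φ ψ => Cochain.add_comp _ _ _ _
        map_smul' := fun a φ => Cochain.comp_assoc_of_first_is_zero_cochain _ _ _ _ }
  comm' i j _ := by
    exact ModuleCat.hom_ext (LinearMap.ext fun φ => δ_comp_ofHom φ f j)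

/-- Precomposition with a morphism `F ⟶ F'`. -/
def homToMap {F F' : CochainComplex B ℤ} (f : F ⟶ F') : homTo ρ F' ⟶ homTo ρ F where
  f i :=
    letI := leftModule ρ F i
    letI := leftModule ρ F' i
    ModuleCat.ofHom
      { toFun := fun φ => Cochain.comp (Cochain.ofHom f) φ (zero_add i)
        map_add' := fun φ ψ => Cochain.comp_add _ _ _ _
        map_smul' := fun a φ => (Cochain.comp_assoc_of_first_is_zero_cochain _ _ _ _).symm }
  comm' i j _ := by
    exact ModuleCat.hom_ext (LinearMap.ext fun φ => δ_ofHom_comp f φ j)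

lemma homFromMap_id (F : CochainComplex B ℤ) : homFromMap ρ (𝟙 F) = 𝟙 _ :=
  HomologicalComplex.hom_ext _ _ fun _ =>
    ModuleCat.hom_ext (LinearMap.ext fun φ => Cochain.comp_id φ)

lemma homFromMap_comp {F F' F'' : CochainComplex B ℤ} (f : F ⟶ F') (g : F' ⟶ F'') :
    homFromMap ρ (f ≫ g) = homFromMap ρ f ≫ homFromMap ρ g :=
  HomologicalComplex.hom_ext _ _ fun _ => ModuleCat.hom_ext (LinearMap.ext fun φ =>
    (congrArg (fun z => Cochain.comp φ z (add_zero _)) (Cochain.ofHom_comp f g)).trans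
      (Cochain.comp_assoc_of_third_is_zero_cochain _ _ _ _).symm)

lemma homToMap_id (F : CochainComplex B ℤ) : homToMap ρ (𝟙 F) = 𝟙 _ :=
  HomologicalComplex.hom_ext _ _ fun _ =>
    ModuleCat.hom_ext (LinearMap.ext fun φ => Cochain.id_comp φ)

lemma homToMap_comp {F F' F'' : CochainComplex B ℤ} (f : F ⟶ F') (g : F' ⟶ F'') :
    homToMap ρ (f ≫ g) = homToMap ρ g ≫ homToMap ρ f :=
  HomologicalComplex.hom_ext _ _ fun _ => ModuleCat.hom_ext (LinearMap.ext fun φ =>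
    (congrArg (fun z => Cochain.comp z φ (zero_add _)) (Cochain.ofHom_comp f g)).trans
      (Cochain.comp_assoc_of_first_is_zero_cochain _ _ _ _))

end HomComplexes

section TensorComplexes

variable {B : Type v} [Category.{u} B] [Abelian B] [HasCoproducts.{u} B]
  [HasCountableCoproducts B] {A : Type u} [Ring A] {E : CochainComplex B ℤ} (ρ : A →+* End E)

variable (V : CochainComplex (ModuleCat.{u} Aᵐᵒᵖ) ℤ)

/-- The term `⨁_{i + j = n} Vⁱ ⊗_A Eʲ`. -/
abbrev tensorX (n : ℤ) : B :=
  ∐ fun p : {p : ℤ × ℤ // p.1 + p.2 = n} => tensorObj (V.X p.1.1) (act ρ p.1.2)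

/-- The morphism `x ↦ v ⊗ x` from `Eʲ`, for `v` of degree `i`. -/
def tensorElt (i j n : ℤ) (h : i + j = n) (v : V.X i) : E.X j ⟶ tensorX ρ V n :=
  tensorι (V.X i) (act ρ j) v ≫
    Sigma.ι (fun p : {p : ℤ × ℤ // p.1 + p.2 = n} => tensorObj (V.X p.1.1) (act ρ p.1.2))
      ⟨(i, j), h⟩

lemma tensorElt_add (i j n : ℤ) (h : i + j = n) (v v' : V.X i) :
    tensorElt ρ V i j n h (v + v') = tensorElt ρ V i j n h v + tensorElt ρ V i j n h v' := by
  rw [tensorElt, tensorι_add, Preadditive.add_comp]; rfl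

lemma tensorElt_zero (i j n : ℤ) (h : i + j = n) : tensorElt ρ V i j n h 0 = 0 := by
  simpa using tensorElt_add ρ V i j n h 0 0

lemma tensorElt_smul (i j n : ℤ) (h : i + j = n) (a : A) (v : V.X i) :
    tensorElt ρ V i j n h (MulOpposite.op a • v) = act ρ j a ≫ tensorElt ρ V i j n h v := by
  rw [tensorElt, tensorι_smul, Category.assoc]; rfl

variable {ρ V} in
lemma tensorX_hom_ext {n : ℤ} {Y : B} {f g : tensorX ρ V n ⟶ Y}
    (h : ∀ i j hij v, tensorElt ρ V i j n hij v ≫ f = tensorElt ρ V i j n hij v ≫ g) : f = g := by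
  refine Sigma.hom_ext _ _ fun ⟨⟨i, j⟩, hij⟩ => tensor_hom_ext fun v => ?_
  have := h i j hij v
  simpa only [tensorElt, Category.assoc] using this

/-- A morphism out of the degree `n` term of `V ⊗_A E` is a family of biadditive and
`A`-balanced assignments `v ↦ (x ↦ f (v ⊗ x))`. -/
def tensorXDesc {n : ℤ} {Y : B} (f : ∀ i j : ℤ, i + j = n → V.X i → (E.X j ⟶ Y))
    (hadd : ∀ i j h v v', f i j h (v + v') = f i j h v + f i j h v')
    (hsmul : ∀ i j h (a : A) v, f i j h (MulOpposite.op a • v) = act ρ j a ≫ f i j h v) :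
    tensorX ρ V n ⟶ Y :=
  Sigma.desc fun p => tensorDesc (V.X p.1.1) (act ρ p.1.2) (f p.1.1 p.1.2 p.2)
    (hadd _ _ _) (hsmul _ _ _)

lemma tensorElt_desc {n : ℤ} {Y : B} (f : ∀ i j : ℤ, i + j = n → V.X i → (E.X j ⟶ Y))
    (hadd) (hsmul) (i j : ℤ) (h : i + j = n) (v : V.X i) :
    tensorElt ρ V i j n h v ≫ tensorXDesc ρ V f hadd hsmul = f i j h v := by
  rw [tensorElt, tensorXDesc, Category.assoc, Sigma.ι_desc, tensorι_desc]

/-- The differential `v ⊗ x ↦ d v ⊗ x + (-1)ⁱ v ⊗ d x` (for `v` of degree `i`). -/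
def tensorD (n n' : ℤ) : tensorX ρ V n ⟶ tensorX ρ V n' :=
  tensorXDesc ρ V
    (fun i j _ v =>
      tensorElt ρ V (n' - j) j n' (sub_add_cancel _ _) ((V.d i (n' - j)).hom v) +
        i.negOnePow • (E.d j (n' - i) ≫ tensorElt ρ V i (n' - i) n' (add_sub_cancel _ _) v))
    (fun i j _ v v' => by
      rw [map_add, tensorElt_add, tensorElt_add, Preadditive.comp_add, smul_add]
      abel)
    (fun i j _ a v => by
      rw [map_smul, tensorElt_smul, tensorElt_smul, Preadditive.comp_add, Linear.comp_units_smul,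
        ← Category.assoc, ← act_d, Category.assoc])

lemma tensorElt_d (i j n i' j' n' : ℤ) (h : i + j = n) (h₁ : i' + j = n') (h₂ : i + j' = n')
    (v : V.X i) :
    tensorElt ρ V i j n h v ≫ tensorD ρ V n n' =
      tensorElt ρ V i' j n' h₁ ((V.d i i').hom v) +
        i.negOnePow • (E.d j j' ≫ tensorElt ρ V i j' n' h₂ v) := by
  obtain rfl : i' = n' - j := by lia
  obtain rfl : j' = n' - i := by lia
  exact tensorElt_desc _ _ _ _ _ _ _ _ _

/-- The complex `V ⊗_A E`. -/
def tensorComplex : CochainComplex B ℤ where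
  X := tensorX ρ V
  d := tensorD ρ V
  shape n n' h := by
    refine tensorX_hom_ext fun i j hij v => ?_
    have h : ¬ n + 1 = n' := h
    have h1 : V.d i (n' - j) = 0 := V.shape _ _ (fun h' => h (by
      have : i + 1 = n' - j := h'
      lia))
    have h2 : E.d j (n' - i) = 0 := E.shape _ _ (fun h' => h (by
      have : j + 1 = n' - i := h'
      lia))
    rw [tensorElt_d ρ V i j n (n' - j) (n' - i) n' hij (by lia) (by lia), h1, h2]
    simp [tensorElt_zero]
  d_comp_d' n n' n'' h h' := by
    refine tensorX_hom_ext fun i j hij v => ?_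
    have h : n + 1 = n' := h
    have h' : n' + 1 = n'' := h'
    rw [← Category.assoc,
      tensorElt_d ρ V i j n (i + 1) (j + 1) n' hij (by lia) (by lia), Preadditive.add_comp,
      Linear.units_smul_comp, Category.assoc,
      tensorElt_d ρ V (i + 1) j n' (i + 1 + 1) (j + 1) n'' _ (by lia) (by lia),
      tensorElt_d ρ V i (j + 1) n' (i + 1) (j + 1 + 1) n'' _ (by lia) (by lia)]
    have h3 : (V.d (i + 1) (i + 1 + 1)).hom ((V.d i (i + 1)).hom v) = 0 := by
      rw [← ModuleCat.comp_apply, V.d_comp_d]; rfl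
    rw [h3, tensorElt_zero, Preadditive.comp_add, Linear.comp_units_smul,
      HomologicalComplex.d_comp_d_assoc, Int.negOnePow_succ]
    simp

section

variable {V} {V' V'' : CochainComplex (ModuleCat.{u} Aᵐᵒᵖ) ℤ} (g : V ⟶ V') (g' : V' ⟶ V'')

/-- The map `v ⊗ x ↦ g v ⊗ x` in degree `n`. -/
def tensorMapX (n : ℤ) : tensorX ρ V n ⟶ tensorX ρ V' n :=
  tensorXDesc ρ V (fun i j h v => tensorElt ρ V' i j n h ((g.f i).hom v))
    (fun i j h v v' => by rw [map_add, tensorElt_add])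
    (fun i j h a v => by rw [map_smul, tensorElt_smul])

lemma tensorElt_mapX (i j n : ℤ) (h : i + j = n) (v : V.X i) :
    tensorElt ρ V i j n h v ≫ tensorMapX ρ g n = tensorElt ρ V' i j n h ((g.f i).hom v) :=
  tensorElt_desc _ _ _ _ _ _ _ _ _

lemma tensorMapX_d (n n' : ℤ) (h : n + 1 = n') :
    tensorMapX ρ g n ≫ tensorD ρ V' n n' = tensorD ρ V n n' ≫ tensorMapX ρ g n' := by
  refine tensorX_hom_ext fun i j hij v => ?_
  rw [← Category.assoc, ← Category.assoc, tensorElt_mapX,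
    tensorElt_d ρ V' i j n (i + 1) (j + 1) n' hij (by lia) (by lia),
    tensorElt_d ρ V i j n (i + 1) (j + 1) n' hij (by lia) (by lia), Preadditive.add_comp,
    Linear.units_smul_comp, Category.assoc, tensorElt_mapX, tensorElt_mapX,
    ← ModuleCat.comp_apply, ← ModuleCat.comp_apply, g.comm]

/-- The morphism `V ⊗_A E ⟶ V' ⊗_A E` induced by `V ⟶ V'`. -/
def tensorComplexMap : tensorComplex ρ V ⟶ tensorComplex ρ V' where
  f := tensorMapX ρ g
  comm' n n' h := tensorMapX_d ρ g n n' h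

variable (V) in
lemma tensorComplexMap_id : tensorComplexMap ρ (𝟙 V) = 𝟙 _ :=
  HomologicalComplex.hom_ext _ _ fun n => by
    change tensorMapX ρ (𝟙 V) n = 𝟙 (tensorX ρ V n)
    refine tensorX_hom_ext fun i j hij v => ?_
    rw [tensorElt_mapX, Category.comp_id]
    rfl

lemma tensorComplexMap_comp :
    tensorComplexMap ρ (g ≫ g') = tensorComplexMap ρ g ≫ tensorComplexMap ρ g' :=
  HomologicalComplex.hom_ext _ _ fun n => by
    change tensorMapX ρ (g ≫ g') n = tensorMapX ρ g n ≫ tensorMapX ρ g' n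
    refine tensorX_hom_ext fun i j hij v => ?_
    rw [tensorElt_mapX, ← Category.assoc, tensorElt_mapX, tensorElt_mapX]
    rfl

end

/-- The canonical evaluation map in degree `n`. -/
def evaluationX (F : CochainComplex B ℤ) (n : ℤ) : tensorX ρ (homFrom ρ F) n ⟶ F.X n :=
  tensorXDesc ρ (homFrom ρ F)
    (fun i j h (φ : Cochain E F i) => φ.v j n ((add_comm j i).trans h))
    (fun _ _ _ _ _ => rfl)
    (fun i j h a φ => (Cochain.zero_cochain_comp_v (Cochain.ofHom (ρ a)) φ j n _).trans (by
      rw [Cochain.ofHom_v]; rfl))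

lemma tensorElt_evaluationX (F : CochainComplex B ℤ) (i j n : ℤ) (h : i + j = n)
    (φ : (homFrom ρ F).X i) :
    tensorElt ρ (homFrom ρ F) i j n h φ ≫ evaluationX ρ F n =
      @Cochain.v B _ _ E F i φ j n ((add_comm j i).trans h) :=
  tensorElt_desc ρ (homFrom ρ F)
    (fun i j h (φ : Cochain E F i) => φ.v j n ((add_comm j i).trans h)) _ _ i j h φ

lemma evaluationX_d (F : CochainComplex B ℤ) (n n' : ℤ) (h : n + 1 = n') :
    evaluationX ρ F n ≫ F.d n n' = tensorD ρ (homFrom ρ F) n n' ≫ evaluationX ρ F n' := by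
  refine tensorX_hom_ext fun i j hij φ => ?_
  rw [← Category.assoc, ← Category.assoc, tensorElt_evaluationX,
    tensorElt_d ρ _ i j n (i + 1) (j + 1) n' hij (by lia) (by lia), Preadditive.add_comp,
    Linear.units_smul_comp, Category.assoc]
  refine Eq.trans ?_ (congrArg₂ (fun x y => x + i.negOnePow • (E.d j (j + 1) ≫ y))
    (tensorElt_evaluationX ρ F (i + 1) j n' (by lia) (δ i (i + 1) φ))
    (tensorElt_evaluationX ρ F i (j + 1) n' (by lia) φ)).symm
  rw [δ_v i (i + 1) rfl φ j n' (by lia) n (j + 1) (by lia) rfl, Int.negOnePow_succ]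
  simp

/-- The canonical evaluation map `Hom(E, F) ⊗_A E ⟶ F`, `φ ⊗ x ↦ φ x`. -/
def evaluation (F : CochainComplex B ℤ) : tensorComplex ρ (homFrom ρ F) ⟶ F where
  f := evaluationX ρ F
  comm' n n' h := evaluationX_d ρ F n n' h

lemma evaluation_naturality {F F' : CochainComplex B ℤ} (f : F ⟶ F') :
    evaluation ρ F ≫ f = tensorComplexMap ρ (homFromMap ρ f) ≫ evaluation ρ F' :=
  HomologicalComplex.hom_ext _ _ fun n => by
    change evaluationX ρ F n ≫ f.f n = tensorMapX ρ (homFromMap ρ f) n ≫ evaluationX ρ F' n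
    refine tensorX_hom_ext fun i j hij φ => ?_
    rw [← Category.assoc, ← Category.assoc, tensorElt_evaluationX, tensorElt_mapX]
    exact (((tensorElt_evaluationX ρ F' i j n hij _).trans
      (Cochain.comp_zero_cochain_v φ (Cochain.ofHom f) _ _ _)).trans
        (by rw [Cochain.ofHom_v])).symm

/-- The total complex `T_E F = {Hom(E, F) ⊗_A E ⟶ F}`, with `F` placed in bidegree `0`,
as a functor on cochain complexes. -/
def twist : CochainComplex B ℤ ⥤ CochainComplex B ℤ where
  obj F := CochainComplex.mappingCone (evaluation ρ F)
  map {F F'} f := CochainComplex.mappingCone.map (evaluation ρ F) (evaluation ρ F')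
    (tensorComplexMap ρ (homFromMap ρ f)) f (evaluation_naturality ρ f)
  map_id F := by
    rw [← CochainComplex.mappingCone.map_id]
    congr 1
    rw [homFromMap_id, tensorComplexMap_id]
  map_comp f g := by
    rw [← CochainComplex.mappingCone.map_comp]
    congr 1
    rw [homFromMap_comp, tensorComplexMap_comp]

end TensorComplexes

section LinComplexes

variable {B : Type v} [Category.{u} B] [Abelian B] [HasProducts.{u} B]
  [HasCountableProducts B] {A : Type u} [Ring A] {E : CochainComplex B ℤ} (ρ : A →+* End E)

variable (W : CochainComplex (ModuleCat.{u} A) ℤ)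

/-- The term `∏_{j = i + n} lin_A(Wⁱ, Eʲ)`. -/
abbrev linX (n : ℤ) : B :=
  ∏ᶜ fun p : {p : ℤ × ℤ // p.1 + n = p.2} => linObj (W.X p.1.1) (act ρ p.1.2)

/-- The morphism `f ↦ f w` to `Eʲ`, for `w` of degree `i`. -/
def linElt (i j n : ℤ) (h : i + n = j) (w : W.X i) : linX ρ W n ⟶ E.X j :=
  Pi.π (fun p : {p : ℤ × ℤ // p.1 + n = p.2} => linObj (W.X p.1.1) (act ρ p.1.2))
    ⟨(i, j), h⟩ ≫ linπ (W.X i) (act ρ j) w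

lemma linElt_add (i j n : ℤ) (h : i + n = j) (w w' : W.X i) :
    linElt ρ W i j n h (w + w') = linElt ρ W i j n h w + linElt ρ W i j n h w' := by
  rw [linElt, linπ_add, Preadditive.comp_add]; rfl

lemma linElt_zero (i j n : ℤ) (h : i + n = j) : linElt ρ W i j n h 0 = 0 := by
  simpa using linElt_add ρ W i j n h 0 0

lemma linElt_smul (i j n : ℤ) (h : i + n = j) (a : A) (w : W.X i) :
    linElt ρ W i j n h (a • w) = linElt ρ W i j n h w ≫ act ρ j a := by
  rw [linElt, linπ_smul, ← Category.assoc]; rfl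

variable {ρ W} in
lemma linX_hom_ext {n : ℤ} {Y : B} {f g : Y ⟶ linX ρ W n}
    (h : ∀ i j hij w, f ≫ linElt ρ W i j n hij w = g ≫ linElt ρ W i j n hij w) : f = g := by
  refine Pi.hom_ext _ _ fun ⟨⟨i, j⟩, hij⟩ => lin_hom_ext fun w => ?_
  have := h i j hij w
  simpa only [linElt, ← Category.assoc] using this

/-- A morphism into the degree `n` term of `lin_A(W, E)` is a family of `A`-linear
assignments `w ↦ (y ↦ f y w)`. -/
def linXLift {n : ℤ} {Y : B} (f : ∀ i j : ℤ, i + n = j → W.X i → (Y ⟶ E.X j))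
    (hadd : ∀ i j h w w', f i j h (w + w') = f i j h w + f i j h w')
    (hsmul : ∀ i j h (a : A) w, f i j h (a • w) = f i j h w ≫ act ρ j a) :
    Y ⟶ linX ρ W n :=
  Pi.lift fun p => linLift (W.X p.1.1) (act ρ p.1.2) (f p.1.1 p.1.2 p.2)
    (hadd _ _ _) (hsmul _ _ _)

@[simp]
lemma linXLift_elt {n : ℤ} {Y : B} (f : ∀ i j : ℤ, i + n = j → W.X i → (Y ⟶ E.X j))
    (hadd) (hsmul) (i j : ℤ) (h : i + n = j) (w : W.X i) :
    linXLift ρ W f hadd hsmul ≫ linElt ρ W i j n h w = f i j h w := by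
  rw [linElt, linXLift, ← Category.assoc, Pi.lift_π, linLift_π]

/-- The differential `(d f) w = (-1)ⁱ (d (f w) - f (d w))` for `w` of degree `i`; with it the
evaluation `w ⊗ f ↦ f w` is a morphism of complexes. -/
def linD (n n' : ℤ) : linX ρ W n ⟶ linX ρ W n' :=
  linXLift ρ W
    (fun i j _ w =>
      i.negOnePow • (linElt ρ W i (i + n) n rfl w ≫ E.d (i + n) j -
        linElt ρ W (j - n) j n (sub_add_cancel _ _) ((W.d i (j - n)).hom w)))
    (fun i j _ w w' => by
      rw [map_add, linElt_add, linElt_add, Preadditive.add_comp, ← smul_add]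
      congr 1
      abel)
    (fun i j _ a w => by
      rw [map_smul, linElt_smul, linElt_smul, Linear.units_smul_comp, Preadditive.sub_comp,
        Category.assoc, Category.assoc, act_d])

lemma linD_elt (i j n i' j' n' : ℤ) (h : i + n' = j) (h₁ : i + n = j') (h₂ : i' + n = j)
    (w : W.X i) :
    linD ρ W n n' ≫ linElt ρ W i j n' h w =
      i.negOnePow • (linElt ρ W i j' n h₁ w ≫ E.d j' j -
        linElt ρ W i' j n h₂ ((W.d i i').hom w)) := by
  obtain rfl : i' = j - n := by lia
  subst h₁
  exact linXLift_elt _ _ _ _ _ _ _ _ _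

/-- The complex `lin_A(W, E)` of `A`-linear maps. -/
def linComplex : CochainComplex B ℤ where
  X := linX ρ W
  d := linD ρ W
  shape n n' h := by
    refine linX_hom_ext fun i j hij w => ?_
    have h : ¬ n + 1 = n' := h
    have h1 : W.d i (j - n) = 0 := W.shape _ _ (fun h' => h (by
      have : i + 1 = j - n := h'
      lia))
    have h2 : E.d (i + n) j = 0 := E.shape _ _ (fun h' => h (by
      have : i + n + 1 = j := h'
      lia))
    rw [linD_elt ρ W i j n (j - n) (i + n) n' hij (by lia) (by lia), h1, h2]
    simp [linElt_zero]
  d_comp_d' n n' n'' h h' := by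
    refine linX_hom_ext fun i j hij w => ?_
    have h : n + 1 = n' := h
    have h' : n' + 1 = n'' := h'
    rw [Category.assoc,
      linD_elt ρ W i j n' (i + 1) (i + n') n'' hij (by lia) (by lia), Linear.comp_units_smul,
      Preadditive.comp_sub, ← Category.assoc,
      linD_elt ρ W i (i + n') n (i + 1) (i + n) n' _ (by lia) (by lia),
      linD_elt ρ W (i + 1) j n (i + 1 + 1) (i + n') n' _ (by lia) (by lia)]
    have h3 : (W.d (i + 1) (i + 1 + 1)).hom ((W.d i (i + 1)).hom w) = 0 := by
      rw [← ModuleCat.comp_apply, W.d_comp_d]; rfl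
    rw [h3, linElt_zero, Linear.units_smul_comp, Preadditive.sub_comp, Category.assoc,
      HomologicalComplex.d_comp_d, Int.negOnePow_succ]
    simp

section

variable {W} {W' W'' : CochainComplex (ModuleCat.{u} A) ℤ} (g : W' ⟶ W) (g' : W'' ⟶ W')

/-- The map `f ↦ f ∘ g` in degree `n`. -/
def linMapX (n : ℤ) : linX ρ W n ⟶ linX ρ W' n :=
  linXLift ρ W' (fun i j h w => linElt ρ W i j n h ((g.f i).hom w))
    (fun i j h w w' => by rw [map_add, linElt_add])
    (fun i j h a w => by rw [map_smul, linElt_smul])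

lemma linMapX_elt (i j n : ℤ) (h : i + n = j) (w : W'.X i) :
    linMapX ρ g n ≫ linElt ρ W' i j n h w = linElt ρ W i j n h ((g.f i).hom w) :=
  linXLift_elt _ _ _ _ _ _ _ _ _

lemma linMapX_d (n n' : ℤ) (h : n + 1 = n') :
    linMapX ρ g n ≫ linD ρ W' n n' = linD ρ W n n' ≫ linMapX ρ g n' := by
  refine linX_hom_ext fun i j hij w => ?_
  rw [Category.assoc, Category.assoc, linMapX_elt,
    linD_elt ρ W' i j n (i + 1) (i + n) n' hij (by lia) (by lia),
    linD_elt ρ W i j n (i + 1) (i + n) n' hij (by lia) (by lia), Linear.comp_units_smul,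
    Preadditive.comp_sub, ← Category.assoc, linMapX_elt, linMapX_elt,
    ← ModuleCat.comp_apply, ← ModuleCat.comp_apply, g.comm]

/-- The morphism `lin_A(W, E) ⟶ lin_A(W', E)` induced by `W' ⟶ W`. -/
def linComplexMap : linComplex ρ W ⟶ linComplex ρ W' where
  f := linMapX ρ g
  comm' n n' h := linMapX_d ρ g n n' h

variable (W) in
lemma linComplexMap_id : linComplexMap ρ (𝟙 W) = 𝟙 _ :=
  HomologicalComplex.hom_ext _ _ fun n => by
    change linMapX ρ (𝟙 W) n = 𝟙 (linX ρ W n)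
    refine linX_hom_ext fun i j hij w => ?_
    rw [linMapX_elt, Category.id_comp]
    rfl

lemma linComplexMap_comp :
    linComplexMap ρ (g' ≫ g) = linComplexMap ρ g ≫ linComplexMap ρ g' :=
  HomologicalComplex.hom_ext _ _ fun n => by
    change linMapX ρ (g' ≫ g) n = linMapX ρ g n ≫ linMapX ρ g' n
    refine linX_hom_ext fun i j hij w => ?_
    rw [linMapX_elt, Category.assoc, linMapX_elt, linMapX_elt]
    rfl

end

/-- The canonical coevaluation map in degree `n`. -/
def coevaluationX (F : CochainComplex B ℤ) (n : ℤ) : F.X n ⟶ linX ρ (homTo ρ F) n :=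
  linXLift ρ (homTo ρ F)
    (fun i j h (φ : Cochain F E i) => φ.v n j ((add_comm n i).trans h))
    (fun _ _ _ _ _ => rfl)
    (fun i j h a φ => (Cochain.comp_zero_cochain_v φ (Cochain.ofHom (ρ a)) n j _).trans (by
      rw [Cochain.ofHom_v]; rfl))

lemma coevaluationX_elt (F : CochainComplex B ℤ) (i j n : ℤ) (h : i + n = j)
    (φ : (homTo ρ F).X i) :
    coevaluationX ρ F n ≫ linElt ρ (homTo ρ F) i j n h φ =
      @Cochain.v B _ _ F E i φ n j ((add_comm n i).trans h) :=
  linXLift_elt ρ (homTo ρ F)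
    (fun i j h (φ : Cochain F E i) => φ.v n j ((add_comm n i).trans h)) _ _ i j h φ

lemma coevaluationX_d (F : CochainComplex B ℤ) (n n' : ℤ) (h : n + 1 = n') :
    coevaluationX ρ F n ≫ linD ρ (homTo ρ F) n n' = F.d n n' ≫ coevaluationX ρ F n' := by
  refine linX_hom_ext fun i j hij φ => ?_
  rw [Category.assoc, Category.assoc, coevaluationX_elt,
    linD_elt ρ _ i j n (i + 1) (i + n) n' hij (by lia) (by lia), Linear.comp_units_smul,
    Preadditive.comp_sub, ← Category.assoc, coevaluationX_elt]
  refine (congrArg (fun x => i.negOnePow •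
    (@Cochain.v B _ _ F E i φ n (i + n) (add_comm n i) ≫ E.d (i + n) j - x))
    (coevaluationX_elt ρ F (i + 1) j n (by lia) (δ i (i + 1) φ))).trans ?_
  rw [δ_v i (i + 1) rfl φ n j (by lia) (i + n) n' (by lia) h, Int.negOnePow_succ]
  simp [smul_smul]

/-- The canonical coevaluation map `F ⟶ lin_A(Hom(F, E), E)`, `x ↦ (φ ↦ φ x)`. -/
def coevaluation (F : CochainComplex B ℤ) : F ⟶ linComplex ρ (homTo ρ F) where
  f := coevaluationX ρ F
  comm' n n' h := coevaluationX_d ρ F n n' h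

lemma coevaluation_naturality {F F' : CochainComplex B ℤ} (f : F ⟶ F') :
    coevaluation ρ F ≫ linComplexMap ρ (homToMap ρ f) = f ≫ coevaluation ρ F' :=
  HomologicalComplex.hom_ext _ _ fun n => by
    change coevaluationX ρ F n ≫ linMapX ρ (homToMap ρ f) n = f.f n ≫ coevaluationX ρ F' n
    refine linX_hom_ext fun i j hij φ => ?_
    rw [Category.assoc, Category.assoc, coevaluationX_elt, linMapX_elt]
    exact ((coevaluationX_elt ρ F i j n hij _).trans
      (Cochain.zero_cochain_comp_v (Cochain.ofHom f) φ _ _ _)).trans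
        (by rw [Cochain.ofHom_v])

/-- The total complex `T*_E F = {F ⟶ lin_A(Hom(F, E), E)}`, with `F` placed in bidegree `0`,
as a functor on cochain complexes. -/
def dualTwist : CochainComplex B ℤ ⥤ CochainComplex B ℤ where
  obj F := CochainComplex.mappingCocone (coevaluation ρ F)
  map {F F'} f := (CochainComplex.mappingCone.map (coevaluation ρ F) (coevaluation ρ F')
    f (linComplexMap ρ (homToMap ρ f)) (coevaluation_naturality ρ f))⟦(-1 : ℤ)⟧'
  map_id F := by
    refine Eq.trans ?_ (CategoryTheory.Functor.map_id (shiftFunctor _ (-1 : ℤ)) _)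
    congr 1
    rw [← CochainComplex.mappingCone.map_id]
    congr 1
    rw [homToMap_id, linComplexMap_id]
  map_comp f g := by
    refine Eq.trans ?_ (CategoryTheory.Functor.map_comp (shiftFunctor _ (-1 : ℤ)) _ _)
    congr 1
    rw [← CochainComplex.mappingCone.map_comp]
    congr 1
    rw [homToMap_comp, linComplexMap_comp]

end LinComplexes


/-! ## Ind-objects, the category `𝔎`, and bounded derived categories -/

section Ind

variable (C : Type u) [SmallCategory C] [Abelian C]

instance indYoneda_preservesFiniteLimits : PreservesFiniteLimits (Ind.yoneda (C := C)) :=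
  PreservesLimits.preservesFiniteLimits _

instance indYoneda_additive : (Ind.yoneda (C := C)).Additive :=
  haveI := preservesBinaryBiproducts_of_preservesBinaryProducts (Ind.yoneda (C := C))
  Functor.additive_of_preservesBinaryBiproducts _

variable {C} in
/-- The action of a scalar `c` on an ind-object, seen as a presheaf: it is the action of
`c • 𝟙 Y` on the sections over each object `Y`. -/
def indScalar {k : Type v} [Field k] [Linear k C] (c : k) (X : Ind C) : X ⟶ X :=
  (Ind.inclusion C).preimage
    { app := fun Y => ((Ind.inclusion C).obj X).map (c • 𝟙 Y.unop).op
      naturality := fun Y Z f => by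
        rw [← Functor.map_comp, ← Functor.map_comp]
        congr 1
        apply Quiver.Hom.unop_inj
        simp }

/-- The complexes which are the objects of `𝔎`: bounded below complexes of injective ind-objects
whose cohomology objects lie in `C` and vanish in large degrees. -/
def kComplex : ObjectProperty (CochainComplex (Ind C) ℤ) := fun K =>
  (∃ a : ℤ, K.IsStrictlyGE a) ∧ (∀ i, Injective (K.X i)) ∧
    (∀ i, (Ind.yoneda (C := C)).essImage (K.homology i)) ∧
    (∃ b : ℤ, ∀ i, b < i → K.ExactAt i)

/-- The category `𝔎`, a full subcategory of the homotopy category of complexes of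
ind-objects. -/
abbrev FrakK : Type _ :=
  ObjectProperty.FullSubcategory
    (fun K : HomotopyCategory (Ind C) (ComplexShape.up ℤ) => kComplex C K.as)

/-- The quotient functor from complexes to `𝔎`. -/
abbrev FrakK.quotient : (kComplex C).FullSubcategory ⥤ FrakK C :=
  ObjectProperty.lift _ ((kComplex C).ι ⋙ HomotopyCategory.quotient (Ind C) (ComplexShape.up ℤ))
    (fun K => K.property)

variable [HasDerivedCategory.{w} C] [HasDerivedCategory.{w'} (Ind C)]

/-- The canonical functor from `𝔎` to the derived category of ind-objects. -/
abbrev FrakK.toDerived : FrakK C ⥤ DerivedCategory (Ind C) :=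
  ObjectProperty.ι _ ⋙ DerivedCategory.Qh

/-- The canonical functor from `D(C)` to the derived category of ind-objects. -/
abbrev derivedInd : DerivedCategory C ⥤ DerivedCategory (Ind C) :=
  (Ind.yoneda (C := C)).mapDerivedCategory

/-- The canonical functor from `Dᵇ(C)` to the derived category of ind-objects. -/
abbrev boundedToInd : DerivedCategory.Bounded C ⥤ DerivedCategory (Ind C) :=
  DerivedCategory.Bounded.ι ⋙ derivedInd C

end Ind

section Spherical

variable {C : Type u} [SmallCategory C] [Abelian C]

/-- A bounded complex of injective ind-objects. -/
structure IsBoundedInjective (I : CochainComplex (Ind C) ℤ) : Prop where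
  bounded_below : ∃ a : ℤ, I.IsStrictlyGE a
  bounded_above : ∃ b : ℤ, I.IsStrictlyLE b
  injective : ∀ i, Injective (I.X i)

variable [HasDerivedCategory.{w} C] [HasDerivedCategory.{w'} (Ind C)]

/-- Generalized `n`-spherical objects of `Dᵇ(C)`; here `A = End(E)` and
`Homⁱ(X, Y) = Hom(X, Y[i])`. -/
structure IsGeneralizedSpherical (k : Type v) [Field k] [Linear k C] (n : ℤ)
    (E : DerivedCategory.Bounded C) : Prop where
  /-- `E` has a finite resolution by injective ind-objects. -/
  finite_injective_resolution : ∃ I : CochainComplex (Ind C) ℤ, IsBoundedInjective I ∧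
    Nonempty (DerivedCategory.Q.obj I ≅ (boundedToInd C).obj E)
  /-- The total dimension of `Hom^•(E, F)` is finite. -/
  finite_hom_from : ∀ F : DerivedCategory.Bounded C,
    Module.Finite k (DirectSum ℤ fun i => ShiftedHom E.obj F.obj i)
  /-- The total dimension of `Hom^•(F, E)` is finite. -/
  finite_hom_to : ∀ F : DerivedCategory.Bounded C,
    Module.Finite k (DirectSum ℤ fun i => ShiftedHom F.obj E.obj i)
  /-- `A ≅ k^r` as algebras. -/
  end_iso : ∃ r : ℕ, Nonempty (End E.obj ≃ₐ[k] (Fin r → k))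
  /-- `Homⁱ(E, E) = 0` for `i ≠ 0, n`. -/
  hom_eq_zero : ∀ i : ℤ, i ≠ 0 → i ≠ n → ∀ f : ShiftedHom E.obj E.obj i, f = 0
  /-- `Homⁿ(E, E) ≅ A` as left `A`-modules. -/
  hom_iso_left : ∃ e : (E.obj ⟶ E.obj) ≃ₗ[k] ShiftedHom E.obj E.obj n,
    ∀ a x : E.obj ⟶ E.obj, e (x ≫ a) = e x ≫ a⟦n⟧'
  /-- `Homⁿ(E, E) ≅ A` as right `A`-modules. -/
  hom_iso_right : ∃ e : (E.obj ⟶ E.obj) ≃ₗ[k] ShiftedHom E.obj E.obj n,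
    ∀ a x : E.obj ⟶ E.obj, e (a ≫ x) = a ≫ e x
  /-- Non-degeneracy of `Homʲ(F, E) × Homⁿ⁻ʲ(E, F) → Homⁿ(E, E)` in the first variable. -/
  nondegenerate_left : ∀ (F : DerivedCategory.Bounded C) (j : ℤ) (f : ShiftedHom F.obj E.obj j),
    (∀ g : ShiftedHom E.obj F.obj (n - j), g.comp f (add_sub_cancel j n) = 0) → f = 0
  /-- Non-degeneracy of `Homʲ(F, E) × Homⁿ⁻ʲ(E, F) → Homⁿ(E, E)` in the second variable. -/
  nondegenerate_right : ∀ (F : DerivedCategory.Bounded C) (j : ℤ)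
    (g : ShiftedHom E.obj F.obj (n - j)),
    (∀ f : ShiftedHom F.obj E.obj j, g.comp f (add_sub_cancel j n) = 0) → g = 0

/-- A complex which can be used to form `- ⊗_A E` and `lin_A(-, E)`, where `A = End(E)`:
a bounded complex of injective ind-objects representing `E`, with a `k`-algebra of endomorphisms
of this complex (honest morphisms, not homotopy classes) which maps isomorphically
to `End(E)`. -/
structure EquivariantModel (k : Type v) [Field k] [Linear k C]
    (E : DerivedCategory.Bounded C) where
  /-- the representing complex -/
  complex : CochainComplex (Ind C) ℤ
  isBoundedInjective : IsBoundedInjective complex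
  /-- it represents `E` -/
  iso : DerivedCategory.Q.obj complex ≅ (boundedToInd C).obj E
  /-- the algebra of endomorphisms of the complex -/
  alg : Subring (End complex)
  /-- its identification with `End(E)` -/
  equiv : alg ≃+* End E.obj
  equiv_spec : ∀ a : alg, DerivedCategory.Q.map (a : End complex) ≫ iso.hom =
    iso.hom ≫ (derivedInd C).map (equiv a)
  /-- scalars act on the complex in the canonical way -/
  scalar_spec : ∀ (c : k) (i : ℤ),
    act alg.subtype i (equiv.symm (c • (1 : End E.obj))) = indScalar c (complex.X i)

variable {k : Type v} [Field k] [Linear k C] {E : DerivedCategory.Bounded C}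
  (M : EquivariantModel k E)

/-- `T : 𝔎 ⥤ 𝔎` is the twist functor `F ↦ {Hom(E, F) ⊗_A E ⟶ F}`. As the total complex need not
consist of injectives, it is compared with `T F` inside the derived category of ind-objects, of
which `𝔎` is a full subcategory; this determines `T` up to isomorphism. -/
def IsTwistOnK (T : FrakK C ⥤ FrakK C) : Prop :=
  Nonempty (FrakK.quotient C ⋙ T ⋙ FrakK.toDerived C ≅
    (kComplex C).ι ⋙ twist M.alg.subtype ⋙ DerivedCategory.Q)

/-- `T : 𝔎 ⥤ 𝔎` is the dual twist functor `F ↦ {F ⟶ lin_A(Hom(F, E), E)}`. -/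
def IsDualTwistOnK (T : FrakK C ⥤ FrakK C) : Prop :=
  Nonempty (FrakK.quotient C ⋙ T ⋙ FrakK.toDerived C ≅
    (kComplex C).ι ⋙ dualTwist M.alg.subtype ⋙ DerivedCategory.Q)

/-- `T : Dᵇ(C) ⥤ Dᵇ(C)` is the twist functor: it corresponds to the twist functor of `𝔎`
under the canonical equivalence `Dᵇ(C) ≌ 𝔎` (the one over the derived category of
ind-objects). -/
def IsTwist (T : DerivedCategory.Bounded C ⥤ DerivedCategory.Bounded C) : Prop :=
  ∃ (Φ : DerivedCategory.Bounded C ≌ FrakK C) (T₀ : FrakK C ⥤ FrakK C),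
    Nonempty (Φ.functor ⋙ FrakK.toDerived C ≅ boundedToInd C) ∧ IsTwistOnK M T₀ ∧
    Nonempty (T ⋙ Φ.functor ≅ Φ.functor ⋙ T₀)

/-- `T : Dᵇ(C) ⥤ Dᵇ(C)` is the dual twist functor. -/
def IsDualTwist (T : DerivedCategory.Bounded C ⥤ DerivedCategory.Bounded C) : Prop :=
  ∃ (Φ : DerivedCategory.Bounded C ≌ FrakK C) (T₀ : FrakK C ⥤ FrakK C),
    Nonempty (Φ.functor ⋙ FrakK.toDerived C ≅ boundedToInd C) ∧ IsDualTwistOnK M T₀ ∧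
    Nonempty (T ⋙ Φ.functor ≅ Φ.functor ⋙ T₀)

/-- The functors `S` and `T` are mutually quasi-inverse equivalences. -/
def QuasiInverse {D : Type*} [Category* D] (S T : D ⥤ D) : Prop :=
  S.IsEquivalence ∧ T.IsEquivalence ∧ Nonempty (S ⋙ T ≅ 𝟭 D) ∧ Nonempty (T ⋙ S ≅ 𝟭 D)

end Spherical

end

end TwistFunctors

universe u' v'

namespace TwistFunctors

set_option linter.unusedSectionVars false

noncomputable section

open CategoryTheory Limits CochainComplex.HomComplex

/-! ## Complexes of modules over a semisimple ring -/

section Semisimple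

variable {R : Type u} [Ring R]

/-! Fix a model of `E`, an object `X` of `𝔎`, and put `W = Hom(X, E)` and `V = Hom(E, X)`. Write `D`
for the dual of a complex of `A`-modules with values in `A`, with the shift by one built in
(`dualComplex`). The spherical conditions say that `Hom(E, E)` has cohomology `A` in degree `0` and
a dualizing module in degree `n`, and that composition into degree `n` is a perfect pairing between
the cohomology of `V` and that of `W`. Perfectness comes from non-degeneracy and finite dimension,
after composing with the trace of `k^r` (`isDualPair_of_nondegenerate`).

Dual twist followed by twist. `T* X` is the fibre of `X ⟶ lin_A(W, E)`. Under the adjunction `Hom(E,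
lin_A(W, E)) = Hom_A(W, Hom(E, E))`, applying `Hom(E, -)` to the coevaluation gives the composition
map `Hom(E, X) ⟶ Hom_A(W, Hom(E, E))`. As `A` is semisimple, the cohomology of the target consists
of the graded maps from `H(W)` to `A` and to `Hⁿ`, and duality says that `Hom(E, X)` accounts
exactly for the second part. What remains in the fibre is the first part, so `Hom(E, T* X) ≃ D(W)`
(`quasiIso_dualTwistComparison`). Since `W` has finite cohomology, `D(W) ⊗_A E ≃ lin_A(W, E)[-1]`
(`quasiIso_contractionHom`). With these identifications the evaluation of `T* X` becomes the
inclusion of `lin_A(W, E)[-1]` into the fibre, and its cone is `X`.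

Twist followed by dual twist. Symmetrically, `Hom(T X, E)` is the fibre of `Hom(X, E) ⟶ Hom(V,
Hom(E, E))` and is equivalent to `D(V)` (`quasiIso_twistComparison`), `lin_A(D(V), E) ≃ (V ⊗_A
E)[1]`, and the coevaluation of `T X` becomes the projection of the cone `T X` to `(V ⊗_A E)[1]`,
whose fibre is `X`. Both fibre computations are instances of one abstract statement about
`DualityData`. All these equivalences are natural zigzags of honest complexes.

Semisimplicity of `A` is used throughout: quasi-isomorphisms of complexes of `A`-modules are
homotopy equivalences, so tensor, lin and dual complexes respect them, and a complex with finite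
cohomology may be replaced by a finite one with zero differential, where dual bases are available.

To reach `𝔎` and `Dᵇ(C)`, one shows that `Dᵇ(C)` is the full subcategory of `D(Ind C)` of bounded
objects with cohomology in `C` (`bijectiveOn_of_bounded`, `exists_bounded_iso`). The key is that an
epimorphism from an ind-object onto an object of `C` is dominated by an epimorphism in `C`, so that
Ext groups can be compared by effacing classes. The category `𝔎` has the same essential image, which
is thick and hence contains the values of both twists.

A model exists because the idempotents of `End(E) ≅ k^r` are split by bounded complexes of
injectives (`exists_splitting_Q`), and `k^r` acts strictly on the direct sum of the summands. -/

lemma moduleCat_comp_d_d (W : CochainComplex (ModuleCat.{u} R) ℤ) (i j l : ℤ) (w : W.X i) :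
    (W.d j l).hom ((W.d i j).hom w) = 0 := by
  rw [← ModuleCat.comp_apply, W.d_comp_d]; rfl

/-- The image is projective and a direct summand, so a projection onto it can be followed by a
section of the map onto the image. -/
lemma exists_generalized_inverse [IsSemisimpleRing R] {M N : ModuleCat.{u} R} (f : M ⟶ N) :
    ∃ g : N ⟶ M, f ≫ g ≫ f = f := by
  have := Module.projective_of_isSemisimpleRing R (LinearMap.range f.hom)
  obtain ⟨s, hs⟩ := Module.projective_lifting_property f.hom.rangeRestrict LinearMap.id
    f.hom.surjective_rangeRestrict
  obtain ⟨q, hq⟩ := exists_isCompl (LinearMap.range f.hom)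
  refine ⟨ModuleCat.ofHom (s ∘ₗ Submodule.projectionOnto _ q hq), ?_⟩
  ext x
  have h1 : Submodule.projectionOnto _ q hq (f.hom x) = ⟨f.hom x, x, rfl⟩ :=
    Submodule.projectionOnto_apply_left hq ⟨f.hom x, x, rfl⟩
  have h2 := LinearMap.congr_fun hs ⟨f.hom x, x, rfl⟩
  have h3 := congrArg Subtype.val h2
  simpa [h1] using h3

/-- A choice of generalized inverses of the differentials. -/
def dInv [IsSemisimpleRing R] (W : CochainComplex (ModuleCat.{u} R) ℤ) (i j : ℤ) :
    W.X j ⟶ W.X i :=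
  (exists_generalized_inverse (W.d i j)).choose

lemma d_dInv_d [IsSemisimpleRing R] (W : CochainComplex (ModuleCat.{u} R) ℤ) (i j : ℤ) :
    W.d i j ≫ dInv W i j ≫ W.d i j = W.d i j :=
  (exists_generalized_inverse (W.d i j)).choose_spec

lemma d_dInv_d_apply [IsSemisimpleRing R] (W : CochainComplex (ModuleCat.{u} R) ℤ) (i j : ℤ)
    (x : W.X i) : (W.d i j).hom ((dInv W i j).hom ((W.d i j).hom x)) = (W.d i j).hom x := by
  exact congrArg (fun f => f.hom x) (d_dInv_d W i j)

/-- The coboundary of a cochain, on elements. -/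
lemma δ_v_apply {W H : CochainComplex (ModuleCat.{u} R) ℤ} {m m' : ℤ} (hm : m + 1 = m')
    (z : Cochain W H m) (p q q₁ p' : ℤ) (hpq : p + m' = q) (h₁ : p + m = q₁) (h₂ : p' + m = q)
    (w : W.X p) :
    ((δ m m' z).v p q hpq).hom w = (H.d q₁ q).hom ((z.v p q₁ h₁).hom w) +
      m'.negOnePow • (z.v p' q h₂).hom ((W.d p p').hom w) := by
  rw [δ_v m m' hm z p q hpq q₁ p' (by lia) (by lia)]
  simp [Units.smul_def]

/-- Over a semisimple ring a complex splits into its cohomology and a contractible part, so the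
class of a cocycle of `Hom(W, H)` is determined by its effect on cohomology. Generalized inverses of
the differentials give an explicit primitive. -/
lemma exists_δ_eq_of_cohomology_zero [IsSemisimpleRing R]
    {W H : CochainComplex (ModuleCat.{u} R) ℤ} {m : ℤ} (z : Cochain W H m)
    (hz : δ m (m + 1) z = 0)
    (h : ∀ (p q q₁ : ℤ) (hpq : p + m = q) (w : W.X p), q₁ + 1 = q →
      (W.d p (p + 1)).hom w = 0 → ∃ y : H.X q₁, (H.d q₁ q).hom y = (z.v p q hpq).hom w)
    (m₁ : ℤ) (hm : m₁ + 1 = m) :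
    ∃ α : Cochain W H m₁, δ m₁ m α = z := by
  -- `P` takes values in cocycles, kills coboundaries, and `dInv` is a homotopy between it and the
  -- identity.
  let P (p : ℤ) : W.X p ⟶ W.X p :=
    𝟙 _ - dInv W (p - 1) p ≫ W.d (p - 1) p - W.d p (p + 1) ≫ dInv W p (p + 1)
  have hP (p : ℤ) : P p ≫ W.d p (p + 1) = 0 := by
    simp only [P, Preadditive.sub_comp, Category.assoc, d_dInv_d, Category.id_comp, W.d_comp_d,
      comp_zero, sub_zero, sub_self]
  have hP' (p p' : ℤ) (h : p' + 1 = p) : W.d p' p ≫ P p = 0 := by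
    obtain rfl : p' = p - 1 := by lia
    simp only [P, Preadditive.comp_sub, d_dInv_d, Category.comp_id,
      HomologicalComplex.d_comp_d_assoc, zero_comp, sub_self]
  -- The first summand is a primitive of `(𝟙 - P) ≫ z`. By hypothesis `P ≫ z` has values in
  -- coboundaries, and the second summand lifts it through the differential of `H`.
  let α : Cochain W H m₁ := Cochain.mk fun p q hpq =>
    m.negOnePow • (dInv W (p - 1) p ≫ z.v (p - 1) q (by lia)) +
      P p ≫ z.v p (q + 1) (by lia) ≫ dInv H q (q + 1)
  have hα (p q q' p' : ℤ) (hpq : p + m₁ = q) (hq' : q + 1 = q') (hp' : p' + 1 = p) :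
      α.v p q hpq = m.negOnePow • (dInv W p' p ≫ z.v p' q (by lia)) +
        P p ≫ z.v p q' (by lia) ≫ dInv H q q' := by
    obtain rfl : p' = p - 1 := by lia
    subst hq'
    rfl
  refine ⟨α, ?_⟩
  ext p q hpq : 1
  rw [δ_v m₁ m hm α p q hpq (q - 1) (p + 1) (by lia) (by lia),
    hα p (q - 1) q (p - 1) (by lia) (by lia) (by lia),
    hα (p + 1) q (q + 1) p (by lia) (by lia) (by lia)]
  have h1 : W.d p (p + 1) ≫ P (p + 1) = 0 := hP' _ _ rfl
  have h2 : z.v (p - 1) (q - 1) (by lia) ≫ H.d (q - 1) q =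
      m.negOnePow • W.d (p - 1) p ≫ z.v p q hpq := by
    have := Cochain.congr_v hz (p - 1) q (by lia)
    rw [δ_v m (m + 1) rfl z (p - 1) q (by lia) (q - 1) p rfl (by lia), Cochain.zero_v,
      Int.negOnePow_succ] at this
    simpa [add_neg_eq_zero] using this
  have h3 : P p ≫ z.v p q hpq ≫ dInv H (q - 1) q ≫ H.d (q - 1) q = P p ≫ z.v p q hpq := by
    ext w
    obtain ⟨y, hy⟩ := h p q (q - 1) hpq ((P p).hom w) (by lia) (by
      rw [← ModuleCat.comp_apply, hP]; rfl)
    simp only [ModuleCat.comp_apply]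
    rw [← hy, d_dInv_d_apply]
  have h4 : W.d p (p + 1) ≫ P (p + 1) ≫ z.v (p + 1) (q + 1) (by lia) ≫ dInv H q (q + 1) = 0 := by
    rw [← Category.assoc, h1, zero_comp]
  simp only [Preadditive.add_comp, Preadditive.comp_add, Linear.units_smul_comp,
    Linear.comp_units_smul, Category.assoc, h2, h3, h4, smul_smul, add_zero,
    Int.units_mul_self, one_smul]
  simp only [P, Preadditive.sub_comp, Category.assoc, Category.id_comp]
  abel

lemma exact_apply {W : CochainComplex (ModuleCat.{u} R) ℤ} {i j l : ℤ} (hij : i + 1 = j)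
    (hjl : j + 1 = l) (h : W.ExactAt j) (w : W.X j) (hw : (W.d j l).hom w = 0) :
    ∃ y : W.X i, (W.d i j).hom y = w := by
  rw [W.exactAt_iff' i j l (by simp; lia) (by simp; lia), ShortComplex.moduleCat_exact_iff] at h
  exact h w hw

lemma exactAt_of_apply {W : CochainComplex (ModuleCat.{u} R) ℤ} {i j l : ℤ} (hij : i + 1 = j)
    (hjl : j + 1 = l)
    (h : ∀ w : W.X j, (W.d j l).hom w = 0 → ∃ y : W.X i, (W.d i j).hom y = w) :
    W.ExactAt j := by
  rw [W.exactAt_iff' i j l (by simp; lia) (by simp; lia), ShortComplex.moduleCat_exact_iff]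
  exact h

/-- Cocycles of an acyclic complex are coboundaries and a chain map sends them to coboundaries, so
every map out of such a complex is null-homotopic by the preceding criterion. -/
instance isKInjective_of_isSemisimpleRing [IsSemisimpleRing R]
    (L : CochainComplex (ModuleCat.{u} R) ℤ) : L.IsKInjective where
  nonempty_homotopy_zero {K} f hK := by
    obtain ⟨α, hα⟩ := exists_δ_eq_of_cohomology_zero (Cochain.ofHom f) (δ_ofHom f)
      (fun p q q₁ hpq w hq hw => by
        obtain rfl : p = q := by lia
        obtain ⟨y, rfl⟩ := exact_apply hq rfl (hK p) w hw
        refine ⟨(f.f q₁).hom y, ?_⟩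
        rw [Cochain.ofHom_v, ← ModuleCat.comp_apply, ← ModuleCat.comp_apply, f.comm])
      (-1) rfl
    exact ⟨(Cochain.equivHomotopy f 0).symm ⟨α, by rw [hα, Cochain.ofHom_zero, add_zero]⟩⟩

end Semisimple

section

variable {B : Type*} [Category* B] [Abelian B]

lemma quasiIso_iff_acyclic_mappingCone {K L : CochainComplex B ℤ} (f : K ⟶ L) :
    QuasiIso f ↔ (CochainComplex.mappingCone f).Acyclic := by
  rw [← HomotopyCategory.quotient_obj_mem_subcategoryAcyclic_iff_acyclic,
    ← HomologicalComplex.mem_quasiIso_iff, ← HomotopyCategory.quotient_map_mem_quasiIso_iff,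
    HomotopyCategory.quasiIso_eq_trW_subcategoryAcyclic]
  exact (HomotopyCategory.subcategoryAcyclic B).trW_iff_of_distinguished _
    (HomotopyCategory.mappingCone_triangleh_distinguished f)

end

section Semisimple

variable {R : Type u} [Ring R]

open CochainComplex in
/-- A criterion for quasi-isomorphisms of complexes of modules. -/
lemma quasiIso_of_apply {W W' : CochainComplex (ModuleCat.{u} R) ℤ} (f : W ⟶ W')
    (hinj : ∀ (i j l : ℤ), i + 1 = j → j + 1 = l → ∀ (w : W.X j) (y : W'.X i),
      (W.d j l).hom w = 0 → (W'.d i j).hom y = (f.f j).hom w → ∃ x : W.X i, (W.d i j).hom x = w)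
    (hsurj : ∀ (i j l : ℤ), i + 1 = j → j + 1 = l → ∀ (w' : W'.X j), (W'.d j l).hom w' = 0 →
      ∃ (w : W.X j) (y : W'.X i), (W.d j l).hom w = 0 ∧
        (f.f j).hom w + (W'.d i j).hom y = w') : QuasiIso f := by
  rw [quasiIso_iff_acyclic_mappingCone]
  intro j
  refine exactAt_of_apply (i := j - 1) (l := j + 1) (by lia) rfl fun x hx => ?_
  -- A cocycle of the cone is a pair with `d a = 0` and `f a + d b = 0`. Injectivity on cohomology
  -- writes `a` as the coboundary of some `a'`, and surjectivity is then applied to the cocycle `f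
  -- a' + b`.
  obtain ⟨a, ha⟩ : ∃ a, a = ((mappingCone.fst f).1.v j (j + 1) rfl).hom x := ⟨_, rfl⟩
  obtain ⟨b, hb⟩ : ∃ b, b = ((mappingCone.snd f).v j j (add_zero j)).hom x := ⟨_, rfl⟩
  have h1 : (W.d (j + 1) (j + 2)).hom a = 0 := by
    have := congrArg (fun g => g.hom x) (mappingCone.d_fst_v f j (j + 1) (j + 2) rfl (by lia))
    simp only [ModuleCat.hom_comp, LinearMap.comp_apply, hx, map_zero] at this
    rw [ha]
    simpa using this.symm
  have h2 : (f.f (j + 1)).hom a + (W'.d j (j + 1)).hom b = 0 := by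
    have := congrArg (fun g => g.hom x) (mappingCone.d_snd_v f j (j + 1) rfl)
    simp only [ModuleCat.hom_comp, LinearMap.comp_apply, hx, map_zero] at this
    rw [ha, hb]
    simpa using this.symm
  obtain ⟨a', rfl⟩ := hinj j (j + 1) (j + 2) rfl (by lia) a (-b) h1
    (by rw [map_neg]; exact (eq_neg_of_add_eq_zero_left h2).symm)
  obtain ⟨w, y, hw, hwy⟩ := hsurj (j - 1) j (j + 1) (by lia) rfl ((f.f j).hom a' + b) (by
    rw [map_add, ← h2]
    congr 1
    exact congrArg (fun g => g.hom a') (f.comm j (j + 1)))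
  refine ⟨((mappingCone.inl f).v j (j - 1) (by lia)).hom (w - a') +
    ((mappingCone.inr f).f (j - 1)).hom y, ?_⟩
  have h3 := congrArg (fun g => g.hom x) (mappingCone.id_X f j (j + 1) rfl)
  have h4 := congrArg (fun g => g.hom (w - a'))
    (mappingCone.inl_v_d f j (j - 1) (j + 1) (by lia) (by lia))
  have h5 := congrArg (fun g => g.hom y) (mappingCone.inr_f_d f (j - 1) j)
  simp only [ModuleCat.hom_add, ModuleCat.hom_sub, ModuleCat.hom_comp, LinearMap.comp_apply,
    LinearMap.add_apply, LinearMap.sub_apply, ModuleCat.hom_id, LinearMap.id_apply,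
    ← ha, ← hb] at h3 h4 h5
  rw [map_add, h4, h5, ← h3, map_sub (W.d j (j + 1)).hom, hw, zero_sub, map_neg, sub_neg_eq_add,
    map_sub (f.f j).hom, ← sub_eq_iff_eq_add'.2 hwy.symm]
  simp only [map_sub, map_add]
  abel


/-- Source and target are both K-injective. The homotopy invariance of tensor, lin and dual
complexes rests on this. -/
lemma homotopyEquivalences_of_quasiIso [IsSemisimpleRing R]
    {W W' : CochainComplex (ModuleCat.{u} R) ℤ} (f : W ⟶ W') [QuasiIso f] :
    HomologicalComplex.homotopyEquivalences _ _ f :=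
  (CochainComplex.IsKInjective.quasiIso_iff f).1 inferInstance

/-- The total cohomology of the complex is finitely generated. -/
structure FiniteCohomology (W : CochainComplex (ModuleCat.{u} R) ℤ) : Prop where
  bounded : ∃ S : Finset ℤ, ∀ i ∉ S, W.ExactAt i
  finite : ∀ i, ∃ (t : Finset (W.X i)),
    ∀ w : W.X i, (W.d i (i + 1)).hom w = 0 → ∃ (z : W.X i) (y : W.X (i - 1)),
      z ∈ Submodule.span R (t : Set (W.X i)) ∧ w = z + (W.d (i - 1) i).hom y

/-- Over a semisimple ring a complex with finitely generated cohomology is quasi-isomorphic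
to a finitely generated complex with zero differentials. -/
lemma FiniteCohomology.exists_quasiIso [IsSemisimpleRing R]
    {W : CochainComplex (ModuleCat.{u} R) ℤ} (h : FiniteCohomology W) :
    ∃ (Z : CochainComplex (ModuleCat.{u} R) ℤ) (s : Z ⟶ W) (S : Finset ℤ),
      QuasiIso s ∧ (∀ i j, Z.d i j = 0) ∧ (∀ i, Module.Finite R (Z.X i)) ∧
      ∀ i ∉ S, ∀ z : Z.X i, z = 0 := by
  obtain ⟨S, hS⟩ := h.bounded
  let Ker (i : ℤ) : Submodule R (W.X i) := LinearMap.ker (W.d i (i + 1)).hom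
  let Im (i : ℤ) : Submodule R (W.X i) := LinearMap.range (W.d (i - 1) i).hom
  have hle (i : ℤ) : Im i ≤ Ker i := by
    rintro _ ⟨x, rfl⟩
    exact moduleCat_comp_d_d W _ _ _ x
  -- `Q i` is a complement of the coboundaries inside the cocycles, so it is a model of the
  -- cohomology in degree `i`.
  have hC (i : ℤ) : ∃ Q : Submodule R (W.X i), Q ⊓ Im i = ⊥ ∧ Im i ⊔ Q = Ker i := by
    obtain ⟨q, hq⟩ := exists_isCompl (Im i)
    refine ⟨q ⊓ Ker i, ?_, ?_⟩
    · rw [inf_right_comm, inf_comm q, hq.inf_eq_bot, bot_inf_eq]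
    · rw [inf_comm, inf_comm (Ker i), ← sup_inf_assoc_of_le q (hle i), hq.sup_eq_top, top_inf_eq]
  choose Q hQ hQ' using hC
  have hQK (i : ℤ) : Q i ≤ Ker i := hQ' i ▸ le_sup_right
  let Z : CochainComplex (ModuleCat.{u} R) ℤ :=
    { X i := ModuleCat.of R (Q i)
      d i j := 0
      shape _ _ _ := rfl
      d_comp_d' _ _ _ _ _ := comp_zero }
  let s : Z ⟶ W :=
    { f i := ModuleCat.ofHom (Q i).subtype
      comm' i j hij := by
        obtain rfl : i + 1 = j := hij
        ext z
        have : (W.d i (i + 1)).hom z.1 = 0 := hQK i z.2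
        simpa [Z] using this }
  have hdec (i : ℤ) (w : W.X i) (hw : (W.d i (i + 1)).hom w = 0) :
      ∃ (z : Q i) (y : W.X (i - 1)), w = z.1 + (W.d (i - 1) i).hom y := by
    have : w ∈ Im i ⊔ Q i := by rw [hQ']; exact hw
    obtain ⟨_, ⟨y, rfl⟩, z, hz, rfl⟩ := Submodule.mem_sup.1 this
    exact ⟨⟨z, hz⟩, y, add_comm _ _⟩
  have hzero (i : ℤ) (z : W.X i) (y : W.X (i - 1)) (hz : z ∈ Q i)
      (hy : (W.d (i - 1) i).hom y = z) : z = 0 := by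
    have : z ∈ Q i ⊓ Im i := ⟨hz, y, hy⟩
    rwa [hQ, Submodule.mem_bot] at this
  refine ⟨Z, s, S, quasiIso_of_apply s ?_ ?_, fun _ _ => rfl, fun i => ?_, fun i hi z => ?_⟩
  · intro i j l hij hjl z y _ hy
    obtain rfl : i = j - 1 := by lia
    have := hzero j z.1 y z.2 hy
    exact ⟨0, by rw [map_zero]; exact (Subtype.ext this).symm⟩
  · intro i j l hij hjl w hw
    obtain rfl : i = j - 1 := by lia
    subst hjl
    obtain ⟨z, y, rfl⟩ := hdec j w hw
    exact ⟨z, y, rfl, rfl⟩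
  · obtain ⟨t, ht⟩ := h.finite i
    have : Module.Finite R ((Submodule.span R (t : Set (W.X i))).map (Im i).mkQ) :=
      Module.Finite.iff_fg.2 (Submodule.FG.map _ ⟨t, rfl⟩)
    -- Modulo coboundaries, `Q i` embeds into the image of the span of `t`; a submodule of a finite
    -- module over a semisimple ring is finite.
    let f : Q i →ₗ[R] (Submodule.span R (t : Set (W.X i))).map (Im i).mkQ :=
      ((Im i).mkQ ∘ₗ (Q i).subtype).codRestrict _ fun z => by
        obtain ⟨w, y, hw, hy⟩ := ht z.1 (hQK i z.2)
        refine ⟨w, hw, ?_⟩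
        simp only [LinearMap.comp_apply, Submodule.subtype_apply, Submodule.mkQ_apply]
        rw [Submodule.Quotient.eq, hy]
        exact ⟨-y, by simp⟩
    refine Module.Finite.of_injective f (LinearMap.ker_eq_bot.1 (LinearMap.ker_eq_bot'.2 fun z hz => ?_))
    have hz' : (Im i).mkQ z.1 = 0 := congrArg Subtype.val hz
    rw [Submodule.mkQ_apply, Submodule.Quotient.mk_eq_zero] at hz'
    obtain ⟨y, hy⟩ := hz'
    exact Subtype.ext (hzero i z.1 y z.2 hy)
  · obtain ⟨y, hy⟩ := exact_apply (i := i - 1) (by lia) rfl (hS i hi) z.1 (hQK i z.2)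
    exact Subtype.ext (hzero i z.1 y z.2 hy)

end Semisimple

end

noncomputable section

open CategoryTheory Limits CochainComplex.HomComplex

/-! ### Cohomology of the fibre of a duality pairing -/

section Core

variable {R : Type u} [Ring R] {B : Type v} [Category.{u} B] [Abelian B]

/-- The situation common to the two composites of twist and dual twist: a complex `H` with
cohomology `B₀` in degree `0` and a dualizing module in degree `n > 0`, and a pairing of a Hom
complex `Hom(K, L)` with a complex `W` with values in `H` which induces an isomorphism of the
cohomology of `Hom(K, L)` with the dual of the cohomology of `W` with respect to the dualizing
module. -/
structure DualityData (n : ℤ) (W H : CochainComplex (ModuleCat.{u} R) ℤ)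
    (K L : CochainComplex B ℤ) (B₀ : ModuleCat.{u} R) where
  c : ∀ m, Cochain K L m →+ Cochain W H m
  c_δ : ∀ m m' x, δ m m' (c m x) = c m' (δ m m' x)
  ι : B₀ ⟶ H.X 0
  ι_d : ι ≫ H.d 0 1 = 0
  ι_inj : ∀ (b : B₀) (y : H.X (-1)), (H.d (-1) 0).hom y = ι.hom b → b = 0
  ι_surj : ∀ h : H.X 0, (H.d 0 1).hom h = 0 →
    ∃ (b : B₀) (y : H.X (-1)), h = ι.hom b + (H.d (-1) 0).hom y
  exact : ∀ i, i ≠ 0 → i ≠ n → H.ExactAt i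
  inj : ∀ (m m₁ : ℤ), m₁ + 1 = m → ∀ x : Cochain K L m, δ m (m + 1) x = 0 →
    (∀ (i n₁ : ℤ) (hi : i + m = n) (w : W.X i), n₁ + 1 = n → (W.d i (i + 1)).hom w = 0 →
      ∃ y : H.X n₁, (H.d n₁ n).hom y = ((c m x).v i n hi).hom w) →
    ∃ y : Cochain K L m₁, δ m₁ m y = x
  surj : ∀ (m : ℤ) (z : Cochain W H m), δ m (m + 1) z = 0 →
    ∃ x : Cochain K L m, δ m (m + 1) x = 0 ∧
      ∀ (i n₁ : ℤ) (hi : i + m = n) (w : W.X i), n₁ + 1 = n → (W.d i (i + 1)).hom w = 0 →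
      ∃ y : H.X n₁, (H.d n₁ n).hom y = (z.v i n hi).hom w - ((c m x).v i n hi).hom w

namespace DualityData

variable {n : ℤ} {W H : CochainComplex (ModuleCat.{u} R) ℤ}
    {K L : CochainComplex B ℤ} {B₀ : ModuleCat.{u} R} (D : DualityData n W H K L B₀)

/-- The cochain defined by a linear form on the term of degree `i`. -/
def formCochain (i m : ℤ) (ξ : W.X i ⟶ B₀) : Cochain W H m :=
  Cochain.single (ξ ≫ D.ι) m

lemma formCochain_v (i m : ℤ) (h : i + m = 0) (ξ : W.X i ⟶ B₀) :
    (D.formCochain i m ξ).v i 0 h = ξ ≫ D.ι :=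
  Cochain.single_v _ _ _

lemma formCochain_v_eq_zero (i m p q : ℤ) (hpq : p + m = q) (hq : q ≠ 0) (ξ : W.X i ⟶ B₀) :
    (D.formCochain i m ξ).v p q hpq = 0 :=
  Cochain.single_v_eq_zero' _ _ _ _ _ hq

/-- The only possibly nonzero components of the coboundary have values in degrees `1` and `0`; the
first vanishes because `ι` takes values in cocycles, the second because `ξ` kills coboundaries. -/
lemma δ_formCochain (i m m' p : ℤ) (h : i + m = 0) (hm : m + 1 = m') (hp : p + 1 = i)
    (ξ : W.X i ⟶ B₀) (hξ : W.d p i ≫ ξ = 0) : δ m m' (D.formCochain i m ξ) = 0 := by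
  ext a b hab : 1
  rw [δ_v m m' hm _ a b hab (b - 1) (a + 1) rfl rfl, Cochain.zero_v]
  by_cases hb : b = 1
  · subst hb
    obtain rfl : a = i := by lia
    rw [D.formCochain_v_eq_zero _ _ (a + 1) 1 (by lia) (by lia)]
    have : (D.formCochain a m ξ).v a (1 - 1) (by lia) = ξ ≫ D.ι := D.formCochain_v a m h ξ
    rw [this, comp_zero, smul_zero, add_zero, Category.assoc]
    exact (congrArg _ D.ι_d).trans comp_zero
  · rw [D.formCochain_v_eq_zero _ _ a (b - 1) (by lia) (by lia), zero_comp, zero_add]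
    by_cases hb' : b = 0
    · subst hb'
      obtain rfl : a = p := by lia
      subst hp
      rw [D.formCochain_v (a + 1) m h, ← Category.assoc, hξ, zero_comp, smul_zero]
    · rw [D.formCochain_v_eq_zero _ _ _ b (by lia) hb', comp_zero, smul_zero]

variable [IsSemisimpleRing R] (hn : 0 < n)
include hn

/-- This is the surjectivity half of the statement that the fibre of `c : Hom(K, L) ⟶ Hom(W, H)`
computes the dual of `W` with values in `B₀`. A cocycle of the fibre is a pair `(x, φ)` with `δ φ =
c x`. The part of `φ` in the dualizing degree `n` is absorbed by `Hom(K, L)`, and what is left is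
visible on cohomology only in degree `0`, where it is a linear form. -/
lemma exists_form (m m₁ m₂ i p : ℤ) (h₁ : m₁ + 1 = m) (h₂ : m₂ + 1 = m₁) (hi : i + m₁ = 0)
    (hp : p + 1 = i) (x : Cochain K L m) (hx : δ m (m + 1) x = 0) (φ : Cochain W H m₁)
    (hφ : δ m₁ m φ = D.c m x) :
    ∃ (ξ : W.X i ⟶ B₀) (y : Cochain K L m₁) (ψ : Cochain W H m₂), W.d p i ≫ ξ = 0 ∧
      δ m₁ m y = x ∧ φ = D.formCochain i m₁ ξ + D.c m₁ y + δ m₂ m₁ ψ := by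
  -- The equation `δ φ = c x` shows that `x` pairs cocycles of `W` to coboundaries, so `x` is a
  -- coboundary.
  obtain ⟨y₀, hy₀⟩ := D.inj m m₁ h₁ x hx fun a n₁ ha w hn₁ hw => by
    refine ⟨(φ.v a n₁ (by lia)).hom w, ?_⟩
    rw [← hφ, δ_v_apply h₁ φ a n n₁ (a + 1) ha (by lia) (by lia) w, hw, map_zero, smul_zero,
      add_zero]
  -- Now `φ - c y₀` is a cocycle; `x₁` realizes its component in degree `n` up to coboundaries, and
  -- `θ` below is what remains.
  obtain ⟨x₁, hx₁, h⟩ := D.surj m₁ (φ - D.c m₁ y₀) (by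
    obtain rfl := h₁
    rw [δ_sub, hφ, D.c_δ, hy₀, sub_self])
  obtain rfl := h₁
  obtain ⟨θ, hθ⟩ : ∃ θ, θ = φ - D.c m₁ (y₀ + x₁) := ⟨_, rfl⟩
  have hθδ : δ m₁ (m₁ + 1) θ = 0 := by
    rw [hθ, δ_sub, hφ, D.c_δ, δ_add, hy₀, hx₁, add_zero, sub_self]
  have hθd (a b q₁ q : ℤ) (hab : a + 1 = b) (h : b + m₁ = q) (h' : a + m₁ = q₁) (w : W.X a) :
      (θ.v b q h).hom ((W.d a b).hom w) =
        m₁.negOnePow • (H.d q₁ q).hom ((θ.v a q₁ h').hom w) := by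
    have := congrArg (fun f => f.hom w) (Cochain.congr_v hθδ a q (by lia))
    simp only [Cochain.zero_v, ModuleCat.hom_zero, LinearMap.zero_apply] at this
    rw [δ_v_apply rfl θ a q q₁ b (by lia) h' h w, Int.negOnePow_succ, Units.neg_smul,
      add_neg_eq_zero] at this
    rw [this, smul_smul, Int.units_mul_self, one_smul]
  have hker (w : W.X i) (hw : (W.d i (i + 1)).hom w = 0) :
      ∃ b : B₀, ∃ y, (θ.v i 0 hi).hom w = D.ι.hom b + (H.d (-1) 0).hom y := by
    refine D.ι_surj _ ?_
    have h1 := hθd i (i + 1) 0 1 rfl (by lia) hi w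
    rw [hw, map_zero] at h1
    have h2 := congrArg (fun y => m₁.negOnePow • y) h1
    simpa [smul_smul] using h2.symm
  have huniq (b b' : B₀) (y y' : H.X (-1))
      (h : D.ι.hom b + (H.d (-1) 0).hom y = D.ι.hom b' + (H.d (-1) 0).hom y') : b = b' := by
    refine sub_eq_zero.1 (D.ι_inj (b - b') (y' - y) ?_)
    rw [map_sub, map_sub, sub_eq_sub_iff_add_eq_add, add_comm, ← h, add_comm]
  choose b hb using hker
  -- On cocycles of degree `i` the values of `θ` are cocycles of `H` of degree `0`, and their
  -- `B₀`-component is unique by `ι_inj`, hence linear.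
  let β : LinearMap.ker (W.d i (i + 1)).hom →ₗ[R] B₀ :=
    { toFun w := b w.1 w.2
      map_add' w w' := by
        obtain ⟨y, hy⟩ := hb w.1 w.2
        obtain ⟨y', hy'⟩ := hb w'.1 w'.2
        obtain ⟨y'', hy''⟩ := hb (w + w').1 (w + w').2
        refine huniq _ _ y'' (y + y') ?_
        rw [← hy'', map_add, map_add, Submodule.coe_add, map_add, hy, hy']
        abel
      map_smul' r w := by
        obtain ⟨y, hy⟩ := hb w.1 w.2
        obtain ⟨y'', hy''⟩ := hb (r • w).1 (r • w).2
        refine huniq _ _ y'' (r • y) ?_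
        rw [← hy'', map_smul, RingHom.id_apply, map_smul, Submodule.coe_smul, map_smul, hy,
          smul_add] }
  have hβ (w : W.X p) (hw) : β ⟨(W.d p i).hom w, hw⟩ = 0 := by
    obtain ⟨y, hy⟩ := hb ((W.d p i).hom w) hw
    refine huniq _ _ y (m₁.negOnePow • (θ.v p (-1) (by lia)).hom w) ?_
    rw [map_zero, zero_add]
    refine hy.symm.trans ((hθd p i (-1) 0 hp hi (by lia) w).trans ?_)
    simp [Units.smul_def]
  -- A retraction onto the cocycles extends the form `β` to the whole term `W.X i`.
  let e : W.X i →ₗ[R] LinearMap.ker (W.d i (i + 1)).hom :=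
    (LinearMap.id - (dInv W i (i + 1)).hom ∘ₗ (W.d i (i + 1)).hom).codRestrict _ fun w => by
      simp [LinearMap.mem_ker, d_dInv_d_apply]
  have he (w : W.X i) (hw : (W.d i (i + 1)).hom w = 0) : e w = ⟨w, hw⟩ :=
    Subtype.ext (by simp [e, hw])
  let ξ : W.X i ⟶ B₀ := ModuleCat.ofHom (β ∘ₗ e)
  have hξ : W.d p i ≫ ξ = 0 := by
    ext w
    change β (e ((W.d p i).hom w)) = 0
    rw [he _ (moduleCat_comp_d_d W _ _ _ w)]
    exact hβ w _
  -- After subtracting the form, `θ` vanishes on cohomology in every degree: in degree `0` by the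
  -- choice of `β`, in degree `n` by the choice of `x₁`, and elsewhere because `H` is exact.
  obtain ⟨ψ, hψ⟩ := exists_δ_eq_of_cohomology_zero (θ - D.formCochain i m₁ ξ) (by
      rw [δ_sub, hθδ, D.δ_formCochain i m₁ _ p hi rfl hp ξ hξ, sub_self]) (by
    intro a q q₁ haq w hq hw
    rw [Cochain.sub_v]
    by_cases h0 : q = 0
    · subst h0
      obtain rfl : a = i := by lia
      obtain rfl : q₁ = -1 := by lia
      obtain ⟨y, hy⟩ := hb w hw
      refine ⟨y, ?_⟩
      rw [D.formCochain_v a m₁ hi, ModuleCat.hom_sub, LinearMap.sub_apply, hy]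
      have : (ξ ≫ D.ι).hom w = D.ι.hom (b w hw) := by
        change D.ι.hom (β (e w)) = _
        rw [he w hw]; rfl
      rw [this, add_sub_cancel_left]
    · rw [D.formCochain_v_eq_zero _ _ _ _ _ h0, sub_zero]
      by_cases hqn : q = n
      · subst hqn
        obtain ⟨y, hy⟩ := h a q₁ haq w hq hw
        refine ⟨y, hy.trans ?_⟩
        rw [hθ, map_add, Cochain.sub_v, Cochain.sub_v, Cochain.add_v]
        simp only [ModuleCat.hom_sub, LinearMap.sub_apply, ModuleCat.hom_add, LinearMap.add_apply]
        abel
      · refine exact_apply hq rfl (D.exact q h0 hqn) _ ?_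
        have h1 := hθd a (a + 1) q (q + 1) rfl (by lia) haq w
        rw [hw, map_zero] at h1
        have h2 := congrArg (fun y => m₁.negOnePow • y) h1
        simpa [smul_smul] using h2.symm) m₂ h₂
  refine ⟨ξ, y₀ + x₁, ψ, hξ, by rw [δ_add, hy₀, hx₁, add_zero], ?_⟩
  rw [hψ, hθ]
  abel

/-- This is the injectivity half. Since `n ≠ 0`, the form cochain has no component in degree `n`, so
`y` pairs trivially with cocycles and is a coboundary. The form is then itself a coboundary, hence
vanishes on cocycles by `ι_inj` and factors through the differential of `W`. -/
lemma form_eq_comp (m₁ m₂ i i' : ℤ) (h₂ : m₂ + 1 = m₁) (hi : i + m₁ = 0) (hi' : i + 1 = i')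
    (ξ : W.X i ⟶ B₀) (y : Cochain K L m₁) (hy : δ m₁ (m₁ + 1) y = 0) (φ : Cochain W H m₂)
    (h : D.formCochain i m₁ ξ = δ m₂ m₁ φ + D.c m₁ y) :
    ∃ ξ' : W.X i' ⟶ B₀, ξ = W.d i i' ≫ ξ' := by
  obtain ⟨u, rfl⟩ := D.inj m₁ m₂ h₂ y hy fun a n₁ ha w hn₁ hw => by
    refine ⟨-(φ.v a n₁ (by lia)).hom w, ?_⟩
    have h1 := congrArg (fun f => f.hom w) (Cochain.congr_v h a n ha)
    rw [D.formCochain_v_eq_zero _ _ _ _ _ hn.ne', Cochain.add_v] at h1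
    simp only [ModuleCat.hom_zero, LinearMap.zero_apply, ModuleCat.hom_add,
      LinearMap.add_apply] at h1
    rw [δ_v_apply h₂ φ a n n₁ (a + 1) ha (by lia) (by lia) w, hw, map_zero, smul_zero,
      add_zero] at h1
    rw [map_neg, neg_eq_iff_add_eq_zero]
    exact h1.symm
  rw [← D.c_δ, ← δ_add] at h
  have h1 (w : W.X i) (hw : (W.d i i').hom w = 0) : ξ.hom w = 0 := by
    refine D.ι_inj _ (((φ + D.c m₂ u).v i (-1) (by lia)).hom w) ?_
    have h1 := congrArg (fun f => f.hom w) (Cochain.congr_v h i 0 hi)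
    rw [D.formCochain_v i m₁ hi] at h1
    rw [δ_v_apply h₂ _ i 0 (-1) i' hi (by lia) (by lia) w, hw, map_zero, smul_zero,
      add_zero] at h1
    exact h1.symm
  refine ⟨dInv W i i' ≫ ξ, ?_⟩
  ext w
  have h2 := h1 (w - (dInv W i i').hom ((W.d i i').hom w)) (by
    rw [map_sub, d_dInv_d_apply, sub_self])
  rw [map_sub, sub_eq_zero] at h2
  simpa using h2

end DualityData

end Core

end

noncomputable section

open CategoryTheory Limits CochainComplex.HomComplex

/-! ## Homotopy invariance of the tensor and lin complexes -/

section TensorHomotopy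

variable {B : Type v} [Category.{u} B] [Abelian B] [HasCoproducts.{u} B]
  [HasCountableCoproducts B] {A : Type u} [Ring A] {E : CochainComplex B ℤ} (ρ : A →+* End E)
  {V V' : CochainComplex (ModuleCat.{u} Aᵐᵒᵖ) ℤ}

/-- The map `v ⊗ x ↦ α v ⊗ x`. -/
def tensorCochainX (α : Cochain V V' (-1)) (n n' : ℤ) (hn : n + -1 = n') :
    tensorX ρ V n ⟶ tensorX ρ V' n' :=
  tensorXDesc ρ V (fun i j h v => tensorElt ρ V' (i - 1) j n' (by lia)
      ((α.v i (i - 1) (by lia)).hom v))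
    (fun i j h v v' => by rw [map_add, tensorElt_add])
    (fun i j h a v => by rw [map_smul, tensorElt_smul])

lemma tensorElt_tensorCochainX (α : Cochain V V' (-1)) (i j n n' i' : ℤ) (h : i + j = n)
    (hn : n + -1 = n') (hi : i + -1 = i') (v : V.X i) :
    tensorElt ρ V i j n h v ≫ tensorCochainX ρ α n n' hn =
      tensorElt ρ V' i' j n' (by lia) ((α.v i i' hi).hom v) := by
  obtain rfl : i' = i - 1 := by lia
  exact tensorElt_desc _ _ _ _ _ _ _ _ _

/-- The cochain `v ⊗ x ↦ α v ⊗ x`. -/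
def tensorCochain (α : Cochain V V' (-1)) :
    Cochain (tensorComplex ρ V) (tensorComplex ρ V') (-1) :=
  Cochain.mk fun n n' hn => tensorCochainX ρ α n n' hn

lemma tensorComplexMap_homotopic {f g : V ⟶ V'} (h : Homotopy f g) :
    Nonempty (Homotopy (tensorComplexMap ρ f) (tensorComplexMap ρ g)) := by
  obtain ⟨α, hα⟩ := Cochain.equivHomotopy f g h
  refine ⟨(Cochain.equivHomotopy _ _).symm ⟨tensorCochain ρ α, ?_⟩⟩
  ext n
  rw [Cochain.add_v, Cochain.ofHom_v, Cochain.ofHom_v,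
    δ_v (-1) 0 rfl _ n n (add_zero n) (n - 1) (n + 1) rfl rfl, Int.negOnePow_zero, one_smul]
  change tensorMapX ρ f n = tensorCochainX ρ α n (n - 1) (by lia) ≫ tensorD ρ V' (n - 1) n +
    tensorD ρ V n (n + 1) ≫ tensorCochainX ρ α (n + 1) n (by lia) + tensorMapX ρ g n
  refine tensorX_hom_ext fun i j hij x => ?_
  have h1 := congrArg (fun z => z.hom x) (Cochain.congr_v hα i i (add_zero i))
  rw [Cochain.add_v, Cochain.ofHom_v, Cochain.ofHom_v,
    δ_v (-1) 0 rfl _ i i (add_zero i) (i - 1) (i + 1) rfl rfl, Int.negOnePow_zero, one_smul] at h1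
  simp only [ModuleCat.hom_add, ModuleCat.hom_comp, LinearMap.add_apply,
    LinearMap.comp_apply] at h1
  rw [Preadditive.comp_add, Preadditive.comp_add, tensorElt_mapX, tensorElt_mapX, h1,
    ← Category.assoc, tensorElt_tensorCochainX ρ α i j n (n - 1) (i - 1) hij (by lia) (by lia),
    tensorElt_d ρ V' (i - 1) j (n - 1) i (j + 1) n (by lia) (by lia) (by lia),
    ← Category.assoc (tensorElt ρ V i j n hij x),
    tensorElt_d ρ V i j n (i + 1) (j + 1) (n + 1) (by lia) (by lia) (by lia),
    Preadditive.add_comp, Linear.units_smul_comp, Category.assoc,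
    tensorElt_tensorCochainX ρ α (i + 1) j (n + 1) n i (by lia) (by lia) (by lia),
    tensorElt_tensorCochainX ρ α i (j + 1) (n + 1) n (i - 1) (by lia) (by lia) (by lia),
    tensorElt_add, tensorElt_add, Int.negOnePow_sub, Int.negOnePow_one]
  simp only [mul_neg, mul_one, Units.neg_smul]
  abel

lemma homotopyEquivalences_tensorComplexMap {f : V ⟶ V'}
    (hf : HomologicalComplex.homotopyEquivalences _ _ f) :
    HomologicalComplex.homotopyEquivalences _ _ (tensorComplexMap ρ f) := by
  obtain ⟨e, rfl⟩ := hf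
  obtain ⟨h⟩ := tensorComplexMap_homotopic ρ e.homotopyHomInvId
  obtain ⟨h'⟩ := tensorComplexMap_homotopic ρ e.homotopyInvHomId
  exact ⟨{  hom := tensorComplexMap ρ e.hom
            inv := tensorComplexMap ρ e.inv
            homotopyHomInvId := (Homotopy.ofEq (tensorComplexMap_comp ρ _ _).symm).trans
              (h.trans (Homotopy.ofEq (tensorComplexMap_id ρ V)))
            homotopyInvHomId := (Homotopy.ofEq (tensorComplexMap_comp ρ _ _).symm).trans
              (h'.trans (Homotopy.ofEq (tensorComplexMap_id ρ V'))) }, rfl⟩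

/-- No flatness or boundedness enters: over a semisimple ring `f` is a homotopy equivalence, and
tensoring preserves those. -/
lemma quasiIso_tensorComplexMap [IsSemisimpleRing A] (f : V ⟶ V') [QuasiIso f] :
    QuasiIso (tensorComplexMap ρ f) :=
  homotopyEquivalences_le_quasiIso _ _ _
    (homotopyEquivalences_tensorComplexMap ρ (homotopyEquivalences_of_quasiIso f))

end TensorHomotopy

section LinHomotopy

variable {B : Type v} [Category.{u} B] [Abelian B] [HasProducts.{u} B]
  [HasCountableProducts B] {A : Type u} [Ring A] {E : CochainComplex B ℤ} (ρ : A →+* End E)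
  {W W' : CochainComplex (ModuleCat.{u} A) ℤ}

/-- The map `f ↦ f ∘ α`, up to sign. -/
def linCochainX (α : Cochain W' W (-1)) (n n' : ℤ) (hn : n + -1 = n') :
    linX ρ W n ⟶ linX ρ W' n' :=
  -- The sign matches the factor `(-1)ⁱ` in the differential of the lin complex.
  linXLift ρ W' (fun i j h w => i.negOnePow • linElt ρ W (i - 1) j n (by lia)
      ((α.v i (i - 1) (by lia)).hom w))
    (fun i j h w w' => by rw [map_add, linElt_add, smul_add])
    (fun i j h a w => by rw [map_smul, linElt_smul, Linear.units_smul_comp])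

lemma linCochainX_linElt (α : Cochain W' W (-1)) (i j n n' i' : ℤ) (h : i + n' = j)
    (hn : n + -1 = n') (hi : i + -1 = i') (w : W'.X i) :
    linCochainX ρ α n n' hn ≫ linElt ρ W' i j n' h w =
      i.negOnePow • linElt ρ W i' j n (by lia) ((α.v i i' hi).hom w) := by
  obtain rfl : i' = i - 1 := by lia
  exact linXLift_elt _ _ _ _ _ _ _ _ _

/-- The cochain `f ↦ f ∘ α`, up to sign. -/
def linCochain (α : Cochain W' W (-1)) :
    Cochain (linComplex ρ W) (linComplex ρ W') (-1) :=
  Cochain.mk fun n n' hn => linCochainX ρ α n n' hn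

lemma linComplexMap_homotopic {f g : W' ⟶ W} (h : Homotopy f g) :
    Nonempty (Homotopy (linComplexMap ρ f) (linComplexMap ρ g)) := by
  obtain ⟨α, hα⟩ := Cochain.equivHomotopy f g h
  refine ⟨(Cochain.equivHomotopy _ _).symm ⟨linCochain ρ α, ?_⟩⟩
  ext n
  rw [Cochain.add_v, Cochain.ofHom_v, Cochain.ofHom_v,
    δ_v (-1) 0 rfl _ n n (add_zero n) (n - 1) (n + 1) rfl rfl, Int.negOnePow_zero, one_smul]
  change linMapX ρ f n = linCochainX ρ α n (n - 1) (by lia) ≫ linD ρ W' (n - 1) n +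
    linD ρ W n (n + 1) ≫ linCochainX ρ α (n + 1) n (by lia) + linMapX ρ g n
  refine linX_hom_ext fun i j hij x => ?_
  have h1 := congrArg (fun z => z.hom x) (Cochain.congr_v hα i i (add_zero i))
  rw [Cochain.add_v, Cochain.ofHom_v, Cochain.ofHom_v,
    δ_v (-1) 0 rfl _ i i (add_zero i) (i - 1) (i + 1) rfl rfl, Int.negOnePow_zero, one_smul] at h1
  simp only [ModuleCat.hom_add, ModuleCat.hom_comp, LinearMap.add_apply,
    LinearMap.comp_apply] at h1
  rw [Preadditive.add_comp, Preadditive.add_comp, linMapX_elt, linMapX_elt,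
    h1, Category.assoc, Category.assoc,
    linD_elt ρ W' i j (n - 1) (i + 1) (j - 1) n (by lia) (by lia) (by lia),
    Linear.comp_units_smul, Preadditive.comp_sub, ← Category.assoc,
    linCochainX_linElt ρ α i (j - 1) n (n - 1) (i - 1) (by lia) (by lia) (by lia),
    linCochainX_linElt ρ α (i + 1) j n (n - 1) i (by lia) (by lia) (by lia),
    linCochainX_linElt ρ α i j (n + 1) n (i - 1) (by lia) (by lia) (by lia),
    Linear.comp_units_smul,
    linD_elt ρ W (i - 1) j n i (j - 1) (n + 1) (by lia) (by lia) (by lia),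
    linElt_add, linElt_add, Int.negOnePow_sub, Int.negOnePow_succ, Int.negOnePow_one,
    Linear.units_smul_comp]
  simp only [mul_neg, mul_one, Units.neg_smul, smul_sub, smul_neg, smul_smul,
    Int.units_mul_self, one_smul]
  abel

lemma homotopyEquivalences_linComplexMap {f : W' ⟶ W}
    (hf : HomologicalComplex.homotopyEquivalences _ _ f) :
    HomologicalComplex.homotopyEquivalences _ _ (linComplexMap ρ f) := by
  obtain ⟨e, rfl⟩ := hf
  obtain ⟨h⟩ := linComplexMap_homotopic ρ e.homotopyHomInvId
  obtain ⟨h'⟩ := linComplexMap_homotopic ρ e.homotopyInvHomId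
  exact ⟨{  hom := linComplexMap ρ e.hom
            inv := linComplexMap ρ e.inv
            homotopyHomInvId := (Homotopy.ofEq (linComplexMap_comp ρ _ _).symm).trans
              (h'.trans (Homotopy.ofEq (linComplexMap_id ρ W)))
            homotopyInvHomId := (Homotopy.ofEq (linComplexMap_comp ρ _ _).symm).trans
              (h.trans (Homotopy.ofEq (linComplexMap_id ρ W'))) }, rfl⟩

lemma quasiIso_linComplexMap [IsSemisimpleRing A] (f : W' ⟶ W) [QuasiIso f] :
    QuasiIso (linComplexMap ρ f) :=
  homotopyEquivalences_le_quasiIso _ _ _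
    (homotopyEquivalences_linComplexMap ρ (homotopyEquivalences_of_quasiIso f))

end LinHomotopy

end

noncomputable section

open CategoryTheory Limits CochainComplex.HomComplex

/-! ## Dual complexes -/

section Dual

variable {R S B₀ : Type u} [Ring R] [Ring S] [AddCommGroup B₀] [Module R B₀] [Module S B₀]
  [SMulCommClass R S B₀]

variable (S B₀) in
/-- The dual of a complex of modules, with values in a bimodule and shifted by one: it is
`Hom(Wⁱ, B₀)` in degree `1 - i`, with differential `(d ξ) w = (-1)ᵐ ξ (d w)` for `ξ` of
degree `m`. -/
def dualComplex (W : CochainComplex (ModuleCat.{u} R) ℤ) : CochainComplex (ModuleCat.{u} S) ℤ where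
  X m := ModuleCat.of S (W.X (1 - m) →ₗ[R] B₀)
  d m m' := ModuleCat.ofHom
    { toFun ξ := m.negOnePow • (ξ ∘ₗ (W.d (1 - m') (1 - m)).hom)
      map_add' ξ η := by rw [LinearMap.add_comp, smul_add]
      map_smul' s ξ := by
        rw [RingHom.id_apply, LinearMap.smul_comp, smul_comm] }
  shape m m' h := by
    ext ξ
    rw [W.shape _ _ (fun h' => h (by
      have : 1 - m' + 1 = 1 - m := h'
      change m + 1 = m'
      lia))]
    simp
  d_comp_d' m m' m'' _ _ := by
    refine ModuleCat.hom_ext (LinearMap.ext fun (ξ : W.X (1 - m) →ₗ[R] B₀) =>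
      LinearMap.ext fun w => ?_)
    simp [moduleCat_comp_d_d]

variable {W W' : CochainComplex (ModuleCat.{u} R) ℤ}

/-- Evaluation of an element of the dual complex. -/
def dualEval {m i : ℤ} (h : i + m = 1) (ξ : (dualComplex S B₀ W).X m) : W.X i →ₗ[R] B₀ :=
  (show W.X (1 - m) →ₗ[R] B₀ from ξ) ∘ₗ (W.XIsoOfEq (show i = 1 - m by lia)).hom.hom

lemma dualEval_eq {m : ℤ} (ξ : (dualComplex S B₀ W).X m) :
    dualEval (by lia) ξ = (show W.X (1 - m) →ₗ[R] B₀ from ξ) := by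
  refine LinearMap.ext fun w => ?_
  simp only [dualEval, HomologicalComplex.XIsoOfEq_rfl]
  rfl

lemma dual_ext {m i : ℤ} (h : i + m = 1) {ξ η : (dualComplex S B₀ W).X m}
    (H : ∀ w : W.X i, dualEval h ξ w = dualEval h η w) : ξ = η := by
  obtain rfl : i = 1 - m := by lia
  rw [dualEval_eq, dualEval_eq] at H
  exact LinearMap.ext H

/-- An element of the dual complex, from a linear form. -/
def dualMk {m i : ℤ} (h : i + m = 1) (f : W.X i →ₗ[R] B₀) : (dualComplex S B₀ W).X m :=
  (show W.X (1 - m) →ₗ[R] B₀ from f ∘ₗ (W.XIsoOfEq (show i = 1 - m by lia)).inv.hom)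

@[simp]
lemma dualEval_dualMk {m i : ℤ} (h : i + m = 1) (f : W.X i →ₗ[R] B₀) :
    dualEval h (dualMk (S := S) h f) = f := by
  obtain rfl : i = 1 - m := by lia
  rw [dualEval_eq]
  ext w
  simp [dualMk]

lemma dualEval_add {m i : ℤ} (h : i + m = 1) (ξ η : (dualComplex S B₀ W).X m) (w : W.X i) :
    dualEval h (ξ + η) w = dualEval h ξ w + dualEval h η w := rfl

lemma dualEval_smul {m i : ℤ} (h : i + m = 1) (s : S) (ξ : (dualComplex S B₀ W).X m)
    (w : W.X i) : dualEval h (s • ξ) w = s • dualEval h ξ w := rfl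

lemma dualEval_d {m m' i i' : ℤ} (h : i + m' = 1) (h' : i' + m = 1)
    (ξ : (dualComplex S B₀ W).X m) (w : W.X i) :
    dualEval h (((dualComplex S B₀ W).d m m').hom ξ) w =
      m.negOnePow • dualEval h' ξ ((W.d i i').hom w) := by
  obtain rfl : i = 1 - m' := by lia
  obtain rfl : i' = 1 - m := by lia
  rw [dualEval_eq, dualEval_eq]
  rfl

variable (S B₀) in
/-- The map of dual complexes given by precomposition. -/
def dualMap (g : W' ⟶ W) : dualComplex S B₀ W ⟶ dualComplex S B₀ W' where
  f m := ModuleCat.ofHom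
    { toFun ξ := (show W.X (1 - m) →ₗ[R] B₀ from ξ) ∘ₗ (g.f (1 - m)).hom
      map_add' ξ η := LinearMap.add_comp _ _ _
      map_smul' s ξ := LinearMap.smul_comp _ _ _ }
  comm' m m' _ := by
    ext ξ
    refine LinearMap.ext fun w => ?_
    change m.negOnePow • (show W.X (1 - m) →ₗ[R] B₀ from ξ)
        ((g.f (1 - m)).hom ((W'.d (1 - m') (1 - m)).hom w)) =
      m.negOnePow • (show W.X (1 - m) →ₗ[R] B₀ from ξ)
        ((W.d (1 - m') (1 - m)).hom ((g.f (1 - m')).hom w))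
    rw [← ModuleCat.comp_apply, ← ModuleCat.comp_apply, g.comm]

lemma dualEval_map (g : W' ⟶ W) {m i : ℤ} (h : i + m = 1) (ξ : (dualComplex S B₀ W).X m)
    (w : W'.X i) :
    dualEval h (((dualMap S B₀ g).f m).hom ξ) w = dualEval h ξ ((g.f i).hom w) := by
  obtain rfl : i = 1 - m := by lia
  rw [dualEval_eq, dualEval_eq]
  rfl

/-- The map `ξ ↦ ξ ∘ α`, up to sign. -/
def dualCochain (α : Cochain W' W (-1)) :
    Cochain (dualComplex S B₀ W) (dualComplex S B₀ W') (-1) :=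
  Cochain.mk fun m m' h => ModuleCat.ofHom
    { toFun ξ := m'.negOnePow •
        ((show W.X (1 - m) →ₗ[R] B₀ from ξ) ∘ₗ (α.v (1 - m') (1 - m) (by lia)).hom)
      map_add' ξ η := by
        refine Eq.trans ?_ (smul_add _ _ _)
        rfl
      map_smul' s ξ := by
        refine Eq.trans ?_ (smul_comm _ _ _)
        rfl }

lemma dualEval_dualCochain (α : Cochain W' W (-1)) {m m' i i' : ℤ} (h : i + m' = 1)
    (h' : i' + m = 1) (hm : m + -1 = m') (ξ : (dualComplex S B₀ W).X m) (w : W'.X i) :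
    dualEval h (((dualCochain α).v m m' hm).hom ξ) w =
      m'.negOnePow • dualEval h' ξ ((α.v i i' (by lia)).hom w) := by
  obtain rfl : i = 1 - m' := by lia
  obtain rfl : i' = 1 - m := by lia
  rw [dualEval_eq, dualEval_eq]
  rfl

lemma dualMap_homotopic {f g : W' ⟶ W} (h : Homotopy f g) :
    Nonempty (Homotopy (dualMap S B₀ f) (dualMap S B₀ g)) := by
  obtain ⟨α, hα⟩ := Cochain.equivHomotopy f g h
  refine ⟨(Cochain.equivHomotopy _ _).symm ⟨dualCochain α, ?_⟩⟩
  ext m : 1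
  rw [Cochain.add_v, Cochain.ofHom_v, Cochain.ofHom_v,
    δ_v (-1) 0 rfl _ m m (add_zero m) (m - 1) (m + 1) rfl rfl, Int.negOnePow_zero, one_smul]
  refine ModuleCat.hom_ext (LinearMap.ext fun
    (ξ : (dualComplex S B₀ W).X m) => ?_)
  refine dual_ext (R := R) (show 1 - m + m = 1 by lia) fun x => ?_
  have h1 := congrArg (fun z => z.hom x) (Cochain.congr_v hα (1 - m) (1 - m) (add_zero _))
  rw [Cochain.add_v, Cochain.ofHom_v, Cochain.ofHom_v,
    δ_v (-1) 0 rfl _ _ _ (add_zero _) (-m) (2 - m) (by lia) (by lia),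
    Int.negOnePow_zero, one_smul] at h1
  simp only [ModuleCat.hom_add, ModuleCat.hom_comp, LinearMap.add_apply,
    LinearMap.comp_apply] at h1 ⊢
  rw [dualEval_map, h1, dualEval_add, dualEval_add, dualEval_map,
    dualEval_d (m := m - 1) (i' := 2 - m) (by lia) (by lia),
    dualEval_dualCochain α (i' := 1 - m) (by lia) (by lia),
    dualEval_dualCochain α (i' := - m) (by lia) (by lia),
    dualEval_d (m := m) (i' := 1 - m) (by lia) (by lia), smul_smul, smul_smul,
    Int.units_mul_self, Int.units_mul_self, one_smul, one_smul, map_add, map_add]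
  abel

variable (S B₀) in
lemma dualMap_id (W : CochainComplex (ModuleCat.{u} R) ℤ) :
    dualMap S B₀ (𝟙 W) = 𝟙 _ := rfl

lemma dualMap_comp {W'' : CochainComplex (ModuleCat.{u} R) ℤ} (f : W'' ⟶ W') (g : W' ⟶ W) :
    dualMap S B₀ (f ≫ g) = dualMap S B₀ g ≫ dualMap S B₀ f := rfl

variable (S B₀) in
lemma quasiIso_dualMap [IsSemisimpleRing R] (f : W' ⟶ W) [QuasiIso f] :
    QuasiIso (dualMap S B₀ f) := by
  refine homotopyEquivalences_le_quasiIso _ _ _ ?_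
  obtain ⟨e, rfl⟩ := homotopyEquivalences_of_quasiIso f
  obtain ⟨h⟩ := dualMap_homotopic (S := S) (B₀ := B₀) e.homotopyHomInvId
  obtain ⟨h'⟩ := dualMap_homotopic (S := S) (B₀ := B₀) e.homotopyInvHomId
  exact ⟨{  hom := dualMap S B₀ e.hom
            inv := dualMap S B₀ e.inv
            homotopyHomInvId := (Homotopy.ofEq (dualMap_comp _ _).symm).trans h'
            homotopyInvHomId := (Homotopy.ofEq (dualMap_comp _ _).symm).trans h }, rfl⟩

end Dual

/-! ## Pairings of complexes -/

section Pairing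

variable {A : Type u} [Ring A]

/-- A pairing of degree `1` of a complex of right modules with a complex of left modules. -/
structure Pairing (V : CochainComplex (ModuleCat.{u} Aᵐᵒᵖ) ℤ)
    (W : CochainComplex (ModuleCat.{u} A) ℤ) where
  toFun : ∀ {i a : ℤ}, a + i = 1 → V.X i → W.X a → A
  add_left : ∀ {i a : ℤ} (h : a + i = 1) (x y : V.X i) (z : W.X a),
    toFun h (x + y) z = toFun h x z + toFun h y z
  add_right : ∀ {i a : ℤ} (h : a + i = 1) (x : V.X i) (y z : W.X a),
    toFun h x (y + z) = toFun h x y + toFun h x z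
  smul_left : ∀ {i a : ℤ} (h : a + i = 1) (r : A) (x : V.X i) (z : W.X a),
    toFun h (MulOpposite.op r • x) z = toFun h x z * r
  smul_right : ∀ {i a : ℤ} (h : a + i = 1) (r : A) (x : V.X i) (z : W.X a),
    toFun h x (r • z) = r * toFun h x z
  d_left : ∀ {i a i' a' : ℤ} (h : a + i' = 1) (h' : a' + i = 1) (x : V.X i) (z : W.X a),
    toFun h ((V.d i i').hom x) z = i.negOnePow • toFun h' x ((W.d a a').hom z)

/-- The pairing of the dual of a complex of left modules with the complex. -/
def dualPairing (W : CochainComplex (ModuleCat.{u} A) ℤ) :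
    Pairing (dualComplex Aᵐᵒᵖ A W) W where
  toFun h ξ w := dualEval h ξ w
  add_left _ _ _ _ := rfl
  add_right h ξ := map_add (dualEval h ξ)
  smul_left _ _ _ _ := rfl
  smul_right h r ξ := map_smul (dualEval h ξ) r
  d_left h h' ξ w := dualEval_d h h' ξ w

/-- The pairing of a complex of right modules with its dual. -/
def dualPairing' (V : CochainComplex (ModuleCat.{u} Aᵐᵒᵖ) ℤ) :
    Pairing V (dualComplex A A V) where
  toFun h v ξ := dualEval (i := _) (by rw [add_comm, h]) ξ v
  add_left _ _ _ _ := map_add (dualEval _ _) _ _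
  add_right _ _ _ _ := rfl
  smul_left _ _ _ _ := map_smul (dualEval _ _) _ _
  smul_right _ _ _ _ := rfl
  d_left {i a i' a'} h h' v ξ := by
    rw [dualEval_d (m := a) (i := i) (i' := i') (by lia) (by lia)]
    -- If the differential `V.d i i'` is not forced to vanish, then `a = -i` and the two signs are
    -- inverse to each other.
    obtain rfl | h0 := eq_or_ne (i + 1) i'
    · obtain rfl : a = - i := by lia
      rw [Int.negOnePow_neg, smul_smul, Int.units_mul_self, one_smul]
    · rw [V.shape _ _ h0]
      simp

/-- A pair of dual bases for a pairing. -/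
structure DualBases {V : CochainComplex (ModuleCat.{u} Aᵐᵒᵖ) ℤ}
    {W : CochainComplex (ModuleCat.{u} A) ℤ} (β : Pairing V W) where
  S : Finset ℤ
  ν : ℤ → ℕ
  left : ∀ i, Fin (ν i) → V.X i
  right : ∀ i a, a + i = 1 → Fin (ν i) → W.X a
  left_eq : ∀ i a (h : a + i = 1) (x : V.X i),
    x = ∑ s, MulOpposite.op (β.toFun h x (right i a h s)) • left i s
  right_eq : ∀ i a (h : a + i = 1) (y : W.X a), y = ∑ s, β.toFun h (left i s) y • right i a h s
  left_zero : ∀ i ∉ S, ∀ x : V.X i, x = 0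
  right_zero : ∀ i a, a + i = 1 → i ∉ S → ∀ y : W.X a, y = 0

end Pairing

/-- Dual bases of a finite module over a semisimple ring. -/
lemma exists_dualBasis {R : Type u} [Ring R] [IsSemisimpleRing R] (M : Type u) [AddCommGroup M]
    [Module R M] [Module.Finite R M] :
    ∃ (ν : ℕ) (x : Fin ν → M) (f : Fin ν → (M →ₗ[R] R)), ∀ y, y = ∑ s, f s y • x s := by
  have := Module.projective_of_isSemisimpleRing R M
  obtain ⟨ν, f, g, -, -, h⟩ := Module.Finite.exists_comp_eq_id_of_projective R M
  refine ⟨ν, fun s => f (Pi.single s 1), fun s => LinearMap.proj s ∘ₗ g, fun y => ?_⟩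
  have h1 := LinearMap.congr_fun h y
  simp only [LinearMap.comp_apply, LinearMap.id_apply] at h1
  conv_lhs => rw [← h1, ← Finset.univ_sum_single (g y), map_sum]
  refine Finset.sum_congr rfl fun s _ => ?_
  rw [LinearMap.comp_apply, LinearMap.proj_apply, ← map_smul, ← Pi.single_smul', smul_eq_mul,
    mul_one]

section

variable {A : Type u} [Ring A]

lemma nonempty_dualBases [IsSemisimpleRing A] {W : CochainComplex (ModuleCat.{u} A) ℤ}
    (hf : ∀ i, Module.Finite A (W.X i)) (S : Finset ℤ) (hS : ∀ i ∉ S, ∀ z : W.X i, z = 0) :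
    Nonempty (DualBases (dualPairing W)) := by
  have H (i : ℤ) := exists_dualBasis (R := A) (W.X (1 - i))
  choose ν x f h using H
  refine ⟨⟨S.image (fun i => 1 - i), ν, fun i s => dualMk (by lia) (f i s),
    fun i a h s => (W.XIsoOfEq (show 1 - i = a by lia)).hom.hom (x i s), fun i a ha ξ => ?_,
    fun i a ha y => ?_, fun i hi ξ => ?_, fun i a ha hi y => ?_⟩⟩
  · obtain rfl : a = 1 - i := by lia
    refine dual_ext (i := 1 - i) (by lia) fun w => ?_
    conv_lhs => rw [h i w, map_sum]
    have hsum (t : Fin (ν i) → (dualComplex Aᵐᵒᵖ A W).X i) :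
        dualEval (i := 1 - i) (by lia) (∑ s, t s) w = ∑ s, dualEval (by lia) (t s) w :=
      map_sum (AddMonoidHom.mk' (fun ξ => dualEval (S := Aᵐᵒᵖ) (B₀ := A) (i := 1 - i) (by lia) ξ w)
        fun ξ η => rfl) t Finset.univ
    rw [hsum]
    refine Finset.sum_congr rfl fun s _ => ?_
    rw [dualEval_smul, dualEval_dualMk, map_smul]
    simp [dualPairing]
  · obtain rfl : a = 1 - i := by lia
    refine (h i y).trans (Finset.sum_congr rfl fun s _ => ?_)
    simp [dualPairing]
  · refine dual_ext (i := 1 - i) (by lia) fun w => ?_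
    rw [hS (1 - i) (fun h => hi (Finset.mem_image.2 ⟨_, h, by lia⟩)) w, map_zero, map_zero]
  · exact hS a (fun h => hi (Finset.mem_image.2 ⟨_, h, by lia⟩)) y

lemma nonempty_dualBases' [IsSemisimpleRing A] {V : CochainComplex (ModuleCat.{u} Aᵐᵒᵖ) ℤ}
    (hf : ∀ i, Module.Finite Aᵐᵒᵖ (V.X i)) (S : Finset ℤ) (hS : ∀ i ∉ S, ∀ z : V.X i, z = 0) :
    Nonempty (DualBases (dualPairing' V)) := by
  have H (i : ℤ) := exists_dualBasis (R := Aᵐᵒᵖ) (V.X i)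
  choose ν x f h using H
  let g (i : ℤ) (s : Fin (ν i)) : V.X i →ₗ[Aᵐᵒᵖ] A :=
    { toFun y := (f i s y).unop
      map_add' y z := by rw [map_add, MulOpposite.unop_add]
      map_smul' r y := by rw [map_smul]; rfl }
  refine ⟨⟨S, ν, x, fun i a h s => dualMk (by lia) (g i s), fun i a ha y => ?_,
    fun i a ha ξ => ?_, hS, fun i a ha hi ξ => ?_⟩⟩
  · refine (h i y).trans (Finset.sum_congr rfl fun s _ => ?_)
    simp [dualPairing', g]
  · refine dual_ext (i := i) (by lia) fun w => ?_
    conv_lhs => rw [h i w, map_sum]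
    have hsum (t : Fin (ν i) → (dualComplex A A V).X a) :
        dualEval (i := i) (by lia) (∑ s, t s) w = ∑ s, dualEval (by lia) (t s) w :=
      map_sum (AddMonoidHom.mk' (fun ξ => dualEval (S := A) (B₀ := A) (i := i) (by lia) ξ w)
        fun ξ η => rfl) t Finset.univ
    rw [hsum]
    refine Finset.sum_congr rfl fun s _ => ?_
    rw [dualEval_smul, dualEval_dualMk, map_smul]
    simp [dualPairing', g]
  · refine dual_ext (i := i) (by lia) fun w => ?_
    rw [hS i hi w, map_zero, map_zero]

end

end

noncomputable section

open CategoryTheory Limits CochainComplex.HomComplex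

/-! ## Comparison of tensor products and linear maps -/

section Contraction

variable {B : Type v} [Category.{u} B] [Abelian B] [HasCoproducts.{u} B]
  [HasCountableCoproducts B] [HasProducts.{u} B] [HasCountableProducts B]
  {A : Type u} [Ring A] {E : CochainComplex B ℤ} (ρ : A →+* End E)
  {V : CochainComplex (ModuleCat.{u} Aᵐᵒᵖ) ℤ} {W : CochainComplex (ModuleCat.{u} A) ℤ}
  (β : Pairing V W)

lemma act_add (i : ℤ) (a b : A) : act ρ i (a + b) = act ρ i a + act ρ i b := by
  simp only [act, map_add]; rfl

lemma act_zero (i : ℤ) : act ρ i 0 = 0 := by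
  simp only [act, map_zero]; rfl

lemma act_mul (i : ℤ) (a b : A) : act ρ i (a * b) = act ρ i b ≫ act ρ i a := by
  simp only [act, map_mul]; rfl

/-- The map `v ⊗ x ↦ (w ↦ β v w x)`. -/
def contractionX (n n' : ℤ) (h : n + -1 = n') : tensorX ρ V n ⟶ linX ρ W n' :=
  tensorXDesc ρ V (fun i j _ v => linXLift ρ W
    (fun a b hab w => if hai : a + i = 1 then act ρ j (β.toFun hai v w) ≫
      (E.XIsoOfEq (show j = b by lia)).hom else 0)
    (fun a b hab w w' => by
      split_ifs
      · rw [β.add_right, act_add, Preadditive.add_comp]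
      · rw [add_zero])
    (fun a b hab r w => by
      split_ifs with h
      · obtain rfl : j = b := by lia
        rw [β.smul_right, act_mul]
        simp
      · rw [zero_comp]))
    (fun i j _ v v' => linX_hom_ext fun a b hab w => by
      rw [Preadditive.add_comp, linXLift_elt, linXLift_elt, linXLift_elt]
      split_ifs
      · rw [β.add_left, act_add, Preadditive.add_comp]
      · rw [add_zero])
    (fun i j _ r v => linX_hom_ext fun a b hab w => by
      rw [Category.assoc, linXLift_elt, linXLift_elt]
      split_ifs
      · rw [β.smul_left, act_mul, Category.assoc]
      · rw [comp_zero])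

lemma contractionX_apply (n n' : ℤ) (h : n + -1 = n') (i j a : ℤ) (hij : i + j = n)
    (haj : a + n' = j) (hai : a + i = 1) (v : V.X i) (w : W.X a) :
    tensorElt ρ V i j n hij v ≫ contractionX ρ β n n' h ≫ linElt ρ W a j n' haj w =
      act ρ j (β.toFun hai v w) := by
  rw [← Category.assoc, contractionX, tensorElt_desc, linXLift_elt, dif_pos hai]
  simp

lemma contractionX_apply_zero (n n' : ℤ) (h : n + -1 = n') (i j a b : ℤ) (hij : i + j = n)
    (hab : a + n' = b) (hai : a + i ≠ 1) (v : V.X i) (w : W.X a) :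
    tensorElt ρ V i j n hij v ≫ contractionX ρ β n n' h ≫ linElt ρ W a b n' hab w = 0 := by
  rw [← Category.assoc, contractionX, tensorElt_desc, linXLift_elt, dif_neg hai]

/-- A term survives only if `a + i = 1` or `a + 1 + i = 1`. In the first case the two contributions
come from the differential of `E`; in the second they come from the differentials of `V` and `W` and
cancel by `d_left`. -/
lemma contractionX_d (n n' n'' : ℤ) (h : n + -1 = n') (h' : n + 1 = n'') :
    contractionX ρ β n n' h ≫ linD ρ W n' n +
      tensorD ρ V n n'' ≫ contractionX ρ β n'' n (by lia) = 0 := by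
  refine tensorX_hom_ext fun i j hij v => linX_hom_ext fun a b hab w => ?_
  obtain ⟨b', hb⟩ : ∃ b', b' + 1 = b := ⟨b - 1, by lia⟩
  simp only [comp_zero, zero_comp, Preadditive.comp_add, Preadditive.add_comp, Category.assoc]
  rw [linD_elt ρ W a b n' (a + 1) b' n hab (by lia) (by lia) w, Linear.comp_units_smul,
    Linear.comp_units_smul, Preadditive.comp_sub, Preadditive.comp_sub, ← Category.assoc
    (tensorElt ρ V i j n hij v) (tensorD ρ V n n''),
    tensorElt_d ρ V i j n (i + 1) (j + 1) n'' hij (by lia) (by lia), Preadditive.add_comp,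
    Linear.units_smul_comp, Category.assoc]
  by_cases h1 : a + i = 1
  · obtain rfl : b = j + 1 := by lia
    rw [contractionX_apply_zero ρ β n'' n (by lia) (i + 1) j a (j + 1) (by lia) hab (by lia),
      contractionX_apply ρ β n'' n (by lia) i (j + 1) a (by lia) hab h1,
      contractionX_apply_zero ρ β n n' (by lia) i j (a + 1) (j + 1) hij (by lia) (by lia)]
    obtain rfl : b' = j := by lia
    rw [← Category.assoc (contractionX ρ β n n' h), ← Category.assoc (tensorElt ρ V i b' n hij v),
      contractionX_apply ρ β n n' h i b' a hij (by lia) h1, ← act_d]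
    obtain rfl : i = 1 - a := by lia
    simp [Int.negOnePow_sub]
  · by_cases h2 : a + 1 + i = 1
    · obtain rfl : b = j := by lia
      rw [contractionX_apply ρ β n'' n (by lia) (i + 1) b a (by lia) hab (by lia),
        contractionX_apply_zero ρ β n'' n (by lia) i (b + 1) a b (by lia) hab h1,
        contractionX_apply ρ β n n' (by lia) i b (a + 1) hij (by lia) h2,
        ← Category.assoc (contractionX ρ β n n' h), ← Category.assoc (tensorElt ρ V i b n hij v),
        contractionX_apply_zero ρ β n n' h i b a b' hij (by lia) h1,
        β.d_left (a := a) (a' := a + 1) _ h2]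
      obtain rfl : a = - i := by lia
      have : act ρ b (i.negOnePow • β.toFun h2 v ((W.d (-i) (-i + 1)).hom w)) =
          i.negOnePow • act ρ b (β.toFun h2 v ((W.d (-i) (-i + 1)).hom w)) := by
        rcases Int.even_or_odd i with hi | hi
        · simp [Int.negOnePow_even i hi]
        · rw [Int.negOnePow_odd i hi, Units.neg_smul, Units.neg_smul, one_smul, one_smul]
          simp only [act, map_neg]; rfl
      rw [this]
      simp
    · rw [contractionX_apply_zero ρ β n'' n (by lia) (i + 1) j a b (by lia) hab (by lia),
        contractionX_apply_zero ρ β n'' n (by lia) i (j + 1) a b (by lia) hab h1,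
        contractionX_apply_zero ρ β n n' (by lia) i j (a + 1) b hij (by lia) h2,
        ← Category.assoc (contractionX ρ β n n' h), ← Category.assoc (tensorElt ρ V i j n hij v),
        contractionX_apply_zero ρ β n n' h i j a b' hij (by lia) h1]
      simp

/-- The contraction `V ⊗_A E ⟶ lin_A(W, E)`, of degree `-1`, defined by a pairing. -/
def contraction : Cocycle (tensorComplex ρ V) (linComplex ρ W) (-1) :=
  Cocycle.mk (Cochain.mk fun n n' h => contractionX ρ β n n' h) 0 (by lia) (by
    ext n
    rw [δ_v (-1) 0 rfl _ n n (add_zero n) (n - 1) (n + 1) rfl rfl, Int.negOnePow_zero, one_smul]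
    exact contractionX_d ρ β n (n - 1) (n + 1) rfl rfl)

/-- The inverse of the contraction given by dual bases. -/
def expansionX (b : DualBases β) (n n' : ℤ) (h : n + -1 = n') : linX ρ W n' ⟶ tensorX ρ V n :=
  ∑ i ∈ b.S, ∑ s, linElt ρ W (1 - i) (n - i) n' (by lia) (b.right i (1 - i) (by lia) s) ≫
    tensorElt ρ V i (n - i) n (by lia) (b.left i s)

lemma tensorElt_sum {ι : Type*} (T : Finset ι) (i j n : ℤ) (h : i + j = n) (f : ι → V.X i) :
    tensorElt ρ V i j n h (∑ s ∈ T, f s) = ∑ s ∈ T, tensorElt ρ V i j n h (f s) :=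
  map_sum (AddMonoidHom.mk' (tensorElt ρ V i j n h) (tensorElt_add ρ V i j n h)) f T

lemma linElt_sum {ι : Type*} (T : Finset ι) (i j n : ℤ) (h : i + n = j) (f : ι → W.X i) :
    linElt ρ W i j n h (∑ s ∈ T, f s) = ∑ s ∈ T, linElt ρ W i j n h (f s) :=
  map_sum (AddMonoidHom.mk' (linElt ρ W i j n h) (linElt_add ρ W i j n h)) f T

/-- The two halves of the dual basis property express elements of `V` and of `W` through each other,
and balancedness over `A` turns them into the two inverse identities. -/
lemma isIso_contractionX (b : DualBases β) (n n' : ℤ) (h : n + -1 = n') :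
    IsIso (contractionX ρ β n n' h) := by
  refine ⟨expansionX ρ β b n n' h, tensorX_hom_ext fun i j hij v => ?_,
    linX_hom_ext fun a c hac w => ?_⟩
  · rw [Category.comp_id, expansionX]
    simp only [Preadditive.comp_sum]
    rw [Finset.sum_eq_single i]
    · obtain rfl : j = n - i := by lia
      conv_rhs => rw [b.left_eq i (1 - i) (by lia) v, tensorElt_sum]
      refine Finset.sum_congr rfl fun s _ => ?_
      rw [tensorElt_smul, ← contractionX_apply ρ β n n' h i (n - i) (1 - i) hij (by lia) (by lia)]
      simp only [Category.assoc]
    · intro i' _ hi'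
      refine Finset.sum_eq_zero fun s _ => ?_
      rw [← Category.assoc (contractionX ρ β n n' h), ← Category.assoc (tensorElt ρ V i j n hij v),
        contractionX_apply_zero ρ β n n' h i j (1 - i') (n - i') hij (by lia) (by lia), zero_comp]
    · intro hi
      refine Finset.sum_eq_zero fun s _ => ?_
      rw [b.left_zero i hi v, tensorElt_zero, zero_comp]
  · rw [Category.id_comp, expansionX]
    simp only [Preadditive.sum_comp, Category.assoc]
    obtain ⟨i, hi⟩ : ∃ i, i = 1 - a := ⟨_, rfl⟩
    obtain rfl : a = 1 - i := by lia
    rw [Finset.sum_eq_single i]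
    · obtain rfl : c = n - i := by lia
      conv_rhs => rw [b.right_eq i (1 - i) (by lia) w, linElt_sum]
      refine Finset.sum_congr rfl fun s _ => ?_
      rw [linElt_smul, ← contractionX_apply ρ β n n' h i (n - i) (1 - i) (by lia) (by lia) (by lia)]
    · intro i' _ hi'
      refine Finset.sum_eq_zero fun s _ => ?_
      rw [contractionX_apply_zero ρ β n n' h i' (n - i') (1 - i) c (by lia) (by lia) (by lia),
        comp_zero]
    · intro hi
      refine Finset.sum_eq_zero fun s _ => ?_
      rw [b.right_zero i _ (by lia) hi w, linElt_zero]
      simp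

/-- The contraction, as a morphism of complexes. -/
def contractionHom : tensorComplex ρ V ⟶ (linComplex ρ W)⟦(-1 : ℤ)⟧ :=
  Cocycle.homOf ((contraction ρ β).rightShift (-1) 0 (by lia))

lemma contractionHom_f (n : ℤ) :
    (contractionHom ρ β).f n = contractionX ρ β n (n + -1) rfl := by
  simp only [contractionHom, Cocycle.homOf_f, Cocycle.rightShift_coe]
  rw [Cochain.rightShift_v _ _ _ _ _ _ _ (n + -1) (by lia)]
  exact Category.comp_id _

lemma quasiIso_contractionHom_of_dualBases (b : DualBases β) :
    QuasiIso (contractionHom ρ β) := by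
  have (n : ℤ) : IsIso ((contractionHom ρ β).f n) := by
    rw [contractionHom_f ρ β n]
    exact isIso_contractionX ρ β b n (n + -1) rfl
  have := HomologicalComplex.Hom.isIso_of_components (contractionHom ρ β)
  infer_instance

/-- The contraction, as a morphism of complexes from the shifted tensor product. -/
def contractionHom' : (tensorComplex ρ V)⟦(1 : ℤ)⟧ ⟶ linComplex ρ W :=
  Cocycle.homOf ((contraction ρ β).leftShift 1 0 (by lia))

lemma contractionHom'_f (n : ℤ) :
    (contractionHom' ρ β).f n = contractionX ρ β (n + 1) n (by lia) := by
  simp only [contractionHom', Cocycle.homOf_f, Cocycle.leftShift_coe]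
  rw [Cochain.leftShift_v _ _ _ _ _ _ _ (n + 1) (by lia)]
  simp only [mul_zero, sub_self, EuclideanDomain.zero_div, add_zero,
    Int.negOnePow_zero, one_smul]
  exact Category.id_comp _

lemma quasiIso_contractionHom'_of_dualBases (b : DualBases β) :
    QuasiIso (contractionHom' ρ β) := by
  have (n : ℤ) : IsIso ((contractionHom' ρ β).f n) := by
    rw [contractionHom'_f ρ β n]
    exact isIso_contractionX ρ β b (n + 1) n (by lia)
  have := HomologicalComplex.Hom.isIso_of_components (contractionHom' ρ β)
  infer_instance

variable {V' : CochainComplex (ModuleCat.{u} Aᵐᵒᵖ) ℤ} {W' : CochainComplex (ModuleCat.{u} A) ℤ}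
  (β' : Pairing V' W') (f : V ⟶ V') (g : W' ⟶ W)
  (hβ : ∀ {i a : ℤ} (h : a + i = 1) (v : V.X i) (w : W'.X a),
    β'.toFun h ((f.f i).hom v) w = β.toFun h v ((g.f a).hom w))
include hβ

lemma contractionX_naturality (n n' : ℤ) (h : n + -1 = n') :
    tensorMapX ρ f n ≫ contractionX ρ β' n n' h = contractionX ρ β n n' h ≫ linMapX ρ g n' := by
  refine tensorX_hom_ext fun i j hij v => linX_hom_ext fun a b hab w => ?_
  rw [← Category.assoc (tensorElt ρ V i j n hij v), tensorElt_mapX]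
  simp only [Category.assoc]
  rw [linMapX_elt]
  by_cases hai : a + i = 1
  · obtain rfl : j = b := by omega
    rw [contractionX_apply ρ β' n n' h i j a hij hab hai,
      contractionX_apply ρ β n n' h i j a hij hab hai, hβ]
  · rw [contractionX_apply_zero ρ β' n n' h i j a b hij hab hai,
      contractionX_apply_zero ρ β n n' h i j a b hij hab hai]

lemma contractionHom_naturality :
    tensorComplexMap ρ f ≫ contractionHom ρ β' =
      contractionHom ρ β ≫ (linComplexMap ρ g)⟦(-1 : ℤ)⟧' := by
  ext n : 1
  rw [HomologicalComplex.comp_f, HomologicalComplex.comp_f, contractionHom_f, contractionHom_f]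
  exact contractionX_naturality ρ β β' f g hβ n (n + -1) rfl

lemma contractionHom'_naturality :
    (tensorComplexMap ρ f)⟦(1 : ℤ)⟧' ≫ contractionHom' ρ β' =
      contractionHom' ρ β ≫ linComplexMap ρ g := by
  ext n : 1
  rw [HomologicalComplex.comp_f, HomologicalComplex.comp_f, contractionHom'_f, contractionHom'_f]
  exact contractionX_naturality ρ β β' f g hβ (n + 1) n (by omega)

end Contraction

section

variable {B : Type v} [Category.{u} B] [Abelian B] [HasCoproducts.{u} B]
  [HasCountableCoproducts B] [HasProducts.{u} B] [HasCountableProducts B]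
  {A : Type u} [Ring A] [IsSemisimpleRing A] {E : CochainComplex B ℤ} (ρ : A →+* End E)

/-- Source and target are homotopy invariant in `W`, so `W` may be replaced by a finite complex `Z`
with zero differential. There dual bases exist and the contraction is an isomorphism. -/
lemma quasiIso_contractionHom {W : CochainComplex (ModuleCat.{u} A) ℤ} (h : FiniteCohomology W) :
    QuasiIso (contractionHom ρ (dualPairing W)) := by
  obtain ⟨Z, s, S, hs, -, hf, hS⟩ := h.exists_quasiIso
  obtain ⟨b⟩ := nonempty_dualBases hf S hS
  have h1 := contractionHom_naturality ρ (dualPairing W) (dualPairing Z)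
    (dualMap Aᵐᵒᵖ A s) s (fun h v w => dualEval_map s h v w)
  have := quasiIso_dualMap Aᵐᵒᵖ A s
  have := quasiIso_tensorComplexMap ρ (dualMap Aᵐᵒᵖ A s)
  have := quasiIso_linComplexMap ρ s
  have := quasiIso_contractionHom_of_dualBases ρ (dualPairing Z) b
  have h2 : QuasiIso (contractionHom ρ (dualPairing W) ≫ (linComplexMap ρ s)⟦(-1 : ℤ)⟧') := by
    rw [← h1]; infer_instance
  have : QuasiIso ((linComplexMap ρ s)⟦(-1 : ℤ)⟧') := inferInstance
  exact quasiIso_of_comp_right _ ((linComplexMap ρ s)⟦(-1 : ℤ)⟧')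

lemma quasiIso_contractionHom' {V : CochainComplex (ModuleCat.{u} Aᵐᵒᵖ) ℤ}
    (h : FiniteCohomology V) : QuasiIso (contractionHom' ρ (dualPairing' V)) := by
  obtain ⟨Z, s, S, hs, -, hf, hS⟩ := h.exists_quasiIso
  obtain ⟨b⟩ := nonempty_dualBases' hf S hS
  have h1 := contractionHom'_naturality ρ (dualPairing' Z) (dualPairing' V) s
    (dualMap A A s) (fun h v w => (dualEval_map s _ w v).symm)
  have := quasiIso_dualMap A A s
  have := quasiIso_tensorComplexMap ρ s
  have := quasiIso_linComplexMap ρ (dualMap A A s)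
  have := quasiIso_contractionHom'_of_dualBases ρ (dualPairing' Z) b
  have : QuasiIso ((tensorComplexMap ρ s)⟦(1 : ℤ)⟧') := inferInstance
  have h2 : QuasiIso ((tensorComplexMap ρ s)⟦(1 : ℤ)⟧' ≫ contractionHom' ρ (dualPairing' V)) := by
    rw [h1]; infer_instance
  exact quasiIso_of_comp_left ((tensorComplexMap ρ s)⟦(1 : ℤ)⟧') _

end

end

noncomputable section

open CategoryTheory Limits CochainComplex.HomComplex

/-! ### Adjunctions between lin, tensor and Hom complexes -/

section LinAdjunction

variable {B : Type v} [Category.{u} B] [Abelian B] [HasProducts.{u} B] [HasCountableProducts B]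
  {A : Type u} [Ring A] {E : CochainComplex B ℤ} (ρ : A →+* End E)
  {W : CochainComplex (ModuleCat.{u} A) ℤ} {Y : CochainComplex B ℤ}

/-- Evaluation at `w`, as a cochain. -/
def evalCochain {a : ℤ} (w : W.X a) : Cochain (linComplex ρ W) E a :=
  Cochain.mk fun p q hpq => linElt ρ W a q p (by lia) w

lemma evalCochain_v {a : ℤ} (w : W.X a) (p q : ℤ) (hpq : p + a = q) :
    (evalCochain ρ w).v p q hpq = linElt ρ W a q p (by lia) w := rfl

lemma evalCochain_add {a : ℤ} (w w' : W.X a) :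
    evalCochain ρ (w + w') = evalCochain ρ w + evalCochain ρ w' := by
  ext p q hpq : 1
  exact linElt_add ρ W a q p _ w w'

lemma evalCochain_smul {a : ℤ} (r : A) (w : W.X a) :
    evalCochain ρ (r • w) = (evalCochain ρ w).comp (Cochain.ofHom (ρ r)) (add_zero a) := by
  ext p q hpq : 1
  rw [Cochain.comp_zero_cochain_v, Cochain.ofHom_v]
  exact linElt_smul ρ W a q p _ r w

lemma δ_evalCochain {a a' : ℤ} (h : a + 1 = a') (w : W.X a) :
    δ a a' (evalCochain ρ w) = evalCochain ρ ((W.d a a').hom w) := by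
  ext p q hpq : 1
  rw [δ_v a a' h _ p q hpq (q - 1) (p + 1) rfl rfl, evalCochain_v, evalCochain_v, evalCochain_v]
  refine (congrArg (fun z => linElt ρ W a (q - 1) p (by lia) w ≫ E.d (q - 1) q +
    a'.negOnePow • z) (linD_elt ρ W a q p a' (q - 1) (p + 1) (by lia) (by lia) (by lia) w)).trans ?_
  have : a'.negOnePow = - a.negOnePow := by rw [← h, Int.negOnePow_succ]
  rw [this, smul_smul, neg_mul, Int.units_mul_self, Units.neg_smul, one_smul]
  abel

/-- A cochain with values in `lin_A(W, E)` defines a cochain from `W` to the Hom complex. -/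
def linAdjFun {m : ℤ} (φ : Cochain Y (linComplex ρ W) m) : Cochain W (homTo ρ Y) m :=
  Cochain.mk fun a b hab =>
    letI := leftModule ρ Y b
    ModuleCat.ofHom (Y := Cochain Y E b)
      -- The Koszul sign for exchanging `w` and `φ`; with it the bijection commutes with `δ` without
      -- further signs.
      { toFun w := (a * m).negOnePow • φ.comp (evalCochain ρ w) (by lia)
        map_add' w w' := by rw [evalCochain_add, Cochain.comp_add, smul_add]
        map_smul' r w := by
          rw [evalCochain_smul, ← Cochain.comp_assoc_of_third_is_zero_cochain,
            ← Cochain.units_smul_comp]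
          rfl }

/-- The value of a cochain from `W` to the Hom complex. -/
def homToElt {m : ℤ} (ψ : Cochain W (homTo ρ Y) m) (a b : ℤ) (h : a + m = b) (w : W.X a) :
    Cochain Y E b :=
  (ψ.v a b h).hom w

lemma homToElt_add {m : ℤ} (ψ : Cochain W (homTo ρ Y) m) (a b : ℤ) (h : a + m = b)
    (w w' : W.X a) : homToElt ρ ψ a b h (w + w') = homToElt ρ ψ a b h w + homToElt ρ ψ a b h w' :=
  map_add (ψ.v a b h).hom w w'

lemma homToElt_smul {m : ℤ} (ψ : Cochain W (homTo ρ Y) m) (a b : ℤ) (h : a + m = b)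
    (r : A) (w : W.X a) : homToElt ρ ψ a b h (r • w) =
      (homToElt ρ ψ a b h w).comp (Cochain.ofHom (ρ r)) (add_zero b) :=
  map_smul (ψ.v a b h).hom r w

/-- The inverse of `linAdjFun`, termwise. -/
def linAdjInvX {m : ℤ} (ψ : Cochain W (homTo ρ Y) m) (p q : ℤ) (hpq : p + m = q) :
    Y.X p ⟶ linX ρ W q :=
  linXLift ρ W
    (fun a b hab w => (a * m).negOnePow • (homToElt ρ ψ a (a + m) rfl w).v p b (by lia))
    (fun a b hab w w' => by rw [homToElt_add, Cochain.add_v, smul_add])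
    (fun a b hab r w => by
      rw [homToElt_smul, Linear.units_smul_comp, Cochain.comp_zero_cochain_v, Cochain.ofHom_v]
      rfl)

lemma linAdjInvX_elt {m : ℤ} (ψ : Cochain W (homTo ρ Y) m) (p q a b : ℤ) (hpq : p + m = q)
    (hab : a + q = b) (w : W.X a) :
    linAdjInvX ρ ψ p q hpq ≫ linElt ρ W a b q hab w = (a * m).negOnePow •
      (homToElt ρ ψ a (a + m) rfl w).v p b (by lia) := by
  rw [linAdjInvX, linXLift_elt]

/-- The inverse of `linAdjFun`. -/
def linAdjInv {m : ℤ} (ψ : Cochain W (homTo ρ Y) m) : Cochain Y (linComplex ρ W) m :=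
  Cochain.mk fun p q hpq => linAdjInvX ρ ψ p q hpq

lemma linAdjInv_v {m : ℤ} (ψ : Cochain W (homTo ρ Y) m) (p q a b : ℤ) (hpq : p + m = q)
    (hab : a + q = b) (w : W.X a) :
    (linAdjInv ρ ψ).v p q hpq ≫ linElt ρ W a b q hab w = (a * m).negOnePow •
      (homToElt ρ ψ a (a + m) rfl w).v p b (by lia) :=
  linAdjInvX_elt ρ ψ p q a b hpq hab w

lemma comp_evalCochain_v {m : ℤ} (φ : Cochain Y (linComplex ρ W) m) {a b : ℤ} (hab : m + a = b)
    (w : W.X a) (p q r : ℤ) (hpq : p + m = q) (hpr : p + b = r) :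
    (φ.comp (evalCochain ρ w) hab).v p r hpr = φ.v p q hpq ≫ linElt ρ W a r q (by lia) w :=
  Cochain.comp_v _ _ _ p q r hpq (by lia)

/-- Cochains with values in `lin_A(W, E)` are cochains from `W` to the Hom complex. -/
def linAdj (m : ℤ) : Cochain Y (linComplex ρ W) m ≃+ Cochain W (homTo ρ Y) m where
  toFun φ := linAdjFun ρ φ
  invFun ψ := linAdjInv ρ ψ
  left_inv φ := by
    ext p q hpq : 1
    refine linX_hom_ext fun a b hab w => (linAdjInv_v ρ _ p q a b hpq hab w).trans ?_
    change (a * m).negOnePow • Cochain.v ((a * m).negOnePow • φ.comp (evalCochain ρ w) _) p b _ = _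
    rw [Cochain.units_smul_v, smul_smul, Int.units_mul_self, one_smul,
      comp_evalCochain_v ρ φ _ w p q b hpq (by lia)]
    rfl
  right_inv ψ := by
    ext a b hab w
    obtain rfl := hab
    refine Cochain.ext (z₁ := (a * m).negOnePow • (linAdjInv ρ ψ).comp (evalCochain ρ w)
      (add_comm m a)) _ fun p q hpq => ?_
    rw [Cochain.units_smul_v, comp_evalCochain_v ρ _ _ w p (p + m) q rfl (by lia),
      linAdjInv_v, smul_smul, Int.units_mul_self, one_smul]
    rfl
  map_add' φ φ' := by
    ext a b hab w
    change (a * m).negOnePow • Cochain.comp (φ + φ') _ _ = (a * m).negOnePow • Cochain.comp φ _ _ +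
      (a * m).negOnePow • Cochain.comp φ' _ _
    rw [Cochain.add_comp, smul_add]

lemma linAdj_v (m : ℤ) (φ : Cochain Y (linComplex ρ W) m) (a b : ℤ) (hab : a + m = b) (w : W.X a) :
    ((linAdj ρ m φ).v a b hab).hom w =
      (a * m).negOnePow • (show Cochain Y E b from φ.comp (evalCochain ρ w) (by lia)) := rfl

lemma δ_linAdj (m m' : ℤ) (φ : Cochain Y (linComplex ρ W) m) :
    δ m m' (linAdj ρ m φ) = linAdj ρ m' (δ m m' φ) := by
  by_cases hm : m + 1 = m'
  swap
  · rw [δ_shape _ _ hm, δ_shape _ _ hm, map_zero]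
  ext a b hab w
  rw [δ_v_apply hm _ a b (a + m) (a + 1) hab rfl (by lia), linAdj_v, linAdj_v, linAdj_v]
  change δ (a + m) b ((a * m).negOnePow • φ.comp (evalCochain ρ w) _) +
    m'.negOnePow • ((a + 1) * m).negOnePow • φ.comp (evalCochain ρ _) _ =
    (a * m').negOnePow • (δ m m' φ).comp (evalCochain ρ w) _
  have h0 : δ (a + m) b (φ.comp (evalCochain ρ w) (add_comm m a)) =
      φ.comp (evalCochain ρ ((W.d a (a + 1)).hom w)) (by lia) +
        a.negOnePow • (δ m m' φ).comp (evalCochain ρ w) (by lia) := by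
    rw [δ_comp φ (evalCochain ρ w) (add_comm m a) m' (a + 1) b (by lia) hm rfl,
      δ_evalCochain ρ rfl]
  rw [δ_units_smul, h0, smul_add, smul_smul, smul_smul]
  have h1 : m'.negOnePow * ((a + 1) * m).negOnePow = - (a * m).negOnePow := by
    rw [← hm, Int.negOnePow_succ, add_mul, one_mul, Int.negOnePow_add, mul_comm (Int.negOnePow (a * m)),
      neg_mul, ← mul_assoc, Int.units_mul_self, one_mul]
  have h2 : (a * m).negOnePow * a.negOnePow = (a * m').negOnePow := by
    rw [← Int.negOnePow_add, ← hm, mul_add, mul_one]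
  rw [h1, h2, Units.neg_smul]
  abel

variable (W) in
/-- The map `W ⟶ Hom(lin_A(W, E), E)`. -/
def linCounit : W ⟶ homTo ρ (linComplex ρ W) where
  f a :=
    letI := leftModule ρ (linComplex ρ W) a
    ModuleCat.ofHom (Y := Cochain (linComplex ρ W) E a)
      { toFun w := evalCochain ρ w
        map_add' := evalCochain_add ρ
        map_smul' := evalCochain_smul ρ }
  comm' a a' h := by
    ext w
    exact δ_evalCochain ρ h w

/-- A triangle identity. It later identifies the coevaluation of `T X`, composed with the map
induced by the comparison, with a plain projection. -/
lemma coevaluation_linCounit :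
    coevaluation ρ (linComplex ρ W) ≫ linComplexMap ρ (linCounit ρ W) = 𝟙 _ := by
  ext n : 1
  refine linX_hom_ext fun i j hij w => ?_
  change (coevaluationX ρ _ n ≫ linMapX ρ (linCounit ρ W) n) ≫ _ = 𝟙 (linX ρ W n) ≫ _
  rw [Category.assoc, linMapX_elt, coevaluationX_elt, Category.id_comp]
  rfl

end LinAdjunction

section TensorAdjunction

variable {B : Type v} [Category.{u} B] [Abelian B] [HasCoproducts.{u} B]
  [HasCountableCoproducts B]
  {A : Type u} [Ring A] {E : CochainComplex B ℤ} (ρ : A →+* End E)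
  {V : CochainComplex (ModuleCat.{u} Aᵐᵒᵖ) ℤ} {Y : CochainComplex B ℤ}

/-- The cochain `x ↦ v ⊗ x`. -/
def tensorEltCochain {a : ℤ} (v : V.X a) : Cochain E (tensorComplex ρ V) a :=
  Cochain.mk fun p q hpq => tensorElt ρ V a p q (by lia) v

lemma tensorEltCochain_v {a : ℤ} (v : V.X a) (p q : ℤ) (hpq : p + a = q) :
    (tensorEltCochain ρ v).v p q hpq = tensorElt ρ V a p q (by lia) v := rfl

lemma tensorEltCochain_add {a : ℤ} (v v' : V.X a) :
    tensorEltCochain ρ (v + v') = tensorEltCochain ρ v + tensorEltCochain ρ v' := by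
  ext p q hpq : 1
  exact tensorElt_add ρ V a p q _ v v'

lemma tensorEltCochain_smul {a : ℤ} (r : Aᵐᵒᵖ) (v : V.X a) :
    tensorEltCochain ρ (r • v) =
      (Cochain.ofHom (ρ r.unop)).comp (tensorEltCochain ρ v) (zero_add a) := by
  ext p q hpq : 1
  rw [Cochain.zero_cochain_comp_v, Cochain.ofHom_v]
  exact tensorElt_smul ρ V a p q _ r.unop v

lemma δ_tensorEltCochain {a a' : ℤ} (h : a + 1 = a') (v : V.X a) :
    δ a a' (tensorEltCochain ρ v) = tensorEltCochain ρ ((V.d a a').hom v) := by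
  ext p q hpq : 1
  rw [δ_v a a' h _ p q hpq (q - 1) (p + 1) rfl rfl]
  simp only [tensorEltCochain_v]
  have : a'.negOnePow = - a.negOnePow := by rw [← h, Int.negOnePow_succ]
  refine (congrArg (fun z => z + a'.negOnePow • (E.d p (p + 1) ≫ tensorElt ρ V a (p + 1) q
    (by lia) v)) (tensorElt_d ρ V a p (q - 1) a' (p + 1) q (by lia) (by lia) (by lia) v)).trans ?_
  rw [this, Units.neg_smul, add_neg_cancel_right]

/-- A cochain from `V ⊗_A E` defines a cochain from `V` to the Hom complex. -/
def tensorAdjFun {m : ℤ} (φ : Cochain (tensorComplex ρ V) Y m) : Cochain V (homFrom ρ Y) m :=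
  Cochain.mk fun a b hab =>
    letI := rightModule ρ Y b
    ModuleCat.ofHom (Y := Cochain E Y b)
      { toFun v := (tensorEltCochain ρ v).comp φ hab
        map_add' v v' := by rw [tensorEltCochain_add, Cochain.add_comp]
        map_smul' r v := by
          rw [tensorEltCochain_smul, Cochain.comp_assoc_of_first_is_zero_cochain]
          rfl }

/-- The value of a cochain from `V` to the Hom complex. -/
def homFromElt {m : ℤ} (ψ : Cochain V (homFrom ρ Y) m) (a b : ℤ) (h : a + m = b) (v : V.X a) :
    Cochain E Y b :=
  (ψ.v a b h).hom v

lemma homFromElt_add {m : ℤ} (ψ : Cochain V (homFrom ρ Y) m) (a b : ℤ) (h : a + m = b)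
    (v v' : V.X a) :
    homFromElt ρ ψ a b h (v + v') = homFromElt ρ ψ a b h v + homFromElt ρ ψ a b h v' :=
  map_add (ψ.v a b h).hom v v'

lemma homFromElt_smul {m : ℤ} (ψ : Cochain V (homFrom ρ Y) m) (a b : ℤ) (h : a + m = b)
    (r : A) (v : V.X a) : homFromElt ρ ψ a b h (MulOpposite.op r • v) =
      (Cochain.ofHom (ρ r)).comp (homFromElt ρ ψ a b h v) (zero_add b) :=
  map_smul (ψ.v a b h).hom (MulOpposite.op r) v

/-- The inverse of `tensorAdjFun`, termwise. -/
def tensorAdjInvX {m : ℤ} (ψ : Cochain V (homFrom ρ Y) m) (p q : ℤ) (hpq : p + m = q) :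
    tensorX ρ V p ⟶ Y.X q :=
  tensorXDesc ρ V
    (fun a b hab v => (homFromElt ρ ψ a (a + m) rfl v).v b q (by lia))
    (fun a b hab v v' => by rw [homFromElt_add, Cochain.add_v])
    (fun a b hab r v => by
      rw [homFromElt_smul, Cochain.zero_cochain_comp_v, Cochain.ofHom_v]
      rfl)

lemma tensorElt_tensorAdjInvX {m : ℤ} (ψ : Cochain V (homFrom ρ Y) m) (a b p q : ℤ)
    (hpq : p + m = q) (hab : a + b = p) (v : V.X a) :
    tensorElt ρ V a b p hab v ≫ tensorAdjInvX ρ ψ p q hpq =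
      (homFromElt ρ ψ a (a + m) rfl v).v b q (by lia) := by
  rw [tensorAdjInvX, tensorElt_desc]

/-- The inverse of `tensorAdjFun`. -/
def tensorAdjInv {m : ℤ} (ψ : Cochain V (homFrom ρ Y) m) : Cochain (tensorComplex ρ V) Y m :=
  Cochain.mk fun p q hpq => tensorAdjInvX ρ ψ p q hpq

lemma tensorElt_tensorAdjInv {m : ℤ} (ψ : Cochain V (homFrom ρ Y) m) (a b p q : ℤ)
    (hpq : p + m = q) (hab : a + b = p) (v : V.X a) :
    tensorElt ρ V a b p hab v ≫ (tensorAdjInv ρ ψ).v p q hpq =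
      (homFromElt ρ ψ a (a + m) rfl v).v b q (by lia) :=
  tensorElt_tensorAdjInvX ρ ψ a b p q hpq hab v

lemma tensorEltCochain_comp_v {m : ℤ} (φ : Cochain (tensorComplex ρ V) Y m) {a b : ℤ}
    (hab : a + m = b) (v : V.X a) (p q r : ℤ) (hpq : p + a = q) (hpr : p + b = r) :
    ((tensorEltCochain ρ v).comp φ hab).v p r hpr =
      tensorElt ρ V a p q (by lia) v ≫ φ.v q r (by lia) :=
  Cochain.comp_v _ _ _ p q r hpq (by lia)

/-- Cochains from `V ⊗_A E` are cochains from `V` to the Hom complex. -/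
def tensorAdj (m : ℤ) : Cochain (tensorComplex ρ V) Y m ≃+ Cochain V (homFrom ρ Y) m where
  toFun φ := tensorAdjFun ρ φ
  invFun ψ := tensorAdjInv ρ ψ
  left_inv φ := by
    ext p q hpq : 1
    refine tensorX_hom_ext fun a b hab v => (tensorElt_tensorAdjInv ρ _ a b p q hpq hab v).trans ?_
    exact tensorEltCochain_comp_v ρ φ rfl v b p q (by lia) (by lia)
  right_inv ψ := by
    ext a b hab v
    obtain rfl := hab
    refine Cochain.ext (z₁ := (tensorEltCochain ρ v).comp (tensorAdjInv ρ ψ) rfl) _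
      fun p q hpq => ?_
    rw [tensorEltCochain_comp_v ρ _ _ v p (p + a) q rfl (by lia), tensorElt_tensorAdjInv]
    rfl
  map_add' φ φ' := by
    ext a b hab v
    exact Cochain.comp_add (tensorEltCochain ρ v) φ φ' hab

lemma tensorAdj_v (m : ℤ) (φ : Cochain (tensorComplex ρ V) Y m) (a b : ℤ) (hab : a + m = b)
    (v : V.X a) :
    ((tensorAdj ρ m φ).v a b hab).hom v =
      (show Cochain E Y b from (tensorEltCochain ρ v).comp φ hab) := rfl

lemma δ_tensorAdj (m m' : ℤ) (φ : Cochain (tensorComplex ρ V) Y m) :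
    δ m m' (tensorAdj ρ m φ) = tensorAdj ρ m' (δ m m' φ) := by
  by_cases hm : m + 1 = m'
  swap
  · rw [δ_shape _ _ hm, δ_shape _ _ hm, map_zero]
  ext a b hab v
  rw [δ_v_apply hm _ a b (a + m) (a + 1) hab rfl (by lia), tensorAdj_v, tensorAdj_v, tensorAdj_v]
  change δ (a + m) b ((tensorEltCochain ρ v).comp φ _) +
    m'.negOnePow • (tensorEltCochain ρ _).comp φ _ = (tensorEltCochain ρ v).comp (δ m m' φ) _
  have h0 : m'.negOnePow = - m.negOnePow := by rw [← hm, Int.negOnePow_succ]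
  rw [δ_comp (tensorEltCochain ρ v) φ rfl (a + 1) m' b (by lia) rfl hm, δ_tensorEltCochain ρ rfl,
    h0, Units.neg_smul]
  exact add_neg_cancel_right (G := Cochain E Y b) _ _

variable (V) in
/-- The map `V ⟶ Hom(E, V ⊗_A E)`. -/
def tensorUnit : V ⟶ homFrom ρ (tensorComplex ρ V) where
  f a :=
    letI := rightModule ρ (tensorComplex ρ V) a
    ModuleCat.ofHom (Y := Cochain E (tensorComplex ρ V) a)
      { toFun v := tensorEltCochain ρ v
        map_add' := tensorEltCochain_add ρ
        map_smul' := tensorEltCochain_smul ρ }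
  comm' a a' h := by
    ext v
    exact δ_tensorEltCochain ρ h v

/-- The triangle identity on the tensor side, used in the same way for the evaluation of `T* X`. -/
lemma tensorUnit_evaluation :
    tensorComplexMap ρ (tensorUnit ρ V) ≫ evaluation ρ (tensorComplex ρ V) = 𝟙 _ := by
  ext n : 1
  refine tensorX_hom_ext fun i j hij v => ?_
  change _ ≫ tensorMapX ρ (tensorUnit ρ V) n ≫ evaluationX ρ _ n = _ ≫ 𝟙 (tensorX ρ V n)
  rw [← Category.assoc, tensorElt_mapX, tensorElt_evaluationX, Category.comp_id]
  rfl

end TensorAdjunction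

end

noncomputable section

open CategoryTheory Limits CochainComplex.HomComplex

/-! ### Triangles formed by cones and fibres -/

section Cones

open CochainComplex Pretriangulated

variable {B : Type v} [Category.{u} B] [Abelian B]

lemma quasiIso_mappingCone_map {K L K' L' : CochainComplex B ℤ} (φ : K ⟶ L) (φ' : K' ⟶ L')
    (a : K ⟶ K') (b : L ⟶ L') (h : φ ≫ b = a ≫ φ') [QuasiIso a] [QuasiIso b] :
    QuasiIso (mappingCone.map φ φ' a b h) := by
  let := HasDerivedCategory.standard B
  rw [← DerivedCategory.isIso_Q_map_iff_quasiIso]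
  have ha : IsIso (DerivedCategory.Q.map a) := inferInstance
  have hb : IsIso (DerivedCategory.Q.map b) := inferInstance
  exact isIso₃_of_isIso₁₂
    (DerivedCategory.Q.mapTriangle.map (mappingCone.triangleMap φ φ' a b h))
    (DerivedCategory.mappingCone_triangle_distinguished φ)
    (DerivedCategory.mappingCone_triangle_distinguished φ') ha hb

/-- The inclusion `L⟦-1⟧ ⟶ mappingCocone φ`. -/
def coconeIncl {K L : CochainComplex B ℤ} (φ : K ⟶ L) : L⟦(-1 : ℤ)⟧ ⟶ mappingCocone φ where
  f n := (mappingCocone.inr φ).1.v (n + -1) n (by lia)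
  comm' i j hij := by
    obtain rfl : i + 1 = j := hij
    have h := Cochain.congr_v ((mappingCocone.inr φ).δ_eq_zero 2) (i + -1) (i + 1) (by lia)
    rw [δ_v 1 2 rfl _ _ _ _ i (i + 1 + -1) (by lia) (by lia), Cochain.zero_v,
      Int.negOnePow_even 2 ⟨1, rfl⟩, one_smul] at h
    have h' : (L⟦(-1 : ℤ)⟧).d i (i + 1) = -L.d (i + -1) (i + 1 + -1) := by
      rw [shiftFunctor_obj_d', Int.negOnePow_neg, Int.negOnePow_one, Units.neg_smul, one_smul]
    rw [h']
    exact (eq_neg_of_add_eq_zero_left h).trans (Preadditive.neg_comp _ _).symm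

/-- The sequence `L⟦-1⟧ ⟶ mappingCocone φ ⟶ K`. -/
def coconeShortComplex {K L : CochainComplex B ℤ} (φ : K ⟶ L) :
    ShortComplex (CochainComplex B ℤ) where
  X₁ := L⟦(-1 : ℤ)⟧
  X₂ := mappingCocone φ
  X₃ := K
  f := coconeIncl φ
  g := mappingCocone.fst φ
  zero := by
    ext n
    exact mappingCocone.inr_v_fst_f φ (n + -1) n (by lia)

lemma coconeShortComplex_shortExact {K L : CochainComplex B ℤ} (φ : K ⟶ L) :
    (coconeShortComplex φ).ShortExact := by
  refine HomologicalComplex.shortExact_of_degreewise_shortExact _ fun n => ?_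
  refine ShortComplex.Splitting.shortExact
    { r := (mappingCocone.snd φ).v n (n + -1) rfl
      s := (mappingCocone.inl φ).v n n (add_zero n)
      f_r := ?_
      s_g := ?_
      id := ?_ }
  · exact mappingCocone.inr_v_snd_v φ (n + -1) n (by lia)
  · exact mappingCocone.inl_v_fst_f φ n
  · rw [add_comm]
    exact mappingCocone.id_X φ n (n + -1) rfl

/-- If `P ⟶ L⟦-1⟧` is a quasi-isomorphism then `P ⟶ mappingCocone φ ⟶ K` is a triangle, for
`φ : K ⟶ L`. -/
lemma quasiIso_desc_coconeIncl {K L P : CochainComplex B ℤ} (φ : K ⟶ L) (κ : P ⟶ L⟦(-1 : ℤ)⟧)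
    [QuasiIso κ] (u : P ⟶ mappingCocone φ) (hu : κ ≫ coconeIncl φ = u) (h) :
    QuasiIso (mappingCone.desc u 0 (mappingCocone.fst φ) h) := by
  have h1 := quasiIso_mappingCone_map u (coconeIncl φ) κ (𝟙 _) (by rw [hu, Category.comp_id])
  -- `d` is the quasi-isomorphism from the cone of `L⟦-1⟧ ⟶ mappingCocone φ` to the quotient `K` of
  -- this degreewise split inclusion. The map in question is `d` after the quasi-isomorphism of
  -- cones induced by `κ`.
  obtain ⟨d, hd, h2, h3⟩ : ∃ d : mappingCone (coconeIncl φ) ⟶ K, QuasiIso d ∧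
      (∀ n, (mappingCone.inl (coconeIncl φ)).v (n + 1) n (by lia) ≫ d.f n = 0) ∧
      ∀ n, (mappingCone.inr (coconeIncl φ)).f n ≫ d.f n = (mappingCocone.fst φ).f n :=
    ⟨mappingCone.descShortComplex (coconeShortComplex φ),
      mappingCone.quasiIso_descShortComplex (coconeShortComplex_shortExact φ),
      fun n => mappingCone.inl_v_descShortComplex_f (coconeShortComplex φ) (n + 1) n (by lia),
      fun n => mappingCone.inr_f_descShortComplex_f (coconeShortComplex φ) n⟩
  have h4 : mappingCone.desc u 0 (mappingCocone.fst φ) h =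
      mappingCone.map u (coconeIncl φ) κ (𝟙 _) (by rw [hu, Category.comp_id]) ≫ d := by
    ext n
    rw [mappingCone.ext_from_iff _ (n + 1) _ rfl]
    constructor
    · have : ((mappingCone.inl u).v (n + 1) n (by lia) ≫ (mappingCone.map u (coconeIncl φ) κ (𝟙 _)
          (by rw [hu, Category.comp_id])).f n) ≫ d.f n = 0 := by
        rw [mappingCone.map, mappingCone.inl_v_desc_f, Cochain.zero_cochain_comp_v, Cochain.ofHom_v]
        exact (Category.assoc (κ.f (n + 1)) _ _).trans
          ((congrArg (fun z => κ.f (n + 1) ≫ z) (h2 n)).trans comp_zero)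
      rw [HomologicalComplex.comp_f, mappingCone.inl_v_desc_f, Cochain.zero_v, ← Category.assoc,
        this]
    · simp [mappingCone.map, h3]
  rw [h4]
  exact quasiIso_comp (hφ := h1) (hφ' := hd)

/-- The projection `mappingCone φ ⟶ K⟦1⟧`. -/
def coneProj {K L : CochainComplex B ℤ} (φ : K ⟶ L) : mappingCone φ ⟶ K⟦(1 : ℤ)⟧ where
  f n := (mappingCone.fst φ).1.v n (n + 1) rfl
  comm' i j hij := by
    obtain rfl : i + 1 = j := hij
    have h' : (K⟦(1 : ℤ)⟧).d i (i + 1) = -K.d (i + 1) (i + 1 + 1) := by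
      rw [shiftFunctor_obj_d', Int.negOnePow_one, Units.neg_smul, one_smul]
    rw [h']
    exact (Preadditive.comp_neg _ _).trans ((mappingCone.d_fst_v φ i (i + 1) (i + 1 + 1)
      rfl rfl)).symm

/-- The sequence `L ⟶ mappingCone φ ⟶ K⟦1⟧`. -/
def coneShortComplex {K L : CochainComplex B ℤ} (φ : K ⟶ L) :
    ShortComplex (CochainComplex B ℤ) where
  X₁ := L
  X₂ := mappingCone φ
  X₃ := K⟦(1 : ℤ)⟧
  f := mappingCone.inr φ
  g := coneProj φ
  zero := by
    ext n
    exact mappingCone.inr_f_fst_v φ n (n + 1) rfl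

lemma coneShortComplex_shortExact {K L : CochainComplex B ℤ} (φ : K ⟶ L) :
    (coneShortComplex φ).ShortExact := by
  refine HomologicalComplex.shortExact_of_degreewise_shortExact _ fun n => ?_
  refine ShortComplex.Splitting.shortExact
    { r := (mappingCone.snd φ).v n n (add_zero n)
      s := (mappingCone.inl φ).v (n + 1) n (by lia)
      f_r := ?_
      s_g := ?_
      id := ?_ }
  · exact mappingCone.inr_f_snd_v φ n
  · exact mappingCone.inl_v_fst_v φ (n + 1) n rfl
  · rw [add_comm]
    exact mappingCone.id_X φ n (n + 1) rfl

/-- For morphisms `f : K ⟶ M` and `g : M ⟶ N` with composition zero, the canonical morphism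
from `K⟦1⟧` to the cone of `g`. -/
def toCone {K M N : CochainComplex B ℤ} (f : K ⟶ M) (g : M ⟶ N) (h : f ≫ g = 0) :
    K⟦(1 : ℤ)⟧ ⟶ mappingCone g where
  f n := f.f (n + 1) ≫ (mappingCone.inl g).v (n + 1) n (by lia)
  comm' i j hij := by
    obtain rfl : i + 1 = j := hij
    have h' : (K⟦(1 : ℤ)⟧).d i (i + 1) = -K.d (i + 1) (i + 1 + 1) := by
      rw [shiftFunctor_obj_d', Int.negOnePow_one, Units.neg_smul, one_smul]
    rw [h']
    refine Eq.trans ?_ (Preadditive.neg_comp _ _).symm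
    refine (Category.assoc (f.f (i + 1)) _ _).trans ?_
    rw [mappingCone.inl_v_d g (i + 1) i (i + 1 + 1) (by lia) (by lia),
      Preadditive.comp_sub, ← Category.assoc, ← HomologicalComplex.comp_f, h,
      HomologicalComplex.zero_f, zero_comp, zero_sub, f.comm_assoc]
    rfl

/-- In a sequence `f : K ⟶ M`, `g : M ⟶ N` with composition zero, `K⟦1⟧` is the cone of `g` if
`N` is the cone of `f`. -/
lemma quasiIso_toCone {K M N : CochainComplex B ℤ} (f : K ⟶ M) (g : M ⟶ N) (h : f ≫ g = 0) (h')
    [QuasiIso (mappingCone.desc f 0 g h')] : QuasiIso (toCone f g h) := by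
  let := HasDerivedCategory.standard B
  rw [← DerivedCategory.isIso_Q_map_iff_quasiIso]
  let p := toCone f g h
  let q := mappingCone.desc f 0 g h'
  have hq : IsIso (DerivedCategory.Q.map q) := inferInstance
  obtain ⟨m, hm⟩ : ∃ m : mappingCone f ⟶ K⟦(1 : ℤ)⟧, m = (mappingCone.triangle f).mor₃ := ⟨_, rfl⟩
  obtain ⟨m', hm'⟩ : ∃ m' : mappingCone g ⟶ M⟦(1 : ℤ)⟧, m' = (mappingCone.triangle g).mor₃ :=
    ⟨_, rfl⟩
  have hp (n : ℤ) : p.f n = f.f (n + 1) ≫ (mappingCone.inl g).v (n + 1) n (by lia) := rfl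
  have hp' : p ≫ m' = -f⟦(1 : ℤ)⟧' := by
    ext n
    rw [HomologicalComplex.comp_f, hp, hm']
    refine (Category.assoc _ _ _).trans ((congrArg (fun z => f.f (n + 1) ≫ z)
      (mappingCone.inl_v_triangle_mor₃_f g (n + 1) n (by lia))).trans ?_)
    exact (Preadditive.comp_neg _ _).trans (congrArg Neg.neg (Category.comp_id _))
  -- The middle square of the comparison of triangles commutes only up to homotopy, and the homotopy
  -- is the inclusion `inl g`.
  have H : Homotopy (q ≫ mappingCone.inr g) (m ≫ p) := by
    refine mappingCone.descHomotopy _ _ _ 0 (mappingCone.inl g) ?_ ?_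
    · ext i j hij
      obtain rfl : i = j + 1 := by lia
      have h1 : (mappingCone.inl f).v (j + 1) j hij ≫ m.f j = -𝟙 (K.X (j + 1)) := by
        rw [hm]
        exact mappingCone.inl_v_triangle_mor₃_f f (j + 1) j hij
      have h2 : (mappingCone.inl f).v (j + 1) j hij ≫ m.f j ≫ p.f j =
          -(f.f (j + 1) ≫ (mappingCone.inl g).v (j + 1) j (by lia)) := by
        rw [← Category.assoc, h1]
        exact (Preadditive.neg_comp _ _).trans (congrArg Neg.neg (Category.id_comp _))
      simp only [Cochain.comp_zero_cochain_v, Cochain.ofHom_v, HomologicalComplex.comp_f, δ_zero,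
        zero_add, Cochain.add_v, Cochain.zero_cochain_comp_v, h2, q, mappingCone.inl_v_desc_f_assoc,
        Cochain.zero_v, zero_comp, add_neg_cancel]
    · ext i
      have h1 : (mappingCone.inr f).f i ≫ m.f i = 0 := by
        rw [hm]
        exact mappingCone.inr_f_triangle_mor₃_f f i
      have h2 : (mappingCone.inr f).f i ≫ m.f i ≫ p.f i = 0 := by
        rw [← Category.assoc, h1]
        exact zero_comp
      simp [q]
      exact h2
  -- The rotated triangle of `f` is compared with the triangle of `g` by the maps `𝟙`, `q` and `p`.
  -- As `q` is invertible by assumption, so is `p`.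
  let Φ : (DerivedCategory.Q.mapTriangle.obj (mappingCone.triangle f)).rotate ⟶
      DerivedCategory.Q.mapTriangle.obj (mappingCone.triangle g) :=
    { hom₁ := 𝟙 _
      hom₂ := DerivedCategory.Q.map q
      hom₃ := (DerivedCategory.Q.commShiftIso (1 : ℤ)).inv.app K ≫ DerivedCategory.Q.map p
      comm₁ := by
        change DerivedCategory.Q.map (mappingCone.inr f) ≫ DerivedCategory.Q.map q =
          𝟙 _ ≫ DerivedCategory.Q.map g
        rw [← Functor.map_comp, Category.id_comp]
        exact congrArg _ (mappingCone.inr_desc _ _ _ _)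
      comm₂ := by
        have := DerivedCategory.Q_map_eq_of_homotopy _ H
        rw [Functor.map_comp, Functor.map_comp] at this
        have h1 : (DerivedCategory.Q.map m ≫
          (DerivedCategory.Q.commShiftIso (1 : ℤ)).hom.app K) ≫
          (DerivedCategory.Q.commShiftIso (1 : ℤ)).inv.app K ≫ DerivedCategory.Q.map p =
          DerivedCategory.Q.map q ≫ DerivedCategory.Q.map (mappingCone.inr g) := by
          rw [this, Category.assoc, Iso.hom_inv_id_app_assoc]
        rw [hm] at h1
        exact h1
      comm₃ := by
        have h1 : DerivedCategory.Q.map p ≫ DerivedCategory.Q.map m' =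
            -DerivedCategory.Q.map (f⟦(1 : ℤ)⟧') := by
          rw [← Functor.map_neg, ← hp', Functor.map_comp]
        have h2 : (DerivedCategory.Q.commShiftIso (1 : ℤ)).inv.app K ≫
            DerivedCategory.Q.map (f⟦(1 : ℤ)⟧') = (DerivedCategory.Q.map f)⟦(1 : ℤ)⟧' ≫
              (DerivedCategory.Q.commShiftIso (1 : ℤ)).inv.app M :=
          ((DerivedCategory.Q.commShiftIso (1 : ℤ)).inv.naturality f).symm
        have h3 : (-(DerivedCategory.Q.map f)⟦(1 : ℤ)⟧') ≫ (𝟙 (DerivedCategory.Q.obj M))⟦(1 : ℤ)⟧' =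
            ((DerivedCategory.Q.commShiftIso (1 : ℤ)).inv.app K ≫ DerivedCategory.Q.map p) ≫
              DerivedCategory.Q.map m' ≫ (DerivedCategory.Q.commShiftIso (1 : ℤ)).hom.app M := by
          rw [CategoryTheory.Functor.map_id, Category.comp_id, Category.assoc, reassoc_of% h1,
            Preadditive.neg_comp, Preadditive.comp_neg, reassoc_of% h2, Iso.inv_hom_id_app]
          exact congrArg Neg.neg (Category.comp_id _).symm
        rw [hm'] at h3
        exact h3 }
  have := isIso₃_of_isIso₁₂ Φ
    (rot_of_distTriang _ (DerivedCategory.mappingCone_triangle_distinguished f))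
    (DerivedCategory.mappingCone_triangle_distinguished g) (by change IsIso (𝟙 _); infer_instance) hq
  have h1 : IsIso ((DerivedCategory.Q.commShiftIso (1 : ℤ)).inv.app K ≫ DerivedCategory.Q.map p) :=
    this
  exact (isIso_comp_left_iff _ _).1 h1

end Cones

end

noncomputable section

open CategoryTheory Limits CochainComplex CochainComplex.HomComplex

/-! ### Applying `Hom(E, -)` to the dual twist -/

section DualForms

variable {R S B₀ : Type u} [Ring R] [Ring S] [AddCommGroup B₀] [Module R B₀] [Module S B₀]
  [SMulCommClass R S B₀] {W : CochainComplex (ModuleCat.{u} R) ℤ}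

/-- The linear form given by an element of the dual complex. -/
def dualForm {m i : ℤ} (h : i + m = 1) (ξ : (dualComplex S B₀ W).X m) :
    W.X i ⟶ ModuleCat.of R B₀ :=
  ModuleCat.ofHom (dualEval h ξ)

lemma dualForm_apply {m i : ℤ} (h : i + m = 1) (ξ : (dualComplex S B₀ W).X m) (w : W.X i) :
    (dualForm h ξ).hom w = dualEval h ξ w := rfl

end DualForms

lemma map_intUnits_smul {G H : Type*} [AddCommGroup G] [AddCommGroup H] (f : G →+ H) (a : ℤˣ)
    (x : G) : f (a • x) = a • f x := by
  rw [Units.smul_def, Units.smul_def, map_zsmul]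

lemma DualityData.formCochain_units_smul {R : Type u} [Ring R] {B : Type v} [Category.{u} B]
    [Abelian B] {n : ℤ} {W H : CochainComplex (ModuleCat.{u} R) ℤ} {K L : CochainComplex B ℤ}
    {B₀ : ModuleCat.{u} R} (D : DualityData n W H K L B₀) (i m : ℤ) (a : ℤˣ) (ξ : W.X i ⟶ B₀) :
    D.formCochain i m (a • ξ) = a • D.formCochain i m ξ := by
  rcases Int.units_eq_one_or a with rfl | rfl
  · rw [one_smul, one_smul]
  · rw [Units.neg_smul, one_smul, Units.neg_smul, one_smul, eq_neg_iff_add_eq_zero]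
    ext p q hpq : 1
    rw [Cochain.add_v, Cochain.zero_v]
    by_cases hq : q = 0
    · by_cases hp : p = i
      · subst hp hq
        rw [D.formCochain_v p m hpq, D.formCochain_v p m hpq, Preadditive.neg_comp, neg_add_cancel]
      · rw [formCochain, formCochain, Cochain.single_v_eq_zero _ _ _ _ _ hp,
          Cochain.single_v_eq_zero _ _ _ _ _ hp, add_zero]
    · rw [D.formCochain_v_eq_zero _ _ _ _ _ hq, D.formCochain_v_eq_zero _ _ _ _ _ hq, add_zero]

section CoconeCochains

variable {B : Type v} [Category.{u} B] [Abelian B] {K L M : CochainComplex B ℤ} (φ : K ⟶ L)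

lemma cocone_hom_ext {Z : B} {p q : ℤ} (hpq : p + -1 = q) {f g : Z ⟶ (mappingCocone φ).X p}
    (h₁ : f ≫ (mappingCocone.fst φ).f p = g ≫ (mappingCocone.fst φ).f p)
    (h₂ : f ≫ (mappingCocone.snd φ).v p q hpq = g ≫ (mappingCocone.snd φ).v p q hpq) :
    f = g := by
  rw [← Category.comp_id f, ← Category.comp_id g, ← mappingCocone.id_X φ p q hpq,
    Preadditive.comp_add, Preadditive.comp_add, ← Category.assoc, ← Category.assoc,
    ← Category.assoc, ← Category.assoc, h₁, h₂]

lemma cochain_cocone_ext {n m : ℤ} (h : m + 1 = n) {z z' : Cochain M (mappingCocone φ) n}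
    (h₁ : z.comp (Cochain.ofHom (mappingCocone.fst φ)) (add_zero n) =
      z'.comp (Cochain.ofHom (mappingCocone.fst φ)) (add_zero n))
    (h₂ : z.comp (mappingCocone.snd φ) (show n + -1 = m by lia) =
      z'.comp (mappingCocone.snd φ) (show n + -1 = m by lia)) : z = z' := by
  ext p q hpq : 1
  refine cocone_hom_ext φ (q := q + -1) rfl ?_ ?_
  · simpa using Cochain.congr_v h₁ p q hpq
  · have := Cochain.congr_v h₂ p (q + -1) (by lia)
    rwa [Cochain.comp_v _ _ _ p q (q + -1) hpq rfl, Cochain.comp_v _ _ _ p q (q + -1) hpq rfl]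
      at this

lemma exists_eq_liftCochain {n m : ℤ} (h : m + 1 = n) (z : Cochain M (mappingCocone φ) n) :
    ∃ (α : Cochain M K n) (β : Cochain M L m), z = mappingCocone.liftCochain φ α β h :=
  ⟨z.comp (Cochain.ofHom (mappingCocone.fst φ)) (add_zero n), z.comp (mappingCocone.snd φ) (by lia),
    cochain_cocone_ext φ h (by simp) (by simp)⟩

lemma liftCochain_injective {n m : ℤ} (h : m + 1 = n) {α α' : Cochain M K n} {β β' : Cochain M L m}
    (H : mappingCocone.liftCochain φ α β h = mappingCocone.liftCochain φ α' β' h) :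
    α = α' ∧ β = β' := by
  constructor
  · simpa using congrArg (fun z => Cochain.comp z (Cochain.ofHom (mappingCocone.fst φ))
      (add_zero n)) H
  · simpa using congrArg (fun z => Cochain.comp z (mappingCocone.snd φ)
      (show n + -1 = m by lia)) H

/-- Cochains into the fibre of `φ` are pairs of cochains; this is the differential of the fibre of
`Hom(M, K) ⟶ Hom(M, L)`. -/
lemma δ_liftCochain_eq {n m n' : ℤ} (h : m + 1 = n) (h' : n + 1 = n') (α : Cochain M K n)
    (β : Cochain M L m) : δ n n' (mappingCocone.liftCochain φ α β h) =
      mappingCocone.liftCochain φ (δ n n' α)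
        (-(δ m n β + α.comp (Cochain.ofHom φ) (add_zero n))) h' := by
  rw [mappingCocone.δ_liftCochain _ _ _ _ n' h']
  refine cochain_cocone_ext φ h' ?_ ?_
  · ext p q hpq : 1
    rw [mappingCocone.liftCochain_comp_fst, Cochain.comp_zero_cochain_v, Cochain.ofHom_v,
      Cochain.sub_v, Preadditive.sub_comp, Cochain.comp_zero_cochain_v,
      Cochain.comp_v _ _ h' p (p + n) q rfl (by lia)]
    simp
  · ext p q hpq : 1
    rw [mappingCocone.liftCochain_comp_snd,
      Cochain.comp_v _ _ _ p (q + 1) q (by lia) (by lia), Cochain.sub_v, Preadditive.sub_comp,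
      Cochain.comp_zero_cochain_v, Cochain.comp_v _ _ h' p q (q + 1) hpq (by lia)]
    simp

lemma liftCochain_add {n m : ℤ} (h : m + 1 = n) (α α' : Cochain M K n) (β β' : Cochain M L m) :
    mappingCocone.liftCochain φ α β h + mappingCocone.liftCochain φ α' β' h =
      mappingCocone.liftCochain φ (α + α') (β + β') h :=
  cochain_cocone_ext φ h (by simp) (by simp)

lemma liftCochain_zero {n m : ℤ} (h : m + 1 = n) :
    mappingCocone.liftCochain φ (0 : Cochain M K n) (0 : Cochain M L m) h = 0 :=
  cochain_cocone_ext φ h (by simp) (by simp)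

end CoconeCochains

section PairTo

variable {B : Type v} [Category.{u} B] [Abelian B] [HasProducts.{u} B] [HasCountableProducts B]
  {A : Type u} [Ring A] {E : CochainComplex B ℤ} (ρ : A →+* End E) (X : CochainComplex B ℤ)

/-- The pairing of `Hom(E, X)` and `Hom(X, E)` with values in `Hom(E, E)`, by composition. -/
def pairTo (m : ℤ) : Cochain E X m →+ Cochain (homTo ρ X) (homTo ρ E) m :=
  (linAdj ρ m).toAddMonoidHom.comp
    { toFun x := x.comp (Cochain.ofHom (coevaluation ρ X)) (add_zero m)
      map_zero' := Cochain.zero_comp _ _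
      map_add' _ _ := Cochain.add_comp _ _ _ _ }

lemma pairTo_eq (m : ℤ) (x : Cochain E X m) :
    pairTo ρ X m x = linAdj ρ m (x.comp (Cochain.ofHom (coevaluation ρ X)) (add_zero m)) := rfl

lemma δ_pairTo (m m' : ℤ) (x : Cochain E X m) :
    δ m m' (pairTo ρ X m x) = pairTo ρ X m' (δ m m' x) := by
  rw [pairTo_eq, pairTo_eq, δ_linAdj, δ_comp_ofHom]

lemma pairTo_v (m a b : ℤ) (h : a + m = b) (x : Cochain E X m) (w : Cochain X E a) :
    ((pairTo ρ X m x).v a b h).hom w =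
      (a * m).negOnePow • (show Cochain E E b from x.comp w (by lia)) := by
  have key (w' : (homTo ρ X).X a) (p q : ℤ) (hpq : p + b = q) :
      ((x.comp (Cochain.ofHom (coevaluation ρ X)) (add_zero m)).comp (evalCochain ρ w')
        (show m + a = b by lia)).v p q hpq =
      x.v p (p + m) rfl ≫ @Cochain.v B _ _ X E a w' (p + m) q (by lia) := by
    rw [comp_evalCochain_v ρ _ _ w' p (p + m) q rfl hpq, Cochain.comp_zero_cochain_v,
      Cochain.ofHom_v]
    exact (Category.assoc _ _ _).trans
      (congrArg (fun z => x.v p (p + m) rfl ≫ z) (coevaluationX_elt ρ X a q (p + m) (by lia) w'))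
  refine (linAdj_v ρ m _ a b h _).trans
    (congrArg (fun z : Cochain E E b => (a * m).negOnePow • z) ?_)
  ext p q hpq : 1
  exact (key w p q hpq).trans (Cochain.comp_v x w _ p (p + m) q rfl (by lia)).symm

/-- The action of `A`, as a map from `A` to `Hom(E, E)`. -/
def actTo : ModuleCat.of A A ⟶ (homTo ρ E).X 0 :=
  letI := leftModule ρ E 0
  ModuleCat.ofHom (Y := Cochain E E 0)
    { toFun a := Cochain.ofHom (ρ a)
      map_add' a b := by rw [map_add]; exact Cochain.ofHom_add _ _
      map_smul' a b := by
        rw [smul_eq_mul, map_mul, End.mul_def, Cochain.ofHom_comp]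
        rfl }

end PairTo

section FirstZigzag

variable {B : Type v} [Category.{u} B] [Abelian B] [HasCoproducts.{u} B]
  [HasCountableCoproducts B] [HasProducts.{u} B] [HasCountableProducts B]
  {A : Type u} [Ring A] {E : CochainComplex B ℤ} (ρ : A →+* End E) (X : CochainComplex B ℤ)

/-- The inclusion in the dual twist of `D(W) ⊗_A E`, where `W = Hom(X, E)`. -/
def dualTwistIncl : tensorComplex ρ (dualComplex Aᵐᵒᵖ A (homTo ρ X)) ⟶
    mappingCocone (coevaluation ρ X) :=
  contractionHom ρ (dualPairing (homTo ρ X)) ≫ coconeIncl (coevaluation ρ X)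

/-- The comparison map `D(W) ⟶ Hom(E, T* X)`, where `W = Hom(X, E)`. -/
def dualTwistComparison : dualComplex Aᵐᵒᵖ A (homTo ρ X) ⟶
    homFrom ρ (mappingCocone (coevaluation ρ X)) :=
  tensorUnit ρ _ ≫ homFromMap ρ (dualTwistIncl ρ X)

/-- By naturality of the evaluation and a triangle identity, the evaluation of `T* X` restricts
along the comparison map to the inclusion of `D(W) ⊗_A E`. This is the square that compares `zigzag`
with the composite of the twists. -/
lemma tensorComplexMap_comparison_evaluation :
    tensorComplexMap ρ (dualTwistComparison ρ X) ≫ evaluation ρ (mappingCocone (coevaluation ρ X)) =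
      dualTwistIncl ρ X := by
  rw [dualTwistComparison, tensorComplexMap_comp, Category.assoc, ← evaluation_naturality,
    ← Category.assoc, tensorUnit_evaluation, Category.id_comp]

/-- The component in `lin_A(W, E)` of the comparison map. -/
def formComponent (m m₁ : ℤ) (h : m₁ + 1 = m) (ξ : (dualComplex Aᵐᵒᵖ A (homTo ρ X)).X m) :
    Cochain E (linComplex ρ (homTo ρ X)) m₁ :=
  (tensorEltCochain ρ ξ).comp (contraction ρ (dualPairing (homTo ρ X))).1 (by lia)

lemma formComponent_v (m m₁ : ℤ) (h : m₁ + 1 = m) (ξ : (dualComplex Aᵐᵒᵖ A (homTo ρ X)).X m)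
    (p q r : ℤ) (hpq : p + m₁ = q) (hpr : p + m = r) :
    (formComponent ρ X m m₁ h ξ).v p q hpq = tensorElt ρ _ m p r (by lia) ξ ≫
      contractionX ρ (dualPairing (homTo ρ X)) r q (by lia) := by
  rw [formComponent, Cochain.comp_v _ _ _ p r q (by lia) (by lia)]
  rfl

lemma dualTwistComparison_apply (m m₁ : ℤ) (h : m₁ + 1 = m)
    (ξ : (dualComplex Aᵐᵒᵖ A (homTo ρ X)).X m) :
    ((dualTwistComparison ρ X).f m).hom ξ =
      (show Cochain E (mappingCocone (coevaluation ρ X)) m from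
        mappingCocone.liftCochain _ 0 (formComponent ρ X m m₁ h ξ) h) := by
  change Cochain.comp (tensorEltCochain ρ ξ) (Cochain.ofHom (dualTwistIncl ρ X)) (add_zero m) = _
  have h1 (p r : ℤ) (hpr : p + m = r) : (Cochain.comp (tensorEltCochain ρ ξ)
      (Cochain.ofHom (dualTwistIncl ρ X)) (add_zero m)).v p r hpr =
      (tensorElt ρ _ m p r (by lia) ξ ≫
      contractionX ρ (dualPairing (homTo ρ X)) r (r + -1) rfl) ≫
        (mappingCocone.inr (coevaluation ρ X)).1.v (r + -1) r (by lia) := by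
    rw [Cochain.comp_zero_cochain_v, Cochain.ofHom_v]
    refine Eq.trans ?_ (Category.assoc _ _ _).symm
    exact congrArg (fun z => tensorElt ρ _ m p r (by lia) ξ ≫ z ≫
      (mappingCocone.inr (coevaluation ρ X)).1.v (r + -1) r (by lia))
      (contractionHom_f ρ (dualPairing (homTo ρ X)) r)
  refine cochain_cocone_ext _ h ?_ ?_
  · rw [mappingCocone.liftCochain_comp_fst]
    ext p r hpr : 1
    rw [Cochain.comp_zero_cochain_v, h1 p r hpr, Cochain.ofHom_v]
    refine (Category.assoc _ _ _).trans ((congrArg _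
      (mappingCocone.inr_v_fst_f (coevaluation ρ X) (r + -1) r (by lia))).trans ?_)
    exact comp_zero
  · rw [mappingCocone.liftCochain_comp_snd]
    ext p q hpq : 1
    obtain ⟨r, hr⟩ : ∃ r, r = p + m := ⟨_, rfl⟩
    obtain rfl : q = r + -1 := by lia
    rw [Cochain.comp_v _ _ _ p r (r + -1) hr.symm rfl, h1,
      formComponent_v ρ X m m₁ h ξ p (r + -1) r hpq hr.symm]
    refine (Category.assoc _ _ _).trans ((congrArg _
      (mappingCocone.inr_v_snd_v (coevaluation ρ X) (r + -1) r (by lia))).trans ?_)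
    exact Category.comp_id _

variable {X} {n : ℤ} (D : DualityData n (homTo ρ X) (homTo ρ E) E X (ModuleCat.of A A))
  (hc : ∀ m x, D.c m x = pairTo ρ X m x) (hι : D.ι = actTo ρ)

include hι in
-- Contracting `ξ` with `w` gives the element `ξ w` of `A`, acting on `E`. Hence after adjunction
-- the comparison map produces, up to sign, exactly the form cochains of the abstract duality.
lemma linAdj_formComponent (m m₁ i : ℤ) (h : m₁ + 1 = m) (hi : i + m = 1)
    (ξ : (dualComplex Aᵐᵒᵖ A (homTo ρ X)).X m) :
    linAdj ρ m₁ (formComponent ρ X m m₁ h ξ) =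
      (i * m₁).negOnePow • D.formCochain i m₁ (dualForm hi ξ) := by
  have key (a b : ℤ) (hab : a + m₁ = b) (w : (homTo ρ X).X a) (p q : ℤ) (hpq : p + b = q) :
      ((formComponent ρ X m m₁ h ξ).comp (evalCochain ρ w) (show m₁ + a = b by lia)).v p q hpq =
        tensorElt ρ _ m p (p + m) (by lia) ξ ≫
          contractionX ρ (dualPairing (homTo ρ X)) (p + m) (p + m₁) (by lia) ≫
            linElt ρ (homTo ρ X) a q (p + m₁) (by lia) w := by
    rw [comp_evalCochain_v ρ _ _ w p (p + m₁) q rfl hpq,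
      formComponent_v ρ X m m₁ h ξ p (p + m₁) (p + m) rfl rfl]
    exact Category.assoc _ _ _
  ext a b hab w
  rw [Cochain.units_smul_v]
  refine (linAdj_v ρ m₁ _ a b hab w).trans ?_
  by_cases ha : a = i
  · obtain rfl := ha
    obtain rfl : b = 0 := by lia
    rw [D.formCochain_v a m₁ (by lia), hι]
    refine congrArg (fun z : Cochain E E 0 => (a * m₁).negOnePow • z) ?_
    ext p : 1
    refine (key a 0 hab w p p (add_zero p)).trans ?_
    refine (contractionX_apply ρ _ (p + m) (p + m₁) (by lia) m p a (by lia) (by lia) hi ξ w).trans ?_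
    exact (Cochain.ofHom_v (ρ (dualEval hi ξ w)) p).symm
  · rw [D.formCochain_v_eq_zero i m₁ a b hab (by lia), smul_zero]
    refine (congrArg (fun z : Cochain E E b => (a * m₁).negOnePow • z) ?_).trans
      (smul_zero (A := Cochain E E b) (a * m₁).negOnePow)
    ext p q hpq : 1
    refine (key a b hab w p q hpq).trans ?_
    exact contractionX_apply_zero ρ _ (p + m) (p + m₁) (by lia) m p a q (by lia) (by lia)
      (by lia) ξ w

variable [IsSemisimpleRing A] (hn : 0 < n)
include D hc hι hn

/-- Through `linAdj`, `Hom(E, T* X)` is the fibre of `pairTo : Hom(E, X) ⟶ Hom(W, Hom(E, E))` up to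
signs, and the comparison map sends a form to its form cochain. Then `form_eq_comp` gives
injectivity on cohomology and `exists_form` gives surjectivity. -/
lemma quasiIso_dualTwistComparison : QuasiIso (dualTwistComparison ρ X) := by
  refine quasiIso_of_apply _ ?_ ?_
  · intro i j l hij hjl ξ y hξ hy
    obtain ⟨α, β, rfl⟩ := exists_eq_liftCochain (coevaluation ρ X) (show i - 1 + 1 = i by lia)
      (show Cochain E (mappingCocone (coevaluation ρ X)) i from y)
    have h1 := hy.trans (dualTwistComparison_apply ρ X j i hij ξ)
    have h2 := (δ_liftCochain_eq (coevaluation ρ X) (show i - 1 + 1 = i by lia) hij α β).symm.trans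
      h1
    obtain ⟨h3, h4⟩ := liftCochain_injective _ _ h2
    have h5 := congrArg (fun z => linAdj ρ i z) h4
    have hi : -i + j = 1 := by lia
    simp only [map_neg, map_add] at h5
    rw [linAdj_formComponent ρ D hι j i (-i) hij hi, ← δ_linAdj, ← pairTo_eq, ← hc] at h5
    -- The equation of `lin`-components, moved through `linAdj`, says that the form of `ξ` is a
    -- coboundary plus the image under `c` of a cocycle. The sign `(-i * i).negOnePow` is the one
    -- from `linAdj_formComponent`.
    obtain ⟨ξ', hξ'⟩ := D.form_eq_comp hn i (i - 1) (-i) (1 - i) (by lia) (by lia) (by lia)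
      (dualForm hi ξ) (-((-i * i).negOnePow • α)) (by
        subst hij
        rw [δ_neg, δ_units_smul, h3, smul_zero, neg_zero])
      (-((-i * i).negOnePow • linAdj ρ (i - 1) β)) (by
        rw [δ_neg, δ_units_smul, map_neg, map_intUnits_smul, ← neg_add, ← smul_add, ← smul_neg, h5,
          smul_smul, Int.units_mul_self, one_smul])
    refine ⟨dualMk (by lia) (i.negOnePow • ξ'.hom), dual_ext hi fun w => ?_⟩
    rw [dualEval_d hi (show 1 - i + i = 1 by lia), dualEval_dualMk, ← dualForm_apply hi ξ, hξ',
      LinearMap.smul_apply, smul_smul, Int.units_mul_self, one_smul]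
    rfl
  · intro i j l hij hjl z hz
    obtain ⟨α, β, hαβ⟩ := exists_eq_liftCochain (coevaluation ρ X) hij
      (show Cochain E (mappingCocone (coevaluation ρ X)) j from z)
    obtain rfl : z = mappingCocone.liftCochain _ α β hij := hαβ
    have h2 := (δ_liftCochain_eq (coevaluation ρ X) hij hjl α β).symm.trans
      (hz.trans (liftCochain_zero _ hjl).symm)
    obtain ⟨h3, h4⟩ := liftCochain_injective _ _ h2
    rw [neg_eq_zero] at h4
    have h5 := congrArg (fun z => linAdj ρ j z) h4
    simp only [map_zero, map_add] at h5
    rw [← δ_linAdj, ← pairTo_eq, ← hc] at h5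
    have hi : -i + j = 1 := by lia
    obtain ⟨ξ, y, ψ, hξ, hy, hψ⟩ := D.exists_form hn j i (i - 1) (-i) (-j) hij (by lia) (by lia)
      (by lia) α (by subst hjl; exact h3) (-linAdj ρ i β) (by
        rw [δ_neg, neg_eq_iff_add_eq_zero]; exact h5)
    -- The factor in front of `ξ` cancels the sign of `linAdj_formComponent` and the minus sign in
    -- the cochain `-linAdj ρ i β` to which `exists_form` was applied.
    refine ⟨dualMk hi ((-(-i * i).negOnePow) • ξ.hom), mappingCocone.liftCochain _ y
      ((linAdj ρ (i - 1)).symm ψ) (by lia), dual_ext (show -j + l = 1 by lia) fun w => ?_, ?_⟩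
    · rw [dualEval_d _ hi, dualEval_dualMk]
      have : ξ.hom (((homTo ρ X).d (-j) (-i)).hom w) = 0 := congrArg (fun f => f.hom w) hξ
      rw [LinearMap.smul_apply, this, smul_zero, smul_zero]
      rfl
    · have h6 : -δ (i - 1) i ((linAdj ρ (i - 1)).symm ψ) -
          y.comp (Cochain.ofHom (coevaluation ρ X)) (add_zero i) +
            formComponent ρ X j i hij (dualMk hi ((-(-i * i).negOnePow) • ξ.hom)) = β := by
        apply (linAdj ρ i).injective
        rw [map_add, map_sub, map_neg, ← δ_linAdj, AddEquiv.apply_symm_apply, ← pairTo_eq, ← hc,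
          linAdj_formComponent ρ D hι j i (-i) hij hi]
        have h7 : dualForm hi (dualMk (S := Aᵐᵒᵖ) hi ((-(-i * i).negOnePow) • ξ.hom)) =
            (-(-i * i).negOnePow) • ξ := by
          rw [dualForm, dualEval_dualMk]
          rfl
        rw [h7, D.formCochain_units_smul, Units.neg_smul, smul_neg, smul_smul, Int.units_mul_self,
          one_smul, ← neg_neg (linAdj ρ i β), hψ]
        abel
      have h8 := dualTwistComparison_apply ρ X j i hij
        (dualMk hi ((-(-i * i).negOnePow) • ξ.hom))
      have h9 := δ_liftCochain_eq (coevaluation ρ X) (show i - 1 + 1 = i by lia) hij y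
        ((linAdj ρ (i - 1)).symm ψ)
      refine (congrArg₂ (fun x y : Cochain E (mappingCocone (coevaluation ρ X)) j => x + y)
        h8 h9).trans ?_
      refine (liftCochain_add _ hij _ _ _ _).trans ?_
      rw [zero_add, hy, neg_add', add_comm, h6]

end FirstZigzag

end

noncomputable section

open CategoryTheory Limits CochainComplex CochainComplex.HomComplex

/-! ### Applying `Hom(-, E)` to the twist -/

section ConeCochains

variable {B : Type v} [Category.{u} B] [Abelian B] {K L M : CochainComplex B ℤ} (φ : K ⟶ L)

lemma cochain_cone_ext {n m : ℤ} (h : m + 1 = n) {z z' : Cochain (mappingCone φ) M n}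
    (h₁ : (mappingCone.inl φ).comp z (show -1 + n = m by lia) =
      (mappingCone.inl φ).comp z' (show -1 + n = m by lia))
    (h₂ : (Cochain.ofHom (mappingCone.inr φ)).comp z (zero_add n) =
      (Cochain.ofHom (mappingCone.inr φ)).comp z' (zero_add n)) : z = z' := by
  rw [mappingCone.ext_cochain_from_iff φ m n h]
  exact ⟨h₁, h₂⟩

lemma exists_eq_descCochain {n m : ℤ} (h : m + 1 = n) (z : Cochain (mappingCone φ) M n) :
    ∃ (α : Cochain K M m) (β : Cochain L M n), z = mappingCone.descCochain φ α β h :=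
  ⟨(mappingCone.inl φ).comp z (by lia), (Cochain.ofHom (mappingCone.inr φ)).comp z (zero_add n),
    cochain_cone_ext φ h (by simp) (by simp)⟩

lemma descCochain_injective {n m : ℤ} (h : m + 1 = n) {α α' : Cochain K M m} {β β' : Cochain L M n}
    (H : mappingCone.descCochain φ α β h = mappingCone.descCochain φ α' β' h) :
    α = α' ∧ β = β' := by
  constructor
  · simpa using congrArg (fun z => Cochain.comp (mappingCone.inl φ) z
      (show -1 + n = m by lia)) H
  · simpa using congrArg (fun z => Cochain.comp (Cochain.ofHom (mappingCone.inr φ)) z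
      (zero_add n)) H

lemma δ_descCochain_eq {n m n' : ℤ} (h : m + 1 = n) (h' : n + 1 = n') (α : Cochain K M m)
    (β : Cochain L M n) : δ n n' (mappingCone.descCochain φ α β h) =
      mappingCone.descCochain φ
        (δ m n α + n'.negOnePow • (Cochain.ofHom φ).comp β (zero_add n)) (δ n n' β) h' := by
  rw [mappingCone.δ_descCochain _ _ _ h n' h']
  rfl

lemma descCochain_add {n m : ℤ} (h : m + 1 = n) (α α' : Cochain K M m) (β β' : Cochain L M n) :
    mappingCone.descCochain φ α β h + mappingCone.descCochain φ α' β' h =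
      mappingCone.descCochain φ (α + α') (β + β') h :=
  cochain_cone_ext φ h (by simp) (by simp)

lemma descCochain_zero {n m : ℤ} (h : m + 1 = n) :
    mappingCone.descCochain φ (0 : Cochain K M m) (0 : Cochain L M n) h = 0 :=
  cochain_cone_ext φ h (by simp) (by simp)

end ConeCochains

section PairFrom

variable {B : Type v} [Category.{u} B] [Abelian B] [HasCoproducts.{u} B]
  [HasCountableCoproducts B]
  {A : Type u} [Ring A] {E : CochainComplex B ℤ} (ρ : A →+* End E) (X : CochainComplex B ℤ)

/-- The pairing of `Hom(X, E)` and `Hom(E, X)` with values in `Hom(E, E)`, by composition. -/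
def pairFrom (m : ℤ) : Cochain X E m →+ Cochain (homFrom ρ X) (homFrom ρ E) m :=
  (tensorAdj ρ m).toAddMonoidHom.comp
    { toFun x := (Cochain.ofHom (evaluation ρ X)).comp x (zero_add m)
      map_zero' := Cochain.comp_zero _ _
      map_add' _ _ := Cochain.comp_add _ _ _ _ }

lemma pairFrom_eq (m : ℤ) (x : Cochain X E m) :
    pairFrom ρ X m x = tensorAdj ρ m ((Cochain.ofHom (evaluation ρ X)).comp x (zero_add m)) := rfl

lemma δ_pairFrom (m m' : ℤ) (x : Cochain X E m) :
    δ m m' (pairFrom ρ X m x) = pairFrom ρ X m' (δ m m' x) := by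
  rw [pairFrom_eq, pairFrom_eq, δ_tensorAdj, δ_ofHom_comp]

lemma pairFrom_v (m a b : ℤ) (h : a + m = b) (x : Cochain X E m) (v : Cochain E X a) :
    ((pairFrom ρ X m x).v a b h).hom v = (show Cochain E E b from v.comp x h) := by
  have key (v' : (homFrom ρ X).X a) (p q : ℤ) (hpq : p + b = q) :
      ((tensorEltCochain ρ v').comp ((Cochain.ofHom (evaluation ρ X)).comp x (zero_add m)) h).v
        p q hpq =
      @Cochain.v B _ _ E X a v' p (p + a) rfl ≫ x.v (p + a) q (by lia) := by
    rw [tensorEltCochain_comp_v ρ _ h v' p (p + a) q rfl hpq, Cochain.zero_cochain_comp_v,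
      Cochain.ofHom_v]
    exact (Category.assoc _ _ _).symm.trans
      (congrArg (fun z => z ≫ x.v (p + a) q (by lia))
        (tensorElt_evaluationX ρ X a p (p + a) (by lia) v'))
  refine (tensorAdj_v ρ m _ a b h _).trans
    (show (tensorEltCochain ρ (show (homFrom ρ X).X a from v)).comp
      ((Cochain.ofHom (evaluation ρ X)).comp x (zero_add m)) h = v.comp x h from ?_)
  ext p q hpq : 1
  exact (key v p q hpq).trans (Cochain.comp_v v x _ p (p + a) q rfl (by lia)).symm

/-- The action of `A`, as a map from `A` to `Hom(E, E)`. -/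
def actFrom : ModuleCat.of Aᵐᵒᵖ A ⟶ (homFrom ρ E).X 0 :=
  letI := rightModule ρ E 0
  ModuleCat.ofHom (Y := Cochain E E 0)
    { toFun a := Cochain.ofHom (ρ a)
      map_add' a b := by rw [map_add]; exact Cochain.ofHom_add _ _
      map_smul' a b := by
        rw [MulOpposite.smul_eq_mul_unop, map_mul, End.mul_def, Cochain.ofHom_comp]
        rfl }

end PairFrom

section SecondZigzag

variable {B : Type v} [Category.{u} B] [Abelian B] [HasCoproducts.{u} B]
  [HasCountableCoproducts B] [HasProducts.{u} B] [HasCountableProducts B]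
  {A : Type u} [Ring A] {E : CochainComplex B ℤ} (ρ : A →+* End E) (X : CochainComplex B ℤ)

/-- The projection of the twist to `lin_A(D(V), E)`, where `V = Hom(E, X)`. -/
def twistProj : mappingCone (evaluation ρ X) ⟶ linComplex ρ (dualComplex A A (homFrom ρ X)) :=
  coneProj (evaluation ρ X) ≫ contractionHom' ρ (dualPairing' (homFrom ρ X))

/-- The comparison map `D(V) ⟶ Hom(T X, E)`, where `V = Hom(E, X)`. -/
def twistComparison : dualComplex A A (homFrom ρ X) ⟶ homTo ρ (mappingCone (evaluation ρ X)) :=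
  linCounit ρ _ ≫ homToMap ρ (twistProj ρ X)

/-- The counterpart for `T X`: naturality of the coevaluation and a triangle identity reduce it to
the projection onto `lin_A(D(V), E)`. -/
lemma coevaluation_linComplexMap_comparison :
    coevaluation ρ (mappingCone (evaluation ρ X)) ≫ linComplexMap ρ (twistComparison ρ X) =
      twistProj ρ X := by
  rw [twistComparison, linComplexMap_comp, ← Category.assoc, coevaluation_naturality,
    Category.assoc, coevaluation_linCounit, Category.comp_id]

/-- The component on `V ⊗_A E` of the comparison map. -/
def formComponent' (m m₁ : ℤ) (h : m₁ + 1 = m) (ξ : (dualComplex A A (homFrom ρ X)).X m) :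
    Cochain (tensorComplex ρ (homFrom ρ X)) E m₁ :=
  (contraction ρ (dualPairing' (homFrom ρ X))).1.comp (evalCochain ρ ξ) (by lia)

lemma formComponent'_v (m m₁ : ℤ) (h : m₁ + 1 = m) (ξ : (dualComplex A A (homFrom ρ X)).X m)
    (p q r : ℤ) (hpq : p + m₁ = q) (hpr : p + -1 = r) :
    (formComponent' ρ X m m₁ h ξ).v p q hpq =
      contractionX ρ (dualPairing' (homFrom ρ X)) p r hpr ≫ linElt ρ _ m q r (by lia) ξ := by
  rw [formComponent', Cochain.comp_v _ _ _ p r q hpr (by lia)]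
  rfl

lemma twistComparison_apply (m m₁ : ℤ) (h : m₁ + 1 = m)
    (ξ : (dualComplex A A (homFrom ρ X)).X m) :
    ((twistComparison ρ X).f m).hom ξ =
      (show Cochain (mappingCone (evaluation ρ X)) E m from
        mappingCone.descCochain _ (formComponent' ρ X m m₁ h ξ) 0 h) := by
  change Cochain.comp (Cochain.ofHom (twistProj ρ X)) (evalCochain ρ ξ) (zero_add m) = _
  have h1 (p q : ℤ) (hpq : p + m = q) : (Cochain.comp (Cochain.ofHom (twistProj ρ X))
      (evalCochain ρ ξ) (zero_add m)).v p q hpq =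
      (mappingCone.fst (evaluation ρ X)).1.v p (p + 1) rfl ≫
      contractionX ρ (dualPairing' (homFrom ρ X)) (p + 1) p (by lia) ≫
        linElt ρ _ m q p (by lia) ξ := by
    rw [Cochain.zero_cochain_comp_v, Cochain.ofHom_v]
    refine Eq.trans ?_ (Category.assoc _ _ _)
    exact congrArg (fun z => ((mappingCone.fst (evaluation ρ X)).1.v p (p + 1) rfl ≫ z) ≫
      linElt ρ _ m q p (by lia) ξ) (contractionHom'_f ρ (dualPairing' (homFrom ρ X)) p)
  refine cochain_cone_ext _ h ?_ ?_
  · rw [mappingCone.inl_descCochain]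
    ext p q hpq : 1
    obtain ⟨r, rfl⟩ : ∃ r, p = r + 1 := ⟨p - 1, by lia⟩
    rw [Cochain.comp_v _ _ _ (r + 1) r q (by lia) (by lia), h1,
      formComponent'_v ρ X m m₁ h ξ (r + 1) q r hpq (by lia)]
    refine (Category.assoc _ _ _).symm.trans ((congrArg (fun z => z ≫ _)
      (mappingCone.inl_v_fst_v (evaluation ρ X) (r + 1) r (by lia))).trans ?_)
    exact Category.id_comp _
  · rw [mappingCone.inr_descCochain]
    ext p q hpq : 1
    rw [Cochain.zero_cochain_comp_v, h1, Cochain.ofHom_v]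
    refine (Category.assoc _ _ _).symm.trans ((congrArg (fun z => z ≫ _)
      (mappingCone.inr_f_fst_v (evaluation ρ X) p (p + 1) (by lia))).trans ?_)
    exact zero_comp

variable {X} {n : ℤ} (D : DualityData n (homFrom ρ X) (homFrom ρ E) X E (ModuleCat.of Aᵐᵒᵖ A))
  (hc : ∀ m x, D.c m x = pairFrom ρ X m x) (hι : D.ι = actFrom ρ)

include hι in
-- As before, evaluating `ξ` on `v` gives an element of `A` acting on `E`; the tensor adjunction
-- carries no sign, so none appears.
lemma tensorAdj_formComponent' (m m₁ i : ℤ) (h : m₁ + 1 = m) (hi : i + m = 1)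
    (ξ : (dualComplex A A (homFrom ρ X)).X m) :
    tensorAdj ρ m₁ (formComponent' ρ X m m₁ h ξ) = D.formCochain i m₁ (dualForm hi ξ) := by
  have key (a b : ℤ) (hab : a + m₁ = b) (v : (homFrom ρ X).X a) (p q : ℤ) (hpq : p + b = q) :
      ((tensorEltCochain ρ v).comp (formComponent' ρ X m m₁ h ξ) hab).v p q hpq =
        tensorElt ρ _ a p (p + a) (by lia) v ≫
          contractionX ρ (dualPairing' (homFrom ρ X)) (p + a) (p + a + -1) rfl ≫
            linElt ρ _ m q (p + a + -1) (by lia) ξ := by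
    rw [tensorEltCochain_comp_v ρ _ hab v p (p + a) q rfl hpq,
      formComponent'_v ρ X m m₁ h ξ (p + a) q (p + a + -1) (by lia) rfl]
  ext a b hab v
  refine (tensorAdj_v ρ m₁ _ a b hab v).trans ?_
  by_cases ha : a = i
  · obtain rfl := ha
    obtain rfl : b = 0 := by lia
    rw [D.formCochain_v a m₁ (by lia), hι]
    refine (show (tensorEltCochain ρ v).comp (formComponent' ρ X m m₁ h ξ) hab =
      (show Cochain E E 0 from Cochain.ofHom (ρ (dualEval hi ξ v))) from ?_)
    ext p : 1
    refine (key a 0 hab v p p (add_zero p)).trans ?_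
    refine (contractionX_apply ρ _ (p + a) (p + a + -1) rfl a p m (by lia) (by lia) (by lia)
      v ξ).trans ?_
    exact (Cochain.ofHom_v (ρ (dualEval hi ξ v)) p).symm
  · rw [D.formCochain_v_eq_zero i m₁ a b hab (by lia)]
    refine (show (tensorEltCochain ρ v).comp (formComponent' ρ X m m₁ h ξ) hab =
      (0 : Cochain E E b) from ?_)
    ext p q hpq : 1
    refine (key a b hab v p q hpq).trans ?_
    exact contractionX_apply_zero ρ _ (p + a) (p + a + -1) rfl a p m q (by lia) (by lia)
      (by lia) v ξ

variable [IsSemisimpleRing Aᵐᵒᵖ] (hn : 0 < n)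
include D hc hι hn

/-- A cochain out of the cone `T X` is a pair of cochains on `V ⊗_A E` and on `X`. Through
`tensorAdj`, `Hom(T X, E)` becomes the fibre of `pairFrom` up to signs, and the same abstract
duality applies, now over `Aᵐᵒᵖ`. -/
lemma quasiIso_twistComparison : QuasiIso (twistComparison ρ X) := by
  refine quasiIso_of_apply _ ?_ ?_
  · intro i j l hij hjl ξ y hξ hy
    obtain ⟨α, β, rfl⟩ := exists_eq_descCochain (evaluation ρ X) (show i - 1 + 1 = i by lia)
      (show Cochain (mappingCone (evaluation ρ X)) E i from y)
    have h1 := hy.trans (twistComparison_apply ρ X j i hij ξ)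
    have h2 := (δ_descCochain_eq (evaluation ρ X) (show i - 1 + 1 = i by lia) hij α β).symm.trans
      h1
    obtain ⟨h4, h3⟩ := descCochain_injective _ _ h2
    have h5 := congrArg (fun z => tensorAdj ρ i z) h4
    have hi : -i + j = 1 := by lia
    simp only [map_add] at h5
    rw [tensorAdj_formComponent' ρ D hι j i (-i) hij hi, ← δ_tensorAdj] at h5
    obtain ⟨ξ', hξ'⟩ := D.form_eq_comp hn i (i - 1) (-i) (1 - i) (by lia) (by lia) (by lia)
      (dualForm hi ξ) (j.negOnePow • β) (by
        subst hij
        rw [δ_units_smul, h3, smul_zero])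
      (tensorAdj ρ (i - 1) α) (by
        rw [hc, ← h5, pairFrom_eq, Cochain.comp_units_smul])
    refine ⟨dualMk (by lia) (i.negOnePow • ξ'.hom), dual_ext hi fun w => ?_⟩
    rw [dualEval_d hi (show 1 - i + i = 1 by lia), dualEval_dualMk, ← dualForm_apply hi ξ, hξ',
      LinearMap.smul_apply, smul_smul, Int.units_mul_self, one_smul]
    rfl
  · intro i j l hij hjl z hz
    obtain ⟨α, β, hαβ⟩ := exists_eq_descCochain (evaluation ρ X) hij
      (show Cochain (mappingCone (evaluation ρ X)) E j from z)
    obtain rfl : z = mappingCone.descCochain _ α β hij := hαβ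
    have h2 := (δ_descCochain_eq (evaluation ρ X) hij hjl α β).symm.trans
      (hz.trans (descCochain_zero _ hjl).symm)
    obtain ⟨h4, h3⟩ := descCochain_injective _ _ h2
    have h5 := congrArg (fun z => tensorAdj ρ j z) h4
    simp only [map_zero, map_add] at h5
    rw [← δ_tensorAdj, ← Cochain.comp_units_smul, ← pairFrom_eq, ← hc, map_intUnits_smul] at h5
    have hl : l.negOnePow = -j.negOnePow := by rw [← hjl, Int.negOnePow_succ]
    have hi : -i + j = 1 := by lia
    obtain ⟨ξ, y, ψ, hξ, hy, hψ⟩ := D.exists_form hn j i (i - 1) (-i) (-j) hij (by lia) (by lia)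
      (by lia) β (by subst hjl; exact h3) (j.negOnePow • tensorAdj ρ i α) (by
        rw [hl, Units.neg_smul, add_neg_eq_zero] at h5
        rw [δ_units_smul, h5, smul_smul, Int.units_mul_self, one_smul])
    refine ⟨dualMk hi (j.negOnePow • ξ.hom), mappingCone.descCochain _
      ((tensorAdj ρ (i - 1)).symm (j.negOnePow • ψ)) y (by lia),
      dual_ext (show -j + l = 1 by lia) fun w => ?_, ?_⟩
    · rw [dualEval_d _ hi, dualEval_dualMk]
      have : ξ.hom (((homFrom ρ X).d (-j) (-i)).hom w) = 0 := congrArg (fun f => f.hom w) hξ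
      rw [LinearMap.smul_apply, this, smul_zero, smul_zero]
      rfl
    · have h6 : formComponent' ρ X j i hij (dualMk hi (j.negOnePow • ξ.hom)) +
          (δ (i - 1) i ((tensorAdj ρ (i - 1)).symm (j.negOnePow • ψ)) +
          j.negOnePow • (Cochain.ofHom (evaluation ρ X)).comp y (zero_add i)) = α := by
        apply (tensorAdj ρ i).injective
        rw [map_add, map_add, ← δ_tensorAdj, AddEquiv.apply_symm_apply, ← Cochain.comp_units_smul,
          ← pairFrom_eq, ← hc, tensorAdj_formComponent' ρ D hι j i (-i) hij hi, map_intUnits_smul]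
        have h7 : dualForm hi (dualMk (S := A) hi (j.negOnePow • ξ.hom)) =
            j.negOnePow • ξ := by
          rw [dualForm, dualEval_dualMk]
          rfl
        rw [h7, D.formCochain_units_smul, δ_units_smul, ← smul_add, ← smul_add,
          add_comm (δ _ _ ψ), ← add_assoc, ← hψ, smul_smul, Int.units_mul_self, one_smul]
      have h8 := twistComparison_apply ρ X j i hij (dualMk hi (j.negOnePow • ξ.hom))
      have h9 := δ_descCochain_eq (evaluation ρ X) (show i - 1 + 1 = i by lia) hij
        ((tensorAdj ρ (i - 1)).symm (j.negOnePow • ψ)) y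
      refine (congrArg₂ (fun x y : Cochain (mappingCone (evaluation ρ X)) E j => x + y)
        h8 h9).trans ?_
      refine (descCochain_add _ hij _ _ _ _).trans ?_
      rw [zero_add, hy, h6]

end SecondZigzag

end

noncomputable section

open CategoryTheory Limits CochainComplex CochainComplex.HomComplex

/-! ### Natural zigzags from the composites of twists to the identity -/

section ConeNaturality

variable {B : Type v} [Category.{u} B] [Abelian B] {K L K' L' : CochainComplex B ℤ}
  (φ : K ⟶ L) (φ' : K' ⟶ L') (a : K ⟶ K') (b : L ⟶ L') (h : φ ≫ b = a ≫ φ')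

lemma coconeIncl_eq : coconeIncl φ = (mappingCone.inr φ)⟦(-1 : ℤ)⟧' := by
  ext n : 1
  change (mappingCocone.inr φ).1.v (n + -1) n (by lia) = (mappingCone.inr φ).f (n + -1)
  refine (Cochain.rightShift_v (Cochain.ofHom (mappingCone.inr φ)) (-1) 1 (by lia) (n + -1) n
    (by lia) (n + -1) (by lia)).trans ?_
  rw [Cochain.ofHom_v]
  exact Category.comp_id _

/-- The map of mapping cocones induced by a commutative square. -/
def coconeMap : mappingCocone φ ⟶ mappingCocone φ' := (mappingCone.map φ φ' a b h)⟦(-1 : ℤ)⟧'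

lemma coconeIncl_naturality :
    coconeIncl φ ≫ coconeMap φ φ' a b h = b⟦(-1 : ℤ)⟧' ≫ coconeIncl φ' := by
  rw [coconeIncl_eq, coconeIncl_eq]
  refine ((CategoryTheory.shiftFunctor (CochainComplex B ℤ) (-1 : ℤ)).map_comp _ _).symm.trans
    (Eq.trans ?_ ((CategoryTheory.shiftFunctor (CochainComplex B ℤ) (-1 : ℤ)).map_comp _ _))
  congr 1
  exact mappingCone.inr_desc _ _ _ _

lemma coneMap_comp_eq {K₁ K₂ K₃ K₄ L₁ L₂ L₃ L₄ : CochainComplex B ℤ} {φ₁ : K₁ ⟶ L₁} {φ₂ : K₂ ⟶ L₂}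
    {φ₃ : K₃ ⟶ L₃} {φ₄ : K₄ ⟶ L₄} {a : K₁ ⟶ K₂} {b : L₁ ⟶ L₂} {c : K₂ ⟶ K₄} {d : L₂ ⟶ L₄}
    {a' : K₁ ⟶ K₃} {b' : L₁ ⟶ L₃} {c' : K₃ ⟶ K₄} {d' : L₃ ⟶ L₄} (h₁ : φ₁ ≫ b = a ≫ φ₂)
    (h₂ : φ₂ ≫ d = c ≫ φ₄) (h₁' : φ₁ ≫ b' = a' ≫ φ₃) (h₂' : φ₃ ≫ d' = c' ≫ φ₄)
    (e : a ≫ c = a' ≫ c') (e' : b ≫ d = b' ≫ d') :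
    mappingCone.map φ₁ φ₂ a b h₁ ≫ mappingCone.map φ₂ φ₄ c d h₂ =
      mappingCone.map φ₁ φ₃ a' b' h₁' ≫ mappingCone.map φ₃ φ₄ c' d' h₂' := by
  rw [← mappingCone.map_comp, ← mappingCone.map_comp]
  congr 1

/-- The sign produced by the left shift cancels the minus sign in the definition of
`mappingCocone.fst`. -/
lemma mappingCocone_fst_f (n : ℤ) : (mappingCocone.fst φ).f n =
    (mappingCone.fst φ).1.v (n + -1) n (by lia) := by
  simp only [mappingCocone.fst, HomologicalComplex.neg_f_apply, Cocycle.homOf_f,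
    Cocycle.leftShift_coe]
  rw [Cochain.leftShift_v _ _ _ _ _ _ _ (n + -1) (by lia)]
  have h : (-1 * 0 + -1 * (-1 - 1) / 2 : ℤ).negOnePow = -1 := by
    norm_num
  rw [h, Units.neg_smul, one_smul, neg_neg]
  exact Category.id_comp _

lemma mappingCone_map_fst (n m : ℤ) (hnm : n + 1 = m) :
    (mappingCone.map φ φ' a b h).f n ≫ (mappingCone.fst φ').1.v n m hnm =
      (mappingCone.fst φ).1.v n m hnm ≫ a.f m := by
  rw [mappingCone.ext_from_iff φ m n hnm]
  constructor <;> simp [mappingCone.map]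

lemma mappingCocone_fst_naturality :
    coconeMap φ φ' a b h ≫ mappingCocone.fst φ' = mappingCocone.fst φ ≫ a := by
  ext n : 1
  rw [HomologicalComplex.comp_f, HomologicalComplex.comp_f, mappingCocone_fst_f,
    mappingCocone_fst_f]
  exact mappingCone_map_fst φ φ' a b h (n + -1) n (by lia)

lemma coneProj_naturality :
    mappingCone.map φ φ' a b h ≫ coneProj φ' = coneProj φ ≫ a⟦(1 : ℤ)⟧' := by
  ext n : 1
  exact mappingCone_map_fst φ φ' a b h n (n + 1) rfl

lemma toCone_naturality {M N M' N' : CochainComplex B ℤ} (f : K ⟶ M) (g : M ⟶ N) (hfg : f ≫ g = 0)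
    (f' : K' ⟶ M') (g' : M' ⟶ N') (hfg' : f' ≫ g' = 0) (a : K ⟶ K') (b : M ⟶ M') (c : N ⟶ N')
    (h₁ : f ≫ b = a ≫ f') (h₂ : g ≫ c = b ≫ g') :
    a⟦(1 : ℤ)⟧' ≫ toCone f' g' hfg' = toCone f g hfg ≫ mappingCone.map g g' b c h₂ := by
  ext n : 1
  change a.f (n + 1) ≫ f'.f (n + 1) ≫ (mappingCone.inl g').v (n + 1) n (by lia) =
    (f.f (n + 1) ≫ (mappingCone.inl g).v (n + 1) n (by lia)) ≫ (mappingCone.map g g' b c h₂).f n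
  have h₃ := congrArg (fun z => z.f (n + 1)) h₁
  simp only [HomologicalComplex.comp_f] at h₃
  rw [← Category.assoc, ← h₃]
  simp [mappingCone.map]

end ConeNaturality

section Zigzags

variable {B : Type v} [Category.{u} B] [Abelian B] [HasCoproducts.{u} B]
  [HasCountableCoproducts B] [HasProducts.{u} B] [HasCountableProducts B]
  {A : Type u} [Ring A] {E : CochainComplex B ℤ} (ρ : A →+* End E) {X Y : CochainComplex B ℤ}
  (f : X ⟶ Y)

/-- The map of coevaluation cocones induced by a morphism. -/
abbrev coevaluationCoconeMap :
    mappingCocone (coevaluation ρ X) ⟶ mappingCocone (coevaluation ρ Y) :=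
  coconeMap _ _ f (linComplexMap ρ (homToMap ρ f)) (coevaluation_naturality ρ f)

/-- The map of evaluation cones induced by a morphism. -/
abbrev evaluationConeMap : mappingCone (evaluation ρ X) ⟶ mappingCone (evaluation ρ Y) :=
  mappingCone.map _ _ (tensorComplexMap ρ (homFromMap ρ f)) f (evaluation_naturality ρ f)

lemma dualTwistIncl_naturality :
    dualTwistIncl ρ X ≫ coevaluationCoconeMap ρ f =
      tensorComplexMap ρ (dualMap Aᵐᵒᵖ A (homToMap ρ f)) ≫ dualTwistIncl ρ Y := by
  have h1 := contractionHom_naturality ρ (dualPairing (homTo ρ X)) (dualPairing (homTo ρ Y))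
    (dualMap Aᵐᵒᵖ A (homToMap ρ f)) (homToMap ρ f) (fun h v w => dualEval_map _ h v w)
  have h2 := coconeIncl_naturality _ _ f (linComplexMap ρ (homToMap ρ f))
    (coevaluation_naturality ρ f)
  rw [dualTwistIncl, dualTwistIncl, Category.assoc, ← Category.assoc (tensorComplexMap ρ _), h1,
    Category.assoc]
  exact congrArg (fun z => contractionHom ρ _ ≫ z) h2

lemma twistProj_naturality :
    twistProj ρ X ≫ linComplexMap ρ (dualMap A A (homFromMap ρ f)) =
      evaluationConeMap ρ f ≫ twistProj ρ Y := by
  have h1 := contractionHom'_naturality ρ (dualPairing' (homFrom ρ X)) (dualPairing' (homFrom ρ Y))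
    (homFromMap ρ f) (dualMap A A (homFromMap ρ f))
    (fun h v w => (dualEval_map (homFromMap ρ f) _ w v).symm)
  have h2 := coneProj_naturality _ _ (tensorComplexMap ρ (homFromMap ρ f)) f
    (evaluation_naturality ρ f)
  rw [twistProj, twistProj, ← Category.assoc, h2, Category.assoc, Category.assoc, h1]

lemma dualTwistComparison_naturality :
    dualTwistComparison ρ X ≫ homFromMap ρ (coevaluationCoconeMap ρ f) =
      dualMap Aᵐᵒᵖ A (homToMap ρ f) ≫ dualTwistComparison ρ Y := by
  have h1 : tensorUnit ρ (dualComplex Aᵐᵒᵖ A (homTo ρ X)) ≫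
      homFromMap ρ (tensorComplexMap ρ (dualMap Aᵐᵒᵖ A (homToMap ρ f))) =
      dualMap Aᵐᵒᵖ A (homToMap ρ f) ≫ tensorUnit ρ _ := by
    ext a v
    refine (show (tensorEltCochain ρ v).comp (Cochain.ofHom
      (tensorComplexMap ρ (dualMap Aᵐᵒᵖ A (homToMap ρ f)))) (add_zero a) =
      tensorEltCochain ρ (((dualMap Aᵐᵒᵖ A (homToMap ρ f)).f a).hom v) from ?_)
    ext p q hpq : 1
    rw [Cochain.comp_zero_cochain_v, Cochain.ofHom_v]
    exact tensorElt_mapX ρ _ a p q (by lia) v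
  rw [dualTwistComparison, dualTwistComparison, ← Category.assoc, ← h1, Category.assoc,
    Category.assoc]
  refine congrArg (fun z => tensorUnit ρ _ ≫ z) ?_
  rw [← homFromMap_comp, ← homFromMap_comp, dualTwistIncl_naturality]

lemma twistComparison_naturality :
    twistComparison ρ Y ≫ homToMap ρ (evaluationConeMap ρ f) =
      dualMap A A (homFromMap ρ f) ≫ twistComparison ρ X := by
  have h1 : linCounit ρ (dualComplex A A (homFrom ρ Y)) ≫
      homToMap ρ (linComplexMap ρ (dualMap A A (homFromMap ρ f))) =
      dualMap A A (homFromMap ρ f) ≫ linCounit ρ _ := by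
    ext a v
    refine (show (Cochain.ofHom (linComplexMap ρ (dualMap A A (homFromMap ρ f)))).comp
      (evalCochain ρ v) (zero_add a) =
      evalCochain ρ (((dualMap A A (homFromMap ρ f)).f a).hom v) from ?_)
    ext p q hpq : 1
    rw [Cochain.zero_cochain_comp_v, Cochain.ofHom_v]
    exact linMapX_elt ρ _ a q p (by lia) v
  rw [twistComparison, twistComparison, ← Category.assoc, ← h1, Category.assoc, Category.assoc,
    ← homToMap_comp, ← homToMap_comp, twistProj_naturality]

variable (X) in
lemma dualTwistIncl_fst :
    dualTwistIncl ρ X ≫ mappingCocone.fst (coevaluation ρ X) = 0 := by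
  rw [dualTwistIncl, Category.assoc]
  exact (congrArg (fun z => contractionHom ρ (dualPairing (homTo ρ X)) ≫ z)
    (coconeShortComplex (coevaluation ρ X)).zero).trans comp_zero

variable (X) in
lemma inr_twistProj : mappingCone.inr (evaluation ρ X) ≫ twistProj ρ X = 0 := by
  rw [twistProj, ← Category.assoc]
  exact (congrArg (fun z => z ≫ contractionHom' ρ (dualPairing' (homFrom ρ X)))
    (coneShortComplex (evaluation ρ X)).zero).trans zero_comp

/-- The cone of `D(W) ⊗_A E ⟶ T* X`, where `W = Hom(X, E)`. -/
def zigzag : CochainComplex B ℤ ⥤ CochainComplex B ℤ where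
  obj X := mappingCone (dualTwistIncl ρ X)
  map f := mappingCone.map _ _ (tensorComplexMap ρ (dualMap Aᵐᵒᵖ A (homToMap ρ f)))
    (coevaluationCoconeMap ρ f) (dualTwistIncl_naturality ρ f)
  map_id X := by
    refine Eq.trans ?_ (mappingCone.map_id _)
    congr 1
    · rw [homToMap_id, dualMap_id, tensorComplexMap_id]
    · exact (dualTwist ρ).map_id X
  map_comp f g := by
    refine Eq.trans ?_ (mappingCone.map_comp _ _ _ _ _ _ _ _ _)
    congr 1
    · rw [homToMap_comp, dualMap_comp, tensorComplexMap_comp]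
    · exact (dualTwist ρ).map_comp f g

/-- The comparison of `zigzag` with the identity functor. -/
def zigzagToId : zigzag ρ ⟶ 𝟭 _ where
  app X := mappingCone.desc (dualTwistIncl ρ X) 0 (mappingCocone.fst _)
    ((δ_zero _ _).trans ((congrArg Cochain.ofHom (dualTwistIncl_fst ρ X)).trans
      (Cochain.ofHom_zero _ _)).symm)
  naturality X Y f := by
    change mappingCone.map (dualTwistIncl ρ X) (dualTwistIncl ρ Y) _ _
      (dualTwistIncl_naturality ρ f) ≫ mappingCone.desc (dualTwistIncl ρ Y) 0
        (mappingCocone.fst _) _ = mappingCone.desc (dualTwistIncl ρ X) 0 (mappingCocone.fst _) _ ≫ f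
    have h1 (n : ℤ) := congrArg (fun z => z.f n) (mappingCocone_fst_naturality _ _ f
      (linComplexMap ρ (homToMap ρ f)) (coevaluation_naturality ρ f))
    simp only [HomologicalComplex.comp_f] at h1
    ext n
    rw [mappingCone.ext_from_iff _ (n + 1) n rfl]
    constructor
    · simp [mappingCone.map]
    · simpa [mappingCone.map] using h1 n

/-- The comparison of `zigzag` with the composite of dual twist and twist. -/
def zigzagToTwist : zigzag ρ ⟶ dualTwist ρ ⋙ twist ρ where
  app X := mappingCone.map (dualTwistIncl ρ X) (evaluation ρ (mappingCocone (coevaluation ρ X)))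
    (tensorComplexMap ρ (dualTwistComparison ρ X)) (𝟙 _)
    (by rw [Category.comp_id, tensorComplexMap_comparison_evaluation])
  naturality X Y f := by
    refine coneMap_comp_eq (dualTwistIncl_naturality ρ f) _ _ (evaluation_naturality ρ _) ?_ ?_
    · rw [← tensorComplexMap_comp, ← tensorComplexMap_comp, ← dualTwistComparison_naturality]
      rfl
    · exact (Category.comp_id _).trans (Category.id_comp _).symm

/-- The cone of `T X ⟶ lin_A(D(V), E)`, where `V = Hom(E, X)`. -/
def zagzig : CochainComplex B ℤ ⥤ CochainComplex B ℤ where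
  obj X := mappingCone (twistProj ρ X)
  map f := mappingCone.map _ _ (evaluationConeMap ρ f)
    (linComplexMap ρ (dualMap A A (homFromMap ρ f))) (twistProj_naturality ρ f)
  map_id X := by
    refine Eq.trans ?_ (mappingCone.map_id _)
    congr 1
    · exact (twist ρ).map_id X
    · rw [homFromMap_id, dualMap_id, linComplexMap_id]
  map_comp f g := by
    refine Eq.trans ?_ (mappingCone.map_comp _ _ _ _ _ _ _ _ _)
    congr 1
    · exact (twist ρ).map_comp f g
    · rw [homFromMap_comp, dualMap_comp, linComplexMap_comp]

/-- The comparison of `zagzig` with the shift functor. -/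
def shiftToZagzig : CategoryTheory.shiftFunctor (CochainComplex B ℤ) (1 : ℤ) ⟶ zagzig ρ where
  app X := toCone (mappingCone.inr (evaluation ρ X)) (twistProj ρ X) (inr_twistProj ρ X)
  naturality X Y f := toCone_naturality _ _ _ _ _ _ f (evaluationConeMap ρ f) _
    (by simp [mappingCone.map]) (twistProj_naturality ρ f)

/-- The comparison of `zagzig` with the composite of twist and dual twist. -/
def dualTwistToZagzig :
    twist ρ ⋙ dualTwist ρ ⟶ zagzig ρ ⋙ CategoryTheory.shiftFunctor (CochainComplex B ℤ) (-1 : ℤ) where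
  app X := (mappingCone.map (coevaluation ρ (mappingCone (evaluation ρ X))) (twistProj ρ X) (𝟙 _)
    (linComplexMap ρ (twistComparison ρ X))
    (by rw [Category.id_comp, coevaluation_linComplexMap_comparison]))⟦(-1 : ℤ)⟧'
  naturality X Y f := by
    refine ((CategoryTheory.shiftFunctor (CochainComplex B ℤ) (-1 : ℤ)).map_comp _ _).symm.trans
      (Eq.trans ?_ ((CategoryTheory.shiftFunctor (CochainComplex B ℤ) (-1 : ℤ)).map_comp _ _))
    congr 1
    refine coneMap_comp_eq (coevaluation_naturality ρ _) _ _ (twistProj_naturality ρ f) ?_ ?_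
    · exact (Category.comp_id _).trans (Category.id_comp _).symm
    · change linComplexMap ρ (homToMap ρ (evaluationConeMap ρ f)) ≫
        linComplexMap ρ (twistComparison ρ Y) =
        (show linComplex ρ (homTo ρ (mappingCone (evaluation ρ X))) ⟶ _ from
          linComplexMap ρ (twistComparison ρ X)) ≫ linComplexMap ρ (dualMap A A (homFromMap ρ f))
      rw [← linComplexMap_comp, ← linComplexMap_comp, ← twistComparison_naturality]

variable [HasDerivedCategory.{w} B] [IsSemisimpleRing A]

/-- A natural quasi-isomorphism induces an isomorphism of functors to the derived category. -/
lemma nonempty_iso_of_quasiIso {D : Type*} [Category* D] {F G : D ⥤ CochainComplex B ℤ} (α : F ⟶ G)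
    (h : ∀ X, QuasiIso (α.app X)) :
    Nonempty (F ⋙ DerivedCategory.Q ≅ G ⋙ DerivedCategory.Q) := by
  have (X : D) : IsIso ((Functor.whiskerRight α DerivedCategory.Q).app X) := by
    have := h X
    exact inferInstanceAs (IsIso (DerivedCategory.Q.map (α.app X)))
  have := NatIso.isIso_of_isIso_app (Functor.whiskerRight α DerivedCategory.Q)
  exact ⟨asIso (Functor.whiskerRight α DerivedCategory.Q)⟩

/-- On complexes for which the comparison map is a quasi-isomorphism, the twist functor is a left
inverse of the dual twist functor. -/
lemma nonempty_dualTwist_twist_iso (P : ObjectProperty (CochainComplex B ℤ))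
    (h₁ : ∀ X, P X → FiniteCohomology (homTo ρ X))
    (h₂ : ∀ X, P X → QuasiIso (dualTwistComparison ρ X)) :
    Nonempty (P.ι ⋙ dualTwist ρ ⋙ twist ρ ⋙ DerivedCategory.Q ≅ P.ι ⋙ DerivedCategory.Q) := by
  -- Since `D(W) ⊗_A E` is equivalent to `lin_A(W, E)[-1]`, the cone of its map to the fibre `T* X`
  -- is `X`.
  have hα (X : P.FullSubcategory) : QuasiIso ((zigzagToId ρ).app X.obj) := by
    have := quasiIso_contractionHom ρ (h₁ X.obj X.property)
    exact quasiIso_desc_coconeIncl (coevaluation ρ X.obj)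
      (contractionHom ρ (dualPairing (homTo ρ X.obj))) (dualTwistIncl ρ X.obj) rfl (((δ_zero _ _).trans ((congrArg
      Cochain.ofHom (dualTwistIncl_fst ρ X.obj)).trans (Cochain.ofHom_zero _ _)).symm))
  -- Replacing `D(W)` by `Hom(E, T* X)` turns this cone into `T T* X`.
  have hβ (X : P.FullSubcategory) : QuasiIso ((zigzagToTwist ρ).app X.obj) := by
    have := h₂ X.obj X.property
    have := quasiIso_tensorComplexMap ρ (dualTwistComparison ρ X.obj)
    exact quasiIso_mappingCone_map (dualTwistIncl ρ X.obj)
      (evaluation ρ (mappingCocone (coevaluation ρ X.obj)))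
      (tensorComplexMap ρ (dualTwistComparison ρ X.obj)) (𝟙 _)
      (by rw [Category.comp_id, tensorComplexMap_comparison_evaluation])
  obtain ⟨e₁⟩ := nonempty_iso_of_quasiIso (Functor.whiskerLeft P.ι (zigzagToId ρ)) hα
  obtain ⟨e₂⟩ := nonempty_iso_of_quasiIso (Functor.whiskerLeft P.ι (zigzagToTwist ρ)) hβ
  exact ⟨e₂.symm ≪≫ e₁⟩

/-- On complexes for which the comparison map is a quasi-isomorphism, the dual twist functor is a
left inverse of the twist functor. -/
lemma nonempty_twist_dualTwist_iso (P : ObjectProperty (CochainComplex B ℤ))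
    (h₁ : ∀ X, P X → FiniteCohomology (homFrom ρ X))
    (h₂ : ∀ X, P X → QuasiIso (twistComparison ρ X)) :
    Nonempty (P.ι ⋙ twist ρ ⋙ dualTwist ρ ⋙ DerivedCategory.Q ≅ P.ι ⋙ DerivedCategory.Q) := by
  let S := CategoryTheory.shiftFunctor (CochainComplex B ℤ) (-1 : ℤ)
  -- The sequence `X ⟶ T X ⟶ lin_A(D(V), E)` is a triangle because the last term is equivalent to
  -- `(V ⊗_A E)[1]`. Hence `X[1]` is the cone of the second map, and shifting back gives `X`.
  have hα (X : P.FullSubcategory) : QuasiIso (S.map ((shiftToZagzig ρ).app X.obj)) := by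
    have := quasiIso_contractionHom' ρ (h₁ X.obj X.property)
    have h0 : δ (-1) 0 (0 : Cochain X.obj (linComplex ρ (dualComplex A A (homFrom ρ X.obj))) (-1)) =
        Cochain.ofHom (mappingCone.inr (evaluation ρ X.obj) ≫ twistProj ρ X.obj) := by
      rw [inr_twistProj]
      simp
    have hd : QuasiIso (mappingCone.descShortComplex (coneShortComplex (evaluation ρ X.obj))) :=
      mappingCone.quasiIso_descShortComplex (coneShortComplex_shortExact (evaluation ρ X.obj))
    have h1 : QuasiIso (mappingCone.desc (mappingCone.inr (evaluation ρ X.obj)) 0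
        (twistProj ρ X.obj) h0) := by
      have h2 : mappingCone.desc (mappingCone.inr (evaluation ρ X.obj)) 0
        (twistProj ρ X.obj) h0 =
          mappingCone.descShortComplex (coneShortComplex (evaluation ρ X.obj)) ≫
            contractionHom' ρ (dualPairing' (homFrom ρ X.obj)) := by
        obtain ⟨d, hd, h2, h3⟩ : ∃ d : mappingCone (mappingCone.inr (evaluation ρ X.obj)) ⟶
            (tensorComplex ρ (homFrom ρ X.obj))⟦(1 : ℤ)⟧,
            d = mappingCone.descShortComplex (coneShortComplex (evaluation ρ X.obj)) ∧
            (∀ n, (mappingCone.inl (mappingCone.inr (evaluation ρ X.obj))).v (n + 1) n (by lia) ≫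
              d.f n = 0) ∧
            ∀ n, (mappingCone.inr (mappingCone.inr (evaluation ρ X.obj))).f n ≫ d.f n =
              (coneProj (evaluation ρ X.obj)).f n :=
          ⟨_, rfl, fun n => mappingCone.inl_v_descShortComplex_f
              (coneShortComplex (evaluation ρ X.obj)) (n + 1) n (by lia),
            fun n => mappingCone.inr_f_descShortComplex_f
              (coneShortComplex (evaluation ρ X.obj)) n⟩
        refine Eq.trans ?_ (congrArg (fun z => z ≫ contractionHom' ρ
          (dualPairing' (homFrom ρ X.obj))) hd)
        ext n
        rw [mappingCone.ext_from_iff _ (n + 1) n rfl]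
        constructor
        · rw [mappingCone.inl_v_desc_f, Cochain.zero_v, HomologicalComplex.comp_f,
            ← Category.assoc, h2, zero_comp]
        · rw [mappingCone.inr_f_desc_f, HomologicalComplex.comp_f, ← Category.assoc, h3, twistProj,
            HomologicalComplex.comp_f]
      rw [h2]
      exact quasiIso_comp (hφ := hd) (hφ' := this)
    have := quasiIso_toCone (mappingCone.inr (evaluation ρ X.obj)) (twistProj ρ X.obj)
      (inr_twistProj ρ X.obj) h0
    exact (CochainComplex.quasiIso_shift_iff _ _).2 this
  -- The comparison `D(V) ⟶ Hom(T X, E)` replaces the target of the coevaluation of `T X` by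
  -- `lin_A(D(V), E)`.
  have hβ (X : P.FullSubcategory) : QuasiIso ((dualTwistToZagzig ρ).app X.obj) := by
    have := h₂ X.obj X.property
    have := quasiIso_linComplexMap ρ (twistComparison ρ X.obj)
    exact (CochainComplex.quasiIso_shift_iff _ _).2 (quasiIso_mappingCone_map _ _ _ _ _)
  obtain ⟨e₁⟩ := nonempty_iso_of_quasiIso
    (Functor.whiskerLeft P.ι (Functor.whiskerRight (shiftToZagzig ρ) S)) hα
  obtain ⟨e₂⟩ := nonempty_iso_of_quasiIso (Functor.whiskerLeft P.ι (dualTwistToZagzig ρ)) hβ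
  exact ⟨e₂ ≪≫ e₁.symm ≪≫ Functor.isoWhiskerLeft P.ι (Functor.isoWhiskerRight
    (shiftFunctorCompIsoId (CochainComplex B ℤ) (1 : ℤ) (-1) (by lia)) DerivedCategory.Q)⟩

end Zigzags

end

noncomputable section

open CategoryTheory Limits CochainComplex CochainComplex.HomComplex

/-! ### Cocycles of Hom complexes as morphisms in the derived category -/

section CocycleClass

variable {B : Type v} [Category.{u} B] [Abelian B] [HasDerivedCategory.{w} B]
  {K L M : CochainComplex B ℤ}

lemma equivHomShift_symm_f {m : ℤ} (z : Cocycle K L m) (p : ℤ) :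
    (Cocycle.equivHomShift.symm z).f p = z.1.v p (p + m) rfl := by
  rw [Cocycle.equivHomShift_symm_apply]
  refine (Cochain.rightShift_v z.1 m 0 (zero_add m) p p (add_zero p) (p + m) rfl).trans ?_
  exact Category.comp_id _

/-- The morphism in the derived category defined by a cocycle. -/
def cocycleClass {m : ℤ} (z : Cochain K L m) (hz : δ m (m + 1) z = 0) :
    ShiftedHom (DerivedCategory.Q.obj K) (DerivedCategory.Q.obj L) m :=
  ShiftedHom.map (Cocycle.equivHomShift.symm (Cocycle.mk z (m + 1) rfl hz)) DerivedCategory.Q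

lemma cocycleClass_add {m : ℤ} (z z' : Cochain K L m) (hz : δ m (m + 1) z = 0)
    (hz' : δ m (m + 1) z' = 0) :
    cocycleClass (z + z') (by rw [δ_add, hz, hz', add_zero]) =
      cocycleClass z hz + cocycleClass z' hz' := by
  rw [cocycleClass, cocycleClass, cocycleClass, ← ShiftedHom.map_add]
  congr 1
  exact map_add Cocycle.equivHomShift.symm (Cocycle.mk z (m + 1) rfl hz)
    (Cocycle.mk z' (m + 1) rfl hz')

/-- Shifting the target changes no sign in the components, so composition of cochains is composition
of shifted morphisms on the nose. -/
lemma cocycleClass_comp {a b c : ℤ} (h : a + b = c) (z : Cochain K L a) (z' : Cochain L M b)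
    (hz : δ a (a + 1) z = 0) (hz' : δ b (b + 1) z' = 0) :
    cocycleClass (z.comp z' h) (by
        rw [δ_comp z z' h (a + 1) (b + 1) (c + 1) rfl rfl rfl, hz, hz']
        simp) =
      (cocycleClass z hz).comp (cocycleClass z' hz') ((add_comm b a).trans h) := by
  rw [cocycleClass, cocycleClass, cocycleClass, ← ShiftedHom.map_comp]
  congr 1
  subst h
  ext p : 1
  have h1 (x : Cocycle K M (a + b)) (hx : x.1 = z.comp z' rfl) :
      (Cocycle.equivHomShift.symm x).f p = z.v p (p + a) rfl ≫ z'.v (p + a) (p + a + b) rfl ≫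
        (M.XIsoOfEq (show p + a + b = p + (a + b) by lia)).hom := by
    rw [equivHomShift_symm_f, hx, Cochain.comp_v z z' rfl p (p + a) (p + (a + b)) rfl (by lia)]
    congr 1
    have h2 (q : ℤ) (hq : p + a + b = q) : z'.v (p + a) q hq =
        z'.v (p + a) (p + a + b) rfl ≫ (M.XIsoOfEq hq).hom := by
      subst hq
      simp
    exact h2 _ _
  refine (h1 _ rfl).trans ?_
  refine Eq.trans ?_ (congrArg₂ (fun x y => x ≫ y)
    (equivHomShift_symm_f (Cocycle.mk z (a + 1) rfl hz) p).symm (congrArg₂ (fun x y => x ≫ y)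
    (equivHomShift_symm_f (Cocycle.mk z' (b + 1) rfl hz') (p + a)).symm
    (shiftFunctorAdd'_inv_app_f' M b a (a + b) (add_comm b a) p).symm))
  rfl

lemma cocycleClass_ofHom (f : K ⟶ L) :
    cocycleClass (Cochain.ofHom f) (δ_ofHom f) = ShiftedHom.mk₀ 0 rfl (DerivedCategory.Q.map f) := by
  rw [cocycleClass, ← ShiftedHom.map_mk₀]
  congr 1
  ext p : 1
  have h3 : (ShiftedHom.mk₀ (0 : ℤ) rfl f : ShiftedHom K L (0 : ℤ)) =
      f ≫ (shiftFunctorZero (CochainComplex B ℤ) ℤ).inv.app L := by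
    simp [ShiftedHom.mk₀, CategoryTheory.shiftFunctorZero']
  rw [equivHomShift_symm_f, h3]
  refine Eq.trans ?_ (congrArg (fun x => f.f p ≫ x)
    (shiftFunctorZero_inv_app_f L p)).symm
  have h2 (q : ℤ) (hq : p + 0 = q) : (Cochain.ofHom f).v p q hq =
      f.f p ≫ (L.XIsoOfEq ((add_zero p).symm.trans hq)).hom := by
    obtain rfl : p = q := by lia
    simp
  exact h2 _ _

/-- For a K-injective target, morphisms in the derived category are homotopy classes, and
null-homotopies are primitives of the cocycle. -/
lemma cocycleClass_eq_zero_iff [L.IsKInjective] {m : ℤ} (z : Cochain K L m)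
    (hz : δ m (m + 1) z = 0) (m₁ : ℤ) (hm : m₁ + 1 = m) :
    cocycleClass z hz = 0 ↔ ∃ y : Cochain K L m₁, δ m₁ m y = z := by
  have h1 : (∃ y : Cochain K L m₁, δ m₁ m y = z) ↔
      Cocycle.mk z (m + 1) rfl hz ∈ coboundaries K L m := by
    rw [mem_coboundaries_iff _ m₁ hm]
    rfl
  rw [h1, ← CohomologyClass.toHom_mk_eq_zero_iff, CohomologyClass.toHom_mk, cocycleClass,
    ShiftedHom.map]
  have h2 := (IsKInjective.Qh_map_bijective ((HomotopyCategory.quotient _ _).obj K)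
    (L⟦m⟧)).injective
  constructor
  · intro h
    apply h2
    have h3 : DerivedCategory.Q.map (Cocycle.equivHomShift.symm (Cocycle.mk z (m + 1) rfl hz)) = 0 :=
      (cancel_mono ((DerivedCategory.Q.commShiftIso m).hom.app L)).1 (h.trans zero_comp.symm)
    rw [Functor.map_zero, ← cancel_mono ((DerivedCategory.quotientCompQhIso B).hom.app _),
      DerivedCategory.quotientCompQhIso_hom_naturality, h3, zero_comp, comp_zero]
  · intro h
    have h3 := DerivedCategory.quotientCompQhIso_inv_naturality
      (Cocycle.equivHomShift.symm (Cocycle.mk z (m + 1) rfl hz))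
    rw [h, Functor.map_zero, comp_zero] at h3
    have h4 : DerivedCategory.Q.map (Cocycle.equivHomShift.symm (Cocycle.mk z (m + 1) rfl hz)) = 0 :=
      (cancel_mono ((DerivedCategory.quotientCompQhIso B).inv.app _)).1 (h3.trans zero_comp.symm)
    rw [h4, zero_comp]

lemma cocycleClass_surjective [L.IsKInjective] {m : ℤ}
    (f : ShiftedHom (DerivedCategory.Q.obj K) (DerivedCategory.Q.obj L) m) :
    ∃ (z : Cochain K L m) (hz : δ m (m + 1) z = 0), cocycleClass z hz = f := by
  obtain ⟨g, hg⟩ := (IsKInjective.Qh_map_bijective ((HomotopyCategory.quotient _ _).obj K)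
    (L⟦m⟧)).surjective ((DerivedCategory.quotientCompQhIso B).hom.app K ≫
      f ≫ (DerivedCategory.Q.commShiftIso m).inv.app L ≫
      (DerivedCategory.quotientCompQhIso B).inv.app _)
  obtain ⟨g, rfl⟩ := (HomotopyCategory.quotient B (ComplexShape.up ℤ)).map_surjective g
  obtain ⟨x, rfl⟩ := Cocycle.equivHomShift.symm.surjective g
  refine ⟨x.1, x.δ_eq_zero _, ?_⟩
  change DerivedCategory.Q.map (Cocycle.equivHomShift.symm x) ≫ _ = f
  have h := DerivedCategory.quotientCompQhIso_hom_naturality (Cocycle.equivHomShift.symm x)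
  rw [hg] at h
  rw [← cancel_epi ((DerivedCategory.quotientCompQhIso B).hom.app K), ← Category.assoc, ← h]
  simp

end CocycleClass

end

noncomputable section

open CategoryTheory Limits CochainComplex CochainComplex.HomComplex

/-! ### Duality data obtained from graded Hom groups -/

section ShiftedDuality

variable {T : Type*} [Category* T] [Preadditive T] [HasShift T ℤ] {E : T} {A : Type*}
  (act : A → (E ⟶ E))

/-- The conditions on `End^•(E)` satisfied by a spherical object on which `A = EndE` acts. -/
structure IsSphericalAction (n : ℤ) : Prop where
  bijective : Function.Bijective (act)
  eq_zero : ∀ (i : ℤ), i ≠ 0 → i ≠ n →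
    ∀ f : ShiftedHom E E i, f = 0

/-- The conditions satisfied by the graded modules `Hom^•(E, F)` and `Hom^•(F, E)` for a spherical
object `E`. -/
structure IsDualPair (n : ℤ) (F : T) : Prop where
  left_inj : ∀ (i m : ℤ) (h : i + m = n)
    (f : ShiftedHom F E i),
    (∀ g : ShiftedHom E F m, g.comp f h = 0) → f = 0
  right_inj : ∀ (i m : ℤ) (h : i + m = n)
    (g : ShiftedHom E F m),
    (∀ f : ShiftedHom F E i, g.comp f h = 0) → g = 0
  left_surj : ∀ (i m : ℤ) (h : i + m = n)
    (ζ : ShiftedHom F E i →+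
      ShiftedHom E E n),
    (∀ a f, ζ (f ≫ (act a)⟦i⟧') = ζ f ≫ (act a)⟦n⟧') →
    ∃ g : ShiftedHom E F m,
      ∀ f, ζ f = g.comp f h
  right_surj : ∀ (i m : ℤ) (h : i + m = n)
    (ζ : ShiftedHom E F m →+
      ShiftedHom E E n),
    (∀ a g, ζ (act a ≫ g) = act a ≫ ζ g) →
    ∃ f : ShiftedHom F E i,
      ∀ g, ζ g = g.comp f h
  bounded_to : ∃ S : Finset ℤ, ∀ i ∉ S,
    ∀ f : ShiftedHom F E i, f = 0
  bounded_from : ∃ S : Finset ℤ, ∀ i ∉ S,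
    ∀ f : ShiftedHom E F i, f = 0
  finite_to : ∀ i : ℤ, ∃ t : Finset (ShiftedHom F E i),
    ∀ f, f ∈ AddSubmonoid.closure
      {g : ShiftedHom F E i |
        ∃ s : ShiftedHom F E i,
          s ∈ t ∧ ∃ a : A, g = s ≫ (act a)⟦i⟧'}
  finite_from : ∀ i : ℤ,
    ∃ t : Finset (ShiftedHom E F i),
    ∀ f, f ∈ AddSubmonoid.closure
      {g : ShiftedHom E F i |
        ∃ s : ShiftedHom E F i,
          s ∈ t ∧ ∃ a : A, g = act a ≫ s}

end ShiftedDuality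

section InducedMap

variable {R : Type u} [Ring R] {W H : CochainComplex (ModuleCat.{u} R) ℤ} {m : ℤ}

/-- The cocycles of a complex of modules. -/
abbrev cocycles (W : CochainComplex (ModuleCat.{u} R) ℤ) (i : ℤ) : Submodule R (W.X i) :=
  LinearMap.ker (W.d i (i + 1)).hom

lemma cocycle_apply_d (z : Cochain W H m) (hz : δ m (m + 1) z = 0) (a b q q₁ : ℤ) (hab : a + 1 = b)
    (h : b + m = q) (h' : a + m = q₁) (w : W.X a) :
    (z.v b q h).hom ((W.d a b).hom w) =
      m.negOnePow • (H.d q₁ q).hom ((z.v a q₁ h').hom w) := by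
  have := congrArg (fun f => f.hom w) (Cochain.congr_v hz a q (by lia))
  simp only [Cochain.zero_v, ModuleCat.hom_zero, LinearMap.zero_apply] at this
  rw [δ_v_apply rfl z a q q₁ b (by lia) h' h w, Int.negOnePow_succ, Units.neg_smul,
    add_neg_eq_zero] at this
  rw [this, smul_smul, Int.units_mul_self, one_smul]

/-- The map induced by a cocycle on cocycles. -/
def mapCocycles (z : Cochain W H m) (hz : δ m (m + 1) z = 0) (i q : ℤ) (h : i + m = q) :
    cocycles W i →ₗ[R] cocycles H q :=
  (z.v i q h).hom.restrict fun w hw => by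
    have h1 := cocycle_apply_d z hz i (i + 1) (q + 1) q rfl (by lia) h w
    rw [LinearMap.mem_ker.1 hw, map_zero] at h1
    have h2 := congrArg (fun y => m.negOnePow • y) h1
    simpa [smul_smul] using h2.symm

/-- The maps `cl` and `cl'` are allowed to be any models of cohomology classes; with classes in the
derived category, a cocycle of `Hom(W, H)` becomes a functional on groups of shifted morphisms. -/
lemma exists_induced (z : Cochain W H m) (hz : δ m (m + 1) z = 0) (i q : ℤ) (h : i + m = q)
    {G G' : Type*} [AddCommGroup G] [AddCommGroup G'] (cl : cocycles W i →+ G)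
    (hs : Function.Surjective cl) (cl' : cocycles H q →+ G')
    (hk : ∀ w, cl w = 0 → ∃ y, (W.d (i - 1) i).hom y = w.1)
    (hk' : ∀ w y, (H.d (q - 1) q).hom y = w.1 → cl' w = 0) :
    ∃ ζ : G →+ G', ∀ w, ζ (cl w) = cl' (mapCocycles z hz i q h w) := by
  let g : cocycles W i →+ G' := cl'.comp (mapCocycles z hz i q h).toAddMonoidHom
  have hg : cl.ker ≤ g.ker := fun w hw => by
    obtain ⟨y, hy⟩ := hk w hw
    refine hk' _ (m.negOnePow • (z.v (i - 1) (q - 1) (by lia)).hom y) ?_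
    refine Eq.trans ?_ (congrArg (z.v i q h).hom hy)
    rw [cocycle_apply_d z hz (i - 1) i q (q - 1) (by lia) h (by lia) y]
    exact map_intUnits_smul (H.d (q - 1) q).hom.toAddMonoidHom _ _
  refine ⟨AddMonoidHom.liftOfSurjective cl hs ⟨g, hg⟩, fun w => ?_⟩
  exact AddMonoidHom.liftOfRightInverse_comp_apply cl _ _ ⟨g, hg⟩ w

end InducedMap

section Classes

variable {B : Type v} [Category.{u} B] [Abelian B] [HasDerivedCategory.{w} B]
  {A : Type u} [Ring A] {E : CochainComplex B ℤ} (ρ : A →+* End E) (X : CochainComplex B ℤ)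

/-- The class of a cocycle of `Hom(X, E)`. -/
def classTo (i : ℤ) : cocycles (homTo ρ X) i →+
    ShiftedHom (DerivedCategory.Q.obj X) (DerivedCategory.Q.obj E) i :=
  AddMonoidHom.mk' (fun w => cocycleClass (show Cochain X E i from w.1) w.2)
    fun w w' => cocycleClass_add (show Cochain X E i from w.1) (show Cochain X E i from w'.1) w.2 w'.2

/-- The class of a cocycle of `Hom(E, X)`. -/
def classFrom (i : ℤ) : cocycles (homFrom ρ X) i →+
    ShiftedHom (DerivedCategory.Q.obj E) (DerivedCategory.Q.obj X) i :=
  AddMonoidHom.mk' (fun w => cocycleClass (show Cochain E X i from w.1) w.2)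
    fun w w' => cocycleClass_add (show Cochain E X i from w.1) (show Cochain E X i from w'.1) w.2 w'.2

/-- The action of `A` in the derived category. -/
abbrev derivedAct (a : A) : DerivedCategory.Q.obj E ⟶ DerivedCategory.Q.obj E :=
  DerivedCategory.Q.map (ρ a)

lemma classTo_smul (i : ℤ) (a : A) (w : cocycles (homTo ρ X) i) :
    classTo ρ X i (a • w) = classTo ρ X i w ≫ (derivedAct ρ a)⟦i⟧' := by
  refine (cocycleClass_comp (add_zero i) (show Cochain X E i from w.1) (Cochain.ofHom (ρ a)) w.2
    (δ_ofHom (ρ a))).trans ?_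
  rw [cocycleClass_ofHom, ShiftedHom.comp_mk₀]
  rfl

lemma classFrom_smul (i : ℤ) (a : A) (w : cocycles (homFrom ρ X) i) :
    classFrom ρ X i (MulOpposite.op a • w) = derivedAct ρ a ≫ classFrom ρ X i w := by
  refine (cocycleClass_comp (zero_add i) (Cochain.ofHom (ρ a)) (show Cochain E X i from w.1)
    (δ_ofHom (ρ a)) w.2).trans ?_
  rw [cocycleClass_ofHom, ShiftedHom.mk₀_comp]
  rfl

lemma classTo_surjective [E.IsKInjective] (i : ℤ) : Function.Surjective (classTo ρ X i) := fun f => by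
  obtain ⟨z, hz, h⟩ := cocycleClass_surjective f
  exact ⟨⟨z, hz⟩, h⟩

lemma classFrom_surjective [X.IsKInjective] (i : ℤ) : Function.Surjective (classFrom ρ X i) :=
  fun f => by
    obtain ⟨z, hz, h⟩ := cocycleClass_surjective f
    exact ⟨⟨z, hz⟩, h⟩

lemma classTo_eq_zero_iff [E.IsKInjective] (i j : ℤ) (h : j + 1 = i) (w : cocycles (homTo ρ X) i) :
    classTo ρ X i w = 0 ↔ ∃ y, ((homTo ρ X).d j i).hom y = w.1 :=
  cocycleClass_eq_zero_iff (show Cochain X E i from w.1) w.2 j h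

lemma classFrom_eq_zero_iff [X.IsKInjective] (i j : ℤ) (h : j + 1 = i)
    (w : cocycles (homFrom ρ X) i) :
    classFrom ρ X i w = 0 ↔ ∃ y, ((homFrom ρ X).d j i).hom y = w.1 :=
  cocycleClass_eq_zero_iff (show Cochain E X i from w.1) w.2 j h

end Classes

section SphericalPair

variable {B : Type v} [Category.{u} B] [Abelian B] [HasDerivedCategory.{w} B]
  {A : Type u} [Ring A] {E : CochainComplex B ℤ} (ρ : A →+* End E)

variable {ρ} {n : ℤ} {X : CochainComplex B ℤ}

/-- K-injectivity of `E` identifies the cohomology of `Hom(X, E)` with graded morphisms in the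
derived category. Vanishing there gives exactness, and lifts of generators to cocycles generate
modulo coboundaries. -/
lemma IsDualPair.finiteCohomology_homTo [E.IsKInjective] (h : IsDualPair (derivedAct ρ) n (DerivedCategory.Q.obj X)) :
    FiniteCohomology (homTo ρ X) where
  bounded := by
    obtain ⟨S, hS⟩ := h.bounded_to
    refine ⟨S, fun i hi => exactAt_of_apply (sub_add_cancel i 1) rfl fun w hw => ?_⟩
    exact (classTo_eq_zero_iff ρ X i (i - 1) (by lia) ⟨w, hw⟩).1 (hS i hi _)
  finite i := by
    classical
    obtain ⟨t, ht⟩ := h.finite_to i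
    choose σ hσ using classTo_surjective ρ X i
    refine ⟨t.image fun s => (σ s).1, fun w hw => ?_⟩
    have key (f) (hf : f ∈ AddSubmonoid.closure
        {g : ShiftedHom (DerivedCategory.Q.obj X) (DerivedCategory.Q.obj E) i |
        ∃ s : ShiftedHom (DerivedCategory.Q.obj X) (DerivedCategory.Q.obj E) i,
          s ∈ t ∧ ∃ a : A,
        g = s ≫ (derivedAct ρ a)⟦i⟧'}) : ∃ w : cocycles (homTo ρ X) i, classTo ρ X i w = f ∧
        w.1 ∈ Submodule.span A (t.image fun s => (σ s).1 : Set ((homTo ρ X).X i)) := by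
      induction hf using AddSubmonoid.closure_induction with
      | mem f hf =>
        obtain ⟨s, hs, a, rfl⟩ := hf
        refine ⟨a • σ s, by rw [classTo_smul, hσ], Submodule.smul_mem _ _ (Submodule.subset_span ?_)⟩
        exact Finset.mem_coe.2 (Finset.mem_image_of_mem _ hs)
      | zero => exact ⟨0, map_zero _, Submodule.zero_mem _⟩
      | add f g _ _ hf hg =>
        obtain ⟨w, hw, hw'⟩ := hf
        obtain ⟨w₁, hw₁, hw₁'⟩ := hg
        exact ⟨w + w₁, by rw [map_add, hw, hw₁], Submodule.add_mem _ hw' hw₁'⟩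
    obtain ⟨z, hz, hz'⟩ := key _ (ht (classTo ρ X i ⟨w, hw⟩))
    obtain ⟨y, hy⟩ := (classTo_eq_zero_iff ρ X i (i - 1) (by lia) (⟨w, hw⟩ - z)).1
      (by rw [map_sub, hz, sub_self])
    exact ⟨z.1, y, hz', by rw [hy]; simp⟩

lemma IsDualPair.finiteCohomology_homFrom [X.IsKInjective] (h : IsDualPair (derivedAct ρ) n (DerivedCategory.Q.obj X)) :
    FiniteCohomology (homFrom ρ X) where
  bounded := by
    obtain ⟨S, hS⟩ := h.bounded_from
    refine ⟨S, fun i hi => exactAt_of_apply (sub_add_cancel i 1) rfl fun w hw => ?_⟩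
    exact (classFrom_eq_zero_iff ρ X i (i - 1) (by lia) ⟨w, hw⟩).1 (hS i hi _)
  finite i := by
    classical
    obtain ⟨t, ht⟩ := h.finite_from i
    choose σ hσ using classFrom_surjective ρ X i
    refine ⟨t.image fun s => (σ s).1, fun w hw => ?_⟩
    have key (f) (hf : f ∈ AddSubmonoid.closure
        {g : ShiftedHom (DerivedCategory.Q.obj E) (DerivedCategory.Q.obj X) i |
        ∃ s : ShiftedHom (DerivedCategory.Q.obj E) (DerivedCategory.Q.obj X) i,
          s ∈ t ∧ ∃ a : A,
        g = derivedAct ρ a ≫ s}) : ∃ w : cocycles (homFrom ρ X) i, classFrom ρ X i w = f ∧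
        w.1 ∈ Submodule.span Aᵐᵒᵖ (t.image fun s => (σ s).1 : Set ((homFrom ρ X).X i)) := by
      induction hf using AddSubmonoid.closure_induction with
      | mem f hf =>
        obtain ⟨s, hs, a, rfl⟩ := hf
        refine ⟨MulOpposite.op a • σ s, by rw [classFrom_smul, hσ],
          Submodule.smul_mem _ _ (Submodule.subset_span ?_)⟩
        exact Finset.mem_coe.2 (Finset.mem_image_of_mem _ hs)
      | zero => exact ⟨0, map_zero _, Submodule.zero_mem _⟩
      | add f g _ _ hf hg =>
        obtain ⟨w, hw, hw'⟩ := hf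
        obtain ⟨w₁, hw₁, hw₁'⟩ := hg
        exact ⟨w + w₁, by rw [map_add, hw, hw₁], Submodule.add_mem _ hw' hw₁'⟩
    obtain ⟨z, hz, hz'⟩ := key _ (ht (classFrom ρ X i ⟨w, hw⟩))
    obtain ⟨y, hy⟩ := (classFrom_eq_zero_iff ρ X i (i - 1) (by lia) (⟨w, hw⟩ - z)).1
      (by rw [map_sub, hz, sub_self])
    exact ⟨z.1, y, hz', by rw [hy]; simp⟩

lemma classTo_ofHom [E.IsKInjective] (a : A) (h) :
    classTo ρ E 0 ⟨(actTo ρ).hom a, h⟩ = ShiftedHom.mk₀ 0 rfl (derivedAct ρ a) :=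
  cocycleClass_ofHom (ρ a)

lemma classFrom_ofHom [E.IsKInjective] (a : A) (h) :
    classFrom ρ E 0 ⟨(actFrom ρ).hom a, h⟩ = ShiftedHom.mk₀ 0 rfl (derivedAct ρ a) :=
  cocycleClass_ofHom (ρ a)

lemma derivedAct_zero : derivedAct ρ 0 = 0 := by
  rw [derivedAct, map_zero]
  exact DerivedCategory.Q.map_zero _ _

lemma actTo_d : actTo ρ ≫ (homTo ρ E).d 0 1 = 0 :=
  ModuleCat.hom_ext (LinearMap.ext fun a => δ_ofHom (ρ a))

lemma actFrom_d : actFrom ρ ≫ (homFrom ρ E).d 0 1 = 0 :=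
  ModuleCat.hom_ext (LinearMap.ext fun a => δ_ofHom (ρ a))

variable [E.IsKInjective]

lemma IsSphericalAction.exists_eq (h : IsSphericalAction (derivedAct ρ) n)
    (f : ShiftedHom (DerivedCategory.Q.obj E) (DerivedCategory.Q.obj E) (0 : ℤ)) :
    ∃ a, f = ShiftedHom.mk₀ 0 rfl (derivedAct ρ a) := by
  obtain ⟨g, rfl⟩ := (ShiftedHom.homEquiv (0 : ℤ) rfl).surjective f
  obtain ⟨a, rfl⟩ := h.bijective.surjective g
  exact ⟨a, rfl⟩

lemma IsSphericalAction.eq_zero_of_mk₀ (h : IsSphericalAction (derivedAct ρ) n) (a : A)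
    (ha : (ShiftedHom.mk₀ 0 rfl (derivedAct ρ a) : ShiftedHom _ _ (0 : ℤ)) = 0) : a = 0 := by
  refine h.bijective.injective ((ShiftedHom.homEquiv (0 : ℤ) rfl).injective ?_)
  rw [derivedAct_zero]
  exact ha.trans (ShiftedHom.mk₀_zero _ _ (0 : ℤ) rfl).symm

section

variable [HasProducts.{u} B] [HasCountableProducts B]

lemma mapCocycles_pairTo {m i : ℤ} (hi : i + m = n) (x : Cochain E X m)
    (hx : δ m (m + 1) x = 0) (w : cocycles (homTo ρ X) i) :
    classTo ρ E n (mapCocycles (pairTo ρ X m x) (by rw [δ_pairTo, hx, map_zero]) i n hi w) =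
      (i * m).negOnePow • (classFrom ρ X m ⟨x, hx⟩).comp (classTo ρ X i w) hi := by
  let y : cocycles (homTo ρ E) n := ⟨(show Cochain E E n from
    x.comp (show Cochain X E i from w.1) (by lia)), by
      refine (δ_comp x (show Cochain X E i from w.1) (by lia : m + i = n) (m + 1) (i + 1) (n + 1)
        rfl rfl rfl).trans ?_
      rw [hx, (show δ i (i + 1) (show Cochain X E i from w.1) = 0 from w.2),
        Cochain.comp_zero, Cochain.zero_comp, smul_zero, add_zero]
      rfl⟩
  have h1 : mapCocycles (pairTo ρ X m x) (by rw [δ_pairTo, hx, map_zero]) i n hi w =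
      (i * m).negOnePow • y := by
    refine Subtype.ext ((pairTo_v ρ X m i n hi x (show Cochain X E i from w.1)).trans ?_)
    obtain h | h := Int.units_eq_one_or (i * m).negOnePow
    · rw [h, one_smul, one_smul]
    · rw [h, Units.neg_smul, Units.neg_smul, one_smul, one_smul]
      rfl
  rw [h1]
  refine (map_intUnits_smul (classTo ρ E n) _ _).trans (congrArg (fun z => (i * m).negOnePow • z) ?_)
  exact cocycleClass_comp (by lia : m + i = n) x (show Cochain X E i from w.1) hx w.2

/-- The duality between `Hom(X, E)` and `Hom(E, X)` over the terms of `X`. -/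
def dualityTo [X.IsKInjective] (h : IsSphericalAction (derivedAct ρ) n) (h' : IsDualPair (derivedAct ρ) n (DerivedCategory.Q.obj X)) :
    DualityData n (homTo ρ X) (homTo ρ E) E X (ModuleCat.of A A) where
  c := pairTo ρ X
  c_δ m m' x := δ_pairTo ρ X m m' x
  ι := actTo ρ
  ι_d := actTo_d
  ι_inj b y hy := by
    refine h.eq_zero_of_mk₀ b ?_
    rw [← classTo_ofHom b (LinearMap.congr_fun (congrArg ModuleCat.Hom.hom actTo_d) b)]
    exact (classTo_eq_zero_iff ρ E 0 (-1) rfl _).2 ⟨y, hy⟩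
  ι_surj f hf := by
    obtain ⟨a, ha⟩ := h.exists_eq (classTo ρ E 0 ⟨f, hf⟩)
    have h1 := LinearMap.congr_fun (congrArg ModuleCat.Hom.hom (actTo_d (ρ := ρ))) a
    rw [← classTo_ofHom a h1, ← sub_eq_zero, ← map_sub] at ha
    obtain ⟨y, hy⟩ := (classTo_eq_zero_iff ρ E 0 (-1) rfl _).1 ha
    exact ⟨a, y, by rw [hy]; exact (add_sub_cancel _ f).symm⟩
  exact i h0 hn := exactAt_of_apply (sub_add_cancel i 1) rfl fun w hw =>
    (classTo_eq_zero_iff ρ E i (i - 1) (by lia) ⟨w, hw⟩).1 (h.eq_zero i h0 hn _)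
  -- The class of `x` composes to zero with all classes of complementary degree `n - m`, so
  -- non-degeneracy makes it zero.
  inj m m₁ hm x hx hw := by
    refine (classFrom_eq_zero_iff ρ X m m₁ hm ⟨x, hx⟩).1 ?_
    refine h'.right_inj (n - m) m (by lia) _ fun f => ?_
    obtain ⟨w, rfl⟩ := classTo_surjective ρ X (n - m) f
    obtain ⟨y, hy⟩ := hw (n - m) (n - 1) (by lia) w.1 (by lia) w.2
    have h1 := mapCocycles_pairTo (by lia : n - m + m = n) x hx w
    rw [(classTo_eq_zero_iff ρ E n (n - 1) (by lia) _).2 ⟨y, hy⟩] at h1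
    have h2 := congrArg (fun z => ((n - m) * m).negOnePow • z) h1
    rw [smul_smul, Int.units_mul_self, one_smul, smul_zero] at h2
    exact h2.symm
  -- On classes of degree `n - m` the cocycle `z` induces an `A`-linear functional, which by
  -- perfectness is composition with some `g`. The sign in the witness undoes the one in `pairTo`.
  surj m z hz := by
    obtain ⟨ζ, hζ⟩ := exists_induced z hz (n - m) n (by lia) (classTo ρ X (n - m))
      (classTo_surjective ρ X (n - m)) (classTo ρ E n)
      (fun w hw => (classTo_eq_zero_iff ρ X (n - m) (n - m - 1) (by lia) w).1 hw)
      (fun w y hy => (classTo_eq_zero_iff ρ E n (n - 1) (by lia) w).2 ⟨y, hy⟩)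
    obtain ⟨g, hg⟩ := h'.left_surj (n - m) m (by lia) ζ fun a f => by
      obtain ⟨w, rfl⟩ := classTo_surjective ρ X (n - m) f
      rw [← classTo_smul, hζ, hζ, ← classTo_smul, map_smul]
    obtain ⟨x, rfl⟩ := classFrom_surjective ρ X m g
    have hx : δ m (m + 1) (show Cochain E X m from x.1) = 0 := x.2
    refine ⟨((n - m) * m).negOnePow • (show Cochain E X m from x.1), by rw [δ_units_smul, hx,
      smul_zero], fun i n₁ hi w hn₁ hw => ?_⟩
    obtain rfl : i = n - m := by lia
    have h1 := mapCocycles_pairTo hi (show Cochain E X m from x.1) hx ⟨w, hw⟩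
    let s := mapCocycles (pairTo ρ X m (show Cochain E X m from x.1))
      (by rw [δ_pairTo, hx, map_zero]) (n - m) n hi ⟨w, hw⟩
    obtain ⟨y, hy⟩ := (classTo_eq_zero_iff ρ E n n₁ hn₁
      (mapCocycles z hz (n - m) n hi ⟨w, hw⟩ - ((n - m) * m).negOnePow • s)).1 (by
        refine (map_sub _ _ _).trans ?_
        rw [← hζ, hg, map_intUnits_smul (classTo ρ E n), h1, smul_smul, Int.units_mul_self,
          one_smul]
        exact sub_self _)
    refine ⟨y, hy.trans ?_⟩
    rw [map_intUnits_smul (pairTo ρ X m)]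
    obtain h2 | h2 := Int.units_eq_one_or ((n - m) * m).negOnePow
    · rw [h2, one_smul, one_smul]
      rfl
    · rw [h2, Units.neg_smul, Units.neg_smul, one_smul, one_smul]
      rfl

end

section

variable [HasCoproducts.{u} B] [HasCountableCoproducts B]

lemma mapCocycles_pairFrom {m i : ℤ} (hi : i + m = n) (x : Cochain X E m)
    (hx : δ m (m + 1) x = 0) (w : cocycles (homFrom ρ X) i) :
    classFrom ρ E n (mapCocycles (pairFrom ρ X m x) (by rw [δ_pairFrom, hx, map_zero]) i n hi w) =
      (classFrom ρ X i w).comp (classTo ρ X m ⟨x, hx⟩) ((add_comm m i).trans hi) := by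
  let y : cocycles (homFrom ρ E) n := ⟨(show Cochain E E n from
    (show Cochain E X i from w.1).comp x hi), by
      refine (δ_comp (show Cochain E X i from w.1) x hi (i + 1) (m + 1) (n + 1)
        rfl rfl rfl).trans ?_
      rw [hx, (show δ i (i + 1) (show Cochain E X i from w.1) = 0 from w.2),
        Cochain.comp_zero, Cochain.zero_comp, smul_zero, add_zero]
      rfl⟩
  have h1 : mapCocycles (pairFrom ρ X m x) (by rw [δ_pairFrom, hx, map_zero]) i n hi w = y :=
    Subtype.ext (pairFrom_v ρ X m i n hi x (show Cochain E X i from w.1))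
  rw [h1]
  exact cocycleClass_comp hi (show Cochain E X i from w.1) x w.2 hx

/-- The duality between `Hom(E, X)` and `Hom(X, E)` over the terms of `X`. -/
def dualityFrom [X.IsKInjective] (h : IsSphericalAction (derivedAct ρ) n) (h' : IsDualPair (derivedAct ρ) n (DerivedCategory.Q.obj X)) :
    DualityData n (homFrom ρ X) (homFrom ρ E) X E (ModuleCat.of Aᵐᵒᵖ A) where
  c := pairFrom ρ X
  c_δ m m' x := δ_pairFrom ρ X m m' x
  ι := actFrom ρ
  ι_d := actFrom_d
  ι_inj b y hy := by
    refine h.eq_zero_of_mk₀ b ?_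
    rw [← classFrom_ofHom b (LinearMap.congr_fun (congrArg ModuleCat.Hom.hom actFrom_d) b)]
    exact (classFrom_eq_zero_iff ρ E 0 (-1) rfl _).2 ⟨y, hy⟩
  ι_surj f hf := by
    obtain ⟨a, ha⟩ := h.exists_eq (classFrom ρ E 0 ⟨f, hf⟩)
    have h1 := LinearMap.congr_fun (congrArg ModuleCat.Hom.hom (actFrom_d (ρ := ρ))) a
    rw [← classFrom_ofHom a h1, ← sub_eq_zero, ← map_sub] at ha
    obtain ⟨y, hy⟩ := (classFrom_eq_zero_iff ρ E 0 (-1) rfl _).1 ha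
    exact ⟨a, y, by rw [hy]; exact (add_sub_cancel _ f).symm⟩
  exact i h0 hn := exactAt_of_apply (sub_add_cancel i 1) rfl fun w hw =>
    (classFrom_eq_zero_iff ρ E i (i - 1) (by lia) ⟨w, hw⟩).1 (h.eq_zero i h0 hn _)
  inj m m₁ hm x hx hw := by
    refine (classTo_eq_zero_iff ρ X m m₁ hm ⟨x, hx⟩).1 ?_
    refine h'.left_inj m (n - m) (by lia) _ fun f => ?_
    obtain ⟨w, rfl⟩ := classFrom_surjective ρ X (n - m) f
    obtain ⟨y, hy⟩ := hw (n - m) (n - 1) (by lia) w.1 (by lia) w.2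
    have h1 := mapCocycles_pairFrom (by lia : n - m + m = n) x hx w
    rw [(classFrom_eq_zero_iff ρ E n (n - 1) (by lia) _).2 ⟨y, hy⟩] at h1
    exact h1.symm
  surj m z hz := by
    obtain ⟨ζ, hζ⟩ := exists_induced z hz (n - m) n (by lia) (classFrom ρ X (n - m))
      (classFrom_surjective ρ X (n - m)) (classFrom ρ E n)
      (fun w hw => (classFrom_eq_zero_iff ρ X (n - m) (n - m - 1) (by lia) w).1 hw)
      (fun w y hy => (classFrom_eq_zero_iff ρ E n (n - 1) (by lia) w).2 ⟨y, hy⟩)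
    obtain ⟨g, hg⟩ := h'.right_surj m (n - m) (by lia) ζ fun a f => by
      obtain ⟨w, rfl⟩ := classFrom_surjective ρ X (n - m) f
      rw [← classFrom_smul, hζ, hζ, ← classFrom_smul, map_smul]
    obtain ⟨x, rfl⟩ := classTo_surjective ρ X m g
    have hx : δ m (m + 1) (show Cochain X E m from x.1) = 0 := x.2
    refine ⟨x.1, hx, fun i n₁ hi w hn₁ hw => ?_⟩
    obtain rfl : i = n - m := by lia
    have h1 := mapCocycles_pairFrom hi (show Cochain X E m from x.1) hx ⟨w, hw⟩
    let s := mapCocycles (pairFrom ρ X m (show Cochain X E m from x.1))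
      (by rw [δ_pairFrom, hx, map_zero]) (n - m) n hi ⟨w, hw⟩
    obtain ⟨y, hy⟩ := (classFrom_eq_zero_iff ρ E n n₁ hn₁
      (mapCocycles z hz (n - m) n hi ⟨w, hw⟩ - s)).1 (by
        refine (map_sub _ _ _).trans ?_
        rw [← hζ, hg, h1]
        exact sub_self _)
    exact ⟨y, hy⟩

end

lemma quasiIso_dualTwistComparison_of_isDualPair [HasProducts.{u} B] [HasCountableProducts B]
    [HasCoproducts.{u} B] [HasCountableCoproducts B] [IsSemisimpleRing A] [X.IsKInjective]
    (h : IsSphericalAction (derivedAct ρ) n) (h' : IsDualPair (derivedAct ρ) n (DerivedCategory.Q.obj X)) (hn : 0 < n) :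
    QuasiIso (dualTwistComparison ρ X) :=
  quasiIso_dualTwistComparison ρ (dualityTo h h') (fun _ _ => rfl) rfl hn

lemma quasiIso_twistComparison_of_isDualPair [HasProducts.{u} B] [HasCountableProducts B]
    [HasCoproducts.{u} B] [HasCountableCoproducts B] [IsSemisimpleRing Aᵐᵒᵖ] [X.IsKInjective]
    (h : IsSphericalAction (derivedAct ρ) n) (h' : IsDualPair (derivedAct ρ) n (DerivedCategory.Q.obj X)) (hn : 0 < n) :
    QuasiIso (twistComparison ρ X) :=
  quasiIso_twistComparison ρ (dualityFrom h h') (fun _ _ => rfl) rfl hn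

end SphericalPair

end

noncomputable section

open CategoryTheory Limits CochainComplex CochainComplex.HomComplex

/-! ### Perfectness of the composition pairing of a spherical object -/

section Nondegenerate

variable {k : Type*} [Field k] {T : Type*} [Category* T] [Preadditive T] [Linear k T]
  [HasShift T ℤ] [∀ n : ℤ, (CategoryTheory.shiftFunctor T n).Additive]
  [∀ n : ℤ, (CategoryTheory.shiftFunctor T n).Linear k] {E F : T} {n : ℤ} {A : Type*}
  {act : A → (E ⟶ E)}

/-- The linear form on `End(E) ≅ k^r` given by the sum of the components. -/
def endTrace {r : ℕ} (φ : End E ≃ₐ[k] (Fin r → k)) : (E ⟶ E) →ₗ[k] k :=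
  (∑ i, LinearMap.proj i) ∘ₗ φ.toLinearMap

/-- Testing against the primitive idempotent number `i` isolates the coordinate number `i`. -/
lemma endTrace_nondegenerate {r : ℕ} (φ : End E ≃ₐ[k] (Fin r → k)) (x : E ⟶ E)
    (h : ∀ a : E ⟶ E, endTrace φ (x ≫ a) = 0) : x = 0 := by
  refine φ.injective ?_
  rw [map_zero]
  ext i
  have h1 := h (φ.symm (Pi.single i 1))
  have h2 : φ (x ≫ φ.symm (Pi.single i 1)) = Pi.single i 1 * φ x := by
    refine (map_mul φ (φ.symm (Pi.single i 1)) x).trans ?_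
    rw [AlgEquiv.apply_symm_apply]
  have h3 : endTrace φ (x ≫ φ.symm (Pi.single i 1)) = ∑ j, (Pi.single i 1 * φ x : Fin r → k) j := by
    rw [← h2]
    simp [endTrace]
  rw [h3, Finset.sum_eq_single i] at h1
  · simpa using h1
  · intro j _ hj
    simp [hj]
  · simp

/-- `End(E)` is commutative, so the order of composition does not matter. -/
lemma endTrace_nondegenerate' {r : ℕ} (φ : End E ≃ₐ[k] (Fin r → k)) (x : E ⟶ E)
    (h : ∀ a : E ⟶ E, endTrace φ (a ≫ x) = 0) : x = 0 := by
  refine endTrace_nondegenerate φ x fun a => ?_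
  have h1 : x ≫ a = a ≫ x := by
    refine φ.injective ?_
    exact (map_mul φ (show End E from a) x).trans ((mul_comm (φ a) (φ x)).trans (map_mul φ (show End E from x) a).symm)
  rw [h1, h]

/-- If each of two finite dimensional vector spaces embeds into the dual of the other one, then
these embeddings are isomorphisms. -/
lemma exists_eq_pairing {M N : Type*} [AddCommGroup M] [Module k M] [AddCommGroup N] [Module k N]
    [Module.Finite k M] [Module.Finite k N] (β : M →ₗ[k] N →ₗ[k] k) (β' : N →ₗ[k] M →ₗ[k] k)
    (h : ∀ x, (∀ y, β x y = 0) → x = 0) (h' : ∀ y, (∀ x, β' y x = 0) → y = 0)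
    (ξ : N →ₗ[k] k) : ∃ x, β x = ξ := by
  have h1 : Function.Injective β := by
    refine (injective_iff_map_eq_zero β).2 fun x hx => h x fun y => by rw [hx]; rfl
  have h2 : Function.Injective β' := by
    refine (injective_iff_map_eq_zero β').2 fun x hx => h' x fun y => by rw [hx]; rfl
  -- The pairings `β` and `β'` may be unrelated: only the dimensions of the two spaces are compared.
  have e1 := LinearMap.finrank_le_finrank_of_injective h1
  have e2 := LinearMap.finrank_le_finrank_of_injective h2
  rw [Subspace.dual_finrank_eq] at e2
  have e3 : Module.finrank k (N →ₗ[k] k) = Module.finrank k N := Subspace.dual_finrank_eq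
  exact (LinearMap.injective_iff_surjective_of_finrank_eq_finrank (by omega)).1 h1 ξ

/-- The `k`-bilinear composition pairing. -/
def compPairing (τ : ShiftedHom E E n →ₗ[k] k) (i m : ℤ) (h : i + m = n) :
    ShiftedHom E F m →ₗ[k] ShiftedHom F E i →ₗ[k] k :=
  LinearMap.mk₂ k (fun g f => τ (g.comp f h))
    (fun g g' f => by rw [ShiftedHom.add_comp, map_add])
    (fun c g f => by rw [ShiftedHom.smul_comp, map_smul])
    (fun g f f' => by rw [ShiftedHom.comp_add, map_add])
    (fun c g f => by rw [ShiftedHom.comp_smul, map_smul])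

lemma finite_of_directSum {M : ℤ → Type*} [∀ i, AddCommGroup (M i)] [∀ i, Module k (M i)]
    [Module.Finite k (DirectSum ℤ M)] (i : ℤ) : Module.Finite k (M i) :=
  Module.Finite.of_surjective (DirectSum.component k ℤ M i) fun x =>
    ⟨DirectSum.lof k ℤ M i x, by simp⟩

lemma exists_finset_of_directSum {M : ℤ → Type*} [∀ i, AddCommGroup (M i)] [∀ i, Module k (M i)]
    [h : Module.Finite k (DirectSum ℤ M)] : ∃ S : Finset ℤ, ∀ i ∉ S, ∀ x : M i, x = 0 := by
  classical
  obtain ⟨t, ht⟩ := h.fg_top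
  refine ⟨t.biUnion fun x => DFinsupp.support x, fun i hi x => ?_⟩
  have h1 : (⊤ : Submodule k (DirectSum ℤ M)) ≤ LinearMap.ker (DirectSum.component k ℤ M i) := by
    rw [← ht, Submodule.span_le]
    intro y hy
    by_contra h2
    exact hi (Finset.mem_biUnion.2 ⟨y, hy, DFinsupp.mem_support_iff.2 h2⟩)
  have h2 := h1 (x := DirectSum.lof k ℤ M i x) trivial
  simpa using h2

/-- Composing the pairing with a trace on `Hom(E, E[n])` makes it `k`-valued and still
non-degenerate, because `A` acts on the factors. Each factor then embeds into the finite dimensional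
dual of the other, so the embeddings are bijective. An `A`-linear map to `Hom(E, E[n])` is
determined by its trace, which turns representability of `k`-forms into representability of
`A`-linear maps. -/
lemma isDualPair_of_nondegenerate (hact : Function.Surjective act)
    {r : ℕ} (φ : End E ≃ₐ[k] (Fin r → k))
    (e : (E ⟶ E) ≃ₗ[k] ShiftedHom E E n) (he : ∀ a x : E ⟶ E, e (x ≫ a) = e x ≫ a⟦n⟧')
    (e' : (E ⟶ E) ≃ₗ[k] ShiftedHom E E n) (he' : ∀ a x : E ⟶ E, e' (a ≫ x) = a ≫ e' x)
    [Module.Finite k (DirectSum ℤ fun i => ShiftedHom E F i)]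
    [Module.Finite k (DirectSum ℤ fun i => ShiftedHom F E i)]
    (hl : ∀ (j : ℤ) (f : ShiftedHom F E j),
      (∀ g : ShiftedHom E F (n - j), g.comp f (add_sub_cancel j n) = 0) → f = 0)
    (hr : ∀ (j : ℤ) (g : ShiftedHom E F (n - j)),
      (∀ f : ShiftedHom F E j, g.comp f (add_sub_cancel j n) = 0) → g = 0) :
    IsDualPair act n F := by
  have hl' (i m : ℤ) (h : i + m = n) (f : ShiftedHom F E i)
      (hf : ∀ g : ShiftedHom E F m, g.comp f h = 0) : f = 0 := by
    obtain rfl : m = n - i := by lia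
    exact hl i f hf
  have hr' (i m : ℤ) (h : i + m = n) (g : ShiftedHom E F m)
      (hg : ∀ f : ShiftedHom F E i, g.comp f h = 0) : g = 0 := by
    obtain rfl : m = n - i := by lia
    exact hr i g hg
  -- Two traces are needed, because the left and the right linear identifications of `Hom(E, E[n])`
  -- with `A` are not assumed to agree.
  let τ : ShiftedHom E E n →ₗ[k] k := endTrace φ ∘ₗ e.symm.toLinearMap
  let τ' : ShiftedHom E E n →ₗ[k] k := endTrace φ ∘ₗ e'.symm.toLinearMap
  have hτ (x : ShiftedHom E E n) (hx : ∀ a : E ⟶ E, τ (x ≫ a⟦n⟧') = 0) : x = 0 := by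
    obtain ⟨y, rfl⟩ := e.surjective x
    rw [endTrace_nondegenerate φ y fun a => ?_, map_zero]
    have := hx a
    rw [← he] at this
    simpa [τ] using this
  have hτ' (x : ShiftedHom E E n) (hx : ∀ a : E ⟶ E, τ' (a ≫ x) = 0) : x = 0 := by
    obtain ⟨y, rfl⟩ := e'.surjective x
    rw [endTrace_nondegenerate' φ y fun a => ?_, map_zero]
    have := hx a
    rw [← he'] at this
    simpa [τ'] using this
  have hr₁ (i m : ℤ) (h : i + m = n) (g : ShiftedHom E F m) (f : ShiftedHom F E i) (a : E ⟶ E) :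
      g.comp (f ≫ a⟦i⟧') h = g.comp f h ≫ a⟦n⟧' := by
    rw [← ShiftedHom.comp_mk₀ f 0 rfl a, ← ShiftedHom.comp_mk₀ _ 0 rfl a,
      ShiftedHom.comp_assoc _ _ _ _ _ (by lia)]
  have hl₁ (i m : ℤ) (h : i + m = n) (g : ShiftedHom E F m) (f : ShiftedHom F E i) (a : E ⟶ E) :
      ShiftedHom.comp (a ≫ g) f h = a ≫ g.comp f h := by
    simp [ShiftedHom.comp]
  have fin₁ (i : ℤ) : Module.Finite k (ShiftedHom E F i) :=
    finite_of_directSum (k := k) (M := fun i => ShiftedHom E F i) i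
  have fin₂ (i : ℤ) : Module.Finite k (ShiftedHom F E i) :=
    finite_of_directSum (k := k) (M := fun i => ShiftedHom F E i) i
  have inj₁ (i m : ℤ) (h : i + m = n) (g : ShiftedHom E F m)
      (hg : ∀ f : ShiftedHom F E i, τ (g.comp f h) = 0) : g = 0 :=
    hr' i m h g fun f => hτ _ fun a => by rw [← hr₁, hg]
  have inj₂ (i m : ℤ) (h : i + m = n) (f : ShiftedHom F E i)
      (hf : ∀ g : ShiftedHom E F m, τ' (g.comp f h) = 0) : f = 0 :=
    hl' i m h f fun g => hτ' _ fun a => by rw [← hl₁, hf]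
  have smul₁ (i : ℤ) (c : k) (f : ShiftedHom F E i) : c • f = f ≫ (c • 𝟙 E)⟦i⟧' := by
    rw [Functor.map_smul, CategoryTheory.Functor.map_id, Linear.comp_smul, Category.comp_id]
  have smul₂ (i : ℤ) (F : T) (c : k) (g : ShiftedHom E F i) : c • g = (c • 𝟙 E) ≫ g := by
    rw [Linear.smul_comp, Category.id_comp]
  refine
    { left_inj := hl'
      right_inj := hr'
      left_surj i m h ζ hζ := ?_
      right_surj i m h ζ hζ := ?_
      bounded_to := exists_finset_of_directSum (k := k) (M := fun i => ShiftedHom F E i)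
      bounded_from := exists_finset_of_directSum (k := k) (M := fun i => ShiftedHom E F i)
      finite_to i := ?_
      finite_from i := ?_ }
  -- Scalars of `k` act through `A` since `act` is surjective, so an `A`-linear map is `k`-linear.
  · let ξ : ShiftedHom F E i →ₗ[k] ShiftedHom E E n :=
      { toFun := ζ
        map_add' := map_add ζ
        map_smul' c f := by
          obtain ⟨a, ha⟩ := hact (c • 𝟙 E)
          rw [smul₁, ← ha, hζ, ha, RingHom.id_apply, Functor.map_smul,
            CategoryTheory.Functor.map_id, Linear.comp_smul, Category.comp_id] }
    obtain ⟨g, hg⟩ := exists_eq_pairing (compPairing τ i m h) (compPairing τ' i m h).flip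
      (inj₁ i m h) (inj₂ i m h) (τ ∘ₗ ξ)
    -- Two values in `Hom(E, E[n])` agree if all their multiples by `A` have the same trace; by
    -- linearity of `ζ` this is the representation of `τ ∘ ζ` at multiples of `f`.
    refine ⟨g, fun f => sub_eq_zero.1 (hτ _ fun a => ?_)⟩
    obtain ⟨b, rfl⟩ := hact a
    have h1 := LinearMap.congr_fun hg (f ≫ (act b)⟦i⟧')
    have h2 : τ (g.comp (f ≫ (act b)⟦i⟧') h) = τ (ζ (f ≫ (act b)⟦i⟧')) := h1
    rw [Preadditive.sub_comp, map_sub, ← hζ, ← hr₁, h2, sub_self]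
  · let ξ : ShiftedHom E F m →ₗ[k] ShiftedHom E E n :=
      { toFun := ζ
        map_add' := map_add ζ
        map_smul' c f := by
          obtain ⟨a, ha⟩ := hact (c • 𝟙 E)
          rw [smul₂, ← ha, hζ, ha, RingHom.id_apply, Linear.smul_comp, Category.id_comp] }
    obtain ⟨f, hf⟩ := exists_eq_pairing (compPairing τ' i m h).flip (compPairing τ i m h)
      (inj₂ i m h) (inj₁ i m h) (τ' ∘ₗ ξ)
    refine ⟨f, fun g => sub_eq_zero.1 (hτ' _ fun a => ?_)⟩
    obtain ⟨b, rfl⟩ := hact a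
    have h1 := LinearMap.congr_fun hf (act b ≫ g)
    have h2 : τ' (ShiftedHom.comp (act b ≫ g) f h) = τ' (ζ (act b ≫ g)) := h1
    rw [Preadditive.comp_sub, map_sub, ← hζ, ← hl₁, h2, sub_self]
  · obtain ⟨t, ht⟩ := (fin₂ i).fg_top
    refine ⟨t, fun f => ?_⟩
    have hf : f ∈ Submodule.span k (t : Set (ShiftedHom F E i)) := by rw [ht]; trivial
    induction hf using Submodule.closure_induction with
    | zero => exact zero_mem _
    | add x y _ _ hx hy => exact add_mem hx hy
    | smul_mem c x hx =>
      obtain ⟨a, ha⟩ := hact (c • 𝟙 E)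
      exact AddSubmonoid.subset_closure ⟨x, hx, a, by rw [ha, smul₁]⟩
  · obtain ⟨t, ht⟩ := (fin₁ i).fg_top
    refine ⟨t, fun f => ?_⟩
    have hf : f ∈ Submodule.span k (t : Set (ShiftedHom E F i)) := by rw [ht]; trivial
    induction hf using Submodule.closure_induction with
    | zero => exact zero_mem _
    | add x y _ _ hx hy => exact add_mem hx hy
    | smul_mem c x hx =>
      obtain ⟨a, ha⟩ := hact (c • 𝟙 E)
      exact AddSubmonoid.subset_closure ⟨x, hx, a, by rw [ha, smul₂]⟩

end Nondegenerate

/-! ### Transport of duality along a functor bijective on graded morphisms -/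

section Transport

variable {T T' : Type*} [Category* T] [Category* T'] [Preadditive T] [Preadditive T']
  [HasShift T ℤ] [HasShift T' ℤ] (G : T ⥤ T') [G.Additive] [G.CommShift ℤ]

variable {G} in
/-- The morphism between the images of `X` and `Y[i]`, up to isomorphisms, induced by a functor. -/
def shiftedHomMap {X Y : T} {X' Y' : T'} (α : X' ≅ G.obj X) (β : Y' ≅ G.obj Y) (i : ℤ) :
    ShiftedHom X Y i →+ ShiftedHom X' Y' i :=
  AddMonoidHom.mk' (fun f => α.hom ≫ f.map G ≫ β.inv⟦i⟧')
    fun f g => by rw [ShiftedHom.map_add, Preadditive.add_comp, Preadditive.comp_add]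

variable {G} in
lemma shiftedHomMap_apply {X Y : T} {X' Y' : T'} (α : X' ≅ G.obj X) (β : Y' ≅ G.obj Y) (i : ℤ)
    (f : ShiftedHom X Y i) : shiftedHomMap α β i f = α.hom ≫ f.map G ≫ β.inv⟦i⟧' := rfl

variable {G} in
lemma shiftedHomMap_comp {X Y Z : T} {X' Y' Z' : T'} (α : X' ≅ G.obj X) (β : Y' ≅ G.obj Y)
    (γ : Z' ≅ G.obj Z) {i j l : ℤ} (h : j + i = l) (f : ShiftedHom X Y i) (g : ShiftedHom Y Z j) :
    shiftedHomMap α γ l (f.comp g h) = (shiftedHomMap α β i f).comp (shiftedHomMap β γ j g) h := by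
  simp only [shiftedHomMap_apply, ShiftedHom.map_comp]
  simp only [ShiftedHom.comp, Functor.map_comp, Category.assoc]
  rw [← Functor.map_comp_assoc (CategoryTheory.shiftFunctor T' i), Iso.inv_hom_id,
    CategoryTheory.Functor.map_id, Category.id_comp]
  congr 3
  exact ((CategoryTheory.shiftFunctorAdd' T' j i l h).inv.naturality _).symm

variable {G} in
lemma shiftedHomMap_comp_map {X Y Z : T} {X' Y' Z' : T'} (α : X' ≅ G.obj X) (β : Y' ≅ G.obj Y)
    (γ : Z' ≅ G.obj Z) {i : ℤ} (f : ShiftedHom X Y i) (g : Y ⟶ Z) (g' : Y' ⟶ Z')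
    (hg : g' ≫ γ.hom = β.hom ≫ G.map g) :
    shiftedHomMap α γ i (f ≫ g⟦i⟧') = shiftedHomMap α β i f ≫ g'⟦i⟧' := by
  have hg' : g' = β.hom ≫ G.map g ≫ γ.inv := by
    rw [← Category.assoc, ← hg, Category.assoc, Iso.hom_inv_id, Category.comp_id]
  simp only [shiftedHomMap_apply, ShiftedHom.map, Functor.map_comp, Category.assoc, hg']
  rw [← Functor.map_comp_assoc (CategoryTheory.shiftFunctor T' i), Iso.inv_hom_id,
    CategoryTheory.Functor.map_id, Category.id_comp]
  congr 2
  exact Functor.commShiftIso_hom_naturality_assoc _ _ _ _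

variable {G} in
lemma map_comp_shiftedHomMap {X Y Z : T} {X' Y' Z' : T'} (α : X' ≅ G.obj X) (β : Y' ≅ G.obj Y)
    (γ : Z' ≅ G.obj Z) {i : ℤ} (f : X ⟶ Y) (g : ShiftedHom Y Z i) (f' : X' ⟶ Y')
    (hf : f' ≫ β.hom = α.hom ≫ G.map f) :
    shiftedHomMap α γ i (f ≫ g) = f' ≫ shiftedHomMap β γ i g := by
  simp only [shiftedHomMap_apply, ShiftedHom.map, Functor.map_comp, Category.assoc]
  rw [← Category.assoc f', hf, Category.assoc]

variable {E F : T} {E' F' : T'} (α : E' ≅ G.obj E) (β : F' ≅ G.obj F) {n : ℤ} {A : Type*}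
  {act : A → (E ⟶ E)} {act' : A → (E' ⟶ E')}

/-- The duality between `Hom^•(E, F)` and `Hom^•(F, E)` is preserved by fully faithful functors. -/
lemma IsDualPair.map (h : IsDualPair act n F)
    (hEE : ∀ i, Function.Bijective (shiftedHomMap α α i))
    (hEF : ∀ i, Function.Bijective (shiftedHomMap α β i))
    (hFE : ∀ i, Function.Bijective (shiftedHomMap β α i))
    (hact : ∀ a, act' a ≫ α.hom = α.hom ≫ G.map (act a)) : IsDualPair act' n F' := by
  let eEE (i : ℤ) := AddEquiv.ofBijective _ (hEE i)
  let eEF (i : ℤ) := AddEquiv.ofBijective _ (hEF i)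
  let eFE (i : ℤ) := AddEquiv.ofBijective _ (hFE i)
  have hc (i m : ℤ) (hi : i + m = n) (g : ShiftedHom E F m) (f : ShiftedHom F E i) :
      eEE n (g.comp f hi) = ShiftedHom.comp (eEF m g) (eFE i f) hi :=
    shiftedHomMap_comp α β α hi g f
  have hFE' (i : ℤ) (a : A) (f : ShiftedHom F E i) :
      eFE i (f ≫ (act a)⟦i⟧') = eFE i f ≫ (act' a)⟦i⟧' :=
    shiftedHomMap_comp_map β α α f _ _ (hact a)
  have hEE₁ (i : ℤ) (a : A) (f : ShiftedHom E E i) :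
      eEE i (f ≫ (act a)⟦i⟧') = eEE i f ≫ (act' a)⟦i⟧' :=
    shiftedHomMap_comp_map α α α f _ _ (hact a)
  have hEE₂ (i : ℤ) (a : A) (f : ShiftedHom E E i) :
      eEE i (act a ≫ f) = act' a ≫ eEE i f :=
    map_comp_shiftedHomMap α α α _ _ _ (hact a)
  have hEF' (i : ℤ) (a : A) (f : ShiftedHom E F i) :
      eEF i (act a ≫ f) = act' a ≫ eEF i f :=
    map_comp_shiftedHomMap α α β _ _ _ (hact a)
  refine
    { left_inj i m hi f hf := ?_
      right_inj i m hi g hg := ?_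
      left_surj i m hi ζ hζ := ?_
      right_surj i m hi ζ hζ := ?_
      bounded_to := ?_
      bounded_from := ?_
      finite_to i := ?_
      finite_from i := ?_ }
  · obtain ⟨f, rfl⟩ := (eFE i).surjective f
    rw [h.left_inj i m hi f fun g => (eEE n).injective ?_, map_zero]
    rw [hc, hf, map_zero]
  · obtain ⟨g, rfl⟩ := (eEF m).surjective g
    rw [h.right_inj i m hi g fun f => (eEE n).injective ?_, map_zero]
    rw [hc, hg, map_zero]
  · obtain ⟨g, hg⟩ := h.left_surj i m hi
      (((eEE n).symm.toAddMonoidHom.comp ζ).comp (eFE i).toAddMonoidHom) fun a f => by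
        refine (eEE n).injective ?_
        simp [hFE', hζ, hEE₁]
    refine ⟨eEF m g, fun f => ?_⟩
    obtain ⟨f, rfl⟩ := (eFE i).surjective f
    rw [← hc, ← hg]
    simp
  · obtain ⟨f, hf⟩ := h.right_surj i m hi
      (((eEE n).symm.toAddMonoidHom.comp ζ).comp (eEF m).toAddMonoidHom) fun a g => by
        refine (eEE n).injective ?_
        simp [hEF', hζ, hEE₂]
    refine ⟨eFE i f, fun g => ?_⟩
    obtain ⟨g, rfl⟩ := (eEF m).surjective g
    rw [← hc, ← hf]
    simp
  · obtain ⟨S, hS⟩ := h.bounded_to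
    refine ⟨S, fun i hi f => ?_⟩
    obtain ⟨f, rfl⟩ := (eFE i).surjective f
    rw [hS i hi f, map_zero]
  · obtain ⟨S, hS⟩ := h.bounded_from
    refine ⟨S, fun i hi f => ?_⟩
    obtain ⟨f, rfl⟩ := (eEF i).surjective f
    rw [hS i hi f, map_zero]
  · classical
    obtain ⟨t, ht⟩ := h.finite_to i
    refine ⟨t.image (eFE i), fun f => ?_⟩
    obtain ⟨f, rfl⟩ := (eFE i).surjective f
    induction ht f using AddSubmonoid.closure_induction with
    | mem f hf =>
      obtain ⟨s, hs, a, rfl⟩ := hf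
      exact AddSubmonoid.subset_closure ⟨_, Finset.mem_image_of_mem _ hs, a, hFE' _ _ _⟩
    | zero =>
      rw [map_zero]
      exact zero_mem _
    | add x y _ _ hx hy =>
      rw [map_add]
      exact add_mem hx hy
  · classical
    obtain ⟨t, ht⟩ := h.finite_from i
    refine ⟨t.image (eEF i), fun f => ?_⟩
    obtain ⟨f, rfl⟩ := (eEF i).surjective f
    induction ht f using AddSubmonoid.closure_induction with
    | mem f hf =>
      obtain ⟨s, hs, a, rfl⟩ := hf
      exact AddSubmonoid.subset_closure ⟨_, Finset.mem_image_of_mem _ hs, a, hEF' _ _ _⟩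
    | zero =>
      rw [map_zero]
      exact zero_mem _
    | add x y _ _ hx hy =>
      rw [map_add]
      exact add_mem hx hy

lemma IsSphericalAction.map (h : IsSphericalAction act n)
    (hEE : ∀ i, Function.Bijective (shiftedHomMap α α i))
    (hE : Function.Bijective (fun f : E ⟶ E => G.map f))
    (hact : ∀ a, act' a ≫ α.hom = α.hom ≫ G.map (act a)) : IsSphericalAction act' n where
  bijective := by
    have h1 : act' = fun a => α.hom ≫ G.map (act a) ≫ α.inv := by
      funext a
      rw [← Category.assoc, ← hact, Category.assoc, Iso.hom_inv_id, Category.comp_id]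
    rw [h1]
    exact (Iso.homCongr α.symm α.symm).bijective.comp (hE.comp h.bijective)
  eq_zero i h0 hn f := by
    obtain ⟨f, rfl⟩ := (hEE i).surjective f
    rw [h.eq_zero i h0 hn f, map_zero]

end Transport

end

noncomputable section

open CategoryTheory Limits CochainComplex CochainComplex.HomComplex

/-! ### Reduction of ind-objects to finite stages -/

section IndLifting

variable {C : Type u} [SmallCategory C] [Abelian C]

/-- A morphism from an object of `C` to a filtered colimit of objects of `C` which vanishes
already vanishes at a later stage. -/
lemma exists_map_eq_zero_of_comp_ι_eq_zero {J : Type u} [SmallCategory J] [IsFiltered J]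
    (Q : J ⥤ C) {Y : C} (j : J) (a : Y ⟶ Q.obj j)
    (h : (Ind.yoneda (C := C)).map a ≫ colimit.ι (Q ⋙ Ind.yoneda) j = 0) :
    ∃ (i : J) (s : j ⟶ i), a ≫ Q.map s = 0 := by
  -- Taking sections over `Y` preserves filtered colimits, so equality in the colimit is already
  -- equality at a later stage.
  let V : Ind C ⥤ Type u := Ind.inclusion C ⋙ (CategoryTheory.evaluation Cᵒᵖ (Type u)).obj (Opposite.op Y)
  have hc : IsColimit (V.mapCocone (colimit.cocone (Q ⋙ Ind.yoneda))) :=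
    isColimitOfPreserves V (colimit.isColimit _)
  let θ (X : C) (b : Y ⟶ X) : V.obj (Ind.yoneda.obj X) :=
    (Ind.yonedaCompInclusion.inv.app X).app (Opposite.op Y) b
  have hθ (X : C) : Function.Injective (θ X) := by
    intro b b' hb
    have h1 (z : Y ⟶ X) : (Ind.yonedaCompInclusion.hom.app X).app (Opposite.op Y) (θ X z) = z := by
      have h2 := congrArg (fun t => t.app (Opposite.op Y))
        (Ind.yonedaCompInclusion.inv_hom_id_app X)
      exact congrArg (fun t => t z) h2
    rw [← h1 b, hb, h1]
  have hθ' {X X' : C} (b : Y ⟶ X) (f : X ⟶ X') :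
      V.map (Ind.yoneda.map f) (θ X b) = θ X' (b ≫ f) := by
    have h2 := congrArg (fun t => t.app (Opposite.op Y))
      (Ind.yonedaCompInclusion.inv.naturality f)
    exact (congrArg (fun t => t b) h2).symm
  have h0 : (Ind.yoneda (C := C)).map a ≫ colimit.ι (Q ⋙ Ind.yoneda) j =
      (Ind.yoneda (C := C)).map 0 ≫ colimit.ι (Q ⋙ Ind.yoneda) j := by
    rw [h, Functor.map_zero, zero_comp]
  have h1 := congrArg (fun t => V.map t (θ Y (𝟙 Y))) h0
  simp only [Functor.map_comp, types_comp_apply, hθ', Category.id_comp] at h1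
  obtain ⟨i, s, hs⟩ := (Types.FilteredColimit.isColimit_eq_iff' hc _ _).1 h1
  refine ⟨i, s, hθ _ ?_⟩
  have hs' : V.map (Ind.yoneda.map (Q.map s)) (θ _ a) =
      V.map (Ind.yoneda.map (Q.map s)) (θ _ 0) := hs
  exact (hθ' a _).symm.trans (hs'.trans ((hθ' 0 _).trans (by rw [zero_comp])))

/-- An epimorphism from an ind-object to an object of `C` restricts to an epimorphism on a
subobject which comes from `C`. -/
lemma exists_epi_of_epi {Z : Ind C} {Y : C} (p : Z ⟶ Ind.yoneda.obj Y) [Epi p] :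
    ∃ (X : C) (f : Ind.yoneda.obj X ⟶ Z) (g : X ⟶ Y), Epi g ∧ f ≫ p = Ind.yoneda.map g := by
  let K := Z.presentation.F
  let e : colimit (K ⋙ Ind.yoneda) ≅ Z := Z.colimitPresentationCompYoneda
  let q : K ⟶ (Functor.const _).obj Y :=
    { app j := Ind.yoneda.preimage (colimit.ι (K ⋙ Ind.yoneda) j ≫ e.hom ≫ p)
      naturality i j s := Ind.yoneda.map_injective (by
        have := colimit.w_assoc (K ⋙ Ind.yoneda) s (e.hom ≫ p)
        simpa using this) }
  -- The cokernels of the maps from the stages of `Z` to `Y` form a filtered system. The map from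
  -- `Y` to their colimit vanishes, because it vanishes after the epimorphism `p`. Hence `Y` maps to
  -- zero in the cokernel at some stage, and the map from that stage to `Y` is an epimorphism.
  let π := cokernel.π q
  have h1 (j) : colimit.ι (K ⋙ Ind.yoneda) j ≫ e.hom ≫ p ≫ Ind.yoneda.map (π.app j) ≫
      colimit.ι (cokernel q ⋙ Ind.yoneda) j = 0 := by
    have h2 : colimit.ι (K ⋙ Ind.yoneda) j ≫ e.hom ≫ p = Ind.yoneda.map (q.app j) := by
      simp [q]
    have h3 : q.app j ≫ π.app j = 0 := by
      rw [← NatTrans.comp_app, cokernel.condition]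
      rfl
    rw [reassoc_of% h2, ← Functor.map_comp_assoc, h3, Functor.map_zero, zero_comp]
  have h4 (i j) : Ind.yoneda.map (π.app i) ≫ colimit.ι (cokernel q ⋙ Ind.yoneda) i =
      Ind.yoneda.map (π.app j) ≫ colimit.ι (cokernel q ⋙ Ind.yoneda) j := by
    have h5 {i j} (s : i ⟶ j) : Ind.yoneda.map (π.app i) ≫
        colimit.ι (cokernel q ⋙ Ind.yoneda) i =
        Ind.yoneda.map (π.app j) ≫ colimit.ι (cokernel q ⋙ Ind.yoneda) j := by
      rw [← colimit.w (cokernel q ⋙ Ind.yoneda) s, Functor.comp_map, ← Functor.map_comp_assoc,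
        ← π.naturality]
      simp
    exact (h5 (IsFiltered.leftToMax i j)).trans (h5 (IsFiltered.rightToMax i j)).symm
  obtain ⟨j⟩ : Nonempty Z.presentation.I := IsFiltered.nonempty
  have h6 : Ind.yoneda.map (π.app j) ≫ colimit.ι (cokernel q ⋙ Ind.yoneda) j = 0 := by
    rw [← cancel_epi p, ← cancel_epi e.hom]
    refine colimit.hom_ext fun i => ?_
    rw [h4 j i, h1, comp_zero, comp_zero, comp_zero]
  obtain ⟨i, s, hs⟩ := exists_map_eq_zero_of_comp_ι_eq_zero (cokernel q) j (π.app j) h6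
  have h7 : π.app i = 0 := by
    have := π.naturality s
    rw [hs] at this
    simpa using this
  refine ⟨K.obj i, colimit.ι (K ⋙ Ind.yoneda) i ≫ e.hom, q.app i, ?_, by simp [q]⟩
  refine Preadditive.epi_of_cokernel_zero (f := q.app i) ?_
  have h8 := PreservesCokernel.π_iso_hom ((CategoryTheory.evaluation _ C).obj i) q
  refine h8.symm.trans ?_
  rw [show ((CategoryTheory.evaluation _ C).obj i).map (cokernel.π q) = 0 from h7, zero_comp]

end IndLifting

end

noncomputable section

open CategoryTheory Limits Pretriangulated

/-! ### A five lemma for triangulated functors -/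

section FiveLemma

variable {T T' : Type*} [Category* T] [Category* T'] [Preadditive T] [Preadditive T']
  [HasZeroObject T] [HasZeroObject T'] [HasShift T ℤ] [HasShift T' ℤ]
  [∀ n : ℤ, (CategoryTheory.shiftFunctor T n).Additive]
  [∀ n : ℤ, (CategoryTheory.shiftFunctor T' n).Additive] [Pretriangulated T] [Pretriangulated T']
  (G : T ⥤ T') [G.CommShift ℤ] [G.IsTriangulated]

/-- The functor `G` is bijective on morphisms from `X` to `Y`. -/
def BijectiveOn (X Y : T) : Prop := Function.Bijective (G.map : (X ⟶ Y) → (G.obj X ⟶ G.obj Y))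

variable {G}

omit [Preadditive T] [Preadditive T'] [HasZeroObject T] [HasZeroObject T'] [HasShift T ℤ]
  [HasShift T' ℤ] [∀ n : ℤ, (CategoryTheory.shiftFunctor T n).Additive]
  [∀ n : ℤ, (CategoryTheory.shiftFunctor T' n).Additive] [Pretriangulated T] [Pretriangulated T']
  [G.CommShift ℤ] [G.IsTriangulated] in
lemma BijectiveOn.of_iso {X X' Y Y' : T} (h : BijectiveOn G X Y) (e : X ≅ X') (e' : Y ≅ Y') :
    BijectiveOn G X' Y' := by
  have h1 : (G.map : (X' ⟶ Y') → _) = (Iso.homCongr (G.mapIso e) (G.mapIso e')) ∘ G.map ∘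
      (Iso.homCongr e e').symm := by
    funext f
    simp [Iso.homCongr, ← Functor.map_comp]
  rw [BijectiveOn, h1]
  exact (Equiv.bijective _).comp (h.comp (Equiv.bijective _))

/-- The five lemma for the long exact sequences obtained by mapping the triangle to `Y` and its
image to `G Y`; the two shifted hypotheses are the outer terms of the five. -/
lemma BijectiveOn.of_triangle_left {S : Triangle T} (hS : S ∈ distTriang T) {Y : T}
    (h₁ : BijectiveOn G S.obj₁ Y) (h₃ : BijectiveOn G S.obj₃ Y)
    (h₁' : BijectiveOn G (S.obj₁⟦(1 : ℤ)⟧) Y) (h₃' : BijectiveOn G (S.obj₃⟦(-1 : ℤ)⟧) Y) :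
    BijectiveOn G S.obj₂ Y := by
  have hGS := G.map_distinguished _ hS
  have hGS' := G.map_distinguished _ (rot_of_distTriang _ hS)
  refine ⟨(injective_iff_map_eq_zero (G.mapAddHom (X := S.obj₂) (Y := Y))).2 fun a ha => ?_,
    fun α => ?_⟩
  · replace ha : G.map a = 0 := ha
    obtain ⟨b, rfl⟩ := Triangle.yoneda_exact₂ _ hS a (h₁.injective (by
      rw [G.map_comp, ha, comp_zero, G.map_zero]))
    rw [G.map_comp] at ha
    obtain ⟨c, hc⟩ := Triangle.yoneda_exact₂ _ hGS' (G.map b) ha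
    obtain ⟨c, rfl⟩ := h₁'.surjective c
    have : b = S.mor₃ ≫ c := h₃.injective (by rw [G.map_comp]; exact hc)
    rw [this, comp_distTriang_mor_zero₂₃_assoc _ hS, zero_comp]
  -- A morphism on `S.obj₁` extends to `S.obj₂` exactly when it kills the rotated connecting
  -- morphism `d`, and this can be tested after applying `G`.
  · let d : S.obj₃⟦(-1 : ℤ)⟧ ⟶ S.obj₁ := S.invRotate.mor₁
    have hd : d ≫ S.mor₁ = 0 := comp_distTriang_mor_zero₁₂ _ (inv_rot_of_distTriang _ hS)
    have hd' (β : S.obj₁ ⟶ Y) (hβ : d ≫ β = 0) : ∃ a : S.obj₂ ⟶ Y, β = S.mor₁ ≫ a :=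
      Triangle.yoneda_exact₂ _ (inv_rot_of_distTriang _ hS) β hβ
    obtain ⟨β, hβ⟩ := h₁.surjective (G.map S.mor₁ ≫ α)
    obtain ⟨a, ha⟩ := hd' β (h₃'.injective (by
      rw [G.map_comp, G.map_zero, hβ, ← G.map_comp_assoc, hd, G.map_zero, zero_comp]))
    obtain ⟨γ, hγ⟩ := Triangle.yoneda_exact₂ _ hGS (α - G.map a) (by
      refine (Preadditive.comp_sub _ _ _).trans ?_
      refine sub_eq_zero.2 (hβ.symm.trans ?_)
      rw [ha]
      exact G.map_comp _ _)
    obtain ⟨c, rfl⟩ := h₃.surjective γ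
    refine ⟨a + S.mor₂ ≫ c, ?_⟩
    rw [G.map_add, G.map_comp]
    exact (add_comm _ _).trans (sub_eq_iff_eq_add.1 hγ).symm

lemma BijectiveOn.of_triangle_right {S : Triangle T} (hS : S ∈ distTriang T) {X : T}
    (h₁ : BijectiveOn G X S.obj₁) (h₃ : BijectiveOn G X S.obj₃)
    (h₁' : BijectiveOn G X (S.obj₁⟦(1 : ℤ)⟧)) (h₃' : BijectiveOn G X (S.obj₃⟦(-1 : ℤ)⟧)) :
    BijectiveOn G X S.obj₂ := by
  have hGS := G.map_distinguished _ hS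
  have hGS' := G.map_distinguished _ (inv_rot_of_distTriang _ hS)
  refine ⟨(injective_iff_map_eq_zero (G.mapAddHom (X := X) (Y := S.obj₂))).2 fun a ha => ?_,
    fun α => ?_⟩
  · let d : S.obj₃⟦(-1 : ℤ)⟧ ⟶ S.obj₁ := S.invRotate.mor₁
    have hd : d ≫ S.mor₁ = 0 := comp_distTriang_mor_zero₁₂ _ (inv_rot_of_distTriang _ hS)
    have hd' (b : G.obj X ⟶ G.obj S.obj₁) (hb : b ≫ G.map S.mor₁ = 0) :
        ∃ c : G.obj X ⟶ G.obj (S.obj₃⟦(-1 : ℤ)⟧), b = c ≫ G.map d :=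
      Triangle.coyoneda_exact₂ _ hGS' b hb
    replace ha : G.map a = 0 := ha
    obtain ⟨b, rfl⟩ := Triangle.coyoneda_exact₂ _ hS a (h₃.injective (by
      rw [G.map_comp, ha, zero_comp, G.map_zero]))
    rw [G.map_comp] at ha
    obtain ⟨c, hc⟩ := hd' (G.map b) ha
    obtain ⟨c, rfl⟩ := h₃'.surjective c
    have : b = c ≫ d := h₁.injective (by rw [G.map_comp]; exact hc)
    rw [this, Category.assoc, hd, comp_zero]
  · obtain ⟨β, hβ⟩ := h₃.surjective (α ≫ G.map S.mor₂)
    obtain ⟨a, ha⟩ := Triangle.coyoneda_exact₃ _ hS β (h₁'.injective (by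
      rw [G.map_comp, G.map_zero, hβ, Category.assoc, ← G.map_comp,
        comp_distTriang_mor_zero₂₃ _ hS, G.map_zero, comp_zero]))
    obtain ⟨γ, hγ⟩ := Triangle.coyoneda_exact₂ _ hGS (α - G.map a) (by
      refine (Preadditive.sub_comp _ _ _).trans ?_
      refine sub_eq_zero.2 (hβ.symm.trans ?_)
      rw [ha]
      exact G.map_comp _ _)
    obtain ⟨c, rfl⟩ := h₁.surjective γ
    refine ⟨a + c ≫ S.mor₁, ?_⟩
    rw [G.map_add, G.map_comp]
    exact (add_comm _ _).trans (sub_eq_iff_eq_add.1 hγ).symm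

lemma BijectiveOn.of_triangle_left' {S : Triangle T} (hS : S ∈ distTriang T) {Y : T}
    (h₁ : ∀ n : ℤ, BijectiveOn G (S.obj₁⟦n⟧) Y) (h₃ : ∀ n : ℤ, BijectiveOn G (S.obj₃⟦n⟧) Y) (n : ℤ) :
    BijectiveOn G (S.obj₂⟦n⟧) Y :=
  BijectiveOn.of_triangle_left (Triangle.shift_distinguished _ hS n) (h₁ n) (h₃ n)
    ((h₁ (n + 1)).of_iso ((CategoryTheory.shiftFunctorAdd T n 1).app _) (Iso.refl _))
    ((h₃ (n + -1)).of_iso ((CategoryTheory.shiftFunctorAdd T n (-1)).app _) (Iso.refl _))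

lemma BijectiveOn.of_triangle_right' {S : Triangle T} (hS : S ∈ distTriang T) {X : T}
    (h₁ : ∀ n : ℤ, BijectiveOn G X (S.obj₁⟦n⟧)) (h₃ : ∀ n : ℤ, BijectiveOn G X (S.obj₃⟦n⟧)) (n : ℤ) :
    BijectiveOn G X (S.obj₂⟦n⟧) :=
  BijectiveOn.of_triangle_right (Triangle.shift_distinguished _ hS n) (h₁ n) (h₃ n)
    ((h₁ (n + 1)).of_iso (Iso.refl _) ((CategoryTheory.shiftFunctorAdd T n 1).app _))
    ((h₃ (n + -1)).of_iso (Iso.refl _) ((CategoryTheory.shiftFunctorAdd T n (-1)).app _))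

lemma BijectiveOn.shift {X Y : T} (h : BijectiveOn G X Y) (n : ℤ) :
    BijectiveOn G (X⟦n⟧) (Y⟦n⟧) := by
  have h1 : (G.map : (X⟦n⟧ ⟶ Y⟦n⟧) → _) =
      (Iso.homCongr ((G.commShiftIso n).app X) ((G.commShiftIso n).app Y)).symm ∘
      (CategoryTheory.shiftFunctor T' n).map ∘ G.map ∘
      (Functor.FullyFaithful.ofFullyFaithful (CategoryTheory.shiftFunctor T n)).homEquiv.symm := by
    funext f
    obtain ⟨f, rfl⟩ := (CategoryTheory.shiftFunctor T n).map_surjective f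
    have h2 : (Functor.FullyFaithful.ofFullyFaithful
        (CategoryTheory.shiftFunctor T n)).homEquiv.symm
          ((CategoryTheory.shiftFunctor T n).map f) = f :=
      (Functor.FullyFaithful.ofFullyFaithful (CategoryTheory.shiftFunctor T n)).preimage_map f
    simp only [Function.comp_apply, h2]
    simp [Iso.homCongr]
  rw [BijectiveOn, h1]
  exact (Equiv.bijective _).comp
    (((Functor.FullyFaithful.ofFullyFaithful (CategoryTheory.shiftFunctor T' n)).map_bijective
      _ _).comp (h.comp (Equiv.bijective _)))

end FiveLemma

/-! ### Dévissage along cohomological amplitude -/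

section BoundedInduction

variable {B : Type u} [Category.{v} B] [Abelian B] [HasDerivedCategory.{w} B]

open DerivedCategory

/-- Induction along the canonical t-structure for objects with finitely many nonzero cohomology
objects, all of them in a given class. -/
lemma bounded_induction (S : ObjectProperty B) [S.IsClosedUnderIsomorphisms]
    (hS₀ : ∀ X, IsZero X → S X) (P : ObjectProperty (DerivedCategory B))
    [P.IsClosedUnderIsomorphisms] (hP₀ : ∀ X, IsZero X → P X)
    (hP : ∀ X n, S X → P ((singleFunctor B n).obj X))
    (hT : ∀ T ∈ distTriang (DerivedCategory B), P T.obj₁ → P T.obj₃ → P T.obj₂)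
    (X : DerivedCategory B) (a b : ℤ) (hXa : X.IsGE a) (hXb : X.IsLE b)
    (hX : ∀ i, S ((homologyFunctor B i).obj X)) : P X := by
  -- The induction is on the length of the interval of degrees in which cohomology may be nonzero.
  obtain ⟨d, hd⟩ : ∃ d : ℕ, b + 1 ≤ a + d := ⟨(b + 1 - a).toNat, by omega⟩
  induction d generalizing X b with
  | zero => exact hP₀ _ (TStructure.t.isZero X b a (by omega))
  | succ d hrec =>
    -- Truncation below the top degree: `X₁` keeps the cohomology in degrees below `b`, and `X₃` is
    -- concentrated in degree `b`. Every cohomology object of either is one of `X` or zero, so the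
    -- class `S` is preserved.
    obtain ⟨X₁, X₃, h₁, h₃, f, g, h, hT'⟩ := TStructure.t.exists_triangle X (b - 1) b (by omega)
    have h₁' : X₁.IsLE (b - 1) := ⟨h₁⟩
    have h₃' : X₃.IsGE b := ⟨h₃⟩
    have z₁ (i : ℤ) (hi : b - 1 < i) : IsZero ((homologyFunctor B i).obj X₁) :=
      isZero_of_isLE _ (b - 1) i hi
    have z₃ (i : ℤ) (hi : i < b) : IsZero ((homologyFunctor B i).obj X₃) :=
      isZero_of_isGE _ b i hi
    have iso₁ (i : ℤ) (hi : i < b) : IsIso ((homologyFunctor B i).map f) := by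
      have m : Mono ((homologyFunctor B i).map f) :=
        (HomologySequence.mono_homologyMap_mor₁_iff _ hT' (i - 1) i (by omega)).2
          ((z₃ (i - 1) (by omega)).eq_of_src _ _)
      have e : Epi ((homologyFunctor B i).map f) :=
        (HomologySequence.epi_homologyMap_mor₁_iff _ hT' i).2 ((z₃ i hi).eq_of_tgt _ _)
      exact isIso_of_mono_of_epi _
    have iso₃ (i : ℤ) (hi : b ≤ i) : IsIso ((homologyFunctor B i).map g) := by
      have m : Mono ((homologyFunctor B i).map g) :=
        (HomologySequence.mono_homologyMap_mor₂_iff _ hT' i).2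
          ((z₁ i (by omega)).eq_of_src _ _)
      have e : Epi ((homologyFunctor B i).map g) :=
        (HomologySequence.epi_homologyMap_mor₂_iff _ hT' i (i + 1) rfl).2
          ((z₁ (i + 1) (by omega)).eq_of_tgt _ _)
      exact isIso_of_mono_of_epi _
    have hX₁ (i : ℤ) : S ((homologyFunctor B i).obj X₁) := by
      by_cases hi : i < b
      · have := iso₁ i hi
        exact S.prop_of_iso (asIso ((homologyFunctor B i).map f)).symm (hX i)
      · exact hS₀ _ (z₁ i (by omega))
    have hX₃ (i : ℤ) : S ((homologyFunctor B i).obj X₃) := by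
      by_cases hi : i < b
      · exact hS₀ _ (z₃ i hi)
      · have := iso₃ i (by omega)
        exact S.prop_of_iso (asIso ((homologyFunctor B i).map g)) (hX i)
    have hX₁a : X₁.IsGE a := (isGE_iff _ _).2 fun i hi => by
      by_cases hi' : i < b
      · have := iso₁ i hi'
        exact (isZero_of_isGE X a i hi).of_iso (asIso ((homologyFunctor B i).map f))
      · exact z₁ i (by omega)
    have hX₃b : X₃.IsLE b := (isLE_iff _ _).2 fun i hi => by
      have := iso₃ i (by omega)
      exact (isZero_of_isLE X b i hi).of_iso (asIso ((homologyFunctor B i).map g)).symm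
    refine hT _ hT' (hrec X₁ (b - 1) hX₁a h₁' hX₁ (by push_cast at hd; omega)) ?_
    obtain ⟨Y, ⟨e⟩⟩ := exists_iso_singleFunctor_obj_of_isGE_of_isLE X₃ b
    refine P.prop_of_iso e.symm (hP Y b (S.prop_of_iso ?_ (hX₃ b)))
    exact (homologyFunctor B b).mapIso e ≪≫
      (singleFunctorCompHomologyFunctorIso B b).app Y

end BoundedInduction

/-! ### Comparison of Ext groups by effacing classes -/

section Effaceability

variable {B : Type u} [Category.{v} B] [Abelian B]

/-- With zero differentials around degree `i`, the term `L.X i` is its own cohomology, onto which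
the cycles of `K` map epimorphically. -/
lemma epi_f_of_quasiIso {K L : CochainComplex B ℤ} (s : K ⟶ L) [QuasiIso s] (i : ℤ)
    (h : L.d (i - 1) i = 0) (h' : L.d i (i + 1) = 0) : Epi (s.f i) := by
  have h1 := L.isIso_iCycles i (i + 1) (by simp) h'
  have h2 := L.isIso_homologyπ (i - 1) i (by simp) h
  have h3 : Epi (HomologicalComplex.cyclesMap s i ≫ L.homologyπ i) := by
    rw [← HomologicalComplex.homologyπ_naturality]
    infer_instance
  have h4 : Epi (HomologicalComplex.cyclesMap s i) := by
    have := epi_comp (HomologicalComplex.cyclesMap s i ≫ L.homologyπ i) (inv (L.homologyπ i))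
    simpa using this
  have h5 : Epi (K.iCycles i ≫ s.f i) := by
    rw [← HomologicalComplex.cyclesMap_i]
    infer_instance
  exact epi_of_epi (K.iCycles i) (s.f i)

variable [HasDerivedCategory.{w} B]

/-- Write the morphism as a roof `X ⟵ K ⟶ L` with `K` in degrees at most `0`, and take `Z = K⁰`. It
maps onto `X` because `K` is quasi-isomorphic to `X`, and its map to `L` vanishes because `L` has no
term in degree `0`. -/
lemma exists_epi_comp_eq_zero {X : B} {L : CochainComplex B ℤ} [L.IsStrictlyLE (-1)]
    (α : DerivedCategory.Q.obj ((CochainComplex.singleFunctor B 0).obj X) ⟶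
      DerivedCategory.Q.obj L) :
    ∃ (Z : B) (p : Z ⟶ X), Epi p ∧
      DerivedCategory.Q.map ((CochainComplex.singleFunctor B 0).map p) ≫ α = 0 := by
  obtain ⟨K, hK, s, hs, g, rfl⟩ := DerivedCategory.right_fac_of_isStrictlyLE α 0
  have hs' : QuasiIso s := (DerivedCategory.isIso_Q_map_iff_quasiIso _ s).1 hs
  -- The inclusion of `K⁰` is a morphism of complexes because `K` vanishes above degree `0`.
  let i : (CochainComplex.singleFunctor B 0).obj (K.X 0) ⟶ K :=
    HomologicalComplex.mkHomFromSingle (𝟙 _) fun j hj =>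
      (K.isZero_of_isStrictlyLE 0 j (by simp at hj; omega)).eq_of_tgt _ _
  obtain ⟨p, hp⟩ := (CochainComplex.singleFunctor B 0).map_surjective (i ≫ s)
  refine ⟨K.X 0, p, ?_, ?_⟩
  · have h1 : Epi (s.f 0) := epi_f_of_quasiIso s 0
      ((HomologicalComplex.isZero_single_obj_X _ _ _ _ (by simp)).eq_of_src _ _)
      ((HomologicalComplex.isZero_single_obj_X _ _ _ _ (by simp)).eq_of_tgt _ _)
    let e₀ : ((CochainComplex.singleFunctor B 0).obj (K.X 0)).X 0 ≅ K.X 0 :=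
      HomologicalComplex.singleObjXSelf (ComplexShape.up ℤ) 0 (K.X 0)
    have h2 : (i ≫ s).f 0 = e₀.hom ≫ s.f 0 := by
      rw [HomologicalComplex.comp_f]
      congr 1
      exact (HomologicalComplex.mkHomFromSingle_f _ _).trans (Category.comp_id _)
    have h3 : Epi (((CochainComplex.singleFunctor B 0).map p).f 0) := by
      rw [hp, h2]
      exact epi_comp' (IsIso.epi_of_iso e₀.hom) h1
    have h4 := HomologicalComplex.single_map_f_self (V := B) (ComplexShape.up ℤ) 0 p
    have h5 : Epi ((HomologicalComplex.singleObjXSelf (ComplexShape.up ℤ) 0 (K.X 0)).hom ≫ p) := by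
      have h6 : (HomologicalComplex.singleObjXSelf (ComplexShape.up ℤ) 0 (K.X 0)).hom ≫ p =
          ((HomologicalComplex.single B (ComplexShape.up ℤ) 0).map p).f 0 ≫
          (HomologicalComplex.singleObjXSelf (ComplexShape.up ℤ) 0 X).hom := by
        rw [h4]
        simp
      rw [h6]
      exact epi_comp' h3 inferInstance
    exact epi_of_epi (HomologicalComplex.singleObjXSelf (ComplexShape.up ℤ) 0 (K.X 0)).hom p
  · rw [hp, DerivedCategory.Q.map_comp, Category.assoc, IsIso.hom_inv_id_assoc,
      ← DerivedCategory.Q.map_comp]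
    have : i ≫ g = 0 := by
      refine HomologicalComplex.from_single_hom_ext ?_
      exact (L.isZero_of_isStrictlyLE (-1) 0 (by omega)).eq_of_tgt _ _
    rw [this, DerivedCategory.Q.map_zero]

open Abelian

/-- A class of positive degree is a morphism to `Y[n + 1]`, a complex concentrated in negative
degrees, so the preceding lemma applies. -/
lemma ext_effaceable [HasExt.{w} B] {X Y : B} {n : ℕ} (x : Ext.{w} X Y (n + 1)) :
    ∃ (Z : B) (p : Z ⟶ X), Epi p ∧ (Ext.mk₀ p).comp x (zero_add _) = 0 := by
  let L : CochainComplex B ℤ := ((CochainComplex.singleFunctor B 0).obj Y)⟦((n + 1 : ℕ) : ℤ)⟧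
  have hL : L.IsStrictlyLE (-1) := by
    have : CochainComplex.IsStrictlyLE L (-(n + 1 : ℕ)) :=
      CochainComplex.isStrictlyLE_shift _ 0 ((n + 1 : ℕ) : ℤ) _ (by omega)
    exact CochainComplex.isStrictlyLE_of_le L (-(n + 1 : ℕ)) (-1) (by omega)
  let e := (DerivedCategory.Q.commShiftIso ((n + 1 : ℕ) : ℤ)).app
    ((CochainComplex.singleFunctor B 0).obj Y)
  let x' : DerivedCategory.Q.obj ((CochainComplex.singleFunctor B 0).obj X) ⟶
    (DerivedCategory.Q.obj ((CochainComplex.singleFunctor B 0).obj Y))⟦((n + 1 : ℕ) : ℤ)⟧ := x.hom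
  obtain ⟨Z, p, hp, h⟩ := exists_epi_comp_eq_zero (X := X) (L := L) (x' ≫ e.inv)
  refine ⟨Z, p, hp, Ext.ext ?_⟩
  have h' : DerivedCategory.Q.map ((CochainComplex.singleFunctor B 0).map p) ≫ x' = 0 :=
    (cancel_mono e.inv).1 (((Category.assoc _ _ _).trans h).trans zero_comp.symm)
  refine (Ext.singleFunctor_map_comp_hom p x).symm.trans (h'.trans ?_)
  exact (map_zero Ext.homAddEquiv).symm

end Effaceability

section ExtComparison

open Abelian

variable {C : Type u} [Category.{v} C] [Abelian C] {B : Type u'} [Category.{v'} B] [Abelian B]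
  [HasDerivedCategory.{w} C] [HasDerivedCategory.{w'} B] [HasExt.{w} C] [HasExt.{w'} B]
  (F : C ⥤ B) [F.Additive] [PreservesFiniteLimits F] [PreservesFiniteColimits F]
  [F.Full] [F.Faithful]

/-- Dimension shifting with no projective or injective objects of `C`. A class of positive degree is
effaced by an epimorphism, which by `hF` can be taken in `C` even for classes in `B`, and it then
comes from lower degree through the kernel. The induction needs bijectivity for all first arguments
at once. -/
lemma mapExt_bijective_of_exists_epi
    (hF : ∀ {Z : B} {Y : C} (p : Z ⟶ F.obj Y) [Epi p],
      ∃ (X : C) (f : F.obj X ⟶ Z) (g : X ⟶ Y), Epi g ∧ f ≫ p = F.map g) (X Y : C) (n : ℕ) :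
    Function.Bijective (F.mapExtAddHom X Y n : Ext.{w} X Y n →+ Ext.{w'} (F.obj X) (F.obj Y) n) := by
  induction n generalizing X with
  | zero =>
    simpa [Ext.mapExactFunctor₀] using ⟨Functor.Faithful.map_injective, Functor.Full.map_surjective⟩
  | succ n hn =>
    refine ⟨(injective_iff_map_eq_zero _).2 fun x hx => ?_, fun y => ?_⟩
    · obtain ⟨Z, p, hp, h⟩ := ext_effaceable x
      let S := ShortComplex.mk _ _ (kernel.condition p)
      have hS : S.ShortExact := { exact := ShortComplex.exact_kernel p }
      obtain ⟨x₁, rfl⟩ := Ext.contravariant_sequence_exact₃ hS Y x h (add_comm 1 n)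
      have h1 : (hS.map F).extClass.comp (F.mapExtAddHom S.X₁ Y n x₁) (add_comm 1 n) = 0 := by
        refine Eq.trans ?_ hx
        simp only [Functor.mapExtAddHom_apply, Ext.mapExactFunctor_comp,
          Ext.mapExactFunctor_extClass]
        rfl
      -- The image of `x₁` extends to the middle term of the sequence. By the induction hypothesis
      -- so does `x₁` itself, hence its product with the extension class is zero.
      obtain ⟨x₂, h2⟩ := Ext.contravariant_sequence_exact₁ (hS.map F) (F.obj Y) _ (add_comm 1 n) h1
      obtain ⟨x₂, rfl⟩ := (hn S.X₂).surjective x₂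
      have h3 : (Ext.mk₀ S.f).comp x₂ (zero_add n) = x₁ := (hn S.X₁).injective (by
        rw [← h2]
        simp only [Functor.mapExtAddHom_apply, Ext.mapExactFunctor_comp, Ext.mapExactFunctor_mk₀]
        rfl)
      rw [← h3]
      exact hS.extClass_comp_assoc _
    · obtain ⟨Z, p, hp, h⟩ := ext_effaceable y
      -- The effacing epimorphism lives in `B`; it is dominated by the image of an epimorphism `g`
      -- of `C`, which therefore also effaces `y`.
      obtain ⟨X', f, g, hg, hfg⟩ := hF p
      have h' : (Ext.mk₀ (F.map g)).comp y (zero_add _) = 0 := by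
        rw [← hfg, ← Ext.mk₀_comp_mk₀_assoc, h, Ext.comp_zero]
      let S := ShortComplex.mk _ _ (kernel.condition g)
      have hS : S.ShortExact := { exact := ShortComplex.exact_kernel g }
      obtain ⟨y₁, rfl⟩ := Ext.contravariant_sequence_exact₃ (hS.map F) (F.obj Y) y h' (add_comm 1 n)
      obtain ⟨x₁, rfl⟩ := (hn S.X₁).surjective y₁
      refine ⟨hS.extClass.comp x₁ (add_comm 1 n), ?_⟩
      simp only [Functor.mapExtAddHom_apply, Ext.mapExactFunctor_comp,
        Ext.mapExactFunctor_extClass]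
      rfl

end ExtComparison

end

noncomputable section

open CategoryTheory Limits Pretriangulated

/-! ### The bounded derived category inside a larger derived category -/

section BoundedComparison

open DerivedCategory Abelian

open ZeroObject

variable {C : Type u} [Category.{v} C] [Abelian C] {B : Type u'} [Category.{v'} B] [Abelian B]
  [HasDerivedCategory.{w} C] [HasDerivedCategory.{w'} B]
  (F : C ⥤ B) [F.Additive] [PreservesFiniteLimits F] [PreservesFiniteColimits F]
  [F.Full] [F.Faithful]
  (hF : ∀ {Z : B} {Y : C} (p : Z ⟶ F.obj Y) [Epi p],
    ∃ (X : C) (f : F.obj X ⟶ Z) (g : X ⟶ Y), Epi g ∧ f ≫ p = F.map g)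

lemma isGE_map (X : DerivedCategory C) (a : ℤ) [h : X.IsGE a] : (F.mapDerivedCategory.obj X).IsGE a := by
  obtain ⟨K, _, ⟨e⟩⟩ := X.exists_iso_Q_obj_of_isGE a
  have : CochainComplex.IsStrictlyGE ((F.mapHomologicalComplex (ComplexShape.up ℤ)).obj K) a :=
    (CochainComplex.isStrictlyGE_iff _ a).2 fun i hi =>
      F.map_isZero (K.isZero_of_isStrictlyGE a i hi)
  have h' : (Q.obj ((F.mapHomologicalComplex (ComplexShape.up ℤ)).obj K)).IsGE a := inferInstance
  have h'' : ((F.mapHomologicalComplex (ComplexShape.up ℤ) ⋙ Q).obj K).IsGE a := h'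
  exact TStructure.t.isGE_of_iso ((F.mapDerivedCategoryFactors.app K).symm ≪≫
    F.mapDerivedCategory.mapIso e.symm) a

lemma isLE_map (X : DerivedCategory C) (a : ℤ) [h : X.IsLE a] : (F.mapDerivedCategory.obj X).IsLE a := by
  obtain ⟨K, _, ⟨e⟩⟩ := X.exists_iso_Q_obj_of_isLE a
  have : CochainComplex.IsStrictlyLE ((F.mapHomologicalComplex (ComplexShape.up ℤ)).obj K) a :=
    (CochainComplex.isStrictlyLE_iff _ a).2 fun i hi =>
      F.map_isZero (K.isZero_of_isStrictlyLE a i hi)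
  have h' : (Q.obj ((F.mapHomologicalComplex (ComplexShape.up ℤ)).obj K)).IsLE a := inferInstance
  have h'' : ((F.mapHomologicalComplex (ComplexShape.up ℤ) ⋙ Q).obj K).IsLE a := h'
  exact TStructure.t.isLE_of_iso ((F.mapDerivedCategoryFactors.app K).symm ≪≫
    F.mapDerivedCategory.mapIso e.symm) a

/-- Exact functors commute with cohomology. -/
lemma nonempty_homology_map_iso (X : DerivedCategory C) (i : ℤ) :
    Nonempty ((homologyFunctor B i).obj (F.mapDerivedCategory.obj X) ≅
      F.obj ((homologyFunctor C i).obj X)) := by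
  let K := Q.objPreimage X
  let e : Q.obj K ≅ X := Q.objObjPreimageIso X
  exact ⟨(homologyFunctor B i).mapIso (F.mapDerivedCategory.mapIso e.symm ≪≫
      F.mapDerivedCategoryFactors.app K) ≪≫
    (homologyFunctorFactors B i).app _ ≪≫ (K.sc i).mapHomologyIso F ≪≫
    F.mapIso ((homologyFunctorFactors C i).symm.app K ≪≫ (homologyFunctor C i).mapIso e)⟩

include hF

/-- In negative degrees both groups vanish by the t-structures; in the other degrees they are Ext
groups, compared by the dimension shifting above. -/
lemma bijectiveOn_singleFunctor_zero (X Y : C) (n : ℤ) :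
    BijectiveOn F.mapDerivedCategory ((singleFunctor C 0).obj X)
      (((singleFunctor C 0).obj Y)⟦n⟧) := by
  obtain hn | hn := lt_or_ge n 0
  · have h1 : (((singleFunctor C 0).obj Y)⟦n⟧).IsGE (-n) :=
      TStructure.t.isGE_shift _ 0 n (-n) (by omega)
    have h2 := isGE_map F (((singleFunctor C 0).obj Y)⟦n⟧) (-n)
    have h3 := isLE_map F ((singleFunctor C 0).obj X) 0
    refine ⟨fun f g _ => ?_, fun f => ⟨0, ?_⟩⟩
    · rw [TStructure.t.zero_of_isLE_of_isGE f 0 (-n) (by omega) inferInstance h1,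
        TStructure.t.zero_of_isLE_of_isGE g 0 (-n) (by omega) inferInstance h1]
    · rw [TStructure.t.zero_of_isLE_of_isGE f 0 (-n) (by omega) h3 h2, Functor.map_zero]
  · obtain ⟨m, rfl⟩ := Int.eq_ofNat_of_zero_le hn
    have : HasExt.{w} C := hasExt_of_hasDerivedCategory C
    have : HasExt.{w'} B := hasExt_of_hasDerivedCategory B
    let σ := F.mapDerivedCategorySingleFunctor 0
    let e : (F.mapDerivedCategory.obj ((singleFunctor C 0).obj X) ⟶
        F.mapDerivedCategory.obj (((singleFunctor C 0).obj Y)⟦(m : ℤ)⟧)) ≃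
        ShiftedHom ((singleFunctor B 0).obj (F.obj X)) ((singleFunctor B 0).obj (F.obj Y)) (m : ℤ) :=
      Iso.homCongr (σ.app X) ((F.mapDerivedCategory.commShiftIso (m : ℤ)).app _ ≪≫
        (CategoryTheory.shiftFunctor _ (m : ℤ)).mapIso (σ.app Y))
    have h1 : (F.mapDerivedCategory.map : ((singleFunctor C 0).obj X ⟶
        (((singleFunctor C 0).obj Y)⟦(m : ℤ)⟧)) → _) =
        e.symm ∘ Ext.homEquiv.{w'} ∘ (F.mapExtAddHom X Y m : Ext.{w} X Y m → _) ∘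
          Ext.homEquiv.{w}.symm := by
      funext f
      obtain ⟨x, rfl⟩ := Ext.homEquiv.{w}.surjective f
      refine e.injective ?_
      simp only [Function.comp_apply, Equiv.symm_apply_apply, Equiv.apply_symm_apply]
      refine Eq.trans ?_ (Ext.mapExactFunctor_hom F x).symm
      simp [e, σ, Iso.homCongr, ShiftedHom.map, Ext.hom]
    rw [BijectiveOn, h1]
    exact (Equiv.bijective _).comp ((Equiv.bijective _).comp
      ((mapExt_bijective_of_exists_epi F hF X Y m).comp (Equiv.bijective _)))

omit hF [F.Full] [F.Faithful] in
lemma bijectiveOn_of_isZero_left {X Y : DerivedCategory C} (hX : IsZero X) :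
    BijectiveOn F.mapDerivedCategory X Y :=
  ⟨fun _ _ _ => hX.eq_of_src _ _, fun _ => ⟨0, (F.mapDerivedCategory.map_isZero hX).eq_of_src _ _⟩⟩

omit hF [F.Full] [F.Faithful] in
lemma bijectiveOn_of_isZero_right {X Y : DerivedCategory C} (hY : IsZero Y) :
    BijectiveOn F.mapDerivedCategory X Y :=
  ⟨fun _ _ _ => hY.eq_of_tgt _ _, fun _ => ⟨0, (F.mapDerivedCategory.map_isZero hY).eq_of_tgt _ _⟩⟩

omit [Abelian C] [HasDerivedCategory C] hF [F.Full] [F.Faithful] [F.Additive]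
  [PreservesFiniteLimits F] [PreservesFiniteColimits F] in
variable (B) in
/-- An object placed in degree `m` and shifted by `n` is placed in degree `m - n`. -/
lemma nonempty_singleFunctor_shift_iso (X : B) (m n : ℤ) :
    Nonempty (((singleFunctor B m).obj X)⟦n⟧ ≅ (((singleFunctor B 0).obj X)⟦n - m⟧)) :=
  ⟨(CategoryTheory.shiftFunctor _ n).mapIso
      (((singleFunctors B).shiftIso (-m) m 0 (by omega)).app X).symm ≪≫
    (CategoryTheory.shiftFunctorAdd' _ (-m) n (n - m) (by omega)).symm.app _⟩

/-- Dévissage in the first variable. Shifting both arguments moves the shift of a single object to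
the other side, which reduces to two objects in degree `0`. -/
lemma bijectiveOn_bounded_singleFunctor (X : DerivedCategory C) (a b : ℤ) (hXa : X.IsGE a)
    (hXb : X.IsLE b) (Y : C) (n : ℤ) :
    BijectiveOn F.mapDerivedCategory (X⟦n⟧) ((singleFunctor C 0).obj Y) := by
  let P : ObjectProperty (DerivedCategory C) := fun X => ∀ n : ℤ,
    BijectiveOn F.mapDerivedCategory (X⟦n⟧) ((singleFunctor C 0).obj Y)
  have : P.IsClosedUnderIsomorphisms := ⟨fun e h n =>
    (h n).of_iso ((CategoryTheory.shiftFunctor _ n).mapIso e) (Iso.refl _)⟩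
  refine bounded_induction ⊤ (fun _ _ => trivial) P (fun X hX n => ?_) (fun X m _ n => ?_)
    (fun T hT h₁ h₃ n => BijectiveOn.of_triangle_left' hT h₁ h₃ n) X a b hXa hXb
    (fun _ => trivial) n
  · exact bijectiveOn_of_isZero_left F (Functor.map_isZero _ hX)
  · obtain ⟨e⟩ := nonempty_singleFunctor_shift_iso C X m n
    exact ((bijectiveOn_singleFunctor_zero F hF X Y (-(n - m))).shift (n - m)).of_iso e.symm
      ((CategoryTheory.shiftFunctorCompIsoId _ (-(n - m)) (n - m) (by omega)).app _)

/-- The functor induced by `F` is fully faithful on bounded derived categories. -/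
lemma bijectiveOn_of_bounded (X Y : DerivedCategory C) (a b a' b' : ℤ) (hXa : X.IsGE a)
    (hXb : X.IsLE b) (hYa : Y.IsGE a') (hYb : Y.IsLE b') (n : ℤ) :
    BijectiveOn F.mapDerivedCategory X (Y⟦n⟧) := by
  let P : ObjectProperty (DerivedCategory C) := fun Y => ∀ n : ℤ,
    BijectiveOn F.mapDerivedCategory X (Y⟦n⟧)
  have : P.IsClosedUnderIsomorphisms := ⟨fun e h n =>
    (h n).of_iso (Iso.refl _) ((CategoryTheory.shiftFunctor _ n).mapIso e)⟩
  refine bounded_induction ⊤ (fun _ _ => trivial) P (fun Y hY n => ?_) (fun Y m _ n => ?_)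
    (fun T hT h₁ h₃ n => BijectiveOn.of_triangle_right' hT h₁ h₃ n) Y a' b' hYa hYb
    (fun _ => trivial) n
  · exact bijectiveOn_of_isZero_right F (Functor.map_isZero _ hY)
  · obtain ⟨e⟩ := nonempty_singleFunctor_shift_iso C Y m n
    exact ((bijectiveOn_bounded_singleFunctor F hF X a b hXa hXb Y (-(n - m))).shift
      (n - m)).of_iso
      ((CategoryTheory.shiftFunctorCompIsoId _ (-(n - m)) (n - m) (by omega)).app _) e.symm

lemma bijectiveOn_of_mem_bounded {X Y : DerivedCategory C} (hX : TStructure.t.bounded X)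
    (hY : TStructure.t.bounded Y) (n : ℤ) : BijectiveOn F.mapDerivedCategory X (Y⟦n⟧) := by
  obtain ⟨⟨a, ha⟩, ⟨b, hb⟩⟩ := hX
  obtain ⟨⟨a', ha'⟩, ⟨b', hb'⟩⟩ := hY
  exact bijectiveOn_of_bounded F hF X Y a b a' b' ha hb ha' hb' n

/-- The essential image of the bounded derived category consists of the bounded objects whose
cohomology comes from `C`. -/
lemma exists_bounded_iso (Y : DerivedCategory B) (a b : ℤ) (hYa : Y.IsGE a) (hYb : Y.IsLE b)
    (hY : ∀ i, F.essImage ((homologyFunctor B i).obj Y)) :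
    ∃ X : DerivedCategory C, TStructure.t.bounded X ∧
      Nonempty (F.mapDerivedCategory.obj X ≅ Y) := by
  let P : ObjectProperty (DerivedCategory B) := fun Y =>
    ∃ X : DerivedCategory C, TStructure.t.bounded X ∧
      Nonempty (F.mapDerivedCategory.obj X ≅ Y)
  have : P.IsClosedUnderIsomorphisms := ⟨fun e ⟨X, hX, ⟨e'⟩⟩ => ⟨X, hX, ⟨e' ≪≫ e⟩⟩⟩
  have hb (X : DerivedCategory C) (a b : ℤ) (h : X.IsGE a) (h' : X.IsLE b) :
    TStructure.t.bounded X := ⟨⟨a, h⟩, ⟨b, h'⟩⟩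
  refine bounded_induction F.essImage (fun X hX => ?_) P (fun Y hY => ?_) (fun Y m hY => ?_)
    (fun T hT h₁ h₃ => ?_) Y a b hYa hYb hY
  · exact ⟨0, ⟨(F.map_isZero (isZero_zero C)).iso hX⟩⟩
  · exact ⟨(singleFunctor C 0).obj 0, hb _ 0 0 inferInstance inferInstance,
      ⟨(F.mapDerivedCategory.map_isZero ((singleFunctor C 0).map_isZero (isZero_zero C))).iso hY⟩⟩
  · obtain ⟨X, ⟨e⟩⟩ := hY
    exact ⟨(singleFunctor C m).obj X, hb _ m m inferInstance inferInstance,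
      ⟨(F.mapDerivedCategorySingleFunctor m).app X ≪≫ (singleFunctor B m).mapIso e⟩⟩
  · obtain ⟨X₁, hX₁, ⟨e₁⟩⟩ := h₁
    obtain ⟨X₃, hX₃, ⟨e₃⟩⟩ := h₃
    let G := F.mapDerivedCategory
    -- The connecting morphism comes from `D(C)` by full faithfulness on bounded objects. Completing
    -- it to a triangle there gives a middle vertex whose image is isomorphic to that of `T`.
    obtain ⟨g, hg⟩ := (bijectiveOn_of_mem_bounded F hF hX₃ hX₁ 1).surjective
      (e₃.hom ≫ T.mor₃ ≫ e₁.inv⟦(1 : ℤ)⟧' ≫ (G.commShiftIso (1 : ℤ)).inv.app X₁)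
    obtain ⟨X₂, f, f', hT'⟩ := distinguished_cocone_triangle₂ g
    have hGT' := G.map_distinguished _ hT'
    have hcomm : (G.map g ≫ (G.commShiftIso (1 : ℤ)).hom.app X₁) ≫
        (CategoryTheory.shiftFunctor _ (1 : ℤ)).map e₁.hom = e₃.hom ≫ T.mor₃ := by
      have h1 : (CategoryTheory.shiftFunctor _ (1 : ℤ)).map e₁.inv ≫
          (CategoryTheory.shiftFunctor _ (1 : ℤ)).map e₁.hom = 𝟙 _ := by
        rw [← Functor.map_comp, Iso.inv_hom_id, CategoryTheory.Functor.map_id]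
      have h2 := (G.commShiftIso (1 : ℤ)).inv_hom_id_app X₁
      rw [show G.map g = _ from hg]
      simp only [Category.assoc]
      exact congrArg (fun z => e₃.hom ≫ T.mor₃ ≫ z)
        ((congrArg (fun z => (CategoryTheory.shiftFunctor _ (1 : ℤ)).map e₁.inv ≫ z)
          (((Category.assoc _ _ _).symm.trans (congrArg (fun z => z ≫ _) h2)).trans
            (Category.id_comp _))).trans h1) |>.trans (by rw [Category.comp_id])
    obtain ⟨φ, h1, h2⟩ := complete_distinguished_triangle_morphism₂ _ T hGT' hT e₁.hom e₃.hom hcomm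
    let ψ : G.mapTriangle.obj (Triangle.mk f f' g) ⟶ T :=
      { hom₁ := e₁.hom, hom₂ := φ, hom₃ := e₃.hom, comm₁ := h1, comm₂ := h2, comm₃ := hcomm }
    have : IsIso φ := isIso₂_of_isIso₁₃ ψ hGT' hT e₁.isIso_hom e₃.isIso_hom
    refine ⟨X₂, ?_, ⟨@asIso _ _ _ _ φ this⟩⟩
    obtain ⟨⟨a₁, ha₁⟩, ⟨b₁, hb₁⟩⟩ := hX₁
    obtain ⟨⟨a₃, ha₃⟩, ⟨b₃, hb₃⟩⟩ := hX₃
    have ha₁' : X₁.IsGE a₁ := ha₁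
    have ha₃' : X₃.IsGE a₃ := ha₃
    have hb₁' : X₁.IsLE b₁ := hb₁
    have hb₃' : X₃.IsLE b₃ := hb₃
    refine hb X₂ (min a₁ a₃) (max b₁ b₃) ((isGE_iff _ _).2 fun i hi => ?_)
      ((isLE_iff _ _).2 fun i hi => ?_)
    · exact (HomologySequence.exact₂ _ hT' i).isZero_of_both_zeros
        ((isZero_of_isGE X₁ a₁ i (by omega)).eq_of_src _ _)
        ((isZero_of_isGE X₃ a₃ i (by omega)).eq_of_tgt _ _)
    · exact (HomologySequence.exact₂ _ hT' i).isZero_of_both_zeros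
        ((isZero_of_isLE X₁ b₁ i (by omega)).eq_of_src _ _)
        ((isZero_of_isLE X₃ b₃ i (by omega)).eq_of_tgt _ _)

end BoundedComparison

end

noncomputable section

open CategoryTheory Limits Pretriangulated

/-! ### `Dᵇ(C)` and `𝔎` as the same subcategory of `D(Ind C)` -/

section BoundedInd

open DerivedCategory

variable (C : Type u) [SmallCategory C] [Abelian C]
  [HasDerivedCategory.{w} C] [HasDerivedCategory.{w'} (Ind C)]

lemma boundedToInd_map_bijective (X Y : DerivedCategory.Bounded C) :
    Function.Bijective ((boundedToInd C).map : (X ⟶ Y) → _) := by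
  have h := (bijectiveOn_of_mem_bounded (Ind.yoneda (C := C)) (fun p _ => exists_epi_of_epi p)
    X.property Y.property 0).of_iso (Iso.refl _) ((CategoryTheory.shiftFunctorZero _ ℤ).app _)
  exact h.comp ⟨fun f g h => by ext; exact h, fun f => ⟨⟨f⟩, rfl⟩⟩

instance : (boundedToInd C).Full := ⟨fun f => (boundedToInd_map_bijective C _ _).surjective f⟩

instance : (boundedToInd C).Faithful := ⟨fun h => (boundedToInd_map_bijective C _ _).injective h⟩

instance : (boundedToInd C).essImage.IsTriangulated := inferInstance

variable {C}

/-- The essential image of `Dᵇ(C)` consists of the bounded objects whose cohomology lies in `C`. -/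
lemma essImage_boundedToInd_iff (Y : DerivedCategory (Ind C)) :
    (boundedToInd C).essImage Y ↔
      ((∃ a, Y.IsGE a) ∧ ∃ b, Y.IsLE b) ∧
        ∀ i, (Ind.yoneda (C := C)).essImage ((homologyFunctor _ i).obj Y) := by
  constructor
  · rintro ⟨⟨X, ⟨⟨a, ha⟩, ⟨b, hb⟩⟩⟩, ⟨e⟩⟩
    have ha' : X.IsGE a := ha
    have hb' : X.IsLE b := hb
    have h1 := isGE_map (Ind.yoneda (C := C)) X a
    have h2 := isLE_map (Ind.yoneda (C := C)) X b
    refine ⟨⟨⟨a, ?_⟩, ⟨b, ?_⟩⟩, fun i => ?_⟩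
    · exact TStructure.t.isGE_of_iso (show (Ind.yoneda (C := C)).mapDerivedCategory.obj X ≅ Y from e) a
    · exact TStructure.t.isLE_of_iso (show (Ind.yoneda (C := C)).mapDerivedCategory.obj X ≅ Y from e) b
    · obtain ⟨e'⟩ := nonempty_homology_map_iso (Ind.yoneda (C := C)) X i
      exact ⟨_, ⟨e'.symm ≪≫ (homologyFunctor _ i).mapIso e⟩⟩
  · rintro ⟨⟨⟨a, ha⟩, ⟨b, hb⟩⟩, h⟩
    obtain ⟨X, hX, ⟨e⟩⟩ := exists_bounded_iso (Ind.yoneda (C := C))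
      (fun p _ => exists_epi_of_epi p) Y a b ha hb h
    exact ⟨⟨X, hX⟩, ⟨e⟩⟩

lemma kComplex.isKInjective {K : CochainComplex (Ind C) ℤ} (h : kComplex C K) :
    K.IsKInjective := by
  obtain ⟨⟨a, ha⟩, hI, -, -⟩ := h
  exact CochainComplex.isKInjective_of_injective K a

lemma essImage_boundedToInd_Q {K : CochainComplex (Ind C) ℤ} (a b : ℤ)
    (ha : ∀ i, i < a → K.ExactAt i) (hb : ∀ i, b < i → K.ExactAt i)
    (h : ∀ i, (Ind.yoneda (C := C)).essImage (K.homology i)) :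
    (boundedToInd C).essImage (Q.obj K) := by
  have ha' : K.IsGE a := (CochainComplex.isGE_iff _ _).2 fun i hi => ha i hi
  have hb' : K.IsLE b := (CochainComplex.isLE_iff _ _).2 fun i hi => hb i hi
  refine (essImage_boundedToInd_iff _).2 ⟨⟨⟨a, inferInstance⟩, ⟨b, inferInstance⟩⟩, fun i => ?_⟩
  obtain ⟨X, ⟨e⟩⟩ := h i
  exact ⟨X, ⟨e ≪≫ ((homologyFunctorFactors (Ind C) i).app K).symm⟩⟩

lemma kComplex.essImage {K : CochainComplex (Ind C) ℤ} (h : kComplex C K) :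
    (boundedToInd C).essImage (Q.obj K) := by
  obtain ⟨⟨a, ha⟩, hI, h, ⟨b, hb⟩⟩ := h
  refine essImage_boundedToInd_Q a b (fun i hi => ?_) hb h
  exact ShortComplex.exact_of_isZero_X₂ _ (K.isZero_of_isStrictlyGE a i hi)

/-- A bounded below representative is replaced by a bounded below complex of injectives; the
conditions on cohomology do not depend on the representative. -/
lemma exists_kComplex_iso {Y : DerivedCategory (Ind C)} (hY : (boundedToInd C).essImage Y) :
    ∃ K : CochainComplex (Ind C) ℤ, kComplex C K ∧ Nonempty (Q.obj K ≅ Y) := by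
  obtain ⟨⟨⟨a, ha⟩, ⟨b, hb⟩⟩, h⟩ := (essImage_boundedToInd_iff _).1 hY
  obtain ⟨K, hK, ⟨e⟩⟩ := Y.exists_iso_Q_obj_of_isGE a
  obtain ⟨L, i, hi, hL, hL'⟩ := CochainComplex.Plus.modelCategoryQuillen.exists_quasiIso_injective K a
  have : IsIso (Q.map i) := (DerivedCategory.isIso_Q_map_iff_quasiIso _ i).2 hi
  let e' : Q.obj L ≅ Y := (asIso (Q.map i)).symm ≪≫ e.symm
  have hb' : (Q.obj L).IsLE b := TStructure.t.isLE_of_iso e'.symm b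
  have hb'' : L.IsLE b := (isLE_Q_obj_iff _ _).1 hb'
  refine ⟨L, ⟨⟨a, hL'⟩, hL, fun i => ?_, ⟨b, fun i hi => L.exactAt_of_isLE b i hi⟩⟩, ⟨e'⟩⟩
  obtain ⟨X, ⟨e''⟩⟩ := h i
  exact ⟨X, ⟨e'' ≪≫ (homologyFunctor _ i).mapIso e'.symm ≪≫
    (homologyFunctorFactors (Ind C) i).app L⟩⟩

variable (C)

/-- Bounded below complexes of injectives are K-injective, so homotopy classes into them are
morphisms of the derived category. -/
lemma FrakK.toDerived_map_bijective (X Y : FrakK C) :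
    Function.Bijective ((FrakK.toDerived C).map : (X ⟶ Y) → _) := by
  have := kComplex.isKInjective Y.property
  have h := CochainComplex.IsKInjective.Qh_map_bijective X.obj Y.obj.as
  exact h.comp ⟨fun f g h => by ext; exact h, fun f => ⟨⟨f⟩, rfl⟩⟩

instance : (FrakK.toDerived C).Full := ⟨fun f => (FrakK.toDerived_map_bijective C _ _).surjective f⟩

instance : (FrakK.toDerived C).Faithful :=
  ⟨fun h => (FrakK.toDerived_map_bijective C _ _).injective h⟩

variable {C}

/-- `𝔎` and `Dᵇ(C)` have the same essential image in the derived category of ind-objects. -/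
lemma essImage_toDerived_iff (Y : DerivedCategory (Ind C)) :
    (FrakK.toDerived C).essImage Y ↔ (boundedToInd C).essImage Y := by
  constructor
  · rintro ⟨X, ⟨e⟩⟩
    exact (boundedToInd C).essImage.prop_of_iso
      ((quotientCompQhIso (Ind C)).symm.app X.obj.as ≪≫ e) X.property.essImage
  · intro h
    obtain ⟨K, hK, ⟨e⟩⟩ := exists_kComplex_iso h
    exact ⟨(FrakK.quotient C).obj ⟨K, hK⟩, ⟨(quotientCompQhIso (Ind C)).app K ≪≫ e⟩⟩

variable (C)

/-- The canonical equivalence `Dᵇ(C) ≌ 𝔎`. -/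
lemma exists_bounded_equivalence : ∃ Φ : DerivedCategory.Bounded C ≌ FrakK C,
    Nonempty (Φ.functor ⋙ FrakK.toDerived C ≅ boundedToInd C) := by
  have h (X) : (FrakK.toDerived C).essImage ((boundedToInd C).obj X) :=
    (essImage_toDerived_iff _).2 ⟨X, ⟨Iso.refl _⟩⟩
  let Φ : DerivedCategory.Bounded C ⥤ FrakK C :=
    Functor.essImage.liftFunctor (boundedToInd C) (FrakK.toDerived C) h
  let e : Φ ⋙ FrakK.toDerived C ≅ boundedToInd C := Functor.essImage.liftFunctorCompIso _ _ h
  have : (Φ ⋙ FrakK.toDerived C).Full := Functor.Full.of_iso e.symm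
  have : (Φ ⋙ FrakK.toDerived C).Faithful := Functor.Faithful.of_iso e.symm
  have : Φ.Full := Functor.Full.of_comp_faithful Φ (FrakK.toDerived C)
  have : Φ.Faithful := Functor.Faithful.of_comp Φ (FrakK.toDerived C)
  have : Φ.EssSurj := ⟨fun Y => by
    obtain ⟨X, ⟨e'⟩⟩ := (essImage_toDerived_iff _).1 ⟨Y, ⟨Iso.refl ((FrakK.toDerived C).obj Y)⟩⟩
    exact ⟨X, ⟨(FrakK.toDerived C).preimageIso (e.app X ≪≫ e')⟩⟩⟩
  have : Φ.IsEquivalence := { }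
  exact ⟨Φ.asEquivalence, ⟨e⟩⟩

end BoundedInd

end

noncomputable section

open CategoryTheory Limits Pretriangulated

/-! ### Duality for a model of a spherical object -/

section SphericalModels

open DerivedCategory

variable {C : Type u} [SmallCategory C] [Abelian C]
  [HasDerivedCategory.{w} C] [HasDerivedCategory.{w'} (Ind C)]

lemma shiftedHomMap_derivedInd_bijective {X Y : DerivedCategory C} (hX : TStructure.t.bounded X)
    (hY : TStructure.t.bounded Y) {X' Y' : DerivedCategory (Ind C)}
    (α : X' ≅ (derivedInd C).obj X) (β : Y' ≅ (derivedInd C).obj Y) (i : ℤ) :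
    Function.Bijective (shiftedHomMap α β i) := by
  let e : ((derivedInd C).obj X ⟶ (derivedInd C).obj (Y⟦i⟧)) ≃ ShiftedHom X' Y' i :=
    Iso.homCongr α.symm ((Functor.commShiftIso (derivedInd C) i).app Y ≪≫
      (CategoryTheory.shiftFunctor _ i).mapIso β.symm)
  have h : (shiftedHomMap α β i : ShiftedHom X Y i → _) =
      e ∘ ((derivedInd C).map : (X ⟶ Y⟦i⟧) → _) := by
    funext f
    simp [shiftedHomMap_apply, e, Iso.homCongr, ShiftedHom.map]
  rw [h]
  exact e.bijective.comp (bijectiveOn_of_mem_bounded (Ind.yoneda (C := C))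
    (fun p _ => exists_epi_of_epi p) hX hY i)

variable {k : Type v} [Field k] [Linear k C] {n : ℤ} {E : DerivedCategory.Bounded C}
  (hE : IsGeneralizedSpherical k n E) (M : EquivariantModel k E)

lemma EquivariantModel.isKInjective : M.complex.IsKInjective := by
  obtain ⟨⟨a, ha⟩, -, hI⟩ := M.isBoundedInjective
  exact CochainComplex.isKInjective_of_injective M.complex a

include hE

lemma isSemisimpleRing_end : IsSemisimpleRing (End E.obj) := by
  obtain ⟨r, ⟨φ⟩⟩ := hE.end_iso
  exact φ.symm.toRingEquiv.isSemisimpleRing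

lemma isSemisimpleRing_alg : IsSemisimpleRing M.alg :=
  haveI := isSemisimpleRing_end hE
  M.equiv.symm.isSemisimpleRing

lemma isSemisimpleRing_alg_op : IsSemisimpleRing (M.alg)ᵐᵒᵖ :=
  haveI := isSemisimpleRing_alg hE M
  inferInstance

lemma isSphericalAction_model :
    IsSphericalAction (derivedAct M.alg.subtype) n := by
  have h : IsSphericalAction (E := E.obj) (fun a : M.alg => (M.equiv a : E.obj ⟶ E.obj)) n :=
    ⟨M.equiv.bijective, hE.hom_eq_zero⟩
  exact IsSphericalAction.map (G := derivedInd C) (M.iso :) h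
    (shiftedHomMap_derivedInd_bijective E.property E.property _ _)
    ((bijectiveOn_of_mem_bounded (Ind.yoneda (C := C)) (fun p _ => exists_epi_of_epi p)
      E.property E.property 0).of_iso (Iso.refl _) ((CategoryTheory.shiftFunctorZero _ ℤ).app _))
    M.equiv_spec

/-- The complex `X` represents an object `F` of `Dᵇ(C)`. The spherical conditions give duality for
`E` and `F`, and it is transported along the functor to `D(Ind C)`, which is bijective on graded
morphisms of bounded objects. -/
lemma isDualPair_model {X : CochainComplex (Ind C) ℤ} (hX : kComplex C X) :
    IsDualPair (derivedAct M.alg.subtype) n (Q.obj X) := by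
  obtain ⟨F, ⟨β⟩⟩ := hX.essImage
  obtain ⟨r, ⟨φ⟩⟩ := hE.end_iso
  obtain ⟨e, he⟩ := hE.hom_iso_left
  obtain ⟨e', he'⟩ := hE.hom_iso_right
  have := hE.finite_hom_from F
  have := hE.finite_hom_to F
  have h : IsDualPair (E := E.obj) (fun a : M.alg => (M.equiv a : E.obj ⟶ E.obj)) n F.obj :=
    isDualPair_of_nondegenerate M.equiv.surjective φ e he e' he' (hE.nondegenerate_left F)
      (hE.nondegenerate_right F)
  exact IsDualPair.map (G := derivedInd C) (M.iso :) (β.symm :) h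
    (shiftedHomMap_derivedInd_bijective E.property E.property _ _)
    (shiftedHomMap_derivedInd_bijective E.property F.property _ _)
    (shiftedHomMap_derivedInd_bijective F.property E.property _ _)
    M.equiv_spec

end SphericalModels

end

noncomputable section

open CategoryTheory Limits Pretriangulated CochainComplex.HomComplex

/-! ### Thick subcategories and finite tensor complexes -/

section Retracts

/-- The essential image of a fully faithful functor is closed under retracts if idempotents split
in its source. -/
lemma isStableUnderRetracts_essImage {C : Type u} [Category.{v} C] {D : Type u'} [Category.{v'} D]
    [IsIdempotentComplete C] (F : C ⥤ D) [F.Full] [F.Faithful] :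
    F.essImage.IsStableUnderRetracts where
  of_retract := by
    rintro X Y h ⟨Z, ⟨e⟩⟩
    let p : Z ⟶ Z := F.preimage (e.hom ≫ h.r ≫ h.i ≫ e.inv)
    have hp : p ≫ p = p := F.map_injective (by simp [p])
    obtain ⟨I, i, r, h1, h2⟩ := IsIdempotentComplete.idempotents_split Z p hp
    have h2' : F.map r ≫ F.map i = e.hom ≫ h.r ≫ h.i ≫ e.inv := by
      rw [← F.map_comp, h2, F.map_preimage]
    have h1' : F.map i ≫ F.map r = 𝟙 _ := by rw [← F.map_comp, h1, F.map_id]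
    refine ⟨I, ⟨⟨F.map i ≫ e.hom ≫ h.r, h.i ≫ e.inv ≫ F.map r, ?_, ?_⟩⟩⟩
    · have : F.map i ≫ (e.hom ≫ h.r ≫ h.i ≫ e.inv) ≫ F.map r = 𝟙 _ := by
        rw [← h2', Category.assoc, h1', Category.comp_id, h1']
      simpa using this
    · simp only [Category.assoc]
      rw [← Category.assoc (F.map r), h2']
      simp

variable {B : Type u'} [Category.{v'} B] [Preadditive B] [HasZeroObject B] [HasShift B ℤ]
  [∀ n : ℤ, (CategoryTheory.shiftFunctor B n).Additive] [Pretriangulated B]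

/-- A triangulated subcategory closed under retracts contains an object whose identity is a sum of
graded endomorphisms factoring through an object of the subcategory. -/
lemma prop_of_sum_comp (P : ObjectProperty B) [P.IsTriangulated] [P.IsClosedUnderIsomorphisms]
    [P.IsStableUnderRetracts] {κ : Type} [Fintype κ] {E L : B} (hE : P E) (d d' : κ → ℤ)
    (hd : ∀ b, d b + d' b = 0) (p : ∀ b, ShiftedHom L E (d' b)) (q : ∀ b, ShiftedHom E L (d b))
    (h : ∑ b, (p b).comp (q b) (hd b) = ShiftedHom.mk₀ (0 : ℤ) rfl (𝟙 L)) : P L := by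
  have := HasFiniteBiproducts.of_hasFiniteProducts (C := B)
  have hprod : P (⨁ fun b => E⟦d' b⟧) :=
    P.prop_of_iso (biproduct.isoProduct _).symm (P.prop_pi _ fun b => P.le_shift (d' b) _ hE)
  let f : L ⟶ ⨁ fun b => E⟦d' b⟧ := biproduct.lift p
  let g : (⨁ fun b => E⟦d' b⟧) ⟶ L := biproduct.desc fun b =>
    (q b)⟦d' b⟧' ≫ (CategoryTheory.shiftFunctorAdd' B _ _ (0 : ℤ) (hd b)).inv.app L ≫
      (CategoryTheory.shiftFunctorZero' B (0 : ℤ) rfl).hom.app L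
  refine P.prop_of_retract (Y := ⨁ fun b => E⟦d' b⟧) ⟨f, g, ?_⟩ hprod
  have h1 : f ≫ g = (∑ b, (p b).comp (q b) (hd b) : ShiftedHom L L (0 : ℤ)) ≫
      (CategoryTheory.shiftFunctorZero' B (0 : ℤ) rfl).hom.app L := by
    rw [biproduct.lift_desc, Preadditive.sum_comp]
    refine Finset.sum_congr rfl fun b _ => ?_
    simp [ShiftedHom.comp]
  rw [h1, h]
  simp [ShiftedHom.mk₀]

end Retracts

section FiniteTensor

variable {B : Type v} [Category.{u} B] [Abelian B] [HasCoproducts.{u} B]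
  [HasCountableCoproducts B] [HasProducts.{u} B] [HasCountableProducts B] {A : Type u} [Ring A]
  [IsSemisimpleRing A]
  {E : CochainComplex B ℤ} (ρ : A →+* End E)

lemma cochain_sum_v {K L : CochainComplex B ℤ} {κ : Type*} (T : Finset κ) {m : ℤ}
    (z : κ → Cochain K L m) (p q : ℤ) (hpq : p + m = q) :
    (∑ b ∈ T, z b).v p q hpq = ∑ b ∈ T, (z b).v p q hpq :=
  map_sum (AddMonoidHom.mk' (fun z : Cochain K L m => z.v p q hpq) fun _ _ => rfl) z T

lemma δ_finset_sum {K L : CochainComplex B ℤ} {κ : Type*} (T : Finset κ) {m m' : ℤ}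
    (z : κ → Cochain K L m) : δ m m' (∑ b ∈ T, z b) = ∑ b ∈ T, δ m m' (z b) :=
  map_sum (δ_hom ℤ K L m m') z T

/-- The map `r ↦ r` from `A` to the degree `0` endomorphisms of `E`. -/
def scalarCochain {M : ModuleCat.{u} Aᵐᵒᵖ} (f : M →ₗ[Aᵐᵒᵖ] Aᵐᵒᵖ) : M ⟶ (homFrom ρ E).X 0 :=
  letI := rightModule ρ E 0
  ModuleCat.ofHom (Y := Cochain E E 0)
    { toFun x := Cochain.ofHom (ρ (f x).unop)
      map_add' x y := by
        rw [map_add, MulOpposite.unop_add, map_add]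
        exact Cochain.ofHom_add _ _
      map_smul' r x := by
        rw [map_smul, smul_eq_mul, MulOpposite.unop_mul, map_mul]
        exact Cochain.ofHom_comp _ _ }

lemma scalarCochain_apply {M : ModuleCat.{u} Aᵐᵒᵖ} (f : M →ₗ[Aᵐᵒᵖ] Aᵐᵒᵖ) (x : M) :
    (scalarCochain ρ f).hom x = (show Cochain E E 0 from Cochain.ofHom (ρ (f x).unop)) := rfl

variable {Z : CochainComplex (ModuleCat.{u} Aᵐᵒᵖ) ℤ}

/-- The cochain `z ⊗ x ↦ f z x`, for a linear form `f` on the elements of degree `i`. -/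
def formCochain {i : ℤ} (f : Z.X i →ₗ[Aᵐᵒᵖ] Aᵐᵒᵖ) (m : ℤ) : Cochain (tensorComplex ρ Z) E m :=
  (tensorAdj ρ m).symm (Cochain.single (L := homFrom ρ E) (q := 0) (scalarCochain ρ f) m)

lemma δ_formCochain (hZ : ∀ i j, Z.d i j = 0) {i : ℤ} (f : Z.X i →ₗ[Aᵐᵒᵖ] Aᵐᵒᵖ) (m : ℤ) :
    δ m (m + 1) (formCochain ρ f m) = 0 := by
  refine (tensorAdj ρ (m + 1)).injective ?_
  rw [← δ_tensorAdj, map_zero, formCochain, AddEquiv.apply_symm_apply,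
    Cochain.δ_single _ m (m + 1) rfl (i - 1) 1 (by lia) rfl, hZ, zero_comp]
  have h : scalarCochain ρ f ≫ (homFrom ρ E).d 0 1 = 0 := by
    ext x
    exact δ_ofHom (ρ (f x).unop)
  rw [h]
  ext p q hpq : 1
  simp [Cochain.single]

lemma tensorElt_formCochain {i m : ℤ} (h : i + m = 0) (f : Z.X i →ₗ[Aᵐᵒᵖ] Aᵐᵒᵖ) (j n : ℤ)
    (hn : i + j = n) (z : Z.X i) :
    tensorElt ρ Z i j n hn z ≫ (formCochain ρ f m).v n j (by lia) = act ρ j (f z).unop := by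
  refine (tensorElt_tensorAdjInv ρ _ i j n j (by lia) hn z).trans ?_
  have h1 (l : ℤ) (hl : i + m = l) (hl0 : 0 = l) (h' : j + l = j) :
      (homFromElt ρ (Cochain.single (L := homFrom ρ E) (scalarCochain ρ f) m) i l hl z).v j j h' =
        act ρ j (f z).unop := by
    subst hl0
    rw [homFromElt, Cochain.single_v, scalarCochain_apply]
    exact Cochain.ofHom_v _ _
  exact h1 _ rfl h.symm _

lemma tensorElt_formCochain_of_ne {i m : ℤ} (f : Z.X i →ₗ[Aᵐᵒᵖ] Aᵐᵒᵖ) (i' j n j' : ℤ)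
    (hn : i' + j = n) (hm : n + m = j') (hi : i' ≠ i) (z : Z.X i') :
    tensorElt ρ Z i' j n hn z ≫ (formCochain ρ f m).v n j' hm = 0 := by
  refine (tensorElt_tensorAdjInv ρ _ i' j n j' hm hn z).trans ?_
  have h1 : (Cochain.single (L := homFrom ρ E) (scalarCochain ρ f) m).v i' (i' + m) rfl = 0 :=
    Cochain.single_v_eq_zero _ _ _ _ _ hi
  rw [homFromElt, h1]
  rfl

/-- If `Z` is finite with zero differential, the identity of `Z ⊗_A E` is a sum of morphisms which
factor through shifts of `E`. -/
lemma sum_formCochain_comp_tensorEltCochain (S : Finset ℤ) (hS : ∀ i ∉ S, ∀ z : Z.X i, z = 0)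
    (ν : ℤ → ℕ) (x : ∀ i, Fin (ν i) → Z.X i) (f : ∀ i, Fin (ν i) → (Z.X i →ₗ[Aᵐᵒᵖ] Aᵐᵒᵖ))
    (hx : ∀ i y, y = ∑ s, f i s y • x i s) :
    ∑ b : (i : S) × Fin (ν i), (formCochain ρ (f b.1 b.2) (-b.1)).comp
      (tensorEltCochain ρ (x b.1 b.2)) (neg_add_cancel _) =
      Cochain.ofHom (𝟙 (tensorComplex ρ Z)) := by
  ext n : 1
  refine tensorX_hom_ext fun i j hij z => ?_
  let t : E.X j ⟶ (tensorComplex ρ Z).X n := tensorElt ρ Z i j n hij z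
  change t ≫ _ = t ≫ _
  rw [cochain_sum_v, Preadditive.comp_sum, Fintype.sum_sigma, Cochain.ofHom_v]
  have h0 (i' : S) (s : Fin (ν i')) (hi : i ≠ i') : t ≫
      ((formCochain ρ (f i' s) (-i')).comp (tensorEltCochain ρ (x i' s))
        (neg_add_cancel (i' : ℤ))).v n n (add_zero n) = 0 := by
    rw [Cochain.comp_v _ _ _ n (n - i') n (by lia) (by lia), ← Category.assoc]
    exact (congrArg (fun t => t ≫ _) (tensorElt_formCochain_of_ne ρ _ _ _ _ _ _ _ hi _)).trans
      zero_comp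
  by_cases hi : i ∈ S
  · rw [Finset.sum_eq_single (⟨i, hi⟩ : S)
      (fun i' _ hi' => Finset.sum_eq_zero fun s _ => h0 i' s fun h => hi' (Subtype.ext h.symm))
      (fun h => absurd (Finset.mem_univ _) h)]
    refine Eq.trans ?_ (Category.comp_id _).symm
    change _ = tensorElt ρ Z i j n hij z
    conv_rhs => rw [hx i z, tensorElt_sum]
    refine Finset.sum_congr rfl fun s _ => ?_
    rw [Cochain.comp_v _ _ _ n j n (by lia) (by lia), ← Category.assoc]
    refine (congrArg (fun t => t ≫ _)
      (tensorElt_formCochain ρ (by lia) (f i s) j n hij z)).trans ?_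
    exact (tensorElt_smul ρ Z i j n hij (f i s z).unop (x i s)).symm
  · have h1 : t = 0 := by
      change tensorElt ρ Z i j n hij z = 0
      rw [hS i hi z, tensorElt_zero]
    simp [h1]

variable [HasDerivedCategory.{w} B]

lemma cocycleClass_sum {K L : CochainComplex B ℤ} {κ : Type*} (T : Finset κ) {m : ℤ}
    (z : κ → Cochain K L m) (hz : ∀ b, δ m (m + 1) (z b) = 0) :
    cocycleClass (∑ b ∈ T, z b) (by
      rw [δ_finset_sum]; exact Finset.sum_eq_zero fun b _ => hz b) =
      ∑ b ∈ T, cocycleClass (z b) (hz b) := by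
  classical
  induction T using Finset.induction_on with
  | empty =>
    have h : cocycleClass (0 : Cochain K L m) (δ_zero _ _) = 0 := by
      have h := cocycleClass_add (0 : Cochain K L m) 0 (δ_zero _ _) (δ_zero _ _)
      simpa using h
    simpa using h
  | insert a s ha ih =>
    simp only [Finset.sum_insert ha]
    rw [← ih]
    exact cocycleClass_add _ _ _ _

/-- If `V` has finite cohomology then `V ⊗_A E` lies in the thick subcategory generated
by `E`. -/
lemma prop_Q_tensorComplex (P : ObjectProperty (DerivedCategory B)) [P.IsTriangulated]
    [P.IsClosedUnderIsomorphisms] [P.IsStableUnderRetracts] (hE : P (DerivedCategory.Q.obj E))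
    (hZ : ∀ i j, Z.d i j = 0) (hf : ∀ i, Module.Finite Aᵐᵒᵖ (Z.X i)) (S : Finset ℤ)
    (hS : ∀ i ∉ S, ∀ z : Z.X i, z = 0) : P (DerivedCategory.Q.obj (tensorComplex ρ Z)) := by
  have H (i : ℤ) := exists_dualBasis (R := Aᵐᵒᵖ) (Z.X i)
  choose ν x f hx using H
  have h1 (b : (i : S) × Fin (ν i)) := δ_formCochain ρ hZ (f b.1 b.2) (-b.1)
  have h2 (b : (i : S) × Fin (ν i)) :
      δ (b.1 : ℤ) (b.1 + 1) (tensorEltCochain ρ (x b.1 b.2)) = 0 := by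
    rw [δ_tensorEltCochain ρ rfl, hZ]
    ext p q hpq : 1
    exact tensorElt_zero ρ Z _ _ _ _
  -- A dual basis writes the identity of `Z ⊗_A E` as a sum of morphisms through shifts of `E`, so
  -- `Z ⊗_A E` is a retract of a finite sum of such shifts.
  refine prop_of_sum_comp P hE (fun b : (i : S) × Fin (ν i) => (b.1 : ℤ)) (fun b => -b.1)
    (fun b => add_neg_cancel _) (fun b => cocycleClass _ (h1 b)) (fun b => cocycleClass _ (h2 b)) ?_
  have h3 (b : (i : S) × Fin (ν i)) : δ 0 (0 + 1) ((formCochain ρ (f b.1 b.2) (-b.1)).comp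
      (tensorEltCochain ρ (x b.1 b.2)) (neg_add_cancel _)) = 0 := by
    rw [δ_comp _ _ (neg_add_cancel (b.1 : ℤ)) (-b.1 + 1) (b.1 + 1) (0 + 1) rfl rfl rfl, h1, h2]
    simp
  have h4 := cocycleClass_sum Finset.univ _ h3
  refine Eq.trans ?_ (h4.symm.trans ?_)
  · exact Finset.sum_congr rfl fun b _ => (cocycleClass_comp _ _ _ (h1 b) (h2 b)).symm
  · have h5 := sum_formCochain_comp_tensorEltCochain ρ S hS ν x f hx
    have h6 := cocycleClass_ofHom (𝟙 (tensorComplex ρ Z))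
    rw [CategoryTheory.Functor.map_id] at h6
    rw [← h6]
    congr 1

end FiniteTensor

end

noncomputable section

open CategoryTheory Limits Pretriangulated CochainComplex.HomComplex

/-! ### The twists preserve the objects of `𝔎` -/

section InjectiveLin

variable {B : Type v} [Category.{u} B] [Abelian B] [HasCoproducts.{u} B]
  [HasCountableCoproducts B] [HasProducts.{u} B] [HasCountableProducts B] {A : Type u} [Ring A]

/-- Linear maps from a projective module to an injective object form an injective object. -/
lemma injective_linObj {E : CochainComplex B ℤ} (ρ : A →+* End E) (j : ℤ) [Injective (E.X j)]
    (M : ModuleCat.{u} A) [Module.Projective A M] : Injective (linObj M (act ρ j)) where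
  factors {Y Z} g f _ := by
    obtain ⟨s, hs⟩ := Module.projective_def'.1 (inferInstance : Module.Projective A M)
    let h (m : M) : Z ⟶ E.X j := Injective.factorThru (g ≫ linπ M (act ρ j) m) f
    have hh (m : M) : f ≫ h m = g ≫ linπ M (act ρ j) m := Injective.comp_factorThru _ _
    -- The extensions `h m` are chosen separately for each `m` and need not be linear in `m`.
    -- Writing `m` in the free module on the set `M` through a section `s` makes the resulting
    -- family linear.
    let t (m : M) : Z ⟶ E.X j := (s m).sum fun b a => h b ≫ act ρ j a
    have hsum (x : M →₀ A) : f ≫ (x.sum fun b a => h b ≫ act ρ j a) =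
        g ≫ linπ M (act ρ j) (x.sum fun b a => a • b) := by
      induction x using Finsupp.induction_linear with
      | zero =>
        have : linπ M (act ρ j) 0 = 0 := by simpa using linπ_add M (act ρ j) 0 0
        simp [this]
      | add x y hx hy =>
        rw [Finsupp.sum_add_index', Finsupp.sum_add_index', Preadditive.comp_add, hx, hy, linπ_add,
          Preadditive.comp_add]
        · simp
        · simp [add_smul]
        · simp [act_zero]
        · simp [act_add]
      | single b a =>
        rw [Finsupp.sum_single_index (by simp [act_zero]), Finsupp.sum_single_index (by simp),
          linπ_smul, ← Category.assoc, hh, Category.assoc]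
    refine ⟨linLift M (act ρ j) t (fun m m' => ?_) (fun a m => ?_), lin_hom_ext fun m => ?_⟩
    · change (s (m + m')).sum _ = _
      rw [map_add]
      exact Finsupp.sum_add_index' (by simp [act_zero]) (by simp [act_add])
    · change (s (a • m)).sum _ = _
      rw [map_smul, Finsupp.sum_smul_index' (by simp [act_zero])]
      simp only [t, Finsupp.sum, Preadditive.sum_comp, Category.assoc, smul_eq_mul, act_mul]
    · rw [Category.assoc, linLift_π]
      refine (hsum (s m)).trans ?_
      congr 2
      exact LinearMap.congr_fun hs m

variable [IsSemisimpleRing A] {E : CochainComplex B ℤ} (ρ : A →+* End E)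
  (W : CochainComplex (ModuleCat.{u} A) ℤ)

lemma injective_linX [∀ j, Injective (E.X j)] (n : ℤ) : Injective (linX ρ W n) := by
  have (p : {p : ℤ × ℤ // p.1 + n = p.2}) : Injective (linObj (W.X p.1.1) (act ρ p.1.2)) :=
    have := Module.projective_of_isSemisimpleRing A (W.X p.1.1)
    injective_linObj ρ _ _
  infer_instance

lemma isZero_linX (n : ℤ) (h : ∀ i j, i + n = j → (∀ w : W.X i, w = 0) ∨ IsZero (E.X j)) :
    IsZero (linX ρ W n) := by
  rw [IsZero.iff_id_eq_zero]
  refine linX_hom_ext fun i j hij w => ?_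
  obtain h | h := h i j hij
  · rw [h w, linElt_zero, comp_zero, comp_zero]
  · exact h.eq_of_tgt _ _

lemma injective_dualTwist_X [∀ j, Injective (E.X j)] (X : CochainComplex B ℤ)
    [∀ j, Injective (X.X j)] (m : ℤ) : Injective (((dualTwist ρ).obj X).X m) := by
  have : Injective ((linComplex ρ (homTo ρ X)).X (m + -1)) := injective_linX ρ _ _
  exact Injective.of_iso
    (HomologicalComplex.homotopyCofiber.XIsoBiprod (coevaluation ρ X) (m + -1) (m + -1 + 1) rfl).symm
    inferInstance

lemma exists_isStrictlyGE_dualTwist (X : CochainComplex B ℤ) (a b c : ℤ) [X.IsStrictlyGE a]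
    [E.IsStrictlyGE c] [E.IsStrictlyLE b] : ∃ d : ℤ, ((dualTwist ρ).obj X).IsStrictlyGE d := by
  -- A nonzero `lin_A(Wⁱ, Eʲ)` requires `j ≥ c` and `i ≤ b - a`, so it contributes only in degrees
  -- `j - i ≥ c - b + a`.
  refine ⟨min a (c - b + a), (CochainComplex.isStrictlyGE_iff _ _).2 fun m hm => ?_⟩
  have h1 : IsZero ((linComplex ρ (homTo ρ X)).X (m + -1)) := by
    refine isZero_linX ρ _ _ fun i j hij => ?_
    obtain hj | hj := lt_or_ge j c
    · exact Or.inr (E.isZero_of_isStrictlyGE c j hj)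
    · refine Or.inl fun (φ : Cochain X E i) => ?_
      refine (Cochain.ext _ _ fun p q hpq => ?_ : φ = 0)
      obtain hp | hp := lt_or_ge p a
      · exact (X.isZero_of_isStrictlyGE a p hp).eq_of_src _ _
      · exact (E.isZero_of_isStrictlyLE b q (by omega)).eq_of_tgt _ _
  have h2 : IsZero (X.X (m + -1 + 1)) := X.isZero_of_isStrictlyGE a _ (by omega)
  exact (CochainComplex.mappingCone.isZero_X_iff (coevaluation ρ X) (m + -1)).2 ⟨h2, h1⟩

end InjectiveLin

section ThickSubcategory

variable {B : Type v} [Category.{u} B] [Abelian B] [HasCoproducts.{u} B]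
  [HasCountableCoproducts B] [HasProducts.{u} B] [HasCountableProducts B] {A : Type u} [Ring A]
  {E : CochainComplex B ℤ} (ρ : A →+* End E)
  [HasDerivedCategory.{w} B] (P : ObjectProperty (DerivedCategory B)) [P.IsTriangulated]
  [P.IsClosedUnderIsomorphisms]

lemma prop_Q_mappingCone {K L : CochainComplex B ℤ} (f : K ⟶ L) (hK : P (DerivedCategory.Q.obj K))
    (hL : P (DerivedCategory.Q.obj L)) :
    P (DerivedCategory.Q.obj (CochainComplex.mappingCone f)) :=
  P.ext_of_isTriangulatedClosed₃ _ (DerivedCategory.mappingCone_triangle_distinguished f) hK hL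

lemma prop_Q_mappingCocone {K L : CochainComplex B ℤ} (f : K ⟶ L)
    (hK : P (DerivedCategory.Q.obj K)) (hL : P (DerivedCategory.Q.obj L)) :
    P (DerivedCategory.Q.obj (CochainComplex.mappingCocone f)) :=
  P.ext_of_isTriangulatedClosed₁ _ (DerivedCategory.mappingCocone_triangle_distinguished f) hK hL

variable [P.IsStableUnderRetracts]

lemma prop_Q_tensorComplex_of_finiteCohomology [IsSemisimpleRing Aᵐᵒᵖ] [IsSemisimpleRing A]
    (hE : P (DerivedCategory.Q.obj E))
    {V : CochainComplex (ModuleCat.{u} Aᵐᵒᵖ) ℤ} (h : FiniteCohomology V) :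
    P (DerivedCategory.Q.obj (tensorComplex ρ V)) := by
  obtain ⟨Z, s, S, hs, hZ, hf, hS⟩ := h.exists_quasiIso
  have := quasiIso_tensorComplexMap ρ s
  have : IsIso (DerivedCategory.Q.map (tensorComplexMap ρ s)) :=
    (DerivedCategory.isIso_Q_map_iff_quasiIso _ _).2 inferInstance
  exact P.prop_of_iso (asIso (DerivedCategory.Q.map (tensorComplexMap ρ s)))
    (prop_Q_tensorComplex ρ P hE hZ hf S hS)

/-- After replacing `W` by a finite complex with zero differential, the contraction identifies the
lin complex, shifted by `-1`, with a finite tensor complex. -/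
lemma prop_Q_linComplex_of_finiteCohomology [IsSemisimpleRing Aᵐᵒᵖ] [IsSemisimpleRing A]
    (hE : P (DerivedCategory.Q.obj E))
    {W : CochainComplex (ModuleCat.{u} A) ℤ} (h : FiniteCohomology W) :
    P (DerivedCategory.Q.obj (linComplex ρ W)) := by
  obtain ⟨Z, s, S, hs, hZ, hf, hS⟩ := h.exists_quasiIso
  obtain ⟨b⟩ := nonempty_dualBases hf S hS
  have h1 : P (DerivedCategory.Q.obj (tensorComplex ρ (dualComplex Aᵐᵒᵖ A Z))) := by
    refine prop_Q_tensorComplex ρ P hE (fun i j => ?_) (fun i => ?_) b.S b.left_zero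
    · ext ξ
      refine dual_ext (i := 1 - j) (by lia) fun w => ?_
      have h0 : dualEval (S := Aᵐᵒᵖ) (B₀ := A) (i := 1 - i) (by lia) ξ
          ((Z.d (1 - j) (1 - i)).hom w) = 0 := by
        rw [hZ]
        exact map_zero _
      refine (dualEval_d (i' := 1 - i) (by lia) (by lia) ξ w).trans ?_
      rw [h0, smul_zero]
      rfl
    · classical
      refine ⟨⟨Finset.univ.image (b.left i), ?_⟩⟩
      rw [eq_top_iff]
      intro x _
      rw [b.left_eq i (1 - i) (by lia) x]
      exact Submodule.sum_mem _ fun s _ => Submodule.smul_mem _ _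
        (Submodule.subset_span (by simp))
  have := quasiIso_contractionHom_of_dualBases ρ (dualPairing Z) b
  have h2 : IsIso (DerivedCategory.Q.map (contractionHom ρ (dualPairing Z))) :=
    (DerivedCategory.isIso_Q_map_iff_quasiIso _ _).2 inferInstance
  have h3 : P (DerivedCategory.Q.obj ((linComplex ρ Z)⟦(-1 : ℤ)⟧)) :=
    P.prop_of_iso (asIso (DerivedCategory.Q.map (contractionHom ρ (dualPairing Z)))) h1
  have h4 : P ((DerivedCategory.Q.obj (linComplex ρ Z))⟦(-1 : ℤ)⟧) :=
    P.prop_of_iso ((DerivedCategory.Q.commShiftIso (-1 : ℤ)).app _) h3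
  have h5 : P (DerivedCategory.Q.obj (linComplex ρ Z)) :=
    P.prop_of_iso ((CategoryTheory.shiftFunctorCompIsoId (DerivedCategory B) (-1 : ℤ) 1 (by lia)).app _)
      (P.le_shift (1 : ℤ) _ h4)
  have := quasiIso_linComplexMap ρ s
  have : IsIso (DerivedCategory.Q.map (linComplexMap ρ s)) :=
    (DerivedCategory.isIso_Q_map_iff_quasiIso _ _).2 inferInstance
  exact P.prop_of_iso (asIso (DerivedCategory.Q.map (linComplexMap ρ s))).symm h5

end ThickSubcategory

section Models

variable {C : Type u} [SmallCategory C] [Abelian C]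
  [HasDerivedCategory.{w} C] [HasDerivedCategory.{w'} (Ind C)]

/-- The cohomology of a retract is a retract of the cohomology. Idempotents split in the abelian
category `C`, so retracts in `Ind C` of objects of `C` lie in `C`. -/
instance : (boundedToInd C).essImage.IsStableUnderRetracts where
  of_retract {X Y} h hY := by
    obtain ⟨⟨⟨a, ha⟩, ⟨b, hb⟩⟩, hY⟩ := (essImage_boundedToInd_iff Y).1 hY
    have hr (i : ℤ) : Retract ((DerivedCategory.homologyFunctor _ i).obj X)
        ((DerivedCategory.homologyFunctor _ i).obj Y) := h.map _
    have := isStableUnderRetracts_essImage (Ind.yoneda (C := C))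
    refine (essImage_boundedToInd_iff X).2 ⟨⟨⟨a, ?_⟩, ⟨b, ?_⟩⟩, fun i =>
      (Ind.yoneda (C := C)).essImage.prop_of_retract (hr i) (hY i)⟩
    · exact (DerivedCategory.isGE_iff _ _).2 fun i hi =>
        (DerivedCategory.isZero_of_isGE Y a i hi).of_mono (hr i).i
    · exact (DerivedCategory.isLE_iff _ _).2 fun i hi =>
        (DerivedCategory.isZero_of_isLE Y b i hi).of_mono (hr i).i

variable {k : Type v} [Field k] [Linear k C] {n : ℤ} {E : DerivedCategory.Bounded C}
  (hE : IsGeneralizedSpherical k n E) (M : EquivariantModel k E)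

include hE

lemma finiteCohomology_homFrom_model {X : CochainComplex (Ind C) ℤ} (hX : kComplex C X) :
    FiniteCohomology (homFrom M.alg.subtype X) :=
  haveI := hX.isKInjective
  (isDualPair_model hE M hX).finiteCohomology_homFrom

lemma finiteCohomology_homTo_model {X : CochainComplex (Ind C) ℤ} (hX : kComplex C X) :
    FiniteCohomology (homTo M.alg.subtype X) :=
  haveI := M.isKInjective
  (isDualPair_model hE M hX).finiteCohomology_homTo

/-- Finite cohomology puts `Hom(E, X) ⊗_A E` into the thick subcategory generated by `E`, and the
twist is a cone of a map from it to `X`. -/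
lemma essImage_twist {X : CochainComplex (Ind C) ℤ} (hX : kComplex C X) :
    (boundedToInd C).essImage (DerivedCategory.Q.obj ((twist M.alg.subtype).obj X)) := by
  have := isSemisimpleRing_alg hE M
  have := isSemisimpleRing_alg_op hE M
  exact prop_Q_mappingCone _ _ (prop_Q_tensorComplex_of_finiteCohomology _ _ ⟨E, ⟨M.iso.symm⟩⟩
    (finiteCohomology_homFrom_model hE M hX)) hX.essImage

/-- The dual twist functor preserves the objects of `𝔎`. -/
lemma kComplex_dualTwist {X : CochainComplex (Ind C) ℤ} (hX : kComplex C X) :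
    kComplex C ((dualTwist M.alg.subtype).obj X) := by
  have := isSemisimpleRing_alg hE M
  have := isSemisimpleRing_alg_op hE M
  have h1 : (boundedToInd C).essImage (DerivedCategory.Q.obj ((dualTwist M.alg.subtype).obj X)) :=
    prop_Q_mappingCocone _ _ hX.essImage (prop_Q_linComplex_of_finiteCohomology _ _
      ⟨E, ⟨M.iso.symm⟩⟩ (finiteCohomology_homTo_model hE M hX))
  obtain ⟨⟨-, ⟨b, hb⟩⟩, hY⟩ := (essImage_boundedToInd_iff _).1 h1
  obtain ⟨⟨a, ha⟩, hI, -, -⟩ := hX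
  obtain ⟨⟨c, hc⟩, ⟨d, hd⟩, hI'⟩ := M.isBoundedInjective
  have hb' := (DerivedCategory.isLE_Q_obj_iff _ _).1 hb
  -- The dual twist stays in `𝔎` without an injective replacement: linear maps from a projective
  -- module to an injective object form an injective object, and products of injectives are
  -- injective.
  refine ⟨exists_isStrictlyGE_dualTwist _ X a d c, injective_dualTwist_X _ X, fun i => ?_,
    ⟨b, fun i hi => CochainComplex.exactAt_of_isLE _ b i hi⟩⟩
  obtain ⟨Y, ⟨e⟩⟩ := hY i
  exact ⟨Y, ⟨e ≪≫ (DerivedCategory.homologyFunctorFactors (Ind C) i).app _⟩⟩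

end Models

end

noncomputable section

open CategoryTheory Limits Pretriangulated CochainComplex.HomComplex

/-! ### Invariance of the twists under equivalences of complexes -/

section HomInvariance

variable {B : Type v} [Category.{u} B] [Abelian B] {A : Type u} [Ring A]
  {E : CochainComplex B ℤ} (ρ : A →+* End E) {X Y : CochainComplex B ℤ}

lemma exists_comp_eq_of_homotopy {f g : X ⟶ Y} (h : Homotopy f g) {i j l : ℤ} (hij : i + 1 = j)
    (φ : Cochain E X j) (hφ : δ j l φ = 0) (hl : j + 1 = l) : ∃ ψ : Cochain E Y i,
      φ.comp (Cochain.ofHom f) (add_zero j) = δ i j ψ + φ.comp (Cochain.ofHom g) (add_zero j) := by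
  obtain ⟨α, hα⟩ := Cochain.equivHomotopy f g h
  have hi : j + -1 = i := by lia
  refine ⟨φ.comp α hi, ?_⟩
  rw [δ_comp φ α hi l 0 j hij hl (by lia), hφ, hα, Cochain.comp_add]
  simp

lemma quasiIso_homFromMap_of_homotopyEquiv (e : HomotopyEquiv X Y) :
    QuasiIso (homFromMap ρ e.hom) := by
  refine quasiIso_of_apply _ ?_ ?_
  · intro i j l hij hjl (φ : Cochain E X j) (y : Cochain E Y i) hφ hy
    have hφ' : δ j l φ = 0 := hφ
    have hy' : δ i j y = φ.comp (Cochain.ofHom e.hom) (add_zero j) := hy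
    obtain ⟨ψ, hψ⟩ := exists_comp_eq_of_homotopy e.homotopyHomInvId hij φ hφ' hjl
    refine ⟨(y.comp (Cochain.ofHom e.inv) (add_zero i) - ψ : Cochain E X i), ?_⟩
    change δ i j (y.comp (Cochain.ofHom e.inv) (add_zero i) - ψ) = φ
    rw [δ_sub, δ_comp_ofHom, hy', sub_eq_iff_eq_add, Cochain.comp_assoc_of_third_is_zero_cochain,
      ← Cochain.ofHom_comp, hψ, Cochain.comp_id, add_comm]
  · intro i j l hij hjl (φ : Cochain E Y j) hφ
    have hφ' : δ j l φ = 0 := hφ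
    obtain ⟨ψ, hψ⟩ := exists_comp_eq_of_homotopy e.homotopyInvHomId hij φ hφ' hjl
    refine ⟨(φ.comp (Cochain.ofHom e.inv) (add_zero j) : Cochain E X j), (-ψ : Cochain E Y i),
      ?_, ?_⟩
    · change δ j l (φ.comp (Cochain.ofHom e.inv) (add_zero j)) = 0
      rw [δ_comp_ofHom, hφ', Cochain.zero_comp]
    · change (φ.comp (Cochain.ofHom e.inv) (add_zero j)).comp (Cochain.ofHom e.hom) (add_zero j) +
        δ i j (-ψ) = φ
      rw [Cochain.comp_assoc_of_third_is_zero_cochain, ← Cochain.ofHom_comp, hψ, Cochain.comp_id,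
        δ_neg]
      abel

lemma cocycleClass_ofHom_comp [HasDerivedCategory.{w} B] (f : X ⟶ Y) {j : ℤ} (φ : Cochain Y E j)
    (hφ : δ j (j + 1) φ = 0)
    (h : δ j (j + 1) ((Cochain.ofHom f).comp φ (zero_add j)) = 0) :
    cocycleClass ((Cochain.ofHom f).comp φ (zero_add j)) h =
      DerivedCategory.Q.map f ≫ cocycleClass φ hφ :=
  (cocycleClass_comp (zero_add j) (Cochain.ofHom f) φ (δ_ofHom f) hφ).trans (by
    rw [cocycleClass_ofHom, ShiftedHom.mk₀_comp])

/-- Since `E` is K-injective, the cohomology of `Hom(X, E)` consists of morphisms in the derived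
category, where `f` is invertible. Nothing is required of `X` and `Y`. -/
lemma quasiIso_homToMap [E.IsKInjective] (f : X ⟶ Y) [QuasiIso f] : QuasiIso (homToMap ρ f) := by
  let := HasDerivedCategory.standard B
  have hf : IsIso (DerivedCategory.Q.map f) := inferInstance
  refine quasiIso_of_apply _ ?_ ?_
  · rintro i j l hij rfl (φ : Cochain Y E j) (y : Cochain X E i) hφ hy
    have hφ' : δ j (j + 1) φ = 0 := hφ
    have hy' : δ i j y = (Cochain.ofHom f).comp φ (zero_add j) := hy
    have h0 : δ j (j + 1) ((Cochain.ofHom f).comp φ (zero_add j)) = 0 := by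
      rw [← hy', δ_δ]
    have h1 := (cocycleClass_eq_zero_iff _ h0 i hij).2 ⟨y, hy'⟩
    rw [cocycleClass_ofHom_comp f φ hφ' h0] at h1
    exact (cocycleClass_eq_zero_iff _ hφ' i hij).1
      ((cancel_epi (DerivedCategory.Q.map f)).1 (h1.trans comp_zero.symm))
  · rintro i j l hij rfl (φ : Cochain X E j) hφ
    have hφ' : δ j (j + 1) φ = 0 := hφ
    obtain ⟨z, hz, h1⟩ := cocycleClass_surjective (inv (DerivedCategory.Q.map f) ≫
      cocycleClass φ hφ')
    have h0 : δ j (j + 1) ((Cochain.ofHom f).comp z (zero_add j)) = 0 := by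
      rw [δ_ofHom_comp, hz, Cochain.comp_zero]
    have hn : δ j (j + 1) (-((Cochain.ofHom f).comp z (zero_add j))) = 0 := by
      rw [δ_neg, h0, neg_zero]
    have h2 : cocycleClass _ h0 = cocycleClass φ hφ' := by
      rw [cocycleClass_ofHom_comp f z hz h0, h1, IsIso.hom_inv_id_assoc]
    have h3 : cocycleClass _ h0 + cocycleClass _ hn = 0 := by
      rw [← cocycleClass_add]
      exact (cocycleClass_eq_zero_iff _ _ i hij).2 ⟨0, by rw [δ_zero, add_neg_cancel]⟩
    have h4 : cocycleClass (φ + -((Cochain.ofHom f).comp z (zero_add j)))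
        (by rw [δ_add, hφ', hn, add_zero]) = 0 := by
      rw [cocycleClass_add _ _ hφ' hn, ← h2, h3]
    obtain ⟨y, hy⟩ := (cocycleClass_eq_zero_iff _ _ i hij).1 h4
    refine ⟨z, y, hz, ?_⟩
    change (Cochain.ofHom f).comp z (zero_add j) + δ i j y = φ
    rw [hy]
    abel

variable [HasCoproducts.{u} B] [HasCountableCoproducts B] [HasProducts.{u} B]
  [HasCountableProducts B] [IsSemisimpleRing A] [IsSemisimpleRing Aᵐᵒᵖ] [HasDerivedCategory.{w} B]

/-- The functor `Hom(E, -)` need not preserve quasi-isomorphisms between arbitrary complexes;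
inverting homotopy equivalences is enough for a functor on `𝔎`. -/
lemma homotopyEquivalences_isInvertedBy_twist :
    (HomologicalComplex.homotopyEquivalences B (ComplexShape.up ℤ)).IsInvertedBy
      (twist ρ ⋙ DerivedCategory.Q) := by
  rintro X Y f ⟨e, rfl⟩
  have := quasiIso_homFromMap_of_homotopyEquiv ρ e
  have := quasiIso_tensorComplexMap ρ (homFromMap ρ e.hom)
  have : QuasiIso ((twist ρ).map e.hom) := by
    have h : QuasiIso e.hom := inferInstance
    exact quasiIso_mappingCone_map _ _ _ _ (evaluation_naturality ρ e.hom)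
  exact (DerivedCategory.isIso_Q_map_iff_quasiIso _ _).2 this

/-- The dual twist descends to the whole derived category, so it can be applied to `T X` even when
the complex `T X` does not consist of injectives. -/
lemma quasiIso_isInvertedBy_dualTwist [E.IsKInjective] :
    (HomologicalComplex.quasiIso B (ComplexShape.up ℤ)).IsInvertedBy
      (dualTwist ρ ⋙ DerivedCategory.Q) := by
  intro X Y f hf
  have : QuasiIso f := hf
  have := quasiIso_homToMap ρ f
  have := quasiIso_linComplexMap ρ (homToMap ρ f)
  have h : QuasiIso (CochainComplex.mappingCone.map _ _ f (linComplexMap ρ (homToMap ρ f))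
    (coevaluation_naturality ρ f)) := quasiIso_mappingCone_map _ _ _ _ _
  have : QuasiIso ((dualTwist ρ).map f) := by
    change QuasiIso ((CochainComplex.mappingCone.map _ _ f (linComplexMap ρ (homToMap ρ f))
      (coevaluation_naturality ρ f))⟦(-1 : ℤ)⟧')
    infer_instance
  exact (DerivedCategory.isIso_Q_map_iff_quasiIso _ _).2 this

end HomInvariance

end

noncomputable section

open CategoryTheory Limits Pretriangulated

/-! ### The twists as functors on `𝔎` and on `Dᵇ(C)` -/

section Comparison

/-- Comparison of functors on a full subcategory `K` of a localization of a category of complexes: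
if `S` comes from a functor `L` on the localization then `T ⋙ S` can be computed on complexes. -/
lemma nonempty_comp_iso_of_derived_functor {X K Ch D : Type*} [Category* X] [Category* K]
    [Category* Ch] [Category* D] {q : X ⥤ K} {τ : K ⥤ D} [τ.Full] [τ.Faithful] {j : X ⥤ Ch}
    {Q : Ch ⥤ D} (hq : ∀ F G : K ⥤ D, (q ⋙ F ≅ q ⋙ G) → Nonempty (F ≅ G)) (e₀ : q ⋙ τ ≅ j ⋙ Q)
    {T S : K ⥤ K} {t s : Ch ⥤ Ch} (e : q ⋙ T ⋙ τ ≅ j ⋙ t ⋙ Q) (e' : q ⋙ S ⋙ τ ≅ j ⋙ s ⋙ Q)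
    {L : D ⥤ D} (f : Q ⋙ L ≅ s ⋙ Q) (e₁ : j ⋙ t ⋙ s ⋙ Q ≅ j ⋙ Q) : Nonempty (T ⋙ S ≅ 𝟭 K) := by
  obtain ⟨g⟩ := hq (S ⋙ τ) (τ ⋙ L) (e' ≪≫ Functor.isoWhiskerLeft j f.symm ≪≫
    Functor.isoWhiskerRight e₀.symm L)
  obtain ⟨h⟩ := hq ((T ⋙ S) ⋙ τ) (𝟭 _ ⋙ τ) (Functor.isoWhiskerLeft (q ⋙ T) g ≪≫
    Functor.isoWhiskerRight e L ≪≫ Functor.isoWhiskerLeft (j ⋙ t) f ≪≫ e₁ ≪≫ e₀.symm)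
  exact ⟨Functor.fullyFaithfulCancelRight τ h⟩

/-- If `S` lifts to an endofunctor `d` of the category `X` of complexes, then `S ⋙ T` can be computed
on complexes. -/
lemma nonempty_comp_iso_of_lift {X K Ch D : Type*} [Category* X] [Category* K]
    [Category* Ch] [Category* D] {q : X ⥤ K} {τ : K ⥤ D} [τ.Full] [τ.Faithful] {j : X ⥤ Ch}
    {Q : Ch ⥤ D} (hq : ∀ F G : K ⥤ D, (q ⋙ F ≅ q ⋙ G) → Nonempty (F ≅ G)) (e₀ : q ⋙ τ ≅ j ⋙ Q)
    {T S : K ⥤ K} {t s : Ch ⥤ Ch} (e : q ⋙ T ⋙ τ ≅ j ⋙ t ⋙ Q) (e' : q ⋙ S ⋙ τ ≅ j ⋙ s ⋙ Q)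
    {d : X ⥤ X} (f : d ⋙ j ≅ j ⋙ s) (e₁ : j ⋙ s ⋙ t ⋙ Q ≅ j ⋙ Q) : Nonempty (S ⋙ T ≅ 𝟭 K) := by
  let g : q ⋙ S ≅ d ⋙ q := Functor.fullyFaithfulCancelRight τ
    (e' ≪≫ Functor.isoWhiskerRight f.symm Q ≪≫ Functor.isoWhiskerLeft d e₀.symm)
  obtain ⟨h⟩ := hq ((S ⋙ T) ⋙ τ) (𝟭 _ ⋙ τ) (Functor.isoWhiskerRight g (T ⋙ τ) ≪≫
    Functor.isoWhiskerLeft d e ≪≫ Functor.isoWhiskerRight f (t ⋙ Q) ≪≫ e₁ ≪≫ e₀.symm)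
  exact ⟨Functor.fullyFaithfulCancelRight τ h⟩

end Comparison

section FunctorsOnK

variable {C : Type u} [SmallCategory C] [Abelian C]

lemma FrakK.quotient_map_surjective (X Y : (kComplex C).FullSubcategory) :
    Function.Surjective ((FrakK.quotient C).map : (X ⟶ Y) → _) := by
  intro f
  obtain ⟨g, hg⟩ := (HomotopyCategory.quotient (Ind C) (ComplexShape.up ℤ)).map_surjective
    (X := X.obj) (Y := Y.obj) f.hom
  exact ⟨⟨g⟩, by ext; exact hg⟩

/-- Functors on `𝔎` can be compared on complexes. -/
lemma FrakK.nonempty_iso {D : Type*} [Category* D] {F G : FrakK C ⥤ D}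
    (e : FrakK.quotient C ⋙ F ≅ FrakK.quotient C ⋙ G) : Nonempty (F ≅ G) :=
  ⟨NatIso.ofComponents (fun X => e.app ⟨X.obj.as, X.property⟩) fun {X Y} f => by
    obtain ⟨g, rfl⟩ := FrakK.quotient_map_surjective ⟨X.obj.as, X.property⟩ ⟨Y.obj.as, Y.property⟩ f
    exact e.hom.naturality g⟩

variable [HasDerivedCategory.{w} C] [HasDerivedCategory.{w'} (Ind C)]

/-- A homotopy invariant functor on complexes induces a functor on `𝔎`. -/
lemma FrakK.exists_lift (G : CochainComplex (Ind C) ℤ ⥤ DerivedCategory (Ind C))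
    (hG : (HomologicalComplex.homotopyEquivalences (Ind C) (ComplexShape.up ℤ)).IsInvertedBy G)
    (h : ∀ X, kComplex C X → (boundedToInd C).essImage (G.obj X)) :
    ∃ T : FrakK C ⥤ FrakK C,
      Nonempty (FrakK.quotient C ⋙ T ⋙ FrakK.toDerived C ≅ (kComplex C).ι ⋙ G) := by
  let H : HomotopyCategory (Ind C) (ComplexShape.up ℤ) ⥤ DerivedCategory (Ind C) :=
    CategoryTheory.Quotient.lift _ G (by
      intro K L f g ⟨h⟩
      exact h.map_eq_of_inverts_homotopyEquivalences (fun j => ⟨j - 1, by simp⟩) G hG)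
  have hH (X : FrakK C) : (FrakK.toDerived C).essImage ((ObjectProperty.ι _ ⋙ H).obj X) :=
    (essImage_toDerived_iff _).2 (h X.obj.as X.property)
  exact ⟨Functor.essImage.liftFunctor (ObjectProperty.ι _ ⋙ H) (FrakK.toDerived C) hH,
    ⟨Functor.isoWhiskerLeft (FrakK.quotient C) (Functor.essImage.liftFunctorCompIso _ _ hH) ≪≫
      Iso.refl _⟩⟩

/-- The functor from complexes to the derived category factors through `𝔎`. -/
lemma FrakK.nonempty_quotient_toDerived_iso :
    Nonempty (FrakK.quotient C ⋙ FrakK.toDerived C ≅ (kComplex C).ι ⋙ DerivedCategory.Q) :=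
  ⟨Functor.isoWhiskerLeft (kComplex C).ι (DerivedCategory.quotientCompQhIso (Ind C))⟩

lemma QuasiInverse.of_iso {D : Type*} [Category* D] {S T : D ⥤ D} (e : S ⋙ T ≅ 𝟭 D)
    (e' : T ⋙ S ≅ 𝟭 D) : QuasiInverse S T :=
  ⟨(CategoryTheory.Equivalence.mk S T e.symm e').isEquivalence_functor,
    (CategoryTheory.Equivalence.mk S T e.symm e').isEquivalence_inverse, ⟨e⟩, ⟨e'⟩⟩

variable {k : Type v} [Field k] [Linear k C] {n : ℤ} {E : DerivedCategory.Bounded C}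
  (hE : IsGeneralizedSpherical k n E) (M : EquivariantModel k E)

include hE

lemma exists_isTwistOnK : ∃ T, IsTwistOnK M T := by
  have := isSemisimpleRing_alg hE M
  have := isSemisimpleRing_alg_op hE M
  exact FrakK.exists_lift _ (homotopyEquivalences_isInvertedBy_twist M.alg.subtype)
    fun X hX => essImage_twist hE M hX

lemma exists_isDualTwistOnK : ∃ T, IsDualTwistOnK M T := by
  have := isSemisimpleRing_alg hE M
  have := isSemisimpleRing_alg_op hE M
  have := M.isKInjective
  exact FrakK.exists_lift _ (MorphismProperty.IsInvertedBy.of_le _ _ _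
    (quasiIso_isInvertedBy_dualTwist M.alg.subtype) (homotopyEquivalences_le_quasiIso _ _))
    fun X hX => (kComplex_dualTwist hE M hX).essImage

variable (hn : 0 < n) {M} {T T' : FrakK C ⥤ FrakK C} (hT : IsTwistOnK M T)
  (hT' : IsDualTwistOnK M T')

include hn hT hT'

/-- The complex `twist X` need not lie in `𝔎`, so the dual twist is applied to it through its
extension to the derived category. -/
lemma nonempty_twist_dualTwist_onK_iso : Nonempty (T ⋙ T' ≅ 𝟭 _) := by
  have := isSemisimpleRing_alg hE M
  have := isSemisimpleRing_alg_op hE M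
  have := M.isKInjective
  obtain ⟨e⟩ := hT
  obtain ⟨e'⟩ := hT'
  obtain ⟨e₀⟩ := FrakK.nonempty_quotient_toDerived_iso (C := C)
  obtain ⟨e₁⟩ := nonempty_twist_dualTwist_iso M.alg.subtype (kComplex C)
    (fun X hX => finiteCohomology_homFrom_model hE M hX) (fun X hX => by
      have := hX.isKInjective
      exact quasiIso_twistComparison_of_isDualPair (isSphericalAction_model hE M)
        (isDualPair_model hE M hX) hn)
  exact nonempty_comp_iso_of_derived_functor (fun _ _ e => FrakK.nonempty_iso e) e₀ e e'
    (Localization.fac (dualTwist M.alg.subtype ⋙ DerivedCategory.Q)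
      (quasiIso_isInvertedBy_dualTwist M.alg.subtype) DerivedCategory.Q) e₁

/-- The twist does not extend to the derived category in the same way, but `dualTwist` preserves the
complexes of `𝔎`, on which the twist is computed directly. -/
lemma nonempty_dualTwist_twist_onK_iso : Nonempty (T' ⋙ T ≅ 𝟭 _) := by
  have := isSemisimpleRing_alg hE M
  have := isSemisimpleRing_alg_op hE M
  have := M.isKInjective
  obtain ⟨e⟩ := hT
  obtain ⟨e'⟩ := hT'
  obtain ⟨e₀⟩ := FrakK.nonempty_quotient_toDerived_iso (C := C)
  obtain ⟨e₁⟩ := nonempty_dualTwist_twist_iso M.alg.subtype (kComplex C)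
    (fun X hX => finiteCohomology_homTo_model hE M hX) (fun X hX => by
      have := hX.isKInjective
      exact quasiIso_dualTwistComparison_of_isDualPair (isSphericalAction_model hE M)
        (isDualPair_model hE M hX) hn)
  exact nonempty_comp_iso_of_lift (fun _ _ e => FrakK.nonempty_iso e) e₀ e e'
    (ObjectProperty.liftCompιIso _ ((kComplex C).ι ⋙ dualTwist M.alg.subtype)
      fun X => kComplex_dualTwist hE M X.property) e₁

lemma quasiInverse_onK : QuasiInverse T T' := by
  obtain ⟨e⟩ := nonempty_twist_dualTwist_onK_iso hE hn hT hT'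
  obtain ⟨e'⟩ := nonempty_dualTwist_twist_onK_iso hE hn hT hT'
  exact QuasiInverse.of_iso e e'

end FunctorsOnK

section FunctorsOnBounded

variable {C : Type u} [SmallCategory C] [Abelian C]
  [HasDerivedCategory.{w} C] [HasDerivedCategory.{w'} (Ind C)]

/-- An endofunctor of `𝔎` corresponds to an endofunctor of `Dᵇ(C)`. -/
lemma exists_bounded_functor (T₀ : FrakK C ⥤ FrakK C) :
    ∃ (T : DerivedCategory.Bounded C ⥤ DerivedCategory.Bounded C)
      (Φ : DerivedCategory.Bounded C ≌ FrakK C),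
      Nonempty (Φ.functor ⋙ FrakK.toDerived C ≅ boundedToInd C) ∧
      Nonempty (T ⋙ Φ.functor ≅ Φ.functor ⋙ T₀) := by
  obtain ⟨Φ, hΦ⟩ := exists_bounded_equivalence C
  exact ⟨Φ.functor ⋙ T₀ ⋙ Φ.inverse, Φ, hΦ,
    ⟨Functor.isoWhiskerLeft (Φ.functor ⋙ T₀) Φ.counitIso ≪≫ Iso.refl _⟩⟩

lemma nonempty_comp_iso_of_equivalence {D D' : Type*} [Category* D] [Category* D']
    {Φ Ψ : D ⥤ D'} [Φ.Full] [Φ.Faithful] (e : Φ ≅ Ψ) {S T : D ⥤ D} {S₀ T₀ : D' ⥤ D'}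
    (hS : S ⋙ Φ ≅ Φ ⋙ S₀) (hT : T ⋙ Ψ ≅ Ψ ⋙ T₀) (h : S₀ ⋙ T₀ ≅ 𝟭 D') :
    Nonempty (S ⋙ T ≅ 𝟭 D) :=
  ⟨Functor.fullyFaithfulCancelRight Φ (show (S ⋙ T) ⋙ Φ ≅ 𝟭 D ⋙ Φ from
    Functor.isoWhiskerLeft (S ⋙ T) e ≪≫ Functor.isoWhiskerLeft S hT ≪≫
      Functor.isoWhiskerRight (Functor.isoWhiskerLeft S e.symm) T₀ ≪≫
      Functor.isoWhiskerRight hS T₀ ≪≫ Functor.isoWhiskerLeft Φ h)⟩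

variable {k : Type v} [Field k] [Linear k C] {n : ℤ} {E : DerivedCategory.Bounded C}
  (hE : IsGeneralizedSpherical k n E) (M : EquivariantModel k E)

include hE

lemma exists_isTwist : ∃ T, IsTwist M T := by
  obtain ⟨T₀, h₀⟩ := exists_isTwistOnK hE M
  obtain ⟨T, Φ, hΦ, hT⟩ := exists_bounded_functor T₀
  exact ⟨T, Φ, T₀, hΦ, h₀, hT⟩

lemma exists_isDualTwist : ∃ T, IsDualTwist M T := by
  obtain ⟨T₀, h₀⟩ := exists_isDualTwistOnK hE M
  obtain ⟨T, Φ, hΦ, hT⟩ := exists_bounded_functor T₀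
  exact ⟨T, Φ, T₀, hΦ, h₀, hT⟩

lemma quasiInverse_bounded (hn : 0 < n) {M : EquivariantModel k E} {T T' : DerivedCategory.Bounded C ⥤ _}
    (hT : IsTwist M T) (hT' : IsDualTwist M T') : QuasiInverse T T' := by
  obtain ⟨Φ, T₀, ⟨e⟩, h₀, ⟨f⟩⟩ := hT
  obtain ⟨Ψ, T₀', ⟨e'⟩, h₀', ⟨f'⟩⟩ := hT'
  obtain ⟨-, -, ⟨g⟩, ⟨g'⟩⟩ := quasiInverse_onK hE hn h₀ h₀'
  -- The two twists may be defined by different equivalences with `𝔎`. Both lie over the derived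
  -- category of ind-objects, in which `𝔎` is fully embedded, so the equivalences are isomorphic.
  let i : Φ.functor ≅ Ψ.functor :=
    Functor.fullyFaithfulCancelRight (FrakK.toDerived C) (e ≪≫ e'.symm)
  obtain ⟨a⟩ := nonempty_comp_iso_of_equivalence i f f' g
  obtain ⟨a'⟩ := nonempty_comp_iso_of_equivalence i.symm f' f g'
  exact QuasiInverse.of_iso a a'

end FunctorsOnBounded

end

noncomputable section

open CategoryTheory Limits Pretriangulated

/-! ### The `k`-linear structure on ind-objects -/

section IndLinear

variable {C : Type u} [SmallCategory C] [Abelian C]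

/-- Morphisms of ind-objects are determined by their restrictions to objects of `C`. -/
lemma ind_hom_ext {X Z : Ind C} {f g : X ⟶ Z}
    (h : ∀ (Y : C) (t : Ind.yoneda.obj Y ⟶ X), t ≫ f = t ≫ g) : f = g := by
  refine (Ind.inclusion C).map_injective (NatTrans.ext (funext fun Y => ?_))
  ext x
  let t' : (Ind.inclusion C).obj (Ind.yoneda.obj Y.unop) ⟶ (Ind.inclusion C).obj X :=
    Ind.yonedaCompInclusion.hom.app Y.unop ≫ yonedaEquiv.symm x
  have h1 := congrArg (Ind.inclusion C).map (h Y.unop ((Ind.inclusion C).preimage t'))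
  rw [Functor.map_comp, Functor.map_comp, Functor.map_preimage] at h1
  have h2 : (yonedaEquiv.symm x : _ ⟶ (Ind.inclusion C).obj X) ≫ (Ind.inclusion C).map f =
      (yonedaEquiv.symm x : _ ⟶ (Ind.inclusion C).obj X) ≫ (Ind.inclusion C).map g := by
    rw [← cancel_epi (Ind.yonedaCompInclusion.hom.app Y.unop)]
    simpa [t'] using h1
  have h3 := congrArg (fun s => s.app Y (𝟙 Y.unop)) h2
  simpa [yonedaEquiv] using h3

variable {k : Type v} [Field k] [Linear k C]

lemma inclusion_map_indScalar_app (c : k) (X : Ind C) (Y : Cᵒᵖ) :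
    ((Ind.inclusion C).map (indScalar c X)).app Y =
      ((Ind.inclusion C).obj X).map (c • 𝟙 Y.unop).op := by
  rw [indScalar, Functor.map_preimage]

lemma indScalar_naturality (c : k) {X Y : Ind C} (f : X ⟶ Y) :
    f ≫ indScalar c Y = indScalar c X ≫ f := by
  refine (Ind.inclusion C).map_injective (NatTrans.ext (funext fun Z => ?_))
  rw [Functor.map_comp, Functor.map_comp, NatTrans.comp_app, NatTrans.comp_app,
    inclusion_map_indScalar_app, inclusion_map_indScalar_app]
  exact (((Ind.inclusion C).map f).naturality _).symm

lemma indScalar_yoneda (c : k) (Y : C) :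
    indScalar c (Ind.yoneda.obj Y) = Ind.yoneda.map (c • 𝟙 Y) := by
  refine (Ind.inclusion C).map_injective (NatTrans.ext (funext fun Z => ?_))
  rw [inclusion_map_indScalar_app]
  have h1 := (Ind.yonedaCompInclusion (C := C)).hom.naturality (c • 𝟙 Y)
  have h2 := ((Ind.yonedaCompInclusion (C := C)).hom.app Y).naturality (c • 𝟙 Z.unop).op
  have h3 := congrArg (fun s => s.app Z) h1
  rw [← cancel_mono (((Ind.yonedaCompInclusion (C := C)).hom.app Y).app Z)]
  refine h2.trans (Eq.trans ?_ h3.symm)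
  ext x
  simp

/-- Combined with `ind_hom_ext` this reduces every identity between scalars on ind-objects to one in
`C`. -/
lemma comp_indScalar (c : k) {X : Ind C} {Y : C} (t : Ind.yoneda.obj Y ⟶ X) :
    t ≫ indScalar c X = Ind.yoneda.map (c • 𝟙 Y) ≫ t := by
  rw [indScalar_naturality, indScalar_yoneda]

lemma indScalar_mul (c d : k) (X : Ind C) :
    indScalar (c * d) X = indScalar d X ≫ indScalar c X := by
  refine ind_hom_ext fun Y t => ?_
  rw [comp_indScalar, reassoc_of% comp_indScalar d t, comp_indScalar, ← Category.assoc,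
    ← Functor.map_comp]
  simp [mul_smul, smul_comm c d]

lemma indScalar_add (c d : k) (X : Ind C) :
    indScalar (c + d) X = indScalar c X + indScalar d X := by
  refine ind_hom_ext fun Y t => ?_
  rw [Preadditive.comp_add, comp_indScalar, comp_indScalar, comp_indScalar, add_smul,
    Functor.map_add, Preadditive.add_comp]

lemma indScalar_one (X : Ind C) : indScalar (1 : k) X = 𝟙 X := by
  refine ind_hom_ext fun Y t => ?_
  rw [comp_indScalar, one_smul, CategoryTheory.Functor.map_id, Category.id_comp, Category.comp_id]

/-- The action of the scalars on the category of ind-objects. -/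
def indScalarHom (k : Type v) [Field k] [Linear k C] : k →+* CatCenter (Ind C) :=
  RingHom.mk' ⟨⟨fun c => { app := fun X => indScalar c X
                           naturality := fun _ _ f => indScalar_naturality c f },
      NatTrans.ext (funext fun X => indScalar_one X)⟩,
      fun c d => NatTrans.ext (funext fun X => indScalar_mul c d X)⟩
    fun c d => NatTrans.ext (funext fun X => indScalar_add c d X)

/-- The `k`-linear structure of the category of ind-objects. -/
abbrev indLinear (k : Type v) [Field k] [Linear k C] : Linear k (Ind C) :=
  Linear.ofRingMorphism (indScalarHom k)

attribute [local instance] indLinear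

lemma smul_id_ind (c : k) (X : Ind C) : c • 𝟙 X = indScalar c X :=
  (Linear.smulOfRingMorphism_smul_eq (indScalarHom k) c (𝟙 X)).trans (Category.comp_id _)

instance : (Ind.yoneda (C := C)).Linear k where
  map_smul {X Y} f c := by
    have h : c • f = (c • 𝟙 X) ≫ f := by rw [Linear.smul_comp, Category.id_comp]
    have h' : c • Ind.yoneda.map f = (c • 𝟙 _) ≫ Ind.yoneda.map f := by
      rw [Linear.smul_comp, Category.id_comp]
    rw [h, h', Functor.map_comp, smul_id_ind, indScalar_yoneda]

end IndLinear

end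

noncomputable section

open CategoryTheory Limits Pretriangulated

/-! ### Splitting idempotents within bounded complexes of injectives -/

section IdempotentSplitting

variable {D : Type u} [Category.{v} D] [Preadditive D] [HasZeroObject D] [HasShift D ℤ]
  [∀ n : ℤ, (shiftFunctor D n).Additive] [Pretriangulated D]

/-- An idempotent is split by the fibre of `1 - shift ∘ ε` on a countable power. -/
lemma exists_splitting_of_countable_power {I P J : D} (π : ℕ → (P ⟶ I))
    (hext : ∀ {Z : D} {f g : Z ⟶ P}, (∀ n, f ≫ π n = g ≫ π n) → f = g)
    (hlift : ∀ {Z : D} (f : ℕ → (Z ⟶ I)), ∃ l : Z ⟶ P, ∀ n, l ≫ π n = f n)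
    (ε : I ⟶ I) (hε : ε ≫ ε = ε) (φ : P ⟶ P) (hφ : ∀ n, φ ≫ π n = π n - π (n + 1) ≫ ε)
    (ι : J ⟶ P) (δ : P ⟶ J⟦(1 : ℤ)⟧) (hT : Triangle.mk ι φ δ ∈ distTriang D) :
    ∃ (s : J ⟶ I) (r : I ⟶ J), s ≫ r = 𝟙 J ∧ r ≫ s = ε := by
  -- The components of `t` solve the recursion `tₙ - tₙ₊₁ ≫ ε = πₙ`, so `t` is a section of `φ`.
  -- Hence the triangle splits and its first map `ι` is a monomorphism.
  obtain ⟨t, ht⟩ := hlift fun n => π n - π n ≫ ε - ∑ m ∈ Finset.range n, π m ≫ ε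
  have htφ : t ≫ φ = 𝟙 P := hext fun n => by
    rw [Category.assoc, hφ, Preadditive.comp_sub, ht, ← Category.assoc, ht, Category.id_comp,
      Finset.sum_range_succ]
    simp only [Preadditive.sub_comp, Preadditive.add_comp, Preadditive.sum_comp, Category.assoc,
      hε]
    abel
  have : IsSplitEpi φ := ⟨⟨⟨t, htφ⟩⟩⟩
  have : Mono ι := Triangle.mono₁ _ hT (Triangle.mor₃_eq_zero_of_epi₂ _ hT
    (inferInstanceAs (Epi φ)))
  -- The constant sequence of value `ε` lies in the kernel of `φ`, so it factors through `ι`.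
  obtain ⟨c, hc⟩ := hlift fun _ => ε
  have hcφ : c ≫ φ = 0 := hext fun n => by
    rw [Category.assoc, hφ, Preadditive.comp_sub, hc, ← Category.assoc, hc, hε, sub_self,
      zero_comp]
  obtain ⟨r, hr⟩ : ∃ r : I ⟶ J, c = r ≫ ι := Triangle.coyoneda_exact₂ _ hT c hcφ
  have hι : ι ≫ φ = 0 := comp_distTriang_mor_zero₁₂ _ hT
  -- Conversely, all components of `ι` agree and are fixed by `ε`, so that one component together
  -- with `r` splits `ε`.
  have h1 (n : ℕ) : ι ≫ π n = ι ≫ π (n + 1) ≫ ε := by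
    have := hι =≫ π n
    rwa [Category.assoc, hφ, Preadditive.comp_sub, zero_comp, sub_eq_zero] at this
  have h2 (n : ℕ) : ι ≫ π n ≫ ε = ι ≫ π n := by
    rw [← Category.assoc, h1, Category.assoc, Category.assoc, hε]
  have h3 (n : ℕ) : ι ≫ π n = ι ≫ π 0 := by
    induction n with
    | zero => rfl
    | succ n ih => rw [← ih, h1 n, h2]
  refine ⟨ι ≫ π 0, r, ?_, by rw [← Category.assoc, ← hr, hc]⟩
  rw [← cancel_mono ι, Category.assoc, ← hr, Category.id_comp]
  refine hext fun n => ?_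
  rw [Category.assoc, hc, Category.assoc, h2, h3 n]

end IdempotentSplitting

section Power

open HomologicalComplex

variable {B : Type u} [Category.{v} B] [Abelian B] [HasCountableProducts B]
  (I : CochainComplex B ℤ)

/-- The countable power of a complex. -/
def countablePower : CochainComplex B ℤ where
  X i := ∏ᶜ fun _ : ℕ => I.X i
  d i j := Limits.Pi.map fun _ => I.d i j
  shape i j h := Pi.hom_ext _ _ fun n => by simp [I.shape i j h]
  d_comp_d' i j l _ _ := Pi.hom_ext _ _ fun n => by simp

/-- The projections of the countable power. -/
def countablePowerπ (n : ℕ) : countablePower I ⟶ I where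
  f i := Pi.π (fun _ : ℕ => I.X i) n
  comm' i j _ := (Pi.map_π (fun _ : ℕ => I.d i j) n).symm

variable {I}

lemma countablePower_X_hom_ext {X : B} {i : ℤ} {f g : X ⟶ (countablePower I).X i}
    (h : ∀ n, f ≫ (countablePowerπ I n).f i = g ≫ (countablePowerπ I n).f i) : f = g :=
  Pi.hom_ext (f := fun _ : ℕ => I.X i) _ _ h

/-- The morphism to a term of a countable power with given components. -/
def countablePowerLiftX {X : B} {i : ℤ} (f : ℕ → (X ⟶ I.X i)) : X ⟶ (countablePower I).X i :=
  Pi.lift f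

@[simp]
lemma countablePowerLiftX_π {X : B} {i : ℤ} (f : ℕ → (X ⟶ I.X i)) (n : ℕ) :
    countablePowerLiftX f ≫ (countablePowerπ I n).f i = f n :=
  Pi.lift_π f n

/-- The morphism to a countable power with given components. -/
def countablePowerLift {K : CochainComplex B ℤ} (f : ℕ → (K ⟶ I)) : K ⟶ countablePower I where
  f i := countablePowerLiftX fun n => (f n).f i
  comm' i j _ := countablePower_X_hom_ext fun n => by
    rw [Category.assoc, ← Hom.comm, Category.assoc, ← Category.assoc, countablePowerLiftX_π,
      countablePowerLiftX_π, Hom.comm]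

lemma countablePowerLift_π {K : CochainComplex B ℤ} (f : ℕ → (K ⟶ I)) (n : ℕ) :
    countablePowerLift f ≫ countablePowerπ I n = f n := by
  ext i
  exact countablePowerLiftX_π _ n

/-- Morphisms to a countable power are homotopic if their components are. -/
def homotopyCountablePower {K : CochainComplex B ℤ} {f g : K ⟶ countablePower I}
    (h : ∀ n, Homotopy (f ≫ countablePowerπ I n) (g ≫ countablePowerπ I n)) : Homotopy f g where
  hom i j := countablePowerLiftX fun n => (h n).hom i j
  zero i j hij := countablePower_X_hom_ext fun n => by
    rw [zero_comp, countablePowerLiftX_π, (h n).zero i j hij]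
  comm i := countablePower_X_hom_ext fun n => by
    have e : (fun i j => (countablePowerLiftX fun n => (h n).hom i j) ≫
        (countablePowerπ I n).f j) = (h n).hom := by
      ext i j
      simp
    rw [Preadditive.add_comp, Preadditive.add_comp, ← dNext_comp_right, ← prevD_comp_right, e]
    exact (h n).comm i

instance (a : ℤ) [I.IsStrictlyGE a] : (countablePower I).IsStrictlyGE a :=
  (CochainComplex.isStrictlyGE_iff _ _).2 fun i hi => by
    rw [IsZero.iff_id_eq_zero]
    exact Pi.hom_ext _ _ fun _ => (I.isZero_of_isStrictlyGE a i hi).eq_of_tgt _ _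

instance (a : ℤ) [I.IsStrictlyLE a] : (countablePower I).IsStrictlyLE a :=
  (CochainComplex.isStrictlyLE_iff _ _).2 fun i hi => by
    rw [IsZero.iff_id_eq_zero]
    exact Pi.hom_ext _ _ fun _ => (I.isZero_of_isStrictlyLE a i hi).eq_of_tgt _ _

instance (i : ℤ) [Injective (I.X i)] : Injective ((countablePower I).X i) :=
  inferInstanceAs (Injective (∏ᶜ fun _ : ℕ => I.X i))

lemma isStrictlyLE_mappingCocone {K L : CochainComplex B ℤ} (f : K ⟶ L) (b : ℤ)
    [K.IsStrictlyLE b] [L.IsStrictlyLE b] :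
    (CochainComplex.mappingCocone f).IsStrictlyLE (b + 1) :=
  (CochainComplex.isStrictlyLE_iff _ _).2 fun m hm =>
    (CochainComplex.mappingCone.isZero_X_iff f (m + -1)).2
      ⟨K.isZero_of_isStrictlyLE b _ (by omega), L.isZero_of_isStrictlyLE b _ (by omega)⟩

lemma isStrictlyGE_mappingCocone {K L : CochainComplex B ℤ} (f : K ⟶ L) (a : ℤ)
    [K.IsStrictlyGE a] [L.IsStrictlyGE a] :
    (CochainComplex.mappingCocone f).IsStrictlyGE a :=
  (CochainComplex.isStrictlyGE_iff _ _).2 fun m hm =>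
    (CochainComplex.mappingCone.isZero_X_iff f (m + -1)).2
      ⟨K.isZero_of_isStrictlyGE a _ (by omega), L.isZero_of_isStrictlyGE a _ (by omega)⟩

lemma injective_mappingCocone_X {K L : CochainComplex B ℤ} (f : K ⟶ L)
    [∀ i, Injective (K.X i)] [∀ i, Injective (L.X i)] (m : ℤ) :
    Injective ((CochainComplex.mappingCocone f).X m) :=
  Injective.of_iso
    (homotopyCofiber.XIsoBiprod f (m + -1) (m + -1 + 1) rfl).symm inferInstance

variable [HasDerivedCategory.{w} B]

lemma exists_Q_map_eq (K L : CochainComplex B ℤ) [L.IsKInjective]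
    (f : DerivedCategory.Q.obj K ⟶ DerivedCategory.Q.obj L) :
    ∃ g : K ⟶ L, DerivedCategory.Q.map g = f := by
  obtain ⟨g, hg⟩ := (CochainComplex.IsKInjective.Qh_map_bijective
    ((HomotopyCategory.quotient _ _).obj K) L).surjective f
  obtain ⟨g, rfl⟩ := (HomotopyCategory.quotient _ _).map_surjective g
  exact ⟨g, hg⟩

lemma nonempty_homotopy_of_Q_map_eq {K L : CochainComplex B ℤ} [L.IsKInjective] {f g : K ⟶ L}
    (h : DerivedCategory.Q.map f = DerivedCategory.Q.map g) : Nonempty (Homotopy f g) :=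
  ⟨HomotopyCategory.homotopyOfEq _ _ ((CochainComplex.IsKInjective.Qh_map_bijective
    ((HomotopyCategory.quotient _ _).obj K) L).injective h)⟩

lemma Q_map_eq_of_homotopy {K L : CochainComplex B ℤ} {f g : K ⟶ L} (h : Homotopy f g) :
    DerivedCategory.Q.map f = DerivedCategory.Q.map g :=
  congrArg DerivedCategory.Qh.map (HomotopyCategory.eq_of_homotopy _ _ h)

/-- Idempotent endomorphisms in the derived category of a bounded complex of injective objects
split, and are split by a bounded complex of injective objects. -/
lemma exists_splitting_Q [∀ i, Injective (I.X i)] (a b : ℤ) [I.IsStrictlyGE a] [I.IsStrictlyLE b]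
    (ε : DerivedCategory.Q.obj I ⟶ DerivedCategory.Q.obj I) (hε : ε ≫ ε = ε) :
    ∃ (J : CochainComplex B ℤ) (s : DerivedCategory.Q.obj J ⟶ DerivedCategory.Q.obj I)
      (r : DerivedCategory.Q.obj I ⟶ DerivedCategory.Q.obj J),
      J.IsStrictlyGE a ∧ J.IsStrictlyLE (b + 1) ∧ (∀ i, Injective (J.X i)) ∧
        s ≫ r = 𝟙 _ ∧ r ≫ s = ε := by
  have := CochainComplex.isKInjective_of_injective I a
  have := CochainComplex.isKInjective_of_injective (countablePower I) a
  obtain ⟨e, rfl⟩ := exists_Q_map_eq I I ε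
  let φ : countablePower I ⟶ countablePower I :=
    𝟙 _ - countablePowerLift fun n => countablePowerπ I (n + 1) ≫ e
  have hφ (n : ℕ) : φ ≫ countablePowerπ I n =
      countablePowerπ I n - countablePowerπ I (n + 1) ≫ e := by
    rw [Preadditive.sub_comp, countablePowerLift_π, Category.id_comp]
  -- The termwise countable power has the universal property of a product in the derived category:
  -- morphisms into K-injective complexes are homotopy classes, and both chain maps and homotopies
  -- can be chosen componentwise. Products and fibres keep the complexes injective and bounded.
  obtain ⟨s, r, hsr, hrs⟩ := exists_splitting_of_countable_power
    (fun n => DerivedCategory.Q.map (countablePowerπ I n))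
    (fun {Z f g} h => by
      obtain ⟨K, ⟨i⟩⟩ : ∃ K, Nonempty (DerivedCategory.Q.obj K ≅ Z) :=
        ⟨_, ⟨DerivedCategory.Q.objObjPreimageIso Z⟩⟩
      rw [← cancel_epi i.hom]
      obtain ⟨f', hf⟩ := exists_Q_map_eq _ _ (i.hom ≫ f)
      obtain ⟨g', hg⟩ := exists_Q_map_eq _ _ (i.hom ≫ g)
      rw [← hf, ← hg]
      refine Q_map_eq_of_homotopy (homotopyCountablePower fun n =>
        (nonempty_homotopy_of_Q_map_eq ?_).some)
      rw [Functor.map_comp, Functor.map_comp, hf, hg, Category.assoc, Category.assoc, h n])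
    (fun {Z} f => by
      obtain ⟨K, ⟨i⟩⟩ : ∃ K, Nonempty (DerivedCategory.Q.obj K ≅ Z) :=
        ⟨_, ⟨DerivedCategory.Q.objObjPreimageIso Z⟩⟩
      choose f' hf using fun n => exists_Q_map_eq _ _ (i.hom ≫ f n)
      refine ⟨i.inv ≫ DerivedCategory.Q.map (countablePowerLift f'), fun n => ?_⟩
      rw [Category.assoc, ← Functor.map_comp, countablePowerLift_π, hf, Iso.inv_hom_id_assoc])
    _ hε (DerivedCategory.Q.map φ)
    (fun n => by rw [← Functor.map_comp, hφ, Functor.map_sub, Functor.map_comp])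
    _ _ (DerivedCategory.mappingCocone_triangle_distinguished φ)
  exact ⟨_, s, r, isStrictlyGE_mappingCocone φ a, isStrictlyLE_mappingCocone φ b,
    injective_mappingCocone_X φ, hsr, hrs⟩

end Power

end

noncomputable section

open CategoryTheory Limits Pretriangulated

/-! ### Construction of an equivariant model -/

section Splitting

variable {A : Type u} [Category.{v} A] [Preadditive A] [HasFiniteBiproducts A]
  {D : Type u'} [Category.{v'} D] [Preadditive D] (F : A ⥤ D) [F.Additive]
  {ι : Type} [Fintype ι] [DecidableEq ι] (J : ι → A) {X : D}
  (s : ∀ i, F.obj (J i) ⟶ X) (r : ∀ i, X ⟶ F.obj (J i))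

/-- An object which is decomposed by complementary retracts `F (J i)` is the image of `⨁ J`. -/
def biproductIsoOfRetracts (hs : ∀ i, s i ≫ r i = 𝟙 _) (hs' : ∀ i j, i ≠ j → s i ≫ r j = 0)
    (hr : ∑ i, r i ≫ s i = 𝟙 X) : F.obj (⨁ J) ≅ X where
  hom := ∑ i, F.map (biproduct.π J i) ≫ s i
  inv := ∑ i, r i ≫ F.map (biproduct.ι J i)
  hom_inv_id := by
    have h (i j : ι) : (F.map (biproduct.π J i) ≫ s i) ≫ r j ≫ F.map (biproduct.ι J j) =
        if i = j then F.map (biproduct.π J i ≫ biproduct.ι J i) else 0 := by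
      split_ifs with hij
      · subst hij
        rw [Category.assoc, reassoc_of% hs i, Functor.map_comp]
      · rw [Category.assoc, reassoc_of% hs' i j hij, zero_comp, comp_zero]
    simp_rw [Preadditive.sum_comp, Preadditive.comp_sum, h]
    simp only [Finset.sum_ite_eq, Finset.mem_univ, if_true]
    rw [← Functor.map_sum, biproduct.total, CategoryTheory.Functor.map_id]
  inv_hom_id := by
    have h (i j : ι) : (r i ≫ F.map (biproduct.ι J i)) ≫ F.map (biproduct.π J j) ≫ s j =
        if i = j then r i ≫ s i else 0 := by
      rw [Category.assoc, ← Functor.map_comp_assoc]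
      split_ifs with hij
      · subst hij
        rw [biproduct.ι_π_self, CategoryTheory.Functor.map_id, Category.id_comp]
      · rw [biproduct.ι_π_ne _ hij, Functor.map_zero, zero_comp, comp_zero]
    simp_rw [Preadditive.sum_comp, Preadditive.comp_sum, h]
    simpa using hr

variable (k : Type w) [Field k] [Linear k A] [Linear k D] [F.Linear k]

/-- The action of `k^ι` on a biproduct, factor by factor. -/
def biproductScalar : (ι → k) →+* End (⨁ J) where
  toFun c := biproduct.map fun i => c i • 𝟙 (J i)
  map_one' := biproduct.hom_ext _ _ fun i => by simp [End.one_def]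
  map_mul' c d := biproduct.hom_ext _ _ fun i => by
    simp [End.mul_def, mul_smul, smul_comm (c i) (d i)]
  map_zero' := biproduct.hom_ext _ _ fun i => by simp
  map_add' c d := biproduct.hom_ext _ _ fun i => by
    refine Eq.trans ?_ (Preadditive.add_comp _ _ _ _ _ _).symm
    simp [add_smul]

lemma biproductScalar_const (c : k) : biproductScalar J k (fun _ => c) = c • 𝟙 (⨁ J) :=
  biproduct.hom_ext _ _ fun i => by simp [biproductScalar]

variable {k} in
lemma map_biproductScalar_comp (hs hs' hr) (c : ι → k) (e : ι → (X ⟶ X))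
    (he : ∀ i, r i ≫ s i = e i) :
    F.map (biproductScalar J k c) ≫ (biproductIsoOfRetracts F J s r hs hs' hr).hom =
      (biproductIsoOfRetracts F J s r hs hs' hr).hom ≫ ∑ i, c i • e i := by
  have h (i j : ι) : s i ≫ e j = if i = j then s i else 0 := by
    rw [← he]
    split_ifs with hij
    · subst hij
      rw [reassoc_of% hs i]
    · rw [reassoc_of% hs' i j hij, zero_comp]
  have h1 (i : ι) : F.map (biproductScalar J k c) ≫ F.map (biproduct.π J i) =
      c i • F.map (biproduct.π J i) := by
    rw [← Functor.map_comp, ← Functor.map_smul]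
    congr 1
    simp [biproductScalar]
  have h2 (i : ι) : s i ≫ ∑ j, c j • e j = c i • s i := by
    simp [Preadditive.comp_sum, h]
  simp only [biproductIsoOfRetracts, Preadditive.sum_comp]
  rw [Preadditive.comp_sum]
  refine Finset.sum_congr rfl fun i _ => ?_
  rw [Category.assoc, h2, reassoc_of% h1 i, Linear.smul_comp, Linear.comp_smul]

end Splitting

section Model

attribute [local instance] Abelian.hasFiniteBiproducts

variable {C : Type u} [SmallCategory C] [Abelian C]

lemma IsBoundedInjective.biproduct {r : ℕ} (J : Fin r → CochainComplex (Ind C) ℤ) (a b : ℤ)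
    (hJ : ∀ i, (J i).IsStrictlyGE a) (hJ' : ∀ i, (J i).IsStrictlyLE b)
    (hJ'' : ∀ i m, Injective ((J i).X m)) : IsBoundedInjective (⨁ J) := by
  have e (m : ℤ) : (⨁ J).X m ≅ ⨁ fun i => (J i).X m :=
    (HomologicalComplex.eval (Ind C) (ComplexShape.up ℤ) m).mapBiproduct J
  refine ⟨⟨a, (CochainComplex.isStrictlyGE_iff _ _).2 fun m hm => ?_⟩,
    ⟨b, (CochainComplex.isStrictlyLE_iff _ _).2 fun m hm => ?_⟩, fun m => ?_⟩
  · refine IsZero.of_iso ?_ (e m)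
    rw [IsZero.iff_id_eq_zero]
    exact biproduct.hom_ext _ _ fun i => ((J i).isZero_of_isStrictlyGE a m hm).eq_of_tgt _ _
  · refine IsZero.of_iso ?_ (e m)
    rw [IsZero.iff_id_eq_zero]
    exact biproduct.hom_ext _ _ fun i => ((J i).isZero_of_isStrictlyLE b m hm).eq_of_tgt _ _
  · exact Injective.of_iso (e m).symm inferInstance

variable {k : Type v} [Field k] [Linear k C]
  [HasDerivedCategory.{w} C] [HasDerivedCategory.{w'} (Ind C)]

attribute [local instance] indLinear

/-- Every generalized spherical object has an equivariant model. -/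
theorem nonempty_equivariantModel {n : ℤ} {E : DerivedCategory.Bounded C}
    (hE : IsGeneralizedSpherical k n E) : Nonempty (EquivariantModel k E) := by
  obtain ⟨I, ⟨⟨a, ha⟩, ⟨b, hb⟩, hI⟩, ⟨α⟩⟩ := hE.finite_injective_resolution
  obtain ⟨m, ⟨φ⟩⟩ := hE.end_iso
  let G : End E.obj →+* End ((boundedToInd C).obj E) :=
    { (derivedInd C).mapEnd E.obj with
      map_zero' := (derivedInd C).map_zero _ _
      map_add' := fun _ _ => (derivedInd C).map_add }
  have hG : Function.Injective G := fun f g h => by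
    have := (boundedToInd C).map_injective (X := E) (Y := E) (a₁ := ⟨f⟩) (a₂ := ⟨g⟩) h
    exact congrArg (fun t => t.hom) this
  -- These are the images of the primitive idempotents of `k^m`; they are orthogonal with sum `𝟙`.
  let ε (i : Fin m) : (boundedToInd C).obj E ⟶ (boundedToInd C).obj E :=
    G (φ.symm (Pi.single i 1))
  have hε (i j : Fin m) : ε i ≫ ε j = if i = j then ε i else 0 := by
    have h : (Pi.single j 1 * Pi.single i 1 : Fin m → k) =
        if i = j then Pi.single i 1 else 0 := by
      split_ifs with hij
      · rw [hij, ← Pi.single_mul, one_mul]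
      · ext l
        by_cases hl : l = i
        · subst hl
          simp [hij]
        · simp [hl]
    change G (φ.symm (Pi.single j 1)) * G (φ.symm (Pi.single i 1)) = _
    rw [← map_mul, ← map_mul, h]
    split_ifs
    · rfl
    · rw [map_zero, map_zero]
  have hφ (c : Fin m → k) : G (φ.symm c) = ∑ i, c i • ε i := by
    conv_lhs => rw [pi_eq_sum_univ' c]
    rw [map_sum, map_sum]
    refine Finset.sum_congr rfl fun i _ => ?_
    rw [map_smul]
    exact Functor.map_smul (R := k) (derivedInd C) (c i)
      (φ.symm (Pi.single i 1) : E.obj ⟶ E.obj)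
  have hsum : ∑ i, ε i = 𝟙 _ := by
    have := hφ 1
    rw [map_one, map_one] at this
    simpa using this.symm
  -- Each idempotent is moved to the given bounded complex of injectives and split there, which
  -- decomposes `E` into objects represented by the complexes `J i`.
  have hsplit (i : Fin m) := exists_splitting_Q (I := I) a b (α.hom ≫ ε i ≫ α.inv) (by
    simp only [Category.assoc, Iso.inv_hom_id_assoc]
    rw [reassoc_of% hε i i]
    simp)
  choose J s r hJ hJ' hJ'' hsr hrs using hsplit
  have hrs' (i : Fin m) : (α.inv ≫ r i) ≫ s i ≫ α.hom = ε i := by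
    rw [Category.assoc, reassoc_of% hrs i]
    simp
  have hsε (i : Fin m) : s i ≫ α.hom = (s i ≫ α.hom) ≫ ε i := by
    rw [← hrs']
    simp only [Category.assoc, Iso.hom_inv_id_assoc]
    rw [reassoc_of% hsr i]
  have hεr (i : Fin m) : α.inv ≫ r i = ε i ≫ α.inv ≫ r i := by
    rw [← hrs']
    simp only [Category.assoc, Iso.hom_inv_id_assoc]
    rw [hsr i, Category.comp_id]
  have hs (i : Fin m) : (s i ≫ α.hom) ≫ α.inv ≫ r i = 𝟙 _ := by
    simp [hsr i]
  have hs' (i j : Fin m) (hij : i ≠ j) : (s i ≫ α.hom) ≫ α.inv ≫ r j = 0 := by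
    rw [hsε, hεr, Category.assoc, reassoc_of% hε i j, if_neg hij, zero_comp, comp_zero]
  have hr : ∑ i, (α.inv ≫ r i) ≫ s i ≫ α.hom = 𝟙 _ := by
    rw [← hsum]
    exact Finset.sum_congr rfl fun i _ => hrs' i
  -- On the direct sum of the `J i` the algebra `k^m` acts by scalars on each summand: honest
  -- endomorphisms of complexes which satisfy the algebra relations strictly.
  let Ψ : (Fin m → k) →+* End (⨁ J) := biproductScalar J k
  let N : DerivedCategory.Q.obj (⨁ J) ≅ (boundedToInd C).obj E :=
    biproductIsoOfRetracts DerivedCategory.Q J (fun i => s i ≫ α.hom) (fun i => α.inv ≫ r i)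
      hs hs' hr
  have hΨ (c : Fin m → k) : DerivedCategory.Q.map (Ψ c) ≫ N.hom = N.hom ≫ G (φ.symm c) := by
    rw [hφ]
    exact map_biproductScalar_comp DerivedCategory.Q J _ _ hs hs' hr c ε hrs'
  have hinj : Function.Injective Ψ := fun c d h => by
    have h1 : N.hom ≫ G (φ.symm c) = N.hom ≫ G (φ.symm d) := by rw [← hΨ, ← hΨ, h]
    exact φ.symm.injective (hG ((cancel_epi N.hom).1 h1))
  let Ψ' : (Fin m → k) ≃+* Ψ.range := RingEquiv.ofBijective Ψ.rangeRestrict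
    ⟨fun c d h => hinj (congrArg Subtype.val h), Ψ.rangeRestrict_surjective⟩
  exact ⟨{
    complex := ⨁ J
    -- The upper bound is `b + 1` because the splitting is a fibre, which can reach one degree
    -- higher than `I`.
    isBoundedInjective := IsBoundedInjective.biproduct J a (b + 1) hJ hJ' hJ''
    iso := N
    alg := Ψ.range
    equiv := Ψ'.symm.trans φ.symm.toRingEquiv
    equiv_spec := fun x => by
      obtain ⟨c, rfl⟩ := Ψ'.surjective x
      refine (hΨ c).trans ?_
      change _ = N.hom ≫ G (φ.symm (Ψ'.symm (Ψ' c)))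
      rw [RingEquiv.symm_apply_apply]
    scalar_spec := fun c i => by
      change HomologicalComplex.Hom.f (Ψ (φ (c • 1))) i = _
      have h1 : φ (c • 1) = fun _ => c := by
        rw [map_smul, map_one]
        ext
        simp
      have h2 : Ψ (fun _ => c) = c • 𝟙 (⨁ J) := biproductScalar_const J k c
      rw [h1, h2, ← smul_id_ind]
      rfl }⟩

end Model

end

end TwistFunctors

theorem theorem3p9 {k : Type v} [Field k] [IsAlgClosed k]
    {C : Type u} [SmallCategory C] [Abelian C] [Linear k C]
    [HasDerivedCategory.{w} C] [HasDerivedCategory.{w'} (Ind C)]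
    (n : ℤ) (hn : 0 < n) (E : DerivedCategory.Bounded C)
    (hE : TwistFunctors.IsGeneralizedSpherical k n E) :
    Nonempty (TwistFunctors.EquivariantModel k E) ∧
    ∀ M : TwistFunctors.EquivariantModel k E,
      ((∃ T, TwistFunctors.IsTwistOnK M T) ∧ (∃ T', TwistFunctors.IsDualTwistOnK M T') ∧
        ∀ T T', TwistFunctors.IsTwistOnK M T → TwistFunctors.IsDualTwistOnK M T' →
          TwistFunctors.QuasiInverse T T') ∧
      ((∃ T, TwistFunctors.IsTwist M T) ∧ (∃ T', TwistFunctors.IsDualTwist M T') ∧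
        ∀ T T', TwistFunctors.IsTwist M T → TwistFunctors.IsDualTwist M T' →
          TwistFunctors.QuasiInverse T T') := by
  refine ⟨TwistFunctors.nonempty_equivariantModel hE, fun M => ⟨⟨TwistFunctors.exists_isTwistOnK hE M,
    TwistFunctors.exists_isDualTwistOnK hE M,
    fun _ _ hT hT' => TwistFunctors.quasiInverse_onK hE hn hT hT'⟩,
    TwistFunctors.exists_isTwist hE M, TwistFunctors.exists_isDualTwist hE M,
    fun _ _ hT hT' => TwistFunctors.quasiInverse_bounded hE hn hT hT'⟩⟩
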